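/- Let $(X, A_X)$ be a ringed topos ($A_X$ a sheaf of commutative rings). A coconnective commutative differential graded $A_X$-algebra $K=\bigoplus_{n\ge 0}K^n$ (associative, unital, $A_X$-bilinear, $xy=(-1)^{ij}yx$ and $d(xy)=dx\cdot y+(-1)^i x\cdot dy$ for $x\in K^i$, $y\in K^j$) is called an abstract Koszul complex if (C1) $A_X\to H^0(K)$ is an isomorphism, and (C2) for every $q\ge 0$ the multiplication map $H^1(K)^{\otimes q}\to H^q(K)$ factors through an isomorphism $\bigwedge^q H^1(K)\to H^q(K)$. The flatness condition (C3) says that the $A_X$-modules $K^0$, $dK^0$, $Z^1K=\ker(d\colon K^1\to K^2)$ and $H^1(K)$ are flat. For a map $u\colon P\to Q$ of $A_X$-modules and $q\ge 0$, let $\mathrm{Kos}^q(u)$ be the cochain complex with terms $\mathrm{Kos}^q(u)^i=\bigwedge^i(Q)\otimes\Gamma^{q-i}(P)$ ($\Gamma^n$ the $n$-th divided power, zero for $n<0$) and differential $$d\bigl(y\otimes x_1^{[e_1]}\cdots x_r^{[e_r]}\bigr)=\sum_{j=1}^r \bigl(u(x_j)\wedge y\bigr)\otimes\bigl(x_1^{[e_1]}\cdots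 x_j^{[e_j-1]}\cdots x_r^{[e_r]}\bigr).$$ For a coconnective complex $F$ of flat $A_X$-modules, $L\Gamma^q(F)$ denotes the cochain complex associated with the cosimplicial module obtained by applying $\Gamma^q$ termwise to the cosimplicial module that corresponds to $F$ under the Dold–Kan correspondence. Write $\tau_{\le b}$, $\tau_{\ge a}$ for the canonical truncations, $\tau_{[a,b]}=\tau_{\ge a}\tau_{\le b}$; in degree $a$ the complex $\tau_{\ge a}(C)$ is $C^a/dC^{a-1}$. Theorem. Let $q\ge m\ge 0$ be integers such that $m!$ is invertible in $A_X$, and suppose that either $q=m$ or $m+1$ is a nonzerodivisor in $A_X$. Let $K$ be an abstract Koszul complex on $(X,A_X)$ satisfying (C3), and, if $q\ge 2$, suppose that $z\cdot z=0$ for all local sections $z$ of $Z^1K$. (This is automatic if $2$ is invertible, in particular if $m\geq 2$, and if $K$ is strictly graded-commutative.) Write $\tau_{\le 1}K=[K^0\xrightarrow{\partial}Z^1K]$. Then: 1. the multiplication maps $$\mathrm{Kos}^q(\partial)^i=\textstyle\bigwedge^i(Z^1K)\otimes\Gamma^{q-i}(K^0)=\bigwedge^i(Z^1K)\otimes\mathrm{Sym}^{q-i}(K^0)\to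 K^i,\qquad z_1\wedge\cdots\wedge z_i\otimes x_1\cdots x_{q-i}\mapsto z_1\cdots z_i\,x_1\cdots x_{q-i},$$ for $q-m\le i\le q$ (where $\Gamma^{q-i}=\mathrm{Sym}^{q-i}$ because $(q-i)!$ is invertible) are well defined and induce a quasi-isomorphism of complexes $$\tau_{\ge q-m}\,\mathrm{Kos}^q(\partial)\longrightarrow\tau_{[q-m,q]}(K);$$ 2. $\mathrm{Kos}^q(\partial)$ is isomorphic to $L\Gamma^q(\tau_{\le 1}K)$ in the derived category of $A_X$-modules; consequently the source of the map in 1 represents $\tau_{\ge q-m}L\Gamma^q(\tau_{\le 1}K)$. -/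

import Mathlib

open CategoryTheory Limits Opposite TensorProduct

universe w u

namespace Koszul

section Modules

variable (R : Type u) [CommRing R] (M : Type u) [AddCommGroup M] [Module R M]

/-- The `n`-th divided power `Γⁿ_R(M)`, the degree `n` part of the divided power algebra;
it is zero for `n < 0`. -/
noncomputable def DPow (n : ℤ) : Submodule R (DividedPowerAlgebra R M) :=
  Submodule.span R {γ | ∃ (r : ℕ) (e : Fin r → ℕ) (x : Fin r → M),
    ∑ k, (e k : ℤ) = n ∧ γ = ∏ k, DividedPowerAlgebra.dp R (e k) (x k)}

variable {M}

/-- The divided power `x^{[n]}`, with the convention that it is zero for `n < 0`. -/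
noncomputable def dpZ (n : ℤ) (x : M) : DividedPowerAlgebra R M :=
  if n < 0 then 0 else DividedPowerAlgebra.dp R n.toNat x

variable {R}

lemma dpZ_natCast (n : ℕ) (x : M) : dpZ R (n : ℤ) x = DividedPowerAlgebra.dp R n x := by
  simp [dpZ]

lemma dpZ_neg {n : ℤ} (hn : n < 0) (x : M) : dpZ R n x = 0 := by
  simp [dpZ, hn]

lemma prod_dpZ_mem {r : ℕ} (e : Fin r → ℤ) (x : Fin r → M) {n : ℤ} (h : ∑ k, e k = n) :
    ∏ k, dpZ R (e k) (x k) ∈ DPow R M n := by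
  by_cases he : ∃ k, e k < 0
  · obtain ⟨k, hk⟩ := he
    rw [Finset.prod_eq_zero (Finset.mem_univ k) (dpZ_neg (R := R) hk (x k))]
    exact zero_mem _
  · push Not at he
    lift e to Fin r → ℕ using he
    exact Submodule.subset_span ⟨r, e, x, h, by simp [dpZ_natCast]⟩

lemma dp_mem (n : ℕ) (x : M) : DividedPowerAlgebra.dp R n x ∈ DPow R M (n : ℤ) :=
  Submodule.subset_span ⟨1, fun _ ↦ n, fun _ ↦ x, by simp, by simp⟩

/-- The product `x₁ ⋯ x_r ∈ Γʳ(M)` of `r` elements of `M = Γ¹(M)`. -/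
noncomputable def dpProd {r : ℕ} {n : ℤ} (h : (r : ℤ) = n) (x : Fin r → M) : DPow R M n :=
  ⟨∏ k, DividedPowerAlgebra.dp R 1 (x k),
    Submodule.subset_span ⟨r, fun _ ↦ 1, x, by simpa using h, rfl⟩⟩

/-- The products of divided powers span the divided power algebra. -/
lemma dp_induction {P : DividedPowerAlgebra R M → Prop} (γ : DividedPowerAlgebra R M)
    (add : ∀ a b, P a → P b → P (a + b)) (smul : ∀ (c : R) a, P a → P (c • a))
    (prod : ∀ (r : ℕ) (e : Fin r → ℕ) (x : Fin r → M),
      P (∏ k, DividedPowerAlgebra.dp R (e k) (x k))) : P γ := by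
  suffices γ ∈ Submodule.span R {γ | ∃ (r : ℕ) (e : Fin r → ℕ) (x : Fin r → M),
      γ = ∏ k, DividedPowerAlgebra.dp R (e k) (x k)} by
    induction this using Submodule.span_induction with
    | mem a ha => obtain ⟨r, e, x, rfl⟩ := ha; exact prod r e x
    | zero => simpa using smul 0 _ (prod 0 Fin.elim0 Fin.elim0)
    | add a b _ _ ha hb => exact add a b ha hb
    | smul c a _ ha => exact smul c a ha
  induction γ using DividedPowerAlgebra.induction_on with
  | C a =>
    rw [Algebra.algebraMap_eq_smul_one]
    exact Submodule.smul_mem _ _ (Submodule.subset_span ⟨0, Fin.elim0, Fin.elim0, by simp⟩)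
  | add f g hf hg => exact add_mem hf hg
  | dp f n m hf =>
    induction hf using Submodule.span_induction with
    | mem a ha =>
      obtain ⟨r, e, x, rfl⟩ := ha
      exact Submodule.subset_span ⟨r + 1, Fin.snoc e n, Fin.snoc x m, by
        simp [Fin.prod_univ_castSucc]⟩
    | zero => simp
    | add a b _ _ ha hb => rw [add_mul]; exact add_mem ha hb
    | smul c a _ ha => rw [smul_mul_assoc]; exact Submodule.smul_mem _ _ ha

variable (R M)

/-- The weight homomorphism `Γ(M) → Γ(M)[T, T⁻¹]`, `x^{[n]} ↦ x^{[n]} Tⁿ`, which records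
the grading of the divided power algebra. -/
noncomputable def weight :
    DividedPowerAlgebra R M →ₐ[R] AddMonoidAlgebra (DividedPowerAlgebra R M) ℤ :=
  DividedPowerAlgebra.lift'
    (f := fun p ↦ AddMonoidAlgebra.single (p.1 : ℤ) (DividedPowerAlgebra.dp R p.1 p.2))
    (fun m ↦ by
      simp only [DividedPowerAlgebra.dp_zero, AddMonoidAlgebra.one_def, Nat.cast_zero])
    (fun n r m ↦ by
      simp only [DividedPowerAlgebra.dp_smul, AddMonoidAlgebra.smul_single])
    (fun n p m ↦ by
      simp only [AddMonoidAlgebra.single_mul_single, DividedPowerAlgebra.dp_mul,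
        AddMonoidAlgebra.smul_single, Nat.cast_add])
    (fun n a b ↦ by
      simp only [DividedPowerAlgebra.dp_add, AddMonoidAlgebra.single_mul_single]
      rw [← AddMonoidAlgebra.singleAddHom_apply, map_sum]
      refine Finset.sum_congr rfl fun k hk ↦ ?_
      rw [← Finset.HasAntidiagonal.mem_antidiagonal.1 hk, Nat.cast_add]
      rfl)

variable {R M}

lemma weight_prod {r : ℕ} (e : Fin r → ℤ) (x : Fin r → M) :
    weight R M (∏ k, dpZ R (e k) (x k)) =
      AddMonoidAlgebra.single (∑ k, e k) (∏ k, dpZ R (e k) (x k)) := by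
  have h (n : ℤ) (m : M) : weight R M (dpZ R n m) = AddMonoidAlgebra.single n (dpZ R n m) := by
    by_cases hn : n < 0
    · simp [dpZ_neg hn]
    · lift n to ℕ using not_lt.1 hn
      simp [dpZ_natCast, weight]
  rw [map_prod]
  simp only [h]
  rw [AddMonoidAlgebra.prod_single]

variable (R M) in
/-- The projection of the divided power algebra onto its degree `n` part. -/
noncomputable def dpProj (n : ℤ) : DividedPowerAlgebra R M →ₗ[R] DPow R M n :=
  LinearMap.codRestrict (DPow R M n)
    { toFun := fun γ ↦ (weight R M γ).coeff n
      map_add' := fun a b ↦ by simp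
      map_smul' := fun c a ↦ by simp }
    (fun γ ↦ by
      induction γ using dp_induction with
      | add a b ha hb => rw [map_add]; exact add_mem ha hb
      | smul c a ha => rw [map_smul]; exact Submodule.smul_mem _ _ ha
      | prod r e x =>
        have := weight_prod (R := R) (fun k ↦ (e k : ℤ)) x
        simp only [dpZ_natCast] at this
        simp only [LinearMap.coe_mk, AddHom.coe_mk, this, AddMonoidAlgebra.coeff_single,
          Finsupp.single_apply]
        split_ifs with h
        · exact Submodule.subset_span ⟨r, e, x, h, rfl⟩
        · exact zero_mem _)

lemma dpProj_prod {r : ℕ} (e : Fin r → ℤ) (x : Fin r → M) {n : ℤ} (h : ∑ k, e k = n) :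
    dpProj R M n (∏ k, dpZ R (e k) (x k)) = ⟨_, prod_dpZ_mem e x h⟩ := by
  ext
  change ((weight R M) (∏ k, dpZ R (e k) (x k))).coeff n = _
  rw [weight_prod, h]
  exact Finsupp.single_eq_same

/-- Derivations of the divided power algebra can be prescribed on the generators. -/
lemma exists_derivation {N : Type u} [AddCommGroup N] [Module (DividedPowerAlgebra R M) N]
    [Module R N] [IsScalarTower R (DividedPowerAlgebra R M) N] (f : ℕ → M → N)
    (hzero : ∀ m, f 0 m = 0)
    (hsmul : ∀ n (r : R) m, f n (r • m) = r ^ n • f n m)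
    (hmul : ∀ n p m, DividedPowerAlgebra.dp R n m • f p m + DividedPowerAlgebra.dp R p m • f n m =
      (n + p).choose n • f (n + p) m)
    (hadd : ∀ n a b, f n (a + b) = ∑ k ∈ Finset.HasAntidiagonal.antidiagonal n,
      (DividedPowerAlgebra.dp R k.1 a • f k.2 b + DividedPowerAlgebra.dp R k.2 b • f k.1 a)) :
    ∃ D : Derivation R (DividedPowerAlgebra R M) N,
      ∀ n m, D (DividedPowerAlgebra.dp R n m) = f n m := by
  let _ : Module (DividedPowerAlgebra R M)ᵐᵒᵖ N :=
    Module.compHom _ ((RingHom.id (DividedPowerAlgebra R M)).fromOpposite mul_comm)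
  have : IsCentralScalar (DividedPowerAlgebra R M) N := ⟨fun _ _ ↦ rfl⟩
  have op_smul (a : DividedPowerAlgebra R M) (n : N) : MulOpposite.op a • n = a • n := rfl
  let F : DividedPowerAlgebra R M →ₐ[R] TrivSqZeroExt (DividedPowerAlgebra R M) N :=
    DividedPowerAlgebra.lift'
      (f := fun p ↦ TrivSqZeroExt.inl (DividedPowerAlgebra.dp R p.1 p.2) +
        TrivSqZeroExt.inr (f p.1 p.2))
      (fun m ↦ by simp [hzero, DividedPowerAlgebra.dp_zero])
      (fun n r m ↦ by
        ext
        · simp [DividedPowerAlgebra.dp_smul]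
        · simp [hsmul])
      (fun n p m ↦ by
        ext
        · simp [DividedPowerAlgebra.dp_mul]
        · simpa [op_smul, ← Nat.cast_smul_eq_nsmul (DividedPowerAlgebra R M)] using hmul n p m)
      (fun n a b ↦ by
        ext
        · simp [DividedPowerAlgebra.dp_add, TrivSqZeroExt.fst_sum]
        · simpa [op_smul, TrivSqZeroExt.snd_sum] using hadd n a b)
  have hF (n : ℕ) (m : M) : F (DividedPowerAlgebra.dp R n m) =
      TrivSqZeroExt.inl (DividedPowerAlgebra.dp R n m) + TrivSqZeroExt.inr (f n m) := by
    simp [F]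
  have hfst (γ : DividedPowerAlgebra R M) : (F γ).fst = γ := by
    have : (TrivSqZeroExt.fstHom R (DividedPowerAlgebra R M) N).comp F = AlgHom.id R _ := by
      refine DividedPowerAlgebra.algHom_ext fun n m ↦ ?_
      simp [hF]
    exact DFunLike.congr_fun this γ
  refine ⟨Derivation.mk' (TrivSqZeroExt.sndHom (DividedPowerAlgebra R M) N |>.restrictScalars R
    |>.comp F.toLinearMap) (fun a b ↦ ?_), fun n m ↦ ?_⟩
  · simp [op_smul, hfst]
  · simp [hF]

variable (R M) in
lemma exists_comulDerivation :
    ∃ D : Derivation R (DividedPowerAlgebra R M) (DividedPowerAlgebra R M ⊗[R] M),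
      ∀ n m, D (DividedPowerAlgebra.dp R n m) = dpZ R ((n : ℤ) - 1) m ⊗ₜ m := by
  have hs (n : ℕ) (m : M) : dpZ R (((n + 1 : ℕ) : ℤ) - 1) m = DividedPowerAlgebra.dp R n m := by
    rw [← dpZ_natCast]; congr 1; simp
  have h0 (m : M) : dpZ R (-1) m = 0 := dpZ_neg (by simp) m
  refine exists_derivation (R := R) (M := M) (N := DividedPowerAlgebra R M ⊗[R] M)
    (fun n m ↦ dpZ R ((n : ℤ) - 1) m ⊗ₜ m) (fun m ↦ ?_) (fun n r m ↦ ?_) (fun n p m ↦ ?_) (fun n a b ↦ ?_)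
  · simp [h0]
  · cases n with
    | zero => simp [h0]
    | succ n =>
      simp only [hs, DividedPowerAlgebra.dp_smul, tmul_smul, smul_tmul', smul_smul, pow_succ']
  · cases n with
    | zero =>
      cases p with
      | zero => simp [h0]
      | succ p => simp [h0, dpZ_natCast, DividedPowerAlgebra.dp_zero]
    | succ n =>
      cases p with
      | zero => simp [h0, dpZ_natCast, DividedPowerAlgebra.dp_zero]
      | succ p =>
        rw [show n + 1 + (p + 1) = (n + p + 1) + 1 by ring]
        simp only [hs, smul_tmul', smul_eq_mul, DividedPowerAlgebra.dp_mul]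
        have e : (n + p + 1).choose (n + 1) + (n + p + 1).choose (p + 1) =
            (n + p + 1 + 1).choose (n + 1) := by
          rw [Nat.choose_succ_succ (n + p + 1) n, add_comm,
            Nat.choose_symm_of_eq_add (n := n + p + 1) (a := p + 1) (b := n) (by ring)]
        rw [show n + 1 + p = n + p + 1 by ring, show p + 1 + n = n + p + 1 by ring,
          ← add_tmul, ← add_smul, e]
  · cases n with
    | zero => simp [h0]
    | succ n =>
      simp only [hs]
      rw [Finset.sum_add_distrib, Finset.Nat.sum_antidiagonal_succ',
        Finset.Nat.sum_antidiagonal_succ]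
      simp only [hs, Nat.cast_zero, zero_sub, h0, zero_tmul, smul_zero, zero_add,
        DividedPowerAlgebra.dp_add, tmul_add, sum_tmul, smul_tmul', smul_eq_mul]
      rw [add_comm]
      congr 1
      refine Finset.sum_congr rfl fun k _ ↦ ?_
      rw [mul_comm]

variable (R M) in
/-- The derivation `D : Γ(M) → Γ(M) ⊗ M` with `D(x^{[n]}) = x^{[n-1]} ⊗ x`. -/
noncomputable def comulDerivation :
    Derivation R (DividedPowerAlgebra R M) (DividedPowerAlgebra R M ⊗[R] M) :=
  (exists_comulDerivation R M).choose

lemma comulDerivation_dpZ (n : ℤ) (m : M) :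
    comulDerivation R M (dpZ R n m) = dpZ R (n - 1) m ⊗ₜ m := by
  by_cases hn : n < 0
  · simp [dpZ_neg hn, dpZ_neg (show n - 1 < 0 by lia)]
  · lift n to ℕ using not_lt.1 hn
    rw [dpZ_natCast]
    exact (exists_comulDerivation R M).choose_spec n m

lemma comulDerivation_prod {r : ℕ} (e : Fin r → ℤ) (x : Fin r → M) :
    comulDerivation R M (∏ k, dpZ R (e k) (x k)) =
      ∑ k, (∏ l, dpZ R (e l - if l = k then 1 else 0) (x l)) ⊗ₜ x k := by
  have leibniz (s : Finset (Fin r)) (f : Fin r → DividedPowerAlgebra R M) :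
      comulDerivation R M (∏ k ∈ s, f k) =
        ∑ k ∈ s, (∏ l ∈ s.erase k, f l) • comulDerivation R M (f k) := by
    induction s using Finset.induction_on with
    | empty => simp
    | insert a s ha ih =>
      rw [Finset.prod_insert ha, Derivation.leibniz, Finset.sum_insert ha,
        Finset.erase_insert ha, ih, Finset.smul_sum, add_comm]
      congr 1
      refine Finset.sum_congr rfl fun k hk ↦ ?_
      rw [Finset.erase_insert_of_ne (by rintro rfl; exact ha hk),
        Finset.prod_insert (by simp [ha]), smul_smul]
  rw [leibniz]
  refine Finset.sum_congr rfl fun k _ ↦ ?_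
  rw [comulDerivation_dpZ, smul_tmul', smul_eq_mul,
    ← Finset.prod_erase_mul _ _ (Finset.mem_univ k)]
  congr 2
  · refine Finset.prod_congr rfl fun l hl ↦ ?_
    rw [if_neg (Finset.ne_of_mem_erase hl), sub_zero]
  · simp

variable (R M) in
/-- The comultiplication `η : Γⁿ(M) → M ⊗ Γⁿ⁻¹(M)`,
`x₁^{[e₁]} ⋯ x_r^{[e_r]} ↦ ∑ₖ xₖ ⊗ (x₁^{[e₁]} ⋯ xₖ^{[eₖ - 1]} ⋯ x_r^{[e_r]})`. -/
noncomputable def comul (n n' : ℤ) : DPow R M n →ₗ[R] M ⊗[R] DPow R M n' :=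
  (TensorProduct.comm R _ _).toLinearMap ∘ₗ (dpProj R M n').rTensor M ∘ₗ
    (comulDerivation R M).toLinearMap ∘ₗ (DPow R M n).subtype

lemma comul_prod {r : ℕ} (e : Fin r → ℤ) (x : Fin r → M) {n n' : ℤ} (h : ∑ k, e k = n)
    (h' : n' + 1 = n) :
    comul R M n n' ⟨∏ k, dpZ R (e k) (x k), prod_dpZ_mem e x h⟩ =
      ∑ k, x k ⊗ₜ ⟨∏ l, dpZ R (e l - if l = k then 1 else 0) (x l),
        prod_dpZ_mem _ x (by simp [h, ← h'])⟩ := by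
  simp only [comul, LinearMap.comp_apply, Submodule.subtype_apply, Derivation.coeFn_coe, comulDerivation_prod, map_sum]
  refine Finset.sum_congr rfl fun k _ ↦ ?_
  rw [LinearMap.rTensor_tmul, dpProj_prod _ _ (by simp [h, ← h'])]
  rfl

variable {Q : Type u} [AddCommGroup Q] [Module R Q]

variable (R Q) in
/-- The exterior product `Q ⊗ Λⁱ(Q) → Λⁱ⁺¹(Q)`, `x ⊗ y ↦ x ∧ y`. -/
noncomputable def wedge (i : ℕ) : Q →ₗ[R] ⋀[R]^i Q →ₗ[R] ⋀[R]^(i + 1) Q :=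
  LinearMap.mk₂ R (fun x y ↦ ⟨ExteriorAlgebra.ι R x * y, by
      change _ ∈ LinearMap.range (ExteriorAlgebra.ι R) ^ (i + 1)
      rw [pow_succ']
      exact Submodule.mul_mem_mul ⟨x, rfl⟩ y.2⟩)
    (fun x x' y ↦ by ext; simp [add_mul]) (fun c x y ↦ by ext; simp)
    (fun x y y' ↦ by ext; simp [mul_add]) (fun c x y ↦ by ext; simp)

lemma wedge_self (i : ℕ) (x : Q) (y : ⋀[R]^i Q) : wedge R Q (i + 1) x (wedge R Q i x y) = 0 := by
  ext
  simp [wedge, ← mul_assoc]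

lemma wedge_comm (i : ℕ) (x x' : Q) (y : ⋀[R]^i Q) :
    wedge R Q (i + 1) x (wedge R Q i x' y) = - wedge R Q (i + 1) x' (wedge R Q i x y) := by
  have h := wedge_self i (x + x') y
  simp only [map_add, LinearMap.add_apply, wedge_self, zero_add, add_zero] at h
  rw [eq_neg_iff_add_eq_zero]
  exact (add_comm _ _).trans h

lemma wedge_ιMulti (i : ℕ) (x : Q) (y : Fin i → Q) :
    wedge R Q i x (exteriorPower.ιMulti R i y) =
      exteriorPower.ιMulti R (i + 1) (Fin.cons x y : Fin (i + 1) → Q) := by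
  ext
  simp [wedge, ExteriorAlgebra.ιMulti_apply, Matrix.vecTail, Function.comp_def]

variable (u : M →ₗ[R] Q) (q : ℕ)

/-- The degree `i` term `Λⁱ(Q) ⊗ Γ^{q-i}(P)` of the `q`-th Koszul complex of a map `P → Q`. -/
abbrev KosX (R : Type u) [CommRing R] (Q : Type u) [AddCommGroup Q] [Module R Q]
    (P : Type u) [AddCommGroup P] [Module R P] (q i : ℕ) : Type u :=
  (⋀[R]^i Q) ⊗[R] DPow R P ((q : ℤ) - i)

/-- The differential of the `q`-th Koszul complex of `u : P → Q`: the comultiplication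
`Γ^{q-i}(P) → P ⊗ Γ^{q-i-1}(P)`, followed by `u` and the exterior product `Q ⊗ Λⁱ(Q) → Λⁱ⁺¹(Q)`.
Thus `y ⊗ x₁^{[e₁]} ⋯ x_r^{[e_r]}` maps to
`∑ₖ (u(xₖ) ∧ y) ⊗ (x₁^{[e₁]} ⋯ xₖ^{[eₖ - 1]} ⋯ x_r^{[e_r]})`. -/
noncomputable def kosD (i : ℕ) : KosX R Q M q i →ₗ[R] KosX R Q M q (i + 1) :=
  (TensorProduct.lift (wedge R Q i).flip).rTensor _ ∘ₗ
    (TensorProduct.assoc R _ _ _).symm.toLinearMap ∘ₗ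
    ((u.rTensor (DPow R M ((q : ℤ) - (i + 1 : ℕ)))) ∘ₗ
      comul R M ((q : ℤ) - i) ((q : ℤ) - (i + 1 : ℕ))).lTensor _

lemma kosD_tmul (i : ℕ) (y : ⋀[R]^i Q) {r : ℕ} (e : Fin r → ℤ) (x : Fin r → M)
    (h : ∑ k, e k = (q : ℤ) - i) :
    kosD u q i (y ⊗ₜ ⟨∏ k, dpZ R (e k) (x k), prod_dpZ_mem e x h⟩) =
      ∑ k, wedge R Q i (u (x k)) y ⊗ₜ ⟨∏ l, dpZ R (e l - if l = k then 1 else 0) (x l),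
        prod_dpZ_mem _ x (by simp [h]; ring)⟩ := by
  simp only [kosD, LinearMap.comp_apply, LinearMap.lTensor_tmul]
  rw [comul_prod _ _ h (by simp; ring)]
  simp [map_sum, tmul_sum]

/-- Two semilinear maps on `Γⁿ(M)` which agree on products of divided powers are equal. -/
lemma dPow_ext {N : Type u} [AddCommGroup N] {S : Type u} [CommRing S] [Module S N] {σ : R →+* S}
    {n : ℤ} {f g : DPow R M n →ₛₗ[σ] N}
    (h : ∀ (r : ℕ) (e : Fin r → ℤ) (x : Fin r → M) (h : ∑ k, e k = n),
      f ⟨∏ k, dpZ R (e k) (x k), prod_dpZ_mem e x h⟩ =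
        g ⟨∏ k, dpZ R (e k) (x k), prod_dpZ_mem e x h⟩) : f = g := by
  ext ⟨γ, hγ⟩
  have hγ' := hγ
  rw [DPow] at hγ'
  induction hγ' using Submodule.span_induction with
  | mem a ha =>
    obtain ⟨r, e, x, he, rfl⟩ := ha
    have := h r (fun k ↦ (e k : ℤ)) x he
    simpa only [dpZ_natCast] using this
  | zero => exact (map_zero f).trans (map_zero g).symm
  | add a b ha hb ha' hb' =>
    have := congr($(ha' ha) + $(hb' hb))
    rwa [← map_add, ← map_add] at this
  | smul c a ha ha' =>
    have := congr(σ c • $(ha' ha))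
    rwa [← map_smulₛₗ, ← map_smulₛₗ] at this

/-- Two semilinear maps on `Λⁱ(M)` which agree on exterior products are equal. -/
lemma extPow_ext {N : Type u} [AddCommGroup N] {S : Type u} [CommRing S] [Module S N] {σ : R →+* S}
    {i : ℕ} {f g : ⋀[R]^i M →ₛₗ[σ] N}
    (h : ∀ y : Fin i → M, f (exteriorPower.ιMulti R i y) = g (exteriorPower.ιMulti R i y)) :
    f = g := by
  refine LinearMap.ext_on_range (exteriorPower.ιMulti_span R i M) h

/-- Two semilinear maps on `Λⁱ(Q) ⊗ Γ^{q-i}(M)` which agree on generators are equal. -/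
lemma kosX_ext {N : Type u} [AddCommGroup N] {S : Type u} [CommRing S] [Module S N] {σ : R →+* S}
    {i : ℕ} {f g : KosX R Q M q i →ₛₗ[σ] N}
    (h : ∀ (y : Fin i → Q) (r : ℕ) (e : Fin r → ℤ) (x : Fin r → M)
      (h : ∑ k, e k = (q : ℤ) - i),
      f (exteriorPower.ιMulti R i y ⊗ₜ ⟨∏ k, dpZ R (e k) (x k), prod_dpZ_mem e x h⟩) =
        g (exteriorPower.ιMulti R i y ⊗ₜ ⟨∏ k, dpZ R (e k) (x k), prod_dpZ_mem e x h⟩)) :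
    f = g := by
  refine TensorProduct.ext (extPow_ext fun y ↦ dPow_ext fun r e x h' ↦ ?_)
  exact h y r e x h'

lemma kosD_kosD (i : ℕ) : kosD u q (i + 1) ∘ₗ kosD u q i = 0 := by
  refine kosX_ext (N := KosX R Q M q (i + 1 + 1)) q fun y r e x h ↦ ?_
  rw [LinearMap.comp_apply, kosD_tmul _ _ _ _ _ _ h, map_sum, LinearMap.zero_apply]
  have h2 (k : Fin r) : ∑ l, (e l - if l = k then 1 else 0) = (q : ℤ) - (i + 1 : ℕ) := by
    simp [h]; ring
  rw [Finset.sum_congr rfl fun k _ ↦ kosD_tmul u q (i + 1) _ _ x (h2 k)]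
  rw [← Finset.sum_product']
  refine Finset.sum_involution (fun p _ ↦ (p.2, p.1)) ?_ ?_ (by simp) (by simp)
  · rintro ⟨k, l⟩ -
    dsimp only
    simp only [sub_right_comm _ (if _ = k then (1 : ℤ) else 0)]
    rw [← add_tmul, wedge_comm, neg_add_cancel, zero_tmul]
  · rintro ⟨k, l⟩ - hne heq
    obtain rfl : l = k := congr_arg Prod.fst heq
    exact hne (by rw [wedge_self, zero_tmul])

end Modules

section Semilinear

variable {R S T : Type u} [CommRing R] [CommRing S] [CommRing T]
  {σ : R →+* S} {M N : Type u} [AddCommGroup M] [Module R M] [AddCommGroup N] [Module S N]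
  {Q Q' : Type u} [AddCommGroup Q] [Module R Q] [AddCommGroup Q'] [Module S Q']

/-- The homomorphism of divided power algebras induced by a semilinear map,
`x^{[n]} ↦ g(x)^{[n]}`. -/
noncomputable def dpAlgMap (g : M →ₛₗ[σ] N) :
    DividedPowerAlgebra R M →+* DividedPowerAlgebra S N :=
  letI : Algebra R S := σ.toAlgebra
  letI : Module R N := Module.compHom N σ
  haveI : IsScalarTower R S N := ⟨fun a b n ↦ mul_smul (σ a) b n⟩
  (DividedPowerAlgebra.map S
    { toFun := g, map_add' := map_add g, map_smul' := map_smulₛₗ g : M →ₗ[R] N }).toRingHom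

lemma dpAlgMap_dp (g : M →ₛₗ[σ] N) (n : ℕ) (x : M) :
    dpAlgMap g (DividedPowerAlgebra.dp R n x) = DividedPowerAlgebra.dp S n (g x) := by
  let _ : Algebra R S := σ.toAlgebra
  let _ : Module R N := Module.compHom N σ
  have : IsScalarTower R S N := ⟨fun a b n ↦ mul_smul (σ a) b n⟩
  exact DividedPowerAlgebra.map_apply_dp S
    { toFun := g, map_add' := map_add g, map_smul' := map_smulₛₗ g : M →ₗ[R] N }

lemma dpAlgMap_smul (g : M →ₛₗ[σ] N) (c : R) (γ : DividedPowerAlgebra R M) :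
    dpAlgMap g (c • γ) = σ c • dpAlgMap g γ := by
  let _ : Algebra R S := σ.toAlgebra
  let _ : Module R N := Module.compHom N σ
  have : IsScalarTower R S N := ⟨fun a b n ↦ mul_smul (σ a) b n⟩
  exact (map_smul (DividedPowerAlgebra.map S
    { toFun := g, map_add' := map_add g, map_smul' := map_smulₛₗ g : M →ₗ[R] N }) c γ).trans (algebraMap_smul S c _).symm

lemma dpAlgMap_prod (g : M →ₛₗ[σ] N) {r : ℕ} (e : Fin r → ℤ) (x : Fin r → M) :
    dpAlgMap g (∏ k, dpZ R (e k) (x k)) = ∏ k, dpZ S (e k) (g (x k)) := by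
  rw [map_prod]
  refine Finset.prod_congr rfl fun k _ ↦ ?_
  simp only [dpZ]
  split_ifs
  · simp
  · rw [dpAlgMap_dp]

/-- The semilinear map `Γⁿ(M) → Γⁿ(N)` induced by a semilinear map `M → N`. -/
noncomputable def dpMap (g : M →ₛₗ[σ] N) (n : ℤ) : DPow R M n →ₛₗ[σ] DPow S N n where
  toFun γ := ⟨dpAlgMap g γ.1, by
    obtain ⟨γ, hγ⟩ := γ
    have hγ' := hγ
    rw [DPow] at hγ'
    change dpAlgMap g γ ∈ _
    clear hγ
    induction hγ' using Submodule.span_induction with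
    | mem a ha =>
      obtain ⟨r, e, x, h, rfl⟩ := ha
      have := dpAlgMap_prod g (fun k ↦ (e k : ℤ)) x
      simp only [dpZ_natCast] at this
      simp only [this]
      exact Submodule.subset_span ⟨r, e, fun k ↦ g (x k), h, rfl⟩
    | zero => rw [map_zero]; exact zero_mem _
    | add a b _ _ ha hb => rw [map_add]; exact add_mem ha hb
    | smul c a _ ha => rw [dpAlgMap_smul]; exact Submodule.smul_mem _ _ ha⟩
  map_add' a b := Subtype.ext (map_add (dpAlgMap g) _ _)
  map_smul' c a := Subtype.ext (dpAlgMap_smul g _ _)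

lemma dpMap_prod (g : M →ₛₗ[σ] N) {r : ℕ} (e : Fin r → ℤ) (x : Fin r → M) {n : ℤ}
    (h : ∑ k, e k = n) :
    dpMap g n ⟨∏ k, dpZ R (e k) (x k), prod_dpZ_mem e x h⟩ =
      ⟨∏ k, dpZ S (e k) (g (x k)), prod_dpZ_mem e _ h⟩ :=
  Subtype.ext (dpAlgMap_prod g e x)

/-- The semilinear map on `Λⁱ(Q)` induced by an alternating map on `Q'` and a semilinear map
`Q → Q'`. -/
noncomputable def extLift {E : Type u} [AddCommGroup E] [Module S E] (g : Q →ₛₗ[σ] Q') {i : ℕ}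
    (a : Q' [⋀^Fin i]→ₗ[S] E) : ⋀[R]^i Q →ₛₗ[σ] E :=
  letI : Module R E := Module.compHom E σ
  let F : ⋀[R]^i Q →ₗ[R] E := exteriorPower.alternatingMapLinearEquiv
    { toFun := fun y ↦ a (fun k ↦ g (y k))
      map_update_add' := fun y k x x' ↦ by
        have h (z : Q) : (fun l ↦ g (Function.update y k z l)) =
          Function.update (fun l ↦ g (y l)) k (g z) := by
          ext l; exact Function.apply_update (fun _ ↦ g) y k z l
        rw [h, h, h, map_add, AlternatingMap.map_update_add]
      map_update_smul' := fun y k c x ↦ by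
        have h (z : Q) : (fun l ↦ g (Function.update y k z l)) =
          Function.update (fun l ↦ g (y l)) k (g z) := by
          ext l; exact Function.apply_update (fun _ ↦ g) y k z l
        rw [h, h, map_smulₛₗ, AlternatingMap.map_update_smul]
        rfl
      map_eq_zero_of_eq' := fun y k l hkl hne ↦
        a.map_eq_zero_of_eq _ (congr_arg g hkl) hne }
  { toFun := F, map_add' := map_add F, map_smul' := map_smul F }

lemma extLift_ιMulti {E : Type u} [AddCommGroup E] [Module S E] (g : Q →ₛₗ[σ] Q') {i : ℕ}
    (a : Q' [⋀^Fin i]→ₗ[S] E) (y : Fin i → Q) :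
    extLift g a (exteriorPower.ιMulti R i y) = a (fun k ↦ g (y k)) := by
  let _ : Module R E := Module.compHom E σ
  exact exteriorPower.alternatingMapLinearEquiv_apply_ιMulti (R := R) (N := E) _ y

/-- The semilinear map `Λⁱ(Q) → Λⁱ(Q')` induced by a semilinear map `Q → Q'`. -/
noncomputable def extMap (g : Q →ₛₗ[σ] Q') (i : ℕ) : ⋀[R]^i Q →ₛₗ[σ] ⋀[S]^i Q' :=
  extLift g (exteriorPower.ιMulti S i)

lemma extMap_ιMulti (g : Q →ₛₗ[σ] Q') (i : ℕ) (y : Fin i → Q) :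
    extMap g i (exteriorPower.ιMulti R i y) = exteriorPower.ιMulti S i (fun k ↦ g (y k)) :=
  extLift_ιMulti g _ y

/-- The semilinear map `Λⁱ(Q) ⊗ Γ^{q-i}(M) → Λⁱ(Q') ⊗ Γ^{q-i}(N)` induced by semilinear maps
`Q → Q'` and `M → N`. -/
noncomputable def kosMap (g : Q →ₛₗ[σ] Q') (f : M →ₛₗ[σ] N) (q i : ℕ) :
    KosX R Q M q i →ₛₗ[σ] KosX S Q' N q i :=
  TensorProduct.map (extMap g i) (dpMap f _)

lemma kosMap_tmul (g : Q →ₛₗ[σ] Q') (f : M →ₛₗ[σ] N) (q i : ℕ) (y : Fin i → Q) {r : ℕ}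
    (e : Fin r → ℤ) (x : Fin r → M) (h : ∑ k, e k = (q : ℤ) - i) :
    kosMap g f q i (exteriorPower.ιMulti R i y ⊗ₜ ⟨∏ k, dpZ R (e k) (x k), prod_dpZ_mem e x h⟩) =
      exteriorPower.ιMulti S i (fun k ↦ g (y k)) ⊗ₜ
        ⟨∏ k, dpZ S (e k) (f (x k)), prod_dpZ_mem e _ h⟩ := by
  rw [kosMap, TensorProduct.map_tmul, extMap_ιMulti, dpMap_prod _ _ _ h]

/-- The differential of the Koszul complex is natural for semilinear maps. -/
lemma kosD_kosMap (g : Q →ₛₗ[σ] Q') (f : M →ₛₗ[σ] N) (u : M →ₗ[R] Q) (u' : N →ₗ[S] Q')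
    (h : ∀ x, g (u x) = u' (f x)) (q i : ℕ) (t : KosX R Q M q i) :
    kosD u' q i (kosMap g f q i t) = kosMap g f q (i + 1) (kosD u q i t) := by
  suffices (kosD u' q i).comp (kosMap g f q i) = (kosMap g f q (i + 1)).comp (kosD u q i) from
    DFunLike.congr_fun this t
  refine kosX_ext (N := KosX S Q' N q (i + 1)) q fun y r e x he ↦ ?_
  rw [LinearMap.comp_apply, LinearMap.comp_apply, kosMap_tmul (h := he), kosD_tmul _ _ _ _ _ _ he,
    kosD_tmul _ _ _ _ _ _ he, map_sum]
  refine Finset.sum_congr rfl fun k _ ↦ ?_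
  have he' : ∑ l, (e l - if l = k then 1 else 0) = (q : ℤ) - (i + 1 : ℕ) := by
    simp [he]; ring
  rw [wedge_ιMulti, wedge_ιMulti, kosMap_tmul g f q (i + 1) _ _ x he']
  congr 2
  ext l
  refine Fin.cases ?_ (fun l ↦ ?_) l <;> simp [h]

section Functoriality

variable {A : Type u} [AddCommGroup A] [Module T A] {B : Type u} [AddCommGroup B] [Module T B]
  {τ : S →+* T} {ρ : R →+* T}

lemma dpMap_id {σ : R →+* R} (hσ : σ = RingHom.id R) (g : M →ₛₗ[σ] M) (hg : ∀ x, g x = x) (n : ℤ)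
    (γ : DPow R M n) : dpMap g n γ = γ := by
  subst hσ
  suffices dpMap g n = LinearMap.id from DFunLike.congr_fun this γ
  refine dPow_ext (N := DPow R M n) fun r e x h ↦ ?_
  rw [dpMap_prod _ _ _ h]
  simp [hg]

lemma dpMap_comp (hρ : τ.comp σ = ρ) (g : M →ₛₗ[σ] N) (g' : N →ₛₗ[τ] A) (g'' : M →ₛₗ[ρ] A)
    (h : ∀ x, g'' x = g' (g x)) (n : ℤ) (γ : DPow R M n) :
    dpMap g'' n γ = dpMap g' n (dpMap g n γ) := by
  have : RingHomCompTriple σ τ ρ := ⟨hρ⟩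
  suffices dpMap g'' n = (dpMap g' n).comp (dpMap g n) from DFunLike.congr_fun this γ
  refine dPow_ext (N := DPow T A n) fun r e x h' ↦ ?_
  rw [LinearMap.comp_apply, dpMap_prod _ _ _ h', dpMap_prod _ _ _ h', dpMap_prod _ _ _ h']
  simp [h]

lemma extMap_id {σ : R →+* R} (hσ : σ = RingHom.id R) (g : Q →ₛₗ[σ] Q) (hg : ∀ x, g x = x) (i : ℕ)
    (y : ⋀[R]^i Q) : extMap g i y = y := by
  subst hσ
  suffices extMap g i = LinearMap.id from DFunLike.congr_fun this y
  refine extPow_ext (N := ⋀[R]^i Q) fun y ↦ ?_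
  rw [extMap_ιMulti]
  simp [hg]

lemma extMap_comp (hρ : τ.comp σ = ρ) (g : Q →ₛₗ[σ] Q') (g' : Q' →ₛₗ[τ] B) (g'' : Q →ₛₗ[ρ] B)
    (h : ∀ x, g'' x = g' (g x)) (i : ℕ) (y : ⋀[R]^i Q) :
    extMap g'' i y = extMap g' i (extMap g i y) := by
  have : RingHomCompTriple σ τ ρ := ⟨hρ⟩
  suffices extMap g'' i = (extMap g' i).comp (extMap g i) from DFunLike.congr_fun this y
  refine extPow_ext (N := ⋀[T]^i B) fun y ↦ ?_
  rw [LinearMap.comp_apply, extMap_ιMulti, extMap_ιMulti, extMap_ιMulti]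
  simp [h]

lemma kosMap_id {σ : R →+* R} (hσ : σ = RingHom.id R) (g : Q →ₛₗ[σ] Q) (hg : ∀ x, g x = x)
    (f : M →ₛₗ[σ] M) (hf : ∀ x, f x = x) (q i : ℕ) (t : KosX R Q M q i) :
    kosMap g f q i t = t := by
  induction t using TensorProduct.induction_on with
  | zero => rw [map_zero]
  | add a b ha hb => rw [map_add, ha, hb]
  | tmul y γ => rw [kosMap, TensorProduct.map_tmul, extMap_id hσ g hg, dpMap_id hσ f hf]

lemma kosMap_comp (hρ : τ.comp σ = ρ) (g : Q →ₛₗ[σ] Q') (g' : Q' →ₛₗ[τ] B) (g'' : Q →ₛₗ[ρ] B)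
    (h : ∀ x, g'' x = g' (g x)) (f : M →ₛₗ[σ] N) (f' : N →ₛₗ[τ] A) (f'' : M →ₛₗ[ρ] A)
    (h' : ∀ x, f'' x = f' (f x)) (q i : ℕ) (t : KosX R Q M q i) :
    kosMap g'' f'' q i t = kosMap g' f' q i (kosMap g f q i t) := by
  induction t using TensorProduct.induction_on with
  | zero => simp only [map_zero]
  | add a b ha hb => simp only [map_add, ha, hb]
  | tmul y γ =>
    simp only [kosMap, TensorProduct.map_tmul]
    rw [extMap_comp hρ g g' g'' h, dpMap_comp hρ f f' f'' h']

end Functoriality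

end Semilinear

section Presheaves

variable {C : Type u} [SmallCategory C] {R : Cᵒᵖ ⥤ CommRingCat.{u}}

/-- The category of presheaves of modules over a presheaf of commutative rings. -/
abbrev PMod (R : Cᵒᵖ ⥤ CommRingCat.{u}) := PresheafOfModules.{u} (R ⋙ forget₂ CommRingCat RingCat)

/-- A presheaf of modules given by its modules of sections and semilinear restriction maps. -/
noncomputable def mkPMod (M : Cᵒᵖ → Type u) [∀ U, AddCommGroup (M U)] [∀ U, Module (R.obj U) (M U)]
    (res : ∀ {U V : Cᵒᵖ} (f : U ⟶ V), M U →ₛₗ[(R.map f).hom] M V)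
    (res_id : ∀ (U : Cᵒᵖ) (x : M U), res (𝟙 U) x = x)
    (res_comp : ∀ {U V W : Cᵒᵖ} (f : U ⟶ V) (g : V ⟶ W) (x : M U),
      res (f ≫ g) x = res g (res f x)) : PMod R where
  obj U := ModuleCat.of (R.obj U) (M U)
  map {U V} f := ModuleCat.semilinearMapAddEquiv (R.map f).hom
    (ModuleCat.of (R.obj U) (M U)) (ModuleCat.of (R.obj V) (M V)) (res f)
  map_id U := by
    ext x
    exact res_id U x
  map_comp f g := by
    ext x
    exact res_comp f g x

/-- The restriction map of a presheaf of modules as a semilinear map. -/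
noncomputable def res (M : PMod R) {U V : Cᵒᵖ} (f : U ⟶ V) :
    M.obj U →ₛₗ[(R.map f).hom] M.obj V where
  toFun x := M.map f x
  map_add' := map_add (M.map f).hom
  map_smul' c x := M.map_smul f c x

lemma res_apply (M : PMod R) {U V : Cᵒᵖ} (f : U ⟶ V) (x : M.obj U) : res M f x = M.map f x := rfl

lemma res_id (M : PMod R) (U : Cᵒᵖ) (x : M.obj U) : res M (𝟙 U) x = x := by
  rw [res_apply, M.map_id]
  rfl

lemma res_comp (M : PMod R) {U V W : Cᵒᵖ} (f : U ⟶ V) (g : V ⟶ W) (x : M.obj U) :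
    res M (f ≫ g) x = res M g (res M f x) :=
  M.map_comp_apply f g x

lemma map_id_hom (U : Cᵒᵖ) : (R.map (𝟙 U)).hom = RingHom.id (R.obj U) := by
  rw [R.map_id]; rfl

lemma map_comp_hom {U V W : Cᵒᵖ} (f : U ⟶ V) (g : V ⟶ W) :
    (R.map g).hom.comp (R.map f).hom = (R.map (f ≫ g)).hom := by
  rw [R.map_comp]; rfl

/-- The linear map given by a morphism of presheaves of modules on sections over `U`. -/
noncomputable def appₗ {M N : PMod R} (φ : M ⟶ N) (U : Cᵒᵖ) : M.obj U →ₗ[R.obj U] N.obj U where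
  toFun x := φ.app U x
  map_add' := map_add (φ.app U).hom
  map_smul' := map_smul (φ.app U).hom

lemma appₗ_res {M N : PMod R} (φ : M ⟶ N) {U V : Cᵒᵖ} (f : U ⟶ V) (x : M.obj U) :
    appₗ φ V (res M f x) = res N f (appₗ φ U x) :=
  PresheafOfModules.naturality_apply φ f x

/-- A morphism of presheaves of modules given by compatible linear maps. -/
noncomputable def mkPModHom {M N : PMod R} (φ : ∀ U, M.obj U →ₗ[R.obj U] N.obj U)
    (h : ∀ {U V : Cᵒᵖ} (f : U ⟶ V) (x : M.obj U), φ V (M.map f x) = N.map f (φ U x)) : M ⟶ N where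
  app U := ModuleCat.ofHom (φ U)
  naturality f := by
    ext x
    exact h f x

/-- The functor sending `M` to the presheaf `U ↦ Γⁿ(M(U))`. -/
noncomputable def preDPow (R : Cᵒᵖ ⥤ CommRingCat.{u}) (n : ℤ) : PMod R ⥤ PMod R where
  obj M := mkPMod (fun U ↦ DPow (R.obj U) (M.obj U) n) (fun f ↦ dpMap (res M f) n)
    (fun U x ↦ dpMap_id (map_id_hom U) _ (res_id M U) n x)
    (fun f g x ↦ dpMap_comp (map_comp_hom f g) _ _ _ (res_comp M f g) n x)
  map {M N} φ := mkPModHom (fun U ↦ dpMap (appₗ φ U) n) (fun {U V} f x ↦ by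
    exact (dpMap_comp (RingHom.id_comp _) (res M f) (appₗ φ V) ((res N f).comp (appₗ φ U))
      (fun x ↦ (appₗ_res φ f x).symm) n x).symm.trans
      (dpMap_comp (RingHom.comp_id _) (appₗ φ U) (res N f) _ (fun _ ↦ rfl) n x))
  map_id M := by
    ext U x
    exact dpMap_id (R := R.obj U) rfl _ (fun _ ↦ rfl) n x
  map_comp φ ψ := by
    ext U x
    exact dpMap_comp (R := R.obj U) rfl (appₗ φ U) (appₗ ψ U) (appₗ (φ ≫ ψ) U) (fun _ ↦ rfl) n x

/-- The presheaf `U ↦ Λⁱ(M(U))`. -/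
noncomputable def preExt (i : ℕ) (M : PMod R) : PMod R :=
  mkPMod (fun U ↦ ⋀[R.obj U]^i (M.obj U)) (fun f ↦ extMap (res M f) i)
    (fun U x ↦ extMap_id (map_id_hom U) _ (res_id M U) i x)
    (fun f g x ↦ extMap_comp (map_comp_hom f g) _ _ _ (res_comp M f g) i x)

/-- The presheaf `U ↦ Λⁱ(Q(U)) ⊗ Γ^{q-i}(P(U))`. -/
noncomputable def preKosX (Q P : PMod R) (q i : ℕ) : PMod R :=
  mkPMod (fun U ↦ KosX (R.obj U) (Q.obj U) (P.obj U) q i)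
    (fun f ↦ kosMap (res Q f) (res P f) q i)
    (fun U x ↦ kosMap_id (map_id_hom U) _ (res_id Q U) _ (res_id P U) q i x)
    (fun f g x ↦ kosMap_comp (map_comp_hom f g) _ _ _ (res_comp Q f g) _ _ _ (res_comp P f g) q i x)

/-- The presheaf of complexes `U ↦ Kos^q(u : P(U) → Q(U))`. -/
noncomputable def preKos {P Q : PMod R} (u : P ⟶ Q) (q : ℕ) : CochainComplex (PMod R) ℕ :=
  CochainComplex.of (fun i ↦ preKosX Q P q i)
    (fun i ↦ mkPModHom (fun U ↦ kosD (appₗ u U) q i)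
      (fun f x ↦ kosD_kosMap _ _ _ _ (fun x ↦ (appₗ_res u f x).symm) q i x))
    (fun i ↦ by
      ext U x
      exact DFunLike.congr_fun (kosD_kosD (appₗ u U) q i) x)

end Presheaves

section Sheaves

variable {C : Type u} [SmallCategory C] {J : GrothendieckTopology C}

/-- A sheaf of commutative rings, regarded as a sheaf of rings. -/
noncomputable abbrev ringSheaf (A : Sheaf J CommRingCat.{u}) : Sheaf J RingCat.{u} :=
  ⟨A.obj ⋙ forget₂ CommRingCat RingCat,
    ((sheafCompose J (forget₂ CommRingCat RingCat)).obj A).property⟩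

/-- The category of sheaves of modules on the ringed site `(C, J, A)`. -/
abbrev Mod (A : Sheaf J CommRingCat.{u}) := SheafOfModules.{u} (ringSheaf A)

variable (A : Sheaf J CommRingCat.{u})

/-- The sheafification functor for presheaves of modules. -/
noncomputable abbrev shf : PMod A.obj ⥤ Mod A :=
  PresheafOfModules.sheafification (𝟙 (ringSheaf A).obj)

variable {A}

/-- The section of the sheafification given by a section of a presheaf of modules. -/
noncomputable def toShf {M : PMod A.obj} {U : Cᵒᵖ} (x : M.obj U) : ((shf A).obj M).val.obj U :=
  ((PresheafOfModules.sheafificationAdjunction (𝟙 (ringSheaf A).obj)).unit.app M).app U x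

/-- The value of a morphism of sheaves of modules on a section. -/
noncomputable def ap {M N : Mod A} (φ : M ⟶ N) {U : Cᵒᵖ} (x : M.val.obj U) : N.val.obj U :=
  φ.val.app U x

/-- The restriction of a section of a sheaf of modules. -/
noncomputable def rs (M : Mod A) {U V : Cᵒᵖ} (f : U ⟶ V) (x : M.val.obj U) : M.val.obj V :=
  M.val.map f x

/-- A sheaf of modules `M` is flat if tensoring with `M` preserves monomorphisms of sheaves of
modules (the tensor product of sheaves of modules being the sheafification of the presheaf
tensor product). -/
def IsFlat (M : Mod A) : Prop :=
  ∀ ⦃N N' : Mod A⦄ (f : N ⟶ N'), Mono f →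
    Mono ((shf A).map (MonoidalCategoryStruct.whiskerLeft (C := PMod A.obj) M.val f.val))

/-- The `i`-th exterior power of a sheaf of modules: the sheaf associated with
`U ↦ Λⁱ(M(U))`. -/
noncomputable def extPow (i : ℕ) (M : Mod A) : Mod A := (shf A).obj (preExt i M.val)

/-- The section `z₁ ∧ ⋯ ∧ zᵢ` of `Λⁱ(M)`. -/
noncomputable def extSection {i : ℕ} {M : Mod A} {U : Cᵒᵖ} (z : Fin i → M.val.obj U) :
    (extPow i M).val.obj U :=
  toShf (M := preExt i M.val) (exteriorPower.ιMulti (A.obj.obj U) i z)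

variable (A) in
/-- The `n`-th divided power functor on sheaves of modules: `Γⁿ(M)` is the sheaf associated with
`U ↦ Γⁿ(M(U))`. -/
noncomputable def dPow (n : ℤ) : Mod A ⥤ Mod A :=
  SheafOfModules.forget _ ⋙ preDPow A.obj n ⋙ shf A

/-- The `q`-th Koszul complex of a morphism `u : P ⟶ Q` of sheaves of modules. Its degree `i` term
is `Λⁱ(Q) ⊗ Γ^{q-i}(P)`, the sheaf associated with `U ↦ Λⁱ(Q(U)) ⊗ Γ^{q-i}(P(U))`. -/
noncomputable def kos {P Q : Mod A} (u : P ⟶ Q) (q : ℕ) : CochainComplex (Mod A) ℕ :=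
  ((shf A).mapHomologicalComplex _).obj (preKos (R := A.obj) u.val q)

/-- The section `z₁ ∧ ⋯ ∧ zᵢ ⊗ x₁ ⋯ xⱼ` of `Kos^q(u)ⁱ = Λⁱ(Q) ⊗ Γ^{q-i}(P)`, where `i + j = q`. -/
noncomputable def kosSection {P Q : Mod A} (u : P ⟶ Q) {q i j : ℕ} (h : i + j = q) {U : Cᵒᵖ}
    (z : Fin i → Q.val.obj U) (x : Fin j → P.val.obj U) : ((kos u q).X i).val.obj U :=
  toShf (M := preKosX Q.val P.val q i)
    (exteriorPower.ιMulti (A.obj.obj U) i z ⊗ₜ[A.obj.obj U]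
      dpProd (R := A.obj.obj U) (by lia : (j : ℤ) = (q : ℤ) - i) x)

/-- The cosimplicial object associated with a cochain complex concentrated in nonnegative degrees
by the (dual) Dold-Kan correspondence. -/
noncomputable def doldKan {D : Type*} [Category* D] [Abelian D] (F : CochainComplex D ℕ) :
    CosimplicialObject D :=
  (AlgebraicTopology.DoldKan.Γ₀.obj
    (ChainComplex.of (fun n ↦ op (F.X n)) (fun n ↦ (F.d n (n + 1)).op)
      (fun n ↦ by rw [← op_comp, F.d_comp_d, op_zero]))).unop

/-- The derived divided power `LΓ^q(F)` of a coconnective complex `F` of flat sheaves of modules: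
apply `Γ^q` termwise to the cosimplicial sheaf of modules corresponding to `F` and take the
associated cochain complex. -/
noncomputable def derivedDPow (q : ℕ) (F : CochainComplex (Mod A) ℕ) :
    CochainComplex (Mod A) ℕ :=
  (AlgebraicTopology.alternatingCofaceMapComplex (Mod A)).obj
    (((CosimplicialObject.whiskering _ _).obj (dPow A q)).obj (doldKan F))

variable (A) in
/-- A coconnective commutative differential graded `A`-algebra. The multiplication is given by
bilinear maps on local sections compatible with restriction. -/
structure CDGA where
  /-- the underlying complex -/
  cx : CochainComplex (Mod A) ℕ
  /-- the unit -/
  unit : SheafOfModules.unit (ringSheaf A) ⟶ cx.X 0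
  /-- the multiplication of local sections -/
  mul (U : Cᵒᵖ) {i j n : ℕ} (h : i + j = n) :
    (cx.X i).val.obj U →ₗ[A.obj.obj U] (cx.X j).val.obj U →ₗ[A.obj.obj U] (cx.X n).val.obj U
  mul_rs {U V : Cᵒᵖ} (f : U ⟶ V) {i j n : ℕ} (h : i + j = n) (x : (cx.X i).val.obj U)
    (y : (cx.X j).val.obj U) : rs _ f (mul U h x y) = mul V h (rs _ f x) (rs _ f y)
  one_mul (U : Cᵒᵖ) {i : ℕ} (x : (cx.X i).val.obj U) :
    mul U (zero_add i) (ap unit (1 : A.obj.obj U)) x = x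
  mul_one (U : Cᵒᵖ) {i : ℕ} (x : (cx.X i).val.obj U) :
    mul U (add_zero i) x (ap unit (1 : A.obj.obj U)) = x
  mul_assoc (U : Cᵒᵖ) {i j k a b n : ℕ} (ha : i + j = a) (hb : j + k = b) (h : a + k = n)
    (h' : i + b = n) (x : (cx.X i).val.obj U) (y : (cx.X j).val.obj U) (z : (cx.X k).val.obj U) :
    mul U h (mul U ha x y) z = mul U h' x (mul U hb y z)
  mul_comm (U : Cᵒᵖ) {i j n : ℕ} (h : i + j = n) (h' : j + i = n) (x : (cx.X i).val.obj U)
    (y : (cx.X j).val.obj U) : mul U h x y = (-1 : ℤ) ^ (i * j) • mul U h' y x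
  leibniz (U : Cᵒᵖ) {i j n : ℕ} (h : i + j = n) (h₁ : i + 1 + j = n + 1)
    (h₂ : i + (j + 1) = n + 1) (x : (cx.X i).val.obj U) (y : (cx.X j).val.obj U) :
    ap (cx.d n (n + 1)) (mul U h x y) =
      mul U h₁ (ap (cx.d i (i + 1)) x) y + (-1 : ℤ) ^ i • mul U h₂ x (ap (cx.d j (j + 1)) y)

namespace CDGA

variable (K : CDGA A)

/-- The differential of the unit is zero. -/
lemma unit_d : K.unit ≫ K.cx.d 0 1 = 0 := by
  have h (U : Cᵒᵖ) : ap (K.cx.d 0 1) (ap K.unit (1 : A.obj.obj U)) = 0 := by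
    have := K.leibniz U (add_zero 0) (add_zero 1) (zero_add 1)
      (ap K.unit (1 : A.obj.obj U)) (ap K.unit (1 : A.obj.obj U))
    rw [K.mul_one, K.mul_one, K.one_mul, pow_zero, one_smul] at this
    exact left_eq_add.1 this
  apply SheafOfModules.hom_ext
  ext U
  exact h U

/-- The canonical morphism `A ⟶ H⁰(K)`. -/
noncomputable def toH0 : SheafOfModules.unit (ringSheaf A) ⟶ K.cx.homology 0 :=
  K.cx.liftCycles K.unit 1 (by simp) K.unit_d ≫ K.cx.homologyπ 0

variable {K} in
/-- The product `z₁ ⋯ zᵣ` of local sections of degree one. -/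
noncomputable def prodOne {U : Cᵒᵖ} : {r : ℕ} → (Fin r → (K.cx.X 1).val.obj U) →
    (K.cx.X r).val.obj U
  | 0, _ => ap K.unit (1 : A.obj.obj U)
  | _ + 1, z => K.mul U rfl (prodOne (Fin.init z)) (z (Fin.last _))

variable {K} in
/-- The product `x₁ ⋯ xᵣ` of local sections of degree zero. -/
noncomputable def prodZero {U : Cᵒᵖ} : {r : ℕ} → (Fin r → (K.cx.X 0).val.obj U) →
    (K.cx.X 0).val.obj U
  | 0, _ => ap K.unit (1 : A.obj.obj U)
  | _ + 1, x => K.mul U rfl (prodZero (Fin.init x)) (x (Fin.last _))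

/-- The sheaf `Z¹(K)` of cocycles of degree one. -/
noncomputable abbrev Z1 : Mod A := K.cx.cycles 1

/-- The inclusion `Z¹(K) → K¹` on local sections. -/
noncomputable def z1Val {U : Cᵒᵖ} (z : K.Z1.val.obj U) : (K.cx.X 1).val.obj U :=
  ap (K.cx.iCycles 1) z

/-- The differential `∂ : K⁰ ⟶ Z¹(K)`. -/
noncomputable def del : K.cx.X 0 ⟶ K.Z1 := K.cx.toCycles 0 1

/-- The truncation `τ_{≤ 1} K = [K⁰ ⟶ Z¹(K)]`. -/
noncomputable def tauLE1 : CochainComplex (Mod A) ℕ :=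
  HomologicalComplex.double K.del (show (ComplexShape.up ℕ).Rel 0 1 from rfl)

/-- `K` is an abstract Koszul complex: `A → H⁰(K)` is an isomorphism, and for every `q` the
multiplication map `H¹(K)^{⊗ q} → H^q(K)`, `[z₁] ⊗ ⋯ ⊗ [z_q] ↦ [z₁ ⋯ z_q]`, factors through an
isomorphism `Λ^q H¹(K) ≅ H^q(K)`. -/
structure IsAbstractKoszul : Prop where
  isIso_toH0 : IsIso K.toH0
  exists_iso (q : ℕ) : ∃ μ : extPow q (K.cx.homology 1) ≅ K.cx.homology q,
    ∀ (U : Cᵒᵖ) (z : Fin q → K.Z1.val.obj U) (c : (K.cx.cycles q).val.obj U),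
      ap (K.cx.iCycles q) c = prodOne (fun k ↦ K.z1Val (z k)) →
        ap μ.hom (extSection fun k ↦ ap (K.cx.homologyπ 1) (z k)) = ap (K.cx.homologyπ q) c

/-- The flatness condition: the sheaves of modules `K⁰`, `dK⁰`, `Z¹(K)` and `H¹(K)` are flat. -/
structure FlatCondition : Prop where
  flat_zero : IsFlat (K.cx.X 0)
  flat_image : IsFlat (Limits.image (K.cx.d 0 1))
  flat_cycles : IsFlat K.Z1
  flat_homology : IsFlat (K.cx.homology 1)

/-- `μ` is the multiplication map `Λⁱ(Z¹(K)) ⊗ Γʲ(K⁰) → Kⁱ`, where `i + j = q`: it sends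
`z₁ ∧ ⋯ ∧ zᵢ ⊗ x₁ ⋯ xⱼ` to `z₁ ⋯ zᵢ x₁ ⋯ xⱼ`. If `j!` is invertible, `Γʲ` is identified
with the symmetric power `Symʲ`, so that this determines `μ`. -/
def IsMulMap {q i j : ℕ} (h : i + j = q) (μ : (kos K.del q).X i ⟶ K.cx.X i) : Prop :=
  ∀ (U : Cᵒᵖ) (z : Fin i → K.Z1.val.obj U) (x : Fin j → (K.cx.X 0).val.obj U),
    ap μ (kosSection K.del h z x) =
      K.mul U (add_zero i) (prodOne fun k ↦ K.z1Val (z k)) (prodZero x)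

end CDGA

/-- A cochain complex indexed by the natural numbers, extended by zero to negative degrees. -/
noncomputable abbrev toZ (F : CochainComplex (Mod A) ℕ) : CochainComplex (Mod A) ℤ :=
  F.extend ComplexShape.embeddingUpNat

/-- The isomorphism between the degree `i` terms of a complex and of its extension by zero. -/
noncomputable def toZIso (F : CochainComplex (Mod A) ℕ) (i : ℕ) : (toZ F).X (i : ℤ) ≅ F.X i :=
  F.extendXIso ComplexShape.embeddingUpNat rfl

namespace CDGA

variable (K : CDGA A)

/-- The source `τ_{≥ q-m} Kos^q(∂)` of the comparison map. -/
noncomputable abbrev truncKos (q m : ℕ) : CochainComplex (Mod A) ℤ :=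
  (toZ (kos K.del q)).truncGE ((q : ℤ) - m)

/-- The complex `τ_{[a, b]}(K) = τ_{≥ a} τ_{≤ b} (K)`. -/
noncomputable abbrev truncK (a b : ℤ) : CochainComplex (Mod A) ℤ :=
  ((toZ K.cx).truncLE b).truncGE a

/-- The morphism of complexes `φ` is induced by the multiplication maps: for `i + j = q` with
`j ≤ m`, the multiplication map `μ : Kos^q(∂)ⁱ → Kⁱ` factors as `ν` through `(τ_{≤ q} K)ⁱ ⊆ Kⁱ`,
and `φ` is given in degree `i` by `ν` on the quotients defining the truncations `τ_{≥ q-m}`. -/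
def IsInducedByMul {q m : ℕ} (φ : K.truncKos q m ⟶ K.truncK ((q : ℤ) - m) q) : Prop :=
  ∀ (i j : ℕ) (h : i + j = q), j ≤ m →
    ∃ (μ : (kos K.del q).X i ⟶ K.cx.X i) (ν : (kos K.del q).X i ⟶ ((toZ K.cx).truncLE q).X i),
      K.IsMulMap h μ ∧
      ν ≫ ((toZ K.cx).ιTruncLE q).f i = μ ≫ (toZIso K.cx i).inv ∧
      (toZIso (kos K.del q) i).inv ≫ ((toZ (kos K.del q)).πTruncGE ((q : ℤ) - m)).f i ≫ φ.f i =
        ν ≫ (((toZ K.cx).truncLE q).πTruncGE ((q : ℤ) - m)).f i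

end CDGA

end Sheaves

end Koszul

open Koszul

/-!
Both assertions rest on one local description of Koszul cycles, `loc_kosGood`: if `u : P ⟶ Z` is
an epimorphism onto a flat sheaf `B` followed by a monomorphism with flat cokernel `H`, then the
cycles of `Kos^q(u)` in degree `i` are locally sums of boundaries and of elements of
`Λⁱ(Z) ⊗ Γ^{q-i}(ker u)`. No resolution of `P` or `Z` by locally free sheaves is available on a
general ringed site, so the proof works with one cycle at a time. A cycle involves finitely many
sections, and it is a cycle because of finitely many linear relations between them
(`finitelyKilled_of_kosMap_eq_zero`). By the equational criterion for flatness
(`IsFlat.loc_relations`, `loc_coordinates`) these relations hold, locally, already between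
coordinates with respect to finitely many sections; so the cycle comes from a cycle of the Koszul
complex of `M × Rⁿ → Rⁿ × F`, `(m, b) ↦ (b, 0)`, where `M = ker u`. For this map the description
follows by induction on `n`: a basis vector can be split off by the homotopy which is a contraction
on `Λ` and an integration on `Γ` (`kosHomotopy_succ`, `kosGood_splitMap`).

*The multiplication maps.* The products define `n!` times the multiplication map on `Λⁱ(Z¹K) ⊗
Γⁿ(K⁰)`, with `n = q - i`, over every ring (`CDGA.mulPre`), and for `n ≤ m` one may divide by `n!`.
The kernel of `∂ : K⁰ ⟶ Z¹K` is generated by `1`, so `loc_kosGood` shows that `Hⁱ(Kos^q(∂))` is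
generated by the classes of `y ⊗ 1ⁿ` with `y` in `Λⁱ(Z¹K)` (`CDGA.epi_constClass`). Composed with
this epimorphism, the map to `Hⁱ(K)` becomes the projection `Λⁱ(Z¹K) ⟶ Λⁱ(H¹K)` followed by the
given isomorphism to `Hⁱ(K)`. The kernel of the projection is locally spanned by the products `∂x ∧
y`, which already have trivial class in the Koszul complex because `(∂x ∧ y) ⊗ 1ⁿ = d(y ⊗ x1ⁿ)`. So
the map on cohomology is an isomorphism (`CDGA.isIso_of_isMulMap`). In the lowest degree `i = q -
m`, if it is positive, there is no multiplication map in degree `i - 1` to show that boundaries go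
to boundaries. There `(m + 1)!` times the multiplication map exists, so the classes of the images of
boundaries are killed by `m + 1`, and they vanish because the exterior powers of the flat sheaf
`H¹K` are torsion free (`IsFlat.extPow_eq_zero`).

*The derived divided powers.* The cosimplicial object `D` of a two-term complex `u : P ⟶ Q` has
split epimorphisms `Dⁿ⁺¹ ⟶ Q` whose kernel is `Dⁿ`, embedded by the last coface map
(`TwoTermData`). Let `Q` be flat. In the double complex with terms `Λᵇ(Q) ⊗ Γ^{q-b}(Dⁿ⁺¹)`
(`resolvedDouble`), the columns are the Koszul complexes of these split epimorphisms, which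
resolve `Γ^q(Dⁿ)` by `loc_kosGood`. The rows are contracted by the last codegeneracies onto
`Λᵇ(Q) ⊗ Γ^{q-b}(P)`. Comparing the two augmentations gives a quasi-isomorphism
`LΓ^q(P ⟶ Q) ⟶ Kos^q(u)` (`ResolvedDouble.quasiIso_π`).
-/

namespace Koszul

/-! ### Kernels of maps between exterior and divided powers -/

section Kernels

variable {R : Type u} [CommRing R] {M E : Type u} [AddCommGroup M] [Module R M]
  [AddCommGroup E] [Module R E] {Q F : Type u} [AddCommGroup Q] [Module R Q]
  [AddCommGroup F] [Module R F]

/-- The kernel of `Γ(E) → Γ(M)`, for a surjection `E → M`, is the ideal generated by the divided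
powers of positive degree of the elements of the kernel of `E → M`. -/
lemma mem_span_dp_of_dpAlgMap_eq_zero (f : E →ₗ[R] M) (hf : Function.Surjective f)
    {γ : DividedPowerAlgebra R E} (hγ : dpAlgMap f γ = 0) :
    γ ∈ Ideal.span {δ | ∃ (n : ℕ) (k : E), n ≠ 0 ∧ f k = 0 ∧
      δ = DividedPowerAlgebra.dp R n k} := by
  set I := Ideal.span {δ | ∃ (n : ℕ) (k : E), n ≠ 0 ∧ f k = 0 ∧
      δ = DividedPowerAlgebra.dp R n k} with hI
  let π := Ideal.Quotient.mkₐ R I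
  -- modulo `I`, the divided powers of `x` only depend on `f x`
  have key (x y : E) (n : ℕ) (h : f x = f y) : π (DividedPowerAlgebra.dp R n x) =
      π (DividedPowerAlgebra.dp R n y) := by
    have hx : x = (x - y) + y := by abel
    rw [hx, DividedPowerAlgebra.dp_add, map_sum,
      Finset.sum_eq_single ((0, n) : ℕ × ℕ)]
    · simp [DividedPowerAlgebra.dp_zero]
    · rintro ⟨a, b⟩ hab hne
      rw [map_mul]
      have ha : a ≠ 0 := by
        rintro rfl
        simp at hab
        exact hne (by simp [hab])
      have : π (DividedPowerAlgebra.dp R a (x - y)) = 0 :=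
        Ideal.Quotient.eq_zero_iff_mem.2 (Ideal.subset_span ⟨a, x - y, ha, by simp [h], rfl⟩)
      rw [this]; exact zero_mul (π (DividedPowerAlgebra.dp R b y))
    · simp
  let s := Function.surjInv hf
  have hs (m : M) : f (s m) = m := Function.surjInv_eq hf m
  let g : DividedPowerAlgebra R M →ₐ[R] DividedPowerAlgebra R E ⧸ I :=
    DividedPowerAlgebra.lift' (f := fun p ↦ π (DividedPowerAlgebra.dp R p.1 (s p.2)))
      (fun m ↦ by simp [DividedPowerAlgebra.dp_zero])
      (fun n r m ↦ by
        rw [key (s (r • m)) (r • s m) n (by simp [hs]), DividedPowerAlgebra.dp_smul, map_smul])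
      (fun n p m ↦ by rw [← map_mul, DividedPowerAlgebra.dp_mul, map_nsmul])
      (fun n a b ↦ by
        rw [key (s (a + b)) (s a + s b) n (by simp [hs]), DividedPowerAlgebra.dp_add, map_sum]
        simp)
  have hg : (g.toRingHom.comp (dpAlgMap f)) = π.toRingHom := by
    refine RingHom.ext fun δ ↦ ?_
    induction δ using dp_induction with
    | add a b ha hb => rw [map_add, map_add, ha, hb]
    | smul c a ha =>
      have h1 : π.toRingHom (c • a) = c • π.toRingHom a := map_smul π c a
      have h2 : g.toRingHom (c • dpAlgMap f a) = c • g.toRingHom (dpAlgMap f a) :=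
        map_smul g c _
      rw [h1, RingHom.comp_apply, dpAlgMap_smul, RingHom.id_apply, h2, ← ha]
      rfl
    | prod r e x =>
      rw [map_prod, map_prod]
      refine Finset.prod_congr rfl fun k _ ↦ ?_
      rw [RingHom.comp_apply, dpAlgMap_dp]
      change g _ = π _
      rw [DividedPowerAlgebra.lift'_apply_dp]
      exact key _ _ _ (hs _)
  have := DFunLike.congr_fun hg γ
  rw [RingHom.comp_apply, hγ, map_zero] at this
  exact Ideal.Quotient.eq_zero_iff_mem.1 this.symm

/-- An element of the kernel of `Γⁿ(E) → Γⁿ(M)`, for a surjection `E → M`, dies as soon as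
finitely many elements of the kernel of `E → M` die. -/
lemma exists_finset_dpMap_eq_zero (f : E →ₗ[R] M) (hf : Function.Surjective f) {n : ℤ}
    {γ : DPow R E n} (hγ : dpMap f n γ = 0) :
    ∃ T : Finset E, (∀ k ∈ T, f k = 0) ∧
      ∀ {S : Type u} [CommRing S] {σ : R →+* S} {N : Type u} [AddCommGroup N] [Module S N]
        (g : E →ₛₗ[σ] N), (∀ k ∈ T, g k = 0) → dpMap g n γ = 0 := by
  classical
  obtain ⟨γ, hmem⟩ := γ
  have h := mem_span_dp_of_dpAlgMap_eq_zero f hf (congr_arg Subtype.val hγ)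
  dsimp only at h
  suffices ∃ T : Finset E, (∀ k ∈ T, f k = 0) ∧
      ∀ {S : Type u} [CommRing S] {σ : R →+* S} {N : Type u} [AddCommGroup N] [Module S N]
        (g : E →ₛₗ[σ] N), (∀ k ∈ T, g k = 0) → dpAlgMap g γ = 0 by
    obtain ⟨T, hT, h⟩ := this
    exact ⟨T, hT, fun g hg ↦ Subtype.ext (h g hg)⟩
  clear hγ hmem
  induction h using Submodule.span_induction with
  | mem x hx =>
    obtain ⟨n, k, hn, hk, rfl⟩ := hx
    refine ⟨{k}, by simpa using hk, fun g hg ↦ ?_⟩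
    rw [dpAlgMap_dp, hg k (by simp), DividedPowerAlgebra.dp_null_of_ne_zero hn]
  | zero => exact ⟨∅, by simp, fun g _ ↦ map_zero _⟩
  | add x y _ _ hx hy =>
    obtain ⟨T, hT, hx⟩ := hx
    obtain ⟨T', hT', hy⟩ := hy
    refine ⟨T ∪ T', fun k hk ↦ (Finset.mem_union.1 hk).elim (hT k) (hT' k), fun g hg ↦ ?_⟩
    rw [map_add, hx g fun k hk ↦ hg k (by simp [hk]), hy g fun k hk ↦ hg k (by simp [hk]),
      add_zero]
  | smul a x _ hx =>
    obtain ⟨T, hT, hx⟩ := hx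
    refine ⟨T, hT, fun g hg ↦ ?_⟩
    rw [smul_eq_mul, map_mul, hx g hg, mul_zero]

/-- The kernel of `Λⁱ(F) → Λⁱ(Q)`, for a surjection `F → Q`, is spanned by the exterior products
one factor of which belongs to the kernel of `F → Q`. -/
lemma mem_span_ιMulti_of_extMap_eq_zero (f : F →ₗ[R] Q) (hf : Function.Surjective f) {i : ℕ}
    {y : ⋀[R]^i F} (hy : extMap f i y = 0) :
    y ∈ Submodule.span R {z | ∃ e : Fin i → F, (∃ j, f (e j) = 0) ∧
      z = exteriorPower.ιMulti R i e} := by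
  classical
  set N := Submodule.span R {z | ∃ e : Fin i → F, (∃ j, f (e j) = 0) ∧
      z = exteriorPower.ιMulti R i e} with hN
  -- modulo `N`, an exterior product only depends on the images of its factors under `f`
  have key (e e' : Fin i → F) (h : ∀ j, f (e j) = f (e' j)) :
      N.mkQ (exteriorPower.ιMulti R i e) = N.mkQ (exteriorPower.ιMulti R i e') := by
    suffices ∀ s : Finset (Fin i), N.mkQ (exteriorPower.ιMulti R i (s.piecewise e e')) =
        N.mkQ (exteriorPower.ιMulti R i e') by simpa using this Finset.univ
    intro s
    induction s using Finset.induction_on with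
    | empty => simp
    | insert j s hj ih =>
      rw [Finset.piecewise_insert, ← ih, ← sub_eq_zero, ← map_sub]
      have h1 : s.piecewise e e' = Function.update (s.piecewise e e') j (e' j) := by
        rw [eq_comm, Function.update_eq_self_iff]
        simp [hj]
      conv in (exteriorPower.ιMulti R i) (s.piecewise e e') => rw [h1]
      rw [← AlternatingMap.map_update_sub, Submodule.mkQ_apply, Submodule.Quotient.mk_eq_zero]
      exact Submodule.subset_span ⟨_, ⟨j, by simp [h]⟩, rfl⟩
  let s := Function.surjInv hf
  have hs (m : Q) : f (s m) = m := Function.surjInv_eq hf m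
  have hupd (m : Fin i → Q) (j : Fin i) (x : Q) (k : Fin i) :
      f (s (Function.update m j x k)) = Function.update m j x k := hs _
  let a : Q [⋀^Fin i]→ₗ[R] (⋀[R]^i F ⧸ N) :=
    { toFun := fun m ↦ N.mkQ (exteriorPower.ιMulti R i fun j ↦ s (m j))
      map_update_add' := fun m j x y ↦ by
        have h (z : Q) (w : F) (hw : f w = z) :
            N.mkQ (exteriorPower.ιMulti R i fun k ↦ s (Function.update m j z k)) =
            N.mkQ (exteriorPower.ιMulti R i (Function.update (fun k ↦ s (m k)) j w)) := by
          refine key _ _ fun k ↦ ?_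
          rw [hs]
          by_cases hk : k = j
          · subst hk; simp [hw]
          · simp [hk, hs]
        rw [h (x + y) (s x + s y) (by simp [hs]), h x (s x) (hs _), h y (s y) (hs _),
          AlternatingMap.map_update_add, map_add]
      map_update_smul' := fun m j c x ↦ by
        have h (z : Q) (w : F) (hw : f w = z) :
            N.mkQ (exteriorPower.ιMulti R i fun k ↦ s (Function.update m j z k)) =
            N.mkQ (exteriorPower.ιMulti R i (Function.update (fun k ↦ s (m k)) j w)) := by
          refine key _ _ fun k ↦ ?_
          rw [hs]
          by_cases hk : k = j
          · subst hk; simp [hw]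
          · simp [hk, hs]
        rw [h (c • x) (c • s x) (by simp [hs]), h x (s x) (hs _),
          AlternatingMap.map_update_smul, map_smul]
      map_eq_zero_of_eq' := fun m j l hjl hne ↦ by
        rw [(exteriorPower.ιMulti R i).map_eq_zero_of_eq _ (i := j) (j := l) (by simp [hjl]) hne,
          map_zero] }
  have hcomp : (exteriorPower.alternatingMapLinearEquiv a) ∘ₗ extMap f i = N.mkQ := by
    refine extPow_ext (N := ⋀[R]^i F ⧸ N) fun e ↦ ?_
    rw [LinearMap.comp_apply, extMap_ιMulti, exteriorPower.alternatingMapLinearEquiv_apply_ιMulti]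
    exact key _ _ fun j ↦ hs _
  have := DFunLike.congr_fun hcomp y
  rw [LinearMap.comp_apply, hy, map_zero, Submodule.mkQ_apply] at this
  exact (Submodule.Quotient.mk_eq_zero _).1 this.symm

/-- An element of the kernel of `Λⁱ(F) → Λⁱ(Q)`, for a surjection `F → Q`, dies as soon as
finitely many elements of the kernel of `F → Q` die. -/
lemma exists_finset_extMap_eq_zero (f : F →ₗ[R] Q) (hf : Function.Surjective f) {i : ℕ}
    {y : ⋀[R]^i F} (hy : extMap f i y = 0) :
    ∃ T : Finset F, (∀ k ∈ T, f k = 0) ∧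
      ∀ {S : Type u} [CommRing S] {σ : R →+* S} {N : Type u} [AddCommGroup N] [Module S N]
        (g : F →ₛₗ[σ] N), (∀ k ∈ T, g k = 0) → extMap g i y = 0 := by
  classical
  have h := mem_span_ιMulti_of_extMap_eq_zero f hf hy
  clear hy
  induction h using Submodule.span_induction with
  | mem x hx =>
    obtain ⟨e, ⟨j, hj⟩, rfl⟩ := hx
    refine ⟨{e j}, by simpa using hj, fun g hg ↦ ?_⟩
    rw [extMap_ιMulti]
    exact AlternatingMap.map_coord_zero _ j (hg _ (by simp))
  | zero => exact ⟨∅, by simp, fun g _ ↦ map_zero _⟩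
  | add x y _ _ hx hy =>
    obtain ⟨T, hT, hx⟩ := hx
    obtain ⟨T', hT', hy⟩ := hy
    refine ⟨T ∪ T', fun k hk ↦ (Finset.mem_union.1 hk).elim (hT k) (hT' k), fun g hg ↦ ?_⟩
    rw [map_add, hx g fun k hk ↦ hg k (by simp [hk]), hy g fun k hk ↦ hg k (by simp [hk]),
      add_zero]
  | smul a x _ hx =>
    obtain ⟨T, hT, hx⟩ := hx
    refine ⟨T, hT, fun g hg ↦ ?_⟩
    rw [map_smulₛₗ, hx g hg, smul_zero]

lemma dpMap_surjective (f : E →ₗ[R] M) (hf : Function.Surjective f) (n : ℤ) :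
    Function.Surjective (dpMap f n) := by
  rw [← LinearMap.range_eq_top, eq_top_iff]
  rintro ⟨γ, hγ⟩ -
  have hγ' := hγ
  rw [DPow] at hγ'
  induction hγ' using Submodule.span_induction with
  | mem a ha =>
    obtain ⟨r, e, x, he, rfl⟩ := ha
    choose y hy using fun k ↦ hf (x k)
    refine ⟨⟨∏ k, dpZ R (e k) (y k), prod_dpZ_mem _ y he⟩, ?_⟩
    rw [dpMap_prod _ _ _ he]
    simp [dpZ_natCast, hy]
  | zero => exact zero_mem _
  | add a b ha hb ha' hb' => exact add_mem (ha' ha) (hb' hb)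
  | smul c a ha ha' => exact Submodule.smul_mem _ c (ha' ha)

lemma extMap_surjective (f : F →ₗ[R] Q) (hf : Function.Surjective f) (i : ℕ) :
    Function.Surjective (extMap f i) := by
  rw [← LinearMap.range_eq_top, eq_top_iff, ← exteriorPower.ιMulti_span, Submodule.span_le]
  rintro _ ⟨y, rfl⟩
  choose z hz using fun k ↦ hf (y k)
  exact ⟨exteriorPower.ιMulti R i z, by rw [extMap_ιMulti]; simp [hz]⟩

lemma kosMap_surjective (g : F →ₗ[R] Q) (hg : Function.Surjective g) (f : E →ₗ[R] M)
    (hf : Function.Surjective f) (q i : ℕ) : Function.Surjective (kosMap g f q i) :=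
  TensorProduct.map_surjective (extMap_surjective g hg i) (dpMap_surjective f hf _)

/-- An element of `Λⁱ(F) ⊗ Γʲ(E)` is finitely killed by the kernels of `g` and `f` if it dies under
all pairs of semilinear maps which kill certain finite subsets of these kernels. -/
def FinitelyKilled (g : F →ₗ[R] Q) (f : E →ₗ[R] M) {q i : ℕ} (t : KosX R F E q i) : Prop :=
  ∃ (T : Finset F) (T' : Finset E), (∀ k ∈ T, g k = 0) ∧ (∀ k ∈ T', f k = 0) ∧
    ∀ {S : Type u} [CommRing S] {σ : R →+* S} {N N' : Type u} [AddCommGroup N] [Module S N]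
      [AddCommGroup N'] [Module S N'] (g' : F →ₛₗ[σ] N) (f' : E →ₛₗ[σ] N'),
      (∀ k ∈ T, g' k = 0) → (∀ k ∈ T', f' k = 0) → kosMap g' f' q i t = 0

lemma FinitelyKilled.zero (g : F →ₗ[R] Q) (f : E →ₗ[R] M) (q i : ℕ) :
    FinitelyKilled g f (0 : KosX R F E q i) :=
  ⟨∅, ∅, by simp, by simp, fun _ _ _ _ ↦ map_zero _⟩

lemma FinitelyKilled.add {g : F →ₗ[R] Q} {f : E →ₗ[R] M} {q i : ℕ} {a b : KosX R F E q i}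
    (ha : FinitelyKilled g f a) (hb : FinitelyKilled g f b) : FinitelyKilled g f (a + b) := by
  classical
  obtain ⟨T, T', hT, hT', ha⟩ := ha
  obtain ⟨V, V', hV, hV', hb⟩ := hb
  refine ⟨T ∪ V, T' ∪ V', fun k hk ↦ (Finset.mem_union.1 hk).elim (hT k) (hV k),
    fun k hk ↦ (Finset.mem_union.1 hk).elim (hT' k) (hV' k), fun g' f' hg' hf' ↦ ?_⟩
  rw [map_add, ha g' f' (fun k hk ↦ hg' k (Finset.mem_union_left _ hk))
    (fun k hk ↦ hf' k (Finset.mem_union_left _ hk)),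
    hb g' f' (fun k hk ↦ hg' k (Finset.mem_union_right _ hk))
    (fun k hk ↦ hf' k (Finset.mem_union_right _ hk)), add_zero]

/-- The kernel of the tensor product of two surjections is generated by the elements `x ⊗ y`
with `x` or `y` in the kernel of the corresponding surjection. -/
lemma tensor_ker_induction {X X' Y Y' : Type*} [AddCommGroup X] [Module R X] [AddCommGroup X']
    [Module R X'] [AddCommGroup Y] [Module R Y] [AddCommGroup Y'] [Module R Y']
    {a : X →ₗ[R] X'} (ha : Function.Surjective a) {b : Y →ₗ[R] Y'} (hb : Function.Surjective b)
    {p : X ⊗[R] Y → Prop} (zero : p 0) (add : ∀ s t, p s → p t → p (s + t))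
    (left : ∀ x y, a x = 0 → p (x ⊗ₜ y)) (right : ∀ x y, b y = 0 → p (x ⊗ₜ y))
    {t : X ⊗[R] Y} (ht : TensorProduct.map a b t = 0) : p t := by
  have h : t ∈ LinearMap.ker (TensorProduct.map a b) := ht
  rw [TensorProduct.map_ker (f := (LinearMap.ker a).subtype) (f' := (LinearMap.ker b).subtype)
    (LinearMap.exact_subtype_ker_map _) ha (LinearMap.exact_subtype_ker_map _) hb] at h
  obtain ⟨_, ⟨t₁, rfl⟩, _, ⟨t₂, rfl⟩, rfl⟩ := Submodule.mem_sup.1 h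
  clear h ht
  refine add _ _ ?_ ?_
  · induction t₁ using TensorProduct.induction_on with
    | zero => rwa [map_zero]
    | add a b ha hb => rw [map_add]; exact add _ _ ha hb
    | tmul y γ => exact right _ _ γ.2
  · induction t₂ using TensorProduct.induction_on with
    | zero => rwa [map_zero]
    | add a b ha hb => rw [map_add]; exact add _ _ ha hb
    | tmul y γ => exact left _ _ y.2

/-- The elements of the kernel of `Λⁱ(F) ⊗ Γʲ(E) → Λⁱ(Q) ⊗ Γʲ(M)`, for surjections `F → Q` and
`E → M`, die as soon as finitely many elements of the kernels of these surjections die. -/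
lemma finitelyKilled_of_kosMap_eq_zero (g : F →ₗ[R] Q) (hg : Function.Surjective g) (f : E →ₗ[R] M)
    (hf : Function.Surjective f) {q i : ℕ} {t : KosX R F E q i} (ht : kosMap g f q i t = 0) :
    FinitelyKilled g f t := by
  refine tensor_ker_induction (X := ⋀[R]^i F) (X' := ⋀[R]^i Q) (Y := DPow R E ((q : ℤ) - i))
    (Y' := DPow R M ((q : ℤ) - i)) (extMap_surjective g hg i) (dpMap_surjective f hf _)
    (p := fun t ↦ FinitelyKilled g f t) (.zero g f q i) (fun _ _ ↦ .add) (fun y γ h ↦ ?_)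
    (fun y γ h ↦ ?_) ht
  · obtain ⟨T, hT, h⟩ := exists_finset_extMap_eq_zero g hg h
    refine ⟨T, ∅, hT, by simp, fun g' f' hg' _ ↦ ?_⟩
    rw [kosMap, TensorProduct.map_tmul, h _ hg', zero_tmul]
  · obtain ⟨T, hT, h⟩ := exists_finset_dpMap_eq_zero f hf h
    refine ⟨∅, T, by simp, hT, fun g' f' _ hf' ↦ ?_⟩
    rw [kosMap, TensorProduct.map_tmul, h _ hf', tmul_zero]

/-- The elements `y₁ ∧ ⋯ ∧ yᵢ ⊗ x₁^{[e₁]} ⋯ x_r^{[e_r]}` span `Λⁱ(F) ⊗ Γ^{q-i}(E)`. -/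
lemma kosX_induction {q i : ℕ} {p : KosX R F E q i → Prop} (t : KosX R F E q i)
    (gen : ∀ (y : Fin i → F) (r : ℕ) (e : Fin r → ℤ) (x : Fin r → E)
      (h : ∑ k, e k = (q : ℤ) - i), p (exteriorPower.ιMulti R i y ⊗ₜ
        ⟨∏ k, dpZ R (e k) (x k), prod_dpZ_mem e x h⟩)) (zero : p 0)
    (add : ∀ a b, p a → p b → p (a + b)) (smul : ∀ (c : R) a, p a → p (c • a)) : p t := by
  induction t using TensorProduct.induction_on with
  | zero => exact zero
  | add a b ha hb => exact add _ _ ha hb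
  | tmul y γ =>
    have hy : y ∈ Submodule.span R (Set.range (exteriorPower.ιMulti R i (M := F))) := by
      rw [exteriorPower.ιMulti_span]; trivial
    induction hy using Submodule.span_induction with
    | zero => rwa [zero_tmul]
    | add a b _ _ ha hb => rw [add_tmul]; exact add _ _ ha hb
    | smul c a _ ha => rw [← smul_tmul']; exact smul _ _ ha
    | mem y hy =>
      obtain ⟨y, rfl⟩ := hy
      obtain ⟨γ, hγ⟩ := γ
      have hγ' := hγ
      rw [DPow] at hγ'
      induction hγ' using Submodule.span_induction with
      | mem a ha =>
        obtain ⟨r, e, x, he, rfl⟩ := ha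
        simpa only [dpZ_natCast] using gen y r (fun k ↦ (e k : ℤ)) x he
      | zero =>
        have h0 : exteriorPower.ιMulti R i y ⊗ₜ[R] (0 : DPow R E ((q : ℤ) - i)) = 0 :=
          tmul_zero (M := ⋀[R]^i F) (N := DPow R E ((q : ℤ) - i)) _
        exact h0 ▸ zero
      | add a b ha hb ha' hb' =>
        have := add _ _ (ha' ha) (hb' hb)
        rwa [← tmul_add] at this
      | smul c a ha ha' =>
        have := smul c _ (ha' ha)
        rwa [← tmul_smul] at this

/-- The image of an element of `Λⁱ(F) ⊗ Γʲ(E)` under a pair of semilinear maps only depends on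
the values of these maps on finitely many elements. -/
lemma exists_finset_kosMap_congr {q i : ℕ} (t : KosX R F E q i) :
    ∃ (T : Finset F) (T' : Finset E),
      ∀ {S : Type u} [CommRing S] {σ : R →+* S} {N N' : Type u} [AddCommGroup N] [Module S N]
        [AddCommGroup N'] [Module S N'] (g g' : F →ₛₗ[σ] N) (f f' : E →ₛₗ[σ] N'),
        (∀ k ∈ T, g k = g' k) → (∀ k ∈ T', f k = f' k) →
          kosMap g f q i t = kosMap g' f' q i t := by
  classical
  induction t using kosX_induction with
  | gen y r e x h =>
    refine ⟨Finset.univ.image y, Finset.univ.image x, fun g g' f f' hg hf ↦ ?_⟩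
    rw [kosMap_tmul _ _ _ _ _ _ _ h, kosMap_tmul _ _ _ _ _ _ _ h]
    simp only [Finset.mem_image, Finset.mem_univ, true_and, forall_exists_index,
      forall_apply_eq_imp_iff] at hg hf
    simp only [hg, hf]
  | zero => exact ⟨∅, ∅, fun _ _ _ _ _ _ ↦ (map_zero _).trans (map_zero _).symm⟩
  | add x y hx hy =>
    obtain ⟨T, T', hx⟩ := hx
    obtain ⟨V, V', hy⟩ := hy
    refine ⟨T ∪ V, T' ∪ V', fun g g' f f' hg hf ↦ ?_⟩
    rw [map_add, map_add, hx g g' f f' (fun k hk ↦ hg k (Finset.mem_union_left _ hk))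
      (fun k hk ↦ hf k (Finset.mem_union_left _ hk)),
      hy g g' f f' (fun k hk ↦ hg k (Finset.mem_union_right _ hk))
      (fun k hk ↦ hf k (Finset.mem_union_right _ hk))]
  | smul a x hx =>
    obtain ⟨T, T', hx⟩ := hx
    refine ⟨T, T', fun g g' f f' hg hf ↦ ?_⟩
    rw [map_smulₛₗ, map_smulₛₗ, hx g g' f f' hg hf]

end Kernels

/-! ### Contraction and integration along a free factor of rank one -/

section Contraction

variable {R : Type u} [CommRing R] {Q : Type u} [AddCommGroup Q] [Module R Q]

lemma contractLeft_mem (d : Module.Dual R Q) (i : ℕ) {y : ExteriorAlgebra R Q}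
    (hy : y ∈ ⋀[R]^(i + 1) Q) :
    CliffordAlgebra.contractLeft (Q := (0 : QuadraticForm R Q)) d y ∈ ⋀[R]^i Q := by
  induction i generalizing y with
  | zero =>
    change y ∈ LinearMap.range (ExteriorAlgebra.ι R) ^ 1 at hy
    rw [pow_one] at hy
    obtain ⟨x, rfl⟩ := hy
    change _ ∈ LinearMap.range (ExteriorAlgebra.ι R) ^ 0
    rw [pow_zero]
    erw [CliffordAlgebra.contractLeft_ι]
    exact Submodule.algebraMap_mem _
  | succ i ih =>
    change y ∈ LinearMap.range (ExteriorAlgebra.ι R) ^ (i + 1 + 1) at hy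
    rw [pow_succ'] at hy
    induction hy using Submodule.mul_induction_on' with
    | mem_mul_mem a ha b hb =>
      obtain ⟨x, rfl⟩ := ha
      erw [CliffordAlgebra.contractLeft_ι_mul]
      refine Submodule.sub_mem _ (Submodule.smul_mem _ _ hb) ?_
      change _ ∈ LinearMap.range (ExteriorAlgebra.ι R) ^ (i + 1)
      rw [pow_succ']
      exact Submodule.mul_mem_mul ⟨x, rfl⟩ (ih hb)
    | add a _ b _ ha hb => rw [map_add]; exact add_mem ha hb

/-- The contraction `Λⁱ⁺¹(Q) → Λⁱ(Q)` with a linear form on `Q`. -/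
noncomputable def contract (d : Module.Dual R Q) (i : ℕ) : ⋀[R]^(i + 1) Q →ₗ[R] ⋀[R]^i Q :=
  LinearMap.restrict (CliffordAlgebra.contractLeft (Q := (0 : QuadraticForm R Q)) d)
    (fun _ hy ↦ contractLeft_mem d i hy)

lemma contract_wedge (d : Module.Dual R Q) (i : ℕ) (x : Q) (y : ⋀[R]^(i + 1) Q) :
    contract d (i + 1) (wedge R Q (i + 1) x y) = d x • y - wedge R Q i x (contract d i y) :=
  Subtype.ext (CliffordAlgebra.contractLeft_ι_mul (Q := (0 : QuadraticForm R Q)) d x y.1)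

lemma contract_wedge_zero (d : Module.Dual R Q) (x : Q) (y : ⋀[R]^0 Q) :
    contract d 0 (wedge R Q 0 x y) = d x • y := by
  have h := CliffordAlgebra.contractLeft_ι_mul (Q := (0 : QuadraticForm R Q)) d x y.1
  have hy : y.1 ∈ LinearMap.range (ExteriorAlgebra.ι R (M := Q)) ^ 0 := y.2
  rw [pow_zero] at hy
  obtain ⟨c, hc⟩ := Submodule.mem_one.1 hy
  have h0 : CliffordAlgebra.contractLeft (Q := (0 : QuadraticForm R Q)) d y.1 = 0 := by
    rw [← hc]
    exact CliffordAlgebra.contractLeft_algebraMap 0 d c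
  rw [h0, mul_zero, sub_zero] at h
  exact Subtype.ext h

variable (R) in
/-- The exterior product of the last basis vector of `Q × R` with an element of the exterior
algebra of `Q × R`, followed by the contraction with the last coordinate, projects onto the
exterior algebra of `Q`. -/
lemma contract_wedge_snd (i : ℕ) (y : ⋀[R]^i (Q × R)) :
    contract (LinearMap.snd R Q R) i (wedge R (Q × R) i (0, 1) y) =
      extMap (LinearMap.inl R Q R ∘ₗ LinearMap.fst R Q R) i y := by
  suffices h : contract (LinearMap.snd R Q R) i ∘ₗ wedge R (Q × R) i (0, 1) =
      extMap (LinearMap.inl R Q R ∘ₗ LinearMap.fst R Q R) i from DFunLike.congr_fun h y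
  refine extPow_ext (N := ⋀[R]^i (Q × R)) fun z ↦ ?_
  rw [LinearMap.comp_apply, extMap_ιMulti]
  refine Subtype.ext ?_
  change CliffordAlgebra.contractLeft (Q := (0 : QuadraticForm R (Q × R))) (LinearMap.snd R Q R)
    (ExteriorAlgebra.ι R (0, 1) * ExteriorAlgebra.ιMulti R i z) = ExteriorAlgebra.ιMulti R i _
  set c := CliffordAlgebra.contractLeft (Q := (0 : QuadraticForm R (Q × R))) (LinearMap.snd R Q R)
  have hc (x : Q × R) (w : ExteriorAlgebra R (Q × R)) :
      c (ExteriorAlgebra.ι R x * w) = x.2 • w - ExteriorAlgebra.ι R x * c w :=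
    CliffordAlgebra.contractLeft_ι_mul _ _ _
  set f : ExteriorAlgebra R (Q × R) := ExteriorAlgebra.ι R ((0, 1) : Q × R) with hf
  induction i with
  | zero =>
    have h1 : c 1 = 0 := CliffordAlgebra.contractLeft_one _ _
    rw [hc]
    simp [h1]
  | succ i ih =>
    have hz (z : Fin (i + 1) → Q × R) : ExteriorAlgebra.ιMulti R (i + 1) z =
        ExteriorAlgebra.ι R (z 0) * ExteriorAlgebra.ιMulti R i (Fin.tail z) := by
      rw [ExteriorAlgebra.ιMulti_succ_apply]
      rfl
    have ih' : _ = ExteriorAlgebra.ιMulti R i (Fin.tail fun k ↦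
        (LinearMap.inl R Q R ∘ₗ LinearMap.fst R Q R) (z k)) := ih 0 (Fin.tail z)
    rw [hf, hc, one_smul] at ih'
    have he : ExteriorAlgebra.ι R ((LinearMap.inl R Q R ∘ₗ LinearMap.fst R Q R) (z 0)) =
        ExteriorAlgebra.ι R (z 0) - (z 0).2 • f := by
      rw [hf, ← map_smul, ← map_sub]
      congr 1
      ext <;> simp
    have hff : f * f = 0 := ExteriorAlgebra.ι_sq_zero _
    have hfx : f * ExteriorAlgebra.ι R (z 0) = - (ExteriorAlgebra.ι R (z 0) * f) :=
      eq_neg_of_add_eq_zero_left (ExteriorAlgebra.ι_add_mul_swap _ _)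
    rw [hz, hz]
    rw [he, ← ih', hf, hc, hc, one_smul, ← hf, mul_sub, mul_smul_comm, ← mul_assoc f, hfx]
    simp only [sub_mul, mul_sub, smul_mul_assoc, ← mul_assoc, hff, neg_mul, zero_mul, smul_zero]
    abel

end Contraction

section Integration

variable {R : Type u} [CommRing R] {P : Type u} [AddCommGroup P] [Module R P]

/-- The element `x₁^{[e₁]} ⋯ x_r^{[e_r]} f^{[k]}` of `Γⁿ(P × R)`, where the `xₗ` are elements of `P`
and `f` is the basis element of the factor `R`. -/
noncomputable def dpCons {r : ℕ} (k : ℤ) (e : Fin r → ℤ) (x : Fin r → P) {n : ℤ}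
    (h : k + ∑ l, e l = n) : DPow R (P × R) n :=
  ⟨∏ l, dpZ R ((Fin.cons k e : Fin (r + 1) → ℤ) l)
    ((Fin.cons (0, 1) fun l ↦ (x l, 0) : Fin (r + 1) → P × R) l),
    prod_dpZ_mem _ _ (by rw [Fin.sum_univ_succ]; simpa using h)⟩

lemma dpCons_val {r : ℕ} (k : ℤ) (e : Fin r → ℤ) (x : Fin r → P) {n : ℤ}
    (h : k + ∑ l, e l = n) : (dpCons k e x h : DPow R (P × R) n).1 =
      dpZ R k ((0, 1) : P × R) * ∏ l, dpZ R (e l) ((x l, 0) : P × R) := by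
  simp [dpCons, Fin.prod_univ_succ]

/-- The divided power algebra of `P × R` is spanned by the products
`x₁^{[e₁]} ⋯ x_r^{[e_r]} f^{[k]}`. -/
lemma span_dpCons_eq_top : Submodule.span R {γ : DividedPowerAlgebra R (P × R) |
    ∃ (k r : ℕ) (e : Fin r → ℕ) (x : Fin r → P), γ = DividedPowerAlgebra.dp R k ((0, 1) : P × R) *
      ∏ l, DividedPowerAlgebra.dp R (e l) ((x l, 0) : P × R)} = ⊤ := by
  rw [eq_top_iff]
  rintro γ -
  set W := Submodule.span R {γ : DividedPowerAlgebra R (P × R) |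
    ∃ (k r : ℕ) (e : Fin r → ℕ) (x : Fin r → P), γ = DividedPowerAlgebra.dp R k ((0, 1) : P × R) *
      ∏ l, DividedPowerAlgebra.dp R (e l) ((x l, 0) : P × R)} with hW
  induction γ using DividedPowerAlgebra.induction_on with
  | C a =>
    rw [Algebra.algebraMap_eq_smul_one]
    refine W.smul_mem _ ?_
    rw [hW]
    exact Submodule.subset_span ⟨0, 0, Fin.elim0, Fin.elim0, by
      simp [DividedPowerAlgebra.dp_zero]⟩
  | add f g hf hg => exact add_mem hf hg
  | dp γ n m hγ =>
    induction hγ using Submodule.span_induction with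
    | zero => rw [zero_mul]; exact zero_mem _
    | add a b _ _ ha hb => rw [add_mul]; exact add_mem ha hb
    | smul c a _ ha => rw [smul_mul_assoc]; exact W.smul_mem _ ha
    | mem γ hγ =>
      obtain ⟨k, r, e, x, rfl⟩ := hγ
      obtain ⟨p, c⟩ := m
      have hm : ((p, c) : P × R) = (p, 0) + c • (0, 1) := by simp
      rw [hm, DividedPowerAlgebra.dp_add, Finset.mul_sum]
      refine Submodule.sum_mem _ fun ab _ ↦ ?_
      rw [DividedPowerAlgebra.dp_smul, mul_smul_comm, mul_smul_comm]
      refine W.smul_mem _ ?_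
      have h : DividedPowerAlgebra.dp R k ((0, 1) : P × R) *
          (∏ l, DividedPowerAlgebra.dp R (e l) ((x l, 0) : P × R)) *
          (DividedPowerAlgebra.dp R ab.1 ((p, 0) : P × R) *
            DividedPowerAlgebra.dp R ab.2 ((0, 1) : P × R)) =
          (k + ab.2).choose k • (DividedPowerAlgebra.dp R (k + ab.2) ((0, 1) : P × R) *
            ∏ l, DividedPowerAlgebra.dp R ((Fin.cons ab.1 e : Fin (r + 1) → ℕ) l)
              (((Fin.cons p x : Fin (r + 1) → P) l, 0) : P × R)) := by
        rw [← smul_mul_assoc, ← DividedPowerAlgebra.dp_mul, Fin.prod_univ_succ]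
        simp only [Fin.cons_zero, Fin.cons_succ]
        ring
      rw [h]
      refine nsmul_mem ?_ _
      rw [hW]
      exact Submodule.subset_span ⟨_, _, _, _, rfl⟩

lemma dpProj_coe {n : ℤ} (γ : DPow R P n) : dpProj R P n γ.1 = γ := by
  suffices dpProj R P n ∘ₗ (DPow R P n).subtype = LinearMap.id from DFunLike.congr_fun this γ
  refine dPow_ext (N := DPow R P n) fun r e x h ↦ ?_
  exact dpProj_prod _ _ h

lemma dpProj_prod_of_ne {r : ℕ} (e : Fin r → ℤ) (x : Fin r → P) {n : ℤ} (h : ∑ k, e k ≠ n) :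
    dpProj R P n (∏ k, dpZ R (e k) (x k)) = 0 := by
  ext
  change ((weight R P) (∏ k, dpZ R (e k) (x k))).coeff n = _
  rw [weight_prod]
  exact Finsupp.single_eq_of_ne (Ne.symm h)

/-- Induction on the generators `x₁^{[e₁]} ⋯ x_r^{[e_r]} f^{[k]}` of `Γⁿ(P × R)`. -/
lemma dpCons_induction {n : ℤ} {p : DPow R (P × R) n → Prop} (γ : DPow R (P × R) n)
    (gen : ∀ (k r : ℕ) (e : Fin r → ℕ) (x : Fin r → P) (h : (k : ℤ) + ∑ l, (e l : ℤ) = n),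
      p (dpCons (k : ℤ) (fun l ↦ (e l : ℤ)) x h)) (zero : p 0)
    (add : ∀ a b, p a → p b → p (a + b)) (smul : ∀ (c : R) a, p a → p (c • a)) : p γ := by
  rw [← dpProj_coe γ]
  generalize γ.1 = δ
  have hδ : δ ∈ Submodule.span R {γ : DividedPowerAlgebra R (P × R) |
    ∃ (k r : ℕ) (e : Fin r → ℕ) (x : Fin r → P), γ = DividedPowerAlgebra.dp R k ((0, 1) : P × R) *
      ∏ l, DividedPowerAlgebra.dp R (e l) ((x l, 0) : P × R)} := by
    rw [span_dpCons_eq_top]; trivial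
  induction hδ using Submodule.span_induction with
  | zero => rwa [map_zero]
  | add a b _ _ ha hb => rw [map_add]; exact add _ _ ha hb
  | smul c a _ ha => rw [map_smul]; exact smul _ _ ha
  | mem γ hγ =>
    obtain ⟨k, r, e, x, rfl⟩ := hγ
    have hprod : DividedPowerAlgebra.dp R k ((0, 1) : P × R) *
        ∏ l, DividedPowerAlgebra.dp R (e l) ((x l, 0) : P × R) =
        ∏ l, dpZ R ((Fin.cons (k : ℤ) (fun l ↦ (e l : ℤ)) : Fin (r + 1) → ℤ) l)
          ((Fin.cons (0, 1) fun l ↦ (x l, 0) : Fin (r + 1) → P × R) l) := by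
      simp [Fin.prod_univ_succ, dpZ_natCast]
    have hsum : ∑ l, (Fin.cons (k : ℤ) (fun l ↦ (e l : ℤ)) : Fin (r + 1) → ℤ) l =
        k + ∑ l, (e l : ℤ) := by simp [Fin.sum_univ_succ]
    rw [hprod]
    by_cases h : (k : ℤ) + ∑ l, (e l : ℤ) = n
    · rw [dpProj_prod _ _ (hsum.trans h)]
      exact gen k r e x h
    · rwa [dpProj_prod_of_ne _ _ (by rwa [hsum])]

variable (R P) in
/-- The derivation of `Γ(P × R)` with `x ↦ 0` for `x ∈ P` and `f^{[k]} ↦ f^{[k-1]}`. -/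
noncomputable def partialSnd : DividedPowerAlgebra R (P × R) →ₗ[R] DividedPowerAlgebra R (P × R) :=
  (TensorProduct.rid R _).toLinearMap ∘ₗ (LinearMap.snd R P R).lTensor _ ∘ₗ
    (comulDerivation R (P × R)).toLinearMap

lemma partialSnd_dpCons {r : ℕ} (k : ℤ) (e : Fin r → ℤ) (x : Fin r → P) :
    partialSnd R P (dpZ R k ((0, 1) : P × R) * ∏ l, dpZ R (e l) ((x l, 0) : P × R)) =
      dpZ R (k - 1) ((0, 1) : P × R) * ∏ l, dpZ R (e l) ((x l, 0) : P × R) := by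
  have hprod (k : ℤ) : dpZ R k ((0, 1) : P × R) * ∏ l, dpZ R (e l) ((x l, 0) : P × R) =
        ∏ l, dpZ R ((Fin.cons (k : ℤ) (fun l ↦ (e l : ℤ)) : Fin (r + 1) → ℤ) l)
          ((Fin.cons (0, 1) fun l ↦ (x l, 0) : Fin (r + 1) → P × R) l) := by
      simp [Fin.prod_univ_succ]
  rw [hprod, partialSnd, LinearMap.comp_apply, LinearMap.comp_apply]
  erw [comulDerivation_prod]
  rw [map_sum, map_sum, Fin.sum_univ_succ, Finset.sum_eq_zero, add_zero]
  · simp [Fin.prod_univ_succ]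
  · simp

lemma partialSnd_iterate_dpCons {r : ℕ} (k : ℤ) (e : Fin r → ℤ) (x : Fin r → P) (j : ℕ) :
    (partialSnd R P ^ j) (dpZ R k ((0, 1) : P × R) * ∏ l, dpZ R (e l) ((x l, 0) : P × R)) =
      dpZ R (k - j) ((0, 1) : P × R) * ∏ l, dpZ R (e l) ((x l, 0) : P × R) := by
  induction j with
  | zero => simp
  | succ j ih =>
    rw [pow_succ', Module.End.mul_apply, ih, partialSnd_dpCons, sub_sub]
    push_cast
    rfl

variable (R P) in
/-- The projection of `Γ(P × R)` onto `Γ(P)` which kills the divided powers of `f`. -/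
noncomputable def dpFst : DividedPowerAlgebra R (P × R) →ₗ[R] DividedPowerAlgebra R (P × R) where
  toFun := dpAlgMap (LinearMap.inl R P R ∘ₗ LinearMap.fst R P R)
  map_add' := map_add _
  map_smul' c x := dpAlgMap_smul _ c x

lemma dpZ_zero_right {M : Type u} [AddCommGroup M] [Module R M] (k : ℤ) :
    dpZ R k (0 : M) = if k = 0 then 1 else 0 := by
  rw [dpZ]
  split_ifs with h h' h'
  · omega
  · rfl
  · subst h'; exact DividedPowerAlgebra.dp_zero
  · exact DividedPowerAlgebra.dp_null_of_ne_zero (by omega)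

lemma dpFst_dpCons {r : ℕ} (k : ℤ) (e : Fin r → ℤ) (x : Fin r → P) :
    dpFst R P (dpZ R k ((0, 1) : P × R) * ∏ l, dpZ R (e l) ((x l, 0) : P × R)) =
      if k = 0 then ∏ l, dpZ R (e l) ((x l, 0) : P × R) else 0 := by
  have h1 := dpAlgMap_prod (LinearMap.inl R P R ∘ₗ LinearMap.fst R P R) (fun _ : Fin 1 ↦ k)
    (fun _ ↦ (0, 1))
  simp only [Fin.prod_univ_one, LinearMap.comp_apply, LinearMap.fst_apply, map_zero] at h1
  change dpAlgMap _ _ = _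
  rw [map_mul, h1, dpZ_zero_right, dpAlgMap_prod]
  split_ifs <;> simp

variable (R P) in
/-- The operator `Γⁿ(P × R) → Γⁿ⁺¹(P × R)` with `x f^{[k]} ↦ x f^{[k+1]}` for `x ∈ Γⁿ⁻ᵏ(P)`. The
coefficient of `f^{[k]}` is obtained by differentiating `k` times and projecting to `Γ(P)`. -/
noncomputable def integrate (n n' : ℤ) : DPow R (P × R) n →ₗ[R] DPow R (P × R) n' :=
  dpProj R (P × R) n' ∘ₗ
    (∑ j ∈ Finset.range (n.toNat + 1),
      LinearMap.mulLeft R (DividedPowerAlgebra.dp R (j + 1) ((0, 1) : P × R)) ∘ₗ dpFst R P ∘ₗ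
        partialSnd R P ^ j) ∘ₗ (DPow R (P × R) n).subtype

lemma integrate_dpCons {r : ℕ} (k : ℕ) (e : Fin r → ℕ) (x : Fin r → P) {n n' : ℤ}
    (h : k + ∑ l, (e l : ℤ) = n) (hn : n + 1 = n') :
    integrate R P n n' (dpCons (k : ℤ) (fun l ↦ (e l : ℤ)) x h) =
      dpCons ((k : ℤ) + 1) (fun l ↦ (e l : ℤ)) x (by omega) := by
  have hk : k < n.toNat + 1 := by
    have : 0 ≤ ∑ l, (e l : ℤ) := Finset.sum_nonneg fun _ _ ↦ by positivity
    omega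
  refine Eq.trans ?_ (dpProj_coe _)
  simp only [integrate, LinearMap.comp_apply]
  congr 1
  rw [Submodule.subtype_apply, dpCons_val, dpCons_val, LinearMap.sum_apply,
    Finset.sum_eq_single k]
  · rw [LinearMap.comp_apply, LinearMap.comp_apply, partialSnd_iterate_dpCons, dpFst_dpCons,
      sub_self, if_pos rfl, LinearMap.mulLeft_apply, ← dpZ_natCast]
    push_cast
    rfl
  · intro j _ hj
    rw [LinearMap.comp_apply, LinearMap.comp_apply, partialSnd_iterate_dpCons, dpFst_dpCons,
      if_neg (by omega), map_zero]
  · intro h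
    exact absurd (Finset.mem_range.2 hk) h

end Integration

/-! ### The cycles of the Koszul complex of a split map -/

section Homotopy

variable {R : Type u} [CommRing R] {P Q : Type u} [AddCommGroup P] [Module R P]
  [AddCommGroup Q] [Module R Q] (v : P →ₗ[R] Q) (q : ℕ)

variable (R P Q) in
/-- The contracting homotopy of the Koszul complex of `v × id : P × R → Q × R`, relative to the
Koszul complex of `v`: the contraction with the last coordinate on the exterior algebra, and the
integration with respect to the last coordinate on the divided power algebra. -/
noncomputable def kosHomotopy (i : ℕ) :
    KosX R (Q × R) (P × R) q (i + 1) →ₗ[R] KosX R (Q × R) (P × R) q i :=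
  TensorProduct.map (contract (LinearMap.snd R Q R) i)
    (integrate R P ((q : ℤ) - (i + 1 : ℕ)) ((q : ℤ) - i))

lemma kosHomotopy_tmul (i : ℕ) (y : ⋀[R]^(i + 1) (Q × R)) {r : ℕ} (k : ℕ) (e : Fin r → ℕ)
    (x : Fin r → P) (h : k + ∑ l, (e l : ℤ) = (q : ℤ) - (i + 1 : ℕ)) :
    kosHomotopy R P Q q i (y ⊗ₜ dpCons (k : ℤ) (fun l ↦ (e l : ℤ)) x h) =
      contract (LinearMap.snd R Q R) i y ⊗ₜ dpCons ((k : ℤ) + 1) (fun l ↦ (e l : ℤ)) x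
        (by push_cast at h ⊢; linarith) := by
  rw [kosHomotopy, TensorProduct.map_tmul, integrate_dpCons _ _ _ h (by push_cast; ring)]

lemma kosD_dpCons (i : ℕ) (y : ⋀[R]^i (Q × R)) {r : ℕ} (k : ℤ) (e : Fin r → ℤ)
    (x : Fin r → P) (h : k + ∑ l, e l = (q : ℤ) - i) :
    kosD (v.prodMap LinearMap.id) q i (y ⊗ₜ dpCons k e x h) =
      wedge R (Q × R) i (0, 1) y ⊗ₜ dpCons (k - 1) e x (by push_cast; linarith) +
        ∑ j, wedge R (Q × R) i (v (x j), 0) y ⊗ₜ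
          dpCons k (fun l ↦ e l - if l = j then 1 else 0) x (by
            rw [Finset.sum_sub_distrib]; simp; linarith) := by
  rw [dpCons, kosD_tmul _ _ _ _ _ _ (by rw [Fin.sum_univ_succ]; simpa using h),
    Fin.sum_univ_succ]
  congr 1
  · congr 1
    · simp
    · refine Subtype.ext ?_
      rw [dpCons_val]
      simp [Fin.prod_univ_succ, Fin.succ_ne_zero]
  · refine Finset.sum_congr rfl fun j _ ↦ ?_
    congr 1
    refine Subtype.ext ?_
    rw [dpCons_val]
    simp [Fin.prod_univ_succ, (Fin.succ_ne_zero _).symm]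

lemma dpCons_eq_zero {r : ℕ} {k : ℤ} (hk : k < 0) (e : Fin r → ℤ) (x : Fin r → P) {n : ℤ}
    (h : k + ∑ l, e l = n) : (dpCons k e x h : DPow R (P × R) n) = 0 :=
  Subtype.ext (by rw [dpCons_val, dpZ_neg hk, zero_mul]; rfl)

lemma dpCons_eq_zero' {r : ℕ} (k : ℤ) (e : Fin r → ℤ) {j : Fin r} (hj : e j < 0) (x : Fin r → P)
    {n : ℤ} (h : k + ∑ l, e l = n) : (dpCons k e x h : DPow R (P × R) n) = 0 :=
  Subtype.ext (by
    have h0 : dpZ R (e j) ((x j, 0) : P × R) = 0 := dpZ_neg hj _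
    rw [dpCons_val, Finset.prod_eq_zero (Finset.mem_univ j) h0, mul_zero]; rfl)

lemma integrate_dpCons_int {r : ℕ} (k : ℕ) (e : Fin r → ℤ) (x : Fin r → P) {n n' : ℤ}
    (h : k + ∑ l, e l = n) (hn : n + 1 = n') :
    integrate R P n n' (dpCons (k : ℤ) e x h) =
      dpCons ((k : ℤ) + 1) e x (by omega) := by
  by_cases he : ∃ j, e j < 0
  · obtain ⟨j, hj⟩ := he
    rw [dpCons_eq_zero' _ _ hj, dpCons_eq_zero' _ _ hj, map_zero]
  · push Not at he
    lift e to Fin r → ℕ using he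
    exact integrate_dpCons k e x h hn

/-- The projection of `Q × R` onto its first factor, as an endomorphism. -/
abbrev projFst (R : Type u) [CommRing R] (Q : Type u) [AddCommGroup Q] [Module R Q] :
    Q × R →ₗ[R] Q × R := LinearMap.inl R Q R ∘ₗ LinearMap.fst R Q R

lemma dpMap_dpCons {r : ℕ} (k : ℤ) (e : Fin r → ℤ) (x : Fin r → P) {n : ℤ}
    (h : k + ∑ l, e l = n) :
    dpMap (projFst R P) n (dpCons k e x h) = if k = 0 then dpCons k e x h else 0 := by
  rw [dpCons, dpMap_prod (projFst R P) _ _ (by rw [Fin.sum_univ_succ]; simpa using h)]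
  refine Subtype.ext ?_
  split_ifs with hk
  · subst hk
    simp [Fin.prod_univ_succ, dpZ, DividedPowerAlgebra.dp_zero]
  · have h0 : dpZ R k ((0, 0) : P × R) = 0 := by
      rw [show ((0, 0) : P × R) = 0 from rfl, dpZ_zero_right, if_neg hk]
    simp [Fin.prod_univ_succ, h0]

lemma dpCons_congr {r : ℕ} {k k' : ℤ} (hk : k = k') (e : Fin r → ℤ) (x : Fin r → P) {n : ℤ}
    (h : k + ∑ l, e l = n) (h' : k' + ∑ l, e l = n) :
    (dpCons k e x h : DPow R (P × R) n) = dpCons k' e x h' := by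
  subst hk; rfl

lemma kosHomotopy_kosD_tmul (i : ℕ) (y : ⋀[R]^i (Q × R)) {r : ℕ} (k : ℕ) (e : Fin r → ℕ)
    (x : Fin r → P) (h : k + ∑ l, (e l : ℤ) = (q : ℤ) - i) :
    kosHomotopy R P Q q i (kosD (v.prodMap LinearMap.id) q i
        (y ⊗ₜ dpCons (k : ℤ) (fun l ↦ (e l : ℤ)) x h)) =
      (extMap (projFst R Q) i y) ⊗ₜ (if k = 0 then 0 else dpCons (k : ℤ) (fun l ↦ (e l : ℤ)) x h) +
      ∑ j, contract (LinearMap.snd R Q R) i (wedge R (Q × R) i (v (x j), 0) y) ⊗ₜ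
          dpCons ((k : ℤ) + 1) (fun l ↦ (e l : ℤ) - if l = j then 1 else 0) x (by
            rw [Finset.sum_sub_distrib]; simp; linarith) := by
  have hn : (q : ℤ) - (i + 1 : ℕ) + 1 = (q : ℤ) - i := by push_cast; ring
  rw [kosD_dpCons, map_add, map_sum]
  congr 1
  · rw [kosHomotopy, TensorProduct.map_tmul, contract_wedge_snd]
    congr 1
    rcases k with _ | k
    · rw [dpCons_eq_zero (by simp), map_zero, if_pos rfl]
    · rw [if_neg (by omega), dpCons_congr (show ((k + 1 : ℕ) : ℤ) - 1 = (k : ℤ) by simp) _ _ _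
        (by push_cast at h ⊢; linarith), integrate_dpCons _ _ _ _ hn]
      exact dpCons_congr (by simp) _ _ _ _
  · refine Finset.sum_congr rfl fun j _ ↦ ?_
    rw [kosHomotopy, TensorProduct.map_tmul, integrate_dpCons_int _ _ _ _ hn]

/-- Induction on the generators of `Λⁱ(Q') ⊗ Γ^{q-i}(P × R)`. -/
lemma kosX_dpCons_induction {Q' : Type u} [AddCommGroup Q'] [Module R Q'] {q i : ℕ}
    {p : KosX R Q' (P × R) q i → Prop} (t : KosX R Q' (P × R) q i)
    (gen : ∀ (y : ⋀[R]^i Q') (k r : ℕ) (e : Fin r → ℕ) (x : Fin r → P)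
      (h : (k : ℤ) + ∑ l, (e l : ℤ) = (q : ℤ) - i),
      p (y ⊗ₜ dpCons (k : ℤ) (fun l ↦ (e l : ℤ)) x h)) (zero : p 0)
    (add : ∀ a b, p a → p b → p (a + b)) (smul : ∀ (c : R) a, p a → p (c • a)) : p t := by
  induction t using TensorProduct.induction_on with
  | zero => exact zero
  | add a b ha hb => exact add _ _ ha hb
  | tmul y γ =>
    induction γ using dpCons_induction with
    | gen k r e x h => exact gen y k r e x h
    | zero =>
      have h0 : y ⊗ₜ[R] (0 : DPow R (P × R) ((q : ℤ) - i)) = 0 :=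
        tmul_zero (M := ⋀[R]^i Q') (N := DPow R (P × R) ((q : ℤ) - i)) _
      exact h0 ▸ zero
    | add a b ha hb => have := add _ _ ha hb; rwa [← tmul_add] at this
    | smul c a ha => have := smul c _ ha; rwa [← tmul_smul] at this

lemma kosHomotopy_zero (t : KosX R (Q × R) (P × R) q 0) :
    kosHomotopy R P Q q 0 (kosD (v.prodMap LinearMap.id) q 0 t) +
      kosMap (projFst R Q) (projFst R P) q 0 t = t := by
  induction t using kosX_dpCons_induction with
  | zero => simp only [map_zero, add_zero]
  | add a b ha hb =>
    simp only [map_add]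
    conv_rhs => rw [← ha, ← hb]
    abel
  | smul c a ha =>
    rw [map_smul, map_smul, map_smul, ← smul_add, ha]
  | gen y k r e x h =>
    have hy : extMap (projFst R Q) 0 y = y := by
      rw [← contract_wedge_snd, contract_wedge_zero]
      simp
    rw [kosHomotopy_kosD_tmul, kosMap, TensorProduct.map_tmul, dpMap_dpCons, hy,
      Finset.sum_eq_zero, add_zero, ← tmul_add]
    · congr 1
      rcases k with _ | k
      · simp
      · rw [if_neg (by omega), if_neg (by omega), add_zero]
    · intro j _
      rw [contract_wedge_zero]
      simp

/-- The homotopy connects the identity with the projection onto the Koszul complex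
of `v`. -/
lemma kosHomotopy_succ (i : ℕ) (t : KosX R (Q × R) (P × R) q (i + 1)) :
    kosD (v.prodMap LinearMap.id) q i (kosHomotopy R P Q q i t) +
      kosHomotopy R P Q q (i + 1) (kosD (v.prodMap LinearMap.id) q (i + 1) t) +
      kosMap (projFst R Q) (projFst R P) q (i + 1) t = t := by
  induction t using kosX_dpCons_induction with
  | zero => simp only [map_zero, add_zero]
  | add a b ha hb =>
    simp only [map_add]
    conv_rhs => rw [← ha, ← hb]
    abel
  | smul c a ha =>
    simp only [map_smul, ← smul_add]
    rw [ha]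
  | gen y k r e x h =>
    have hy := contract_wedge_snd R (i + 1) y
    rw [contract_wedge, LinearMap.snd_apply, one_smul, sub_eq_iff_eq_add] at hy
    rw [kosHomotopy_kosD_tmul, kosMap, TensorProduct.map_tmul, dpMap_dpCons, kosHomotopy_tmul,
      kosD_dpCons]
    have hd : ((k : ℤ) + 1) + ∑ l, (e l : ℤ) = (q : ℤ) - i := by push_cast at h; linarith
    have hd' (j : Fin r) : ((k : ℤ) + 1) + ∑ l, ((e l : ℤ) - if l = j then 1 else 0) =
        (q : ℤ) - (i + 1 : ℕ) := by
      rw [Finset.sum_sub_distrib]; push_cast at h; simp; linarith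
    have hsum : (∑ j, contract (LinearMap.snd R Q R) (i + 1)
        (wedge R (Q × R) (i + 1) (v (x j), 0) y) ⊗ₜ[R]
          (dpCons ((k : ℤ) + 1) (fun l ↦ (e l : ℤ) - if l = j then 1 else 0) x (hd' j) :
            DPow R (P × R) ((q : ℤ) - (i + 1 : ℕ)))) +
        ∑ j, wedge R (Q × R) i (v (x j), 0) (contract (LinearMap.snd R Q R) i y) ⊗ₜ[R]
          (dpCons ((k : ℤ) + 1) (fun l ↦ (e l : ℤ) - if l = j then 1 else 0) x (hd' j) :
            DPow R (P × R) ((q : ℤ) - (i + 1 : ℕ))) = 0 := by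
      rw [← Finset.sum_add_distrib]
      refine Finset.sum_eq_zero fun j _ ↦ ?_
      rw [contract_wedge, LinearMap.snd_apply, zero_smul, zero_sub, ← add_tmul, neg_add_cancel,
        zero_tmul]
    have key (a b c A B : KosX R (Q × R) (P × R) q (i + 1)) (hAB : A + B = 0) :
        (a + B) + (b + A) + c = a + b + c := by
      rw [show (a + B) + (b + A) + c = a + b + c + (A + B) by abel, hAB, add_zero]
    rw [key _ _ _ _ _ hsum, dpCons_congr (show (k : ℤ) + 1 - 1 = k by ring) _ _ _ h]
    conv_rhs => rw [hy]
    rcases k with _ | k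
    · simp only [Nat.cast_zero, if_true, tmul_zero, add_tmul]
      abel
    · have hk : ((k + 1 : ℕ) : ℤ) ≠ 0 := by omega
      rw [if_neg (by omega), if_neg hk, tmul_zero, add_tmul]
      abel

end Homotopy

section Cycles

variable {R : Type u} [CommRing R] {P Q : Type u} [AddCommGroup P] [Module R P]
  [AddCommGroup Q] [Module R Q]

/-- The boundaries of the Koszul complex of `v` in degree `i`. -/
noncomputable def kosBd (v : P →ₗ[R] Q) (q : ℕ) : (i : ℕ) → Submodule R (KosX R Q P q i)
  | 0 => ⊥
  | i + 1 => LinearMap.range (kosD v q i)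

/-- The image of `Λⁱ(Q) ⊗ Γ^{q-i}(ker v)` in `Λⁱ(Q) ⊗ Γ^{q-i}(P)`. -/
noncomputable def kosPure (v : P →ₗ[R] Q) (q i : ℕ) : Submodule R (KosX R Q P q i) :=
  Submodule.span R {t | ∃ (y : Fin i → Q) (r : ℕ) (e : Fin r → ℤ) (x : Fin r → P)
    (h : ∑ k, e k = (q : ℤ) - i), (∀ k, v (x k) = 0) ∧
      t = exteriorPower.ιMulti R i y ⊗ₜ ⟨∏ k, dpZ R (e k) (x k), prod_dpZ_mem e x h⟩}

/-- The cycles of degree `i` of the Koszul complex of `v` are generated by the boundaries and by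
the elements of `Λⁱ(Q) ⊗ Γ^{q-i}(ker v)`. -/
def KosGood (v : P →ₗ[R] Q) (q i : ℕ) : Prop :=
  ∀ c, kosD v q i c = 0 → c ∈ kosBd v q i ⊔ kosPure v q i

section Map

variable {S : Type u} [CommRing S] {σ : R →+* S} {P' Q' : Type u} [AddCommGroup P'] [Module S P']
  [AddCommGroup Q'] [Module S Q'] {v : P →ₗ[R] Q} {v' : P' →ₗ[S] Q'}
  (g : Q →ₛₗ[σ] Q') (f : P →ₛₗ[σ] P')

lemma kosMap_mem_kosBd (h : ∀ x, g (v x) = v' (f x)) {q i : ℕ} {c : KosX R Q P q i}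
    (hc : c ∈ kosBd v q i) : kosMap g f q i c ∈ kosBd v' q i := by
  cases i with
  | zero =>
    rw [kosBd, Submodule.mem_bot] at hc
    subst hc
    rw [map_zero]
    exact zero_mem _
  | succ i =>
    obtain ⟨b, rfl⟩ := hc
    exact ⟨kosMap g f q i b, kosD_kosMap g f v v' h q i b⟩

lemma kosMap_mem_kosPure (h : ∀ x, g (v x) = v' (f x)) {q i : ℕ} {c : KosX R Q P q i}
    (hc : c ∈ kosPure v q i) : kosMap g f q i c ∈ kosPure v' q i := by
  rw [kosPure] at hc
  induction hc using Submodule.span_induction with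
  | zero => rw [map_zero]; exact zero_mem _
  | add a b _ _ ha hb => rw [map_add]; exact add_mem ha hb
  | smul c a _ ha => rw [map_smulₛₗ]; exact Submodule.smul_mem _ _ ha
  | mem t ht =>
    obtain ⟨y, r, e, x, h', hx, rfl⟩ := ht
    rw [kosMap_tmul (h := h')]
    refine Submodule.subset_span ⟨_, r, e, _, h', fun k ↦ ?_, rfl⟩
    rw [← h, hx, map_zero]

lemma kosMap_mem_sup (h : ∀ x, g (v x) = v' (f x)) {q i : ℕ} {c : KosX R Q P q i}
    (hc : c ∈ kosBd v q i ⊔ kosPure v q i) :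
    kosMap g f q i c ∈ kosBd v' q i ⊔ kosPure v' q i := by
  obtain ⟨a, ha, b, hb, rfl⟩ := Submodule.mem_sup.1 hc
  rw [map_add]
  exact Submodule.add_mem_sup (kosMap_mem_kosBd g f h ha) (kosMap_mem_kosPure g f h hb)

end Map

lemma KosGood.of_retract {P' Q' : Type u} [AddCommGroup P'] [Module R P']
    [AddCommGroup Q'] [Module R Q'] {v : P →ₗ[R] Q} {v' : P' →ₗ[R] Q'} {q i : ℕ}
    (hv : KosGood v q i) (g : Q' →ₗ[R] Q) (f : P' →ₗ[R] P) (h : ∀ x, g (v' x) = v (f x))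
    (g' : Q →ₗ[R] Q') (f' : P →ₗ[R] P') (h' : ∀ x, g' (v x) = v' (f' x))
    (hg : ∀ x, g' (g x) = x) (hf : ∀ x, f' (f x) = x) : KosGood v' q i := by
  intro c hc
  have h1 : kosMap g' f' q i (kosMap g f q i c) = c := by
    rw [← kosMap_comp (RingHom.id_comp _) g g' (g'.comp g) (fun _ ↦ rfl) f f' (f'.comp f)
      (fun _ ↦ rfl)]
    exact kosMap_id rfl _ hg _ hf _ _ _
  rw [← h1]
  refine kosMap_mem_sup g' f' h' (hv _ ?_)
  rw [kosD_kosMap g f v' v h, hc, map_zero]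

lemma kosMap_projFst {q i : ℕ} (c : KosX R (Q × R) (P × R) q i) :
    kosMap (projFst R Q) (projFst R P) q i c =
      kosMap (LinearMap.inl R Q R) (LinearMap.inl R P R) q i
        (kosMap (LinearMap.fst R Q R) (LinearMap.fst R P R) q i c) :=
  kosMap_comp (RingHom.id_comp _) _ _ _ (fun _ ↦ rfl) _ _ _ (fun _ ↦ rfl) _ _ _

/-- Splitting off a direct factor on which the map is the identity does not affect the description
of the cycles: by the homotopy, a cycle is cohomologous to one coming from the Koszul complex
of `v`. -/
lemma KosGood.prodMap_id {v : P →ₗ[R] Q} {q i : ℕ} (hv : KosGood v q i) :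
    KosGood (v.prodMap (LinearMap.id : R →ₗ[R] R)) q i := by
  intro c hc
  have h1 : kosMap (projFst R Q) (projFst R P) q i c ∈
      kosBd (v.prodMap (LinearMap.id : R →ₗ[R] R)) q i ⊔
        kosPure (v.prodMap (LinearMap.id : R →ₗ[R] R)) q i := by
    rw [kosMap_projFst]
    refine kosMap_mem_sup (LinearMap.inl R Q R) (LinearMap.inl R P R) (v := v) (fun x ↦ ?_)
      (hv _ ?_)
    · simp
    · rw [kosD_kosMap (LinearMap.fst R Q R) (LinearMap.fst R P R)
        (v.prodMap (LinearMap.id : R →ₗ[R] R)) v (fun x ↦ by simp), hc, map_zero]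
  cases i with
  | zero =>
    have := kosHomotopy_zero v q c
    rw [hc, map_zero, zero_add] at this
    rwa [this] at h1
  | succ i =>
    have := kosHomotopy_succ v q i c
    rw [hc, map_zero, add_zero] at this
    rw [← this]
    exact add_mem (Submodule.mem_sup_left ⟨_, rfl⟩) h1

lemma kosPure_zero (q i : ℕ) : kosPure (0 : P →ₗ[R] Q) q i = ⊤ := by
  rw [eq_top_iff]
  rintro c -
  induction c using kosX_induction with
  | zero => exact zero_mem _
  | add a b ha hb => exact add_mem ha hb
  | smul c a ha => exact Submodule.smul_mem _ _ ha
  | gen y r e x h => exact Submodule.subset_span ⟨y, r, e, x, h, fun _ ↦ rfl, rfl⟩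

/-- The map `M × Rⁿ → Rⁿ × F`, `(m, b) ↦ (b, 0)`. -/
def splitMap (R M F : Type u) [CommRing R] [AddCommGroup M] [Module R M] [AddCommGroup F]
    [Module R F] (n : ℕ) : M × (Fin n → R) →ₗ[R] (Fin n → R) × F :=
  LinearMap.inl R _ _ ∘ₗ LinearMap.snd R _ _

/-- The induction splits off the last basis vector of `Rⁿ`. For `n = 0` the map is zero, and every
element belongs to `Λⁱ(Q) ⊗ Γ^{q-i}(ker v)`. -/
lemma kosGood_splitMap (M F : Type u) [AddCommGroup M] [Module R M] [AddCommGroup F]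
    [Module R F] (n q i : ℕ) : KosGood (splitMap R M F n) q i := by
  induction n with
  | zero =>
    intro c _
    have h0 : splitMap R M F 0 = 0 := by
      ext x
      · exact Fin.elim0 (by assumption)
      · rfl
      · exact Fin.elim0 (by assumption)
      · rfl
    rw [h0, kosPure_zero, sup_top_eq]
    trivial
  | succ n ih =>
    let a : (Fin (n + 1) → R) →ₗ[R] (Fin n → R) :=
      LinearMap.funLeft R R Fin.castSucc
    let l : (Fin (n + 1) → R) →ₗ[R] R := LinearMap.proj (Fin.last n)
    let s : (Fin n → R) × R →ₗ[R] (Fin (n + 1) → R) :=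
      { toFun := fun p ↦ Fin.snoc p.1 p.2
        map_add' := fun p p' ↦ by
          ext k; refine Fin.lastCases ?_ (fun k ↦ ?_) k <;> simp
        map_smul' := fun c p ↦ by
          ext k; refine Fin.lastCases ?_ (fun k ↦ ?_) k <;> simp }
    have has (p) : a (s p) = p.1 := by ext k; simp [a, s, LinearMap.funLeft]
    have hls (p) : l (s p) = p.2 := by simp [l, s]
    have hs (b) : s (a b, l b) = b := by
      ext k; refine Fin.lastCases ?_ (fun k ↦ ?_) k <;> simp [a, l, s, LinearMap.funLeft]
    refine ih.prodMap_id.of_retract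
      (((a ∘ₗ LinearMap.fst R _ _).prod (LinearMap.snd R _ _)).prod (l ∘ₗ LinearMap.fst R _ _))
      (((LinearMap.fst R _ _).prod (a ∘ₗ LinearMap.snd R _ _)).prod (l ∘ₗ LinearMap.snd R _ _))
      (fun x ↦ by simp [splitMap])
      ((s ∘ₗ ((LinearMap.fst R _ _ ∘ₗ LinearMap.fst R _ _).prod (LinearMap.snd R _ _))).prod
        (LinearMap.snd R _ _ ∘ₗ LinearMap.fst R _ _))
      ((LinearMap.fst R _ _ ∘ₗ LinearMap.fst R _ _).prod
        (s ∘ₗ ((LinearMap.snd R _ _ ∘ₗ LinearMap.fst R _ _).prod (LinearMap.snd R _ _))))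
      (fun x ↦ by simp [splitMap]) (fun x ↦ by simp [hs]) (fun x ↦ by simp [hs])

end Cycles

/-! ### Local calculus in sheaves of modules -/

section Local

variable {C : Type u} [SmallCategory C] (J : GrothendieckTopology C)

/-- `Loc J U p` says that `p` holds on a covering of `U`. The arrows live in `Cᵒᵖ`, so that
`f : U ⟶ V` is the one along which sections over `U` are restricted to `V`. -/
def Loc (U : Cᵒᵖ) (p : ∀ ⦃V : Cᵒᵖ⦄, (U ⟶ V) → Prop) : Prop :=
  ∃ S ∈ J U.unop, ∀ ⦃W : C⦄ (f : W ⟶ U.unop), S f → p f.op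

variable {J} {U : Cᵒᵖ} {p p' : ∀ ⦃V : Cᵒᵖ⦄, (U ⟶ V) → Prop}

lemma Loc.of_forall (h : ∀ ⦃V : Cᵒᵖ⦄ (f : U ⟶ V), p f) : Loc J U p :=
  ⟨⊤, J.top_mem _, fun _ f _ ↦ h f.op⟩

lemma Loc.mono (h : Loc J U p) (h' : ∀ ⦃V : Cᵒᵖ⦄ (f : U ⟶ V), p f → p' f) : Loc J U p' := by
  obtain ⟨S, hS, h⟩ := h
  exact ⟨S, hS, fun _ f hf ↦ h' _ (h f hf)⟩

lemma Loc.and (h : Loc J U p) (h' : Loc J U p') : Loc J U fun _ f ↦ p f ∧ p' f := by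
  obtain ⟨S, hS, h⟩ := h
  obtain ⟨S', hS', h'⟩ := h'
  exact ⟨S ⊓ S', J.intersection_covering hS hS', fun _ f hf ↦ ⟨h f hf.1, h' f hf.2⟩⟩

lemma Loc.trans (h : Loc J U fun V f ↦ Loc J V fun _ g ↦ p (f ≫ g)) : Loc J U p := by
  obtain ⟨S, hS, h⟩ := h
  choose! T hT h using h
  exact ⟨Sieve.bind S.1 (fun W f _ ↦ T f), J.bind_covering hS fun W f hf ↦ hT f hf, by
    rintro W _ ⟨V, g, f, hf, hg, rfl⟩
    exact h f hf g hg⟩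

lemma Loc.bind (h : Loc J U p)
    (h' : ∀ ⦃V : Cᵒᵖ⦄ (f : U ⟶ V), p f → Loc J V fun _ g ↦ p' (f ≫ g)) : Loc J U p' :=
  Loc.trans (h.mono h')

lemma Loc.finset_forall {ι : Type*} (s : Finset ι) {q : ι → ∀ ⦃V : Cᵒᵖ⦄, (U ⟶ V) → Prop}
    (h : ∀ i ∈ s, Loc J U (q i)) : Loc J U fun _ f ↦ ∀ i ∈ s, q i f := by
  classical
  induction s using Finset.induction_on with
  | empty => exact Loc.of_forall fun _ _ _ h ↦ absurd h (Finset.notMem_empty _)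
  | insert a s _ ih =>
    refine ((h a (Finset.mem_insert_self _ _)).and
      (ih fun i hi ↦ h i (Finset.mem_insert_of_mem hi))).mono fun V f hf i hi ↦ ?_
    obtain rfl | hi := Finset.mem_insert.1 hi
    · exact hf.1
    · exact hf.2 i hi

lemma Loc.fintype_forall {ι : Type*} [Fintype ι] {q : ι → ∀ ⦃V : Cᵒᵖ⦄, (U ⟶ V) → Prop}
    (h : ∀ i, Loc J U (q i)) : Loc J U fun _ f ↦ ∀ i, q i f :=
  (Loc.finset_forall Finset.univ fun i _ ↦ h i).mono fun _ _ h i ↦ h i (Finset.mem_univ i)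

end Local

section Sections

variable {C : Type u} [SmallCategory C] {J : GrothendieckTopology C} {A : Sheaf J CommRingCat.{u}}

lemma rs_comp (M : Mod A) {U V W : Cᵒᵖ} (f : U ⟶ V) (g : V ⟶ W) (x : M.val.obj U) :
    rs M (f ≫ g) x = rs M g (rs M f x) := res_comp M.val f g x

lemma rs_add (M : Mod A) {U V : Cᵒᵖ} (f : U ⟶ V) (x y : M.val.obj U) :
    rs M f (x + y) = rs M f x + rs M f y := map_add (res M.val f) x y

lemma rs_zero (M : Mod A) {U V : Cᵒᵖ} (f : U ⟶ V) : rs M f 0 = 0 := map_zero (res M.val f)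

lemma rs_sub (M : Mod A) {U V : Cᵒᵖ} (f : U ⟶ V) (x y : M.val.obj U) :
    rs M f (x - y) = rs M f x - rs M f y := map_sub (res M.val f) x y

section

variable {M N P : Mod A} (φ : M ⟶ N) {U V : Cᵒᵖ}

lemma ap_eq (x : M.val.obj U) : ap φ x = appₗ φ.val U x := rfl

lemma ap_add (x y : M.val.obj U) : ap φ (x + y) = ap φ x + ap φ y := map_add (appₗ φ.val U) x y

lemma ap_zero : ap φ (0 : M.val.obj U) = 0 := map_zero (appₗ φ.val U)

lemma ap_sub (x y : M.val.obj U) : ap φ (x - y) = ap φ x - ap φ y := map_sub (appₗ φ.val U) x y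

lemma ap_smul (c : A.obj.obj U) (x : M.val.obj U) : ap φ (c • x) = c • ap φ x :=
  map_smul (appₗ φ.val U) c x

lemma ap_rs (f : U ⟶ V) (x : M.val.obj U) : ap φ (rs M f x) = rs N f (ap φ x) :=
  appₗ_res φ.val f x

lemma ap_comp (ψ : N ⟶ P) (x : M.val.obj U) : ap (φ ≫ ψ) x = ap ψ (ap φ x) := rfl

lemma ap_id (x : M.val.obj U) : ap (𝟙 M) x = x := rfl

lemma ap_zero_hom (x : M.val.obj U) : ap (0 : M ⟶ N) x = 0 := rfl

lemma ap_add_hom (φ ψ : M ⟶ N) (x : M.val.obj U) : ap (φ + ψ) x = ap φ x + ap ψ x := rfl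

lemma ap_ext {φ ψ : M ⟶ N} (h : ∀ (U : Cᵒᵖ) (x : M.val.obj U), ap φ x = ap ψ x) : φ = ψ := by
  apply SheafOfModules.hom_ext
  ext U x
  exact h U x

end

lemma eq_of_loc {M : Mod A} {U : Cᵒᵖ} {x y : M.val.obj U}
    (h : Loc J U fun _ f ↦ rs M f x = rs M f y) : x = y := by
  obtain ⟨S, hS, h⟩ := h
  exact ((SheafOfModules.toSheaf _).obj M).isSeparated U.unop S hS x y fun W f hf ↦ h f hf

instance preservesFiniteLimits_evaluation (U : Cᵒᵖ) :
    PreservesFiniteLimits (SheafOfModules.evaluation.{u} (ringSheaf A) U) :=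
  SheafOfModules.Finite.evaluationPreservesFiniteLimits _ U

instance additive_evaluation (U : Cᵒᵖ) :
    (SheafOfModules.evaluation.{u} (ringSheaf A) U).Additive where
  map_add := rfl

lemma ap_injective {M N : Mod A} (φ : M ⟶ N) [Mono φ] (U : Cᵒᵖ) :
    Function.Injective (ap φ : M.val.obj U → N.val.obj U) := by
  have : Mono ((SheafOfModules.evaluation.{u} (ringSheaf A) U).map φ) := inferInstance
  exact (ModuleCat.mono_iff_injective _).1 this

lemma exists_ap_eq_of_exact {S : ShortComplex (Mod A)} (hS : S.Exact) [Mono S.f] {U : Cᵒᵖ}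
    (x : S.X₂.val.obj U) (hx : ap S.g x = 0) : ∃ y, ap S.f y = x := by
  have h := (((SheafOfModules.evaluation.{u} (ringSheaf A) U).preservesFiniteLimits_tfae.out 3 1
    rfl rfl).1 (preservesFiniteLimits_evaluation U) S ⟨hS, inferInstance⟩).1
  exact (ShortComplex.moduleCat_exact_iff _).1 h x hx

lemma mono_of_ap_eq_zero {M N : Mod A} (φ : M ⟶ N)
    (h : ∀ (U : Cᵒᵖ) (x : M.val.obj U), ap φ x = 0 → x = 0) : Mono φ := by
  refine Preadditive.mono_of_cancel_zero _ fun {P} g hg ↦ ap_ext fun U x ↦ h U _ ?_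
  rw [← ap_comp, hg]
  rfl

lemma epi_of_loc {M N : Mod A} (φ : M ⟶ N)
    (h : ∀ (U : Cᵒᵖ) (y : N.val.obj U), Loc J U fun _ f ↦ ∃ x, ap φ x = rs N f y) : Epi φ := by
  refine Preadditive.epi_of_cancel_zero _ fun {P} g hg ↦ ap_ext fun U y ↦ ?_
  refine eq_of_loc ((h U y).mono fun V f hf ↦ ?_)
  obtain ⟨x, hx⟩ := hf
  rw [← ap_rs, ← ap_rs, ← hx, ← ap_comp, hg]
  rfl

variable (A) in
/-- The canonical map from a presheaf of modules to the associated sheaf, on sections. -/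
noncomputable def toShfₗ (M : PMod A.obj) (U : Cᵒᵖ) :
    M.obj U →ₗ[A.obj.obj U] ((shf A).obj M).val.obj U where
  toFun x := toShf x
  map_add' x y := map_add (((PresheafOfModules.sheafificationAdjunction
    (𝟙 (ringSheaf A).obj)).unit.app M).app U).hom x y
  map_smul' c x := map_smul (((PresheafOfModules.sheafificationAdjunction
    (𝟙 (ringSheaf A).obj)).unit.app M).app U).hom c x

lemma rs_toShf {M : PMod A.obj} {U V : Cᵒᵖ} (f : U ⟶ V) (x : M.obj U) :
    rs _ f (toShf x) = toShf (res M f x) :=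
  (PresheafOfModules.naturality_apply ((PresheafOfModules.sheafificationAdjunction
    (𝟙 (ringSheaf A).obj)).unit.app M) f x).symm

lemma ap_shf_map {M N : PMod A.obj} (φ : M ⟶ N) {U : Cᵒᵖ} (x : M.obj U) :
    ap ((shf A).map φ) (toShf x) = toShf (appₗ φ U x) := by
  have := (PresheafOfModules.sheafificationAdjunction (𝟙 (ringSheaf A).obj)).unit.naturality φ
  exact (congr(($this).app U x)).symm

lemma loc_of_toShf_eq {M : PMod A.obj} {U : Cᵒᵖ} {x y : M.obj U} (h : toShf x = toShf y) :
    Loc J U fun _ f ↦ res M f x = res M f y :=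
  ⟨Presheaf.equalizerSieve (F := M.presheaf) x y,
    Presheaf.equalizerSieve_mem J (toSheafify J M.presheaf) x y h, fun _ _ hf ↦ hf⟩

lemma loc_exists_toShf {M : PMod A.obj} {U : Cᵒᵖ} (s : ((shf A).obj M).val.obj U) :
    Loc J U fun _ f ↦ ∃ x : M.obj _, toShf x = rs _ f s :=
  ⟨Presheaf.imageSieve (toSheafify J M.presheaf) (U := U.unop) s,
    Presheaf.imageSieve_mem J (toSheafify J M.presheaf) s, fun _ _ hf ↦ hf⟩

/-- The quotient of a presheaf of modules by the image of a morphism. -/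
noncomputable def preCoker {M N : PMod A.obj} (φ : M ⟶ N) : PMod A.obj :=
  mkPMod (fun U ↦ N.obj U ⧸ LinearMap.range (appₗ φ U))
    (fun {U V} f ↦ Submodule.mapQ _ _ (res N f) (by
      rintro _ ⟨x, rfl⟩
      exact ⟨res M f x, appₗ_res φ f x⟩))
    (fun U x ↦ by
      obtain ⟨x, rfl⟩ := Submodule.mkQ_surjective _ x
      exact congr_arg _ (res_id N U x))
    (fun f g x ↦ by
      obtain ⟨x, rfl⟩ := Submodule.mkQ_surjective _ x
      exact congr_arg _ (res_comp N f g x))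

/-- The projection to the quotient by the image of a morphism. -/
noncomputable def preCokerπ {M N : PMod A.obj} (φ : M ⟶ N) : N ⟶ preCoker φ :=
  mkPModHom (fun U ↦ (LinearMap.range (appₗ φ U)).mkQ) (fun _ _ ↦ rfl)

/-- Epimorphisms of sheaves of modules are locally surjective: the map to the sheafification of the
presheaf cokernel vanishes. -/
lemma loc_exists_of_epi {M N : Mod A} (φ : M ⟶ N) [Epi φ] {U : Cᵒᵖ} (y : N.val.obj U) :
    Loc J U fun _ f ↦ ∃ x, ap φ x = rs N f y := by
  let π : N ⟶ (shf A).obj (preCoker φ.val) :=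
    ⟨preCokerπ φ.val ≫ ((PresheafOfModules.sheafificationAdjunction
      (𝟙 (ringSheaf A).obj)).unit.app (preCoker φ.val))⟩
  have hπ {U : Cᵒᵖ} (y : N.val.obj U) :
      ap π y = toShf (M := preCoker φ.val) (appₗ (preCokerπ φ.val) U y) := rfl
  have h0 : φ ≫ π = 0 := ap_ext fun U x ↦ by
    rw [ap_comp, hπ]
    have : appₗ (preCokerπ φ.val) U (ap φ x) = 0 :=
      (Submodule.Quotient.mk_eq_zero _).2 ⟨x, rfl⟩
    rw [this]
    exact map_zero (toShfₗ A (preCoker φ.val) U)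
  have h1 : π = 0 := by rwa [← cancel_epi φ, comp_zero]
  have h2 : toShf (M := preCoker φ.val) (appₗ (preCokerπ φ.val) U y) =
      toShf (0 : (preCoker φ.val).obj U) := by
    rw [← hπ, h1]
    exact (map_zero (toShfₗ A (preCoker φ.val) U)).symm
  refine (loc_of_toShf_eq h2).mono fun V f hf ↦ ?_
  have h3 : appₗ (preCokerπ φ.val) V (rs N f y) = 0 :=
    hf.trans (map_zero (res (preCoker φ.val) f))
  obtain ⟨x, hx⟩ := (Submodule.Quotient.mk_eq_zero _).1 h3
  exact ⟨x, hx⟩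

lemma loc_exists_of_exact {S : ShortComplex (Mod A)} (hS : S.Exact) {U : Cᵒᵖ}
    (x : S.X₂.val.obj U) (hx : ap S.g x = 0) : Loc J U fun _ f ↦ ∃ y, ap S.f y = rs _ f x := by
  have hS' : (ShortComplex.mk _ _ S.iCycles_g).Exact :=
    ShortComplex.exact_of_f_is_kernel _ S.cyclesIsKernel
  obtain ⟨z, hz⟩ := exists_ap_eq_of_exact hS' x hx
  have : Epi S.toCycles := hS.epi_toCycles
  refine (loc_exists_of_epi S.toCycles z).mono fun V f ⟨y, hy⟩ ↦ ⟨y, ?_⟩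
  rw [← hz, ← ap_rs]
  change _ = ap S.iCycles _
  rw [← hy, ← ap_comp, S.toCycles_i]

lemma exact_of_loc {S : ShortComplex (Mod A)}
    (h : ∀ (U : Cᵒᵖ) (x : S.X₂.val.obj U), ap S.g x = 0 →
      Loc J U fun _ f ↦ ∃ y, ap S.f y = rs _ f x) : S.Exact := by
  rw [S.exact_iff_epi_toCycles]
  refine epi_of_loc _ fun U z ↦ (h U (ap S.iCycles z) ?_).mono fun V f ⟨y, hy⟩ ↦ ⟨y, ?_⟩
  · rw [← ap_comp, S.iCycles_g]; rfl
  · apply ap_injective S.iCycles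
    rw [← ap_comp, S.toCycles_i, hy, ap_rs]

/-- A morphism of presheaves of modules which is locally surjective gives an epimorphism of the
associated sheaves. -/
lemma epi_shf_map {M N : PMod A.obj} (φ : M ⟶ N)
    (h : ∀ (U : Cᵒᵖ) (y : N.obj U), Loc J U fun _ f ↦ ∃ x, appₗ φ _ x = res N f y) :
    Epi ((shf A).map φ) := by
  refine epi_of_loc _ fun U s ↦ (loc_exists_toShf s).bind fun V f ⟨y, hy⟩ ↦
    (h V y).mono fun W g ⟨x, hx⟩ ↦ ⟨toShf x, ?_⟩
  rw [ap_shf_map, hx, ← rs_toShf, hy, rs_comp]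

/-- A local criterion for exactness of the complex associated with a complex of presheaves. -/
lemma loc_exists_shf {M N P : PMod A.obj} (φ : M ⟶ N) (ψ : N ⟶ P)
    (h : ∀ (U : Cᵒᵖ) (y : N.obj U), appₗ ψ U y = 0 → Loc J U fun _ f ↦ ∃ x, appₗ φ _ x = res N f y)
    {U : Cᵒᵖ} (s : ((shf A).obj N).val.obj U) (hs : ap ((shf A).map ψ) s = 0) :
    Loc J U fun _ f ↦ ∃ t, ap ((shf A).map φ) t = rs _ f s := by
  refine (loc_exists_toShf s).bind fun V f ⟨y, hy⟩ ↦ ?_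
  have h1 : toShf (appₗ ψ V y) = toShf (0 : P.obj V) := by
    rw [← ap_shf_map, hy, ap_rs, hs, rs_zero]
    exact (map_zero (toShfₗ A P V)).symm
  refine (loc_of_toShf_eq h1).bind fun W g hg ↦ ?_
  have h2 : appₗ ψ W (res N g y) = 0 := by
    rw [appₗ_res, hg, map_zero]
  refine (h W _ h2).mono fun X k ⟨x, hx⟩ ↦ ⟨toShf x, ?_⟩
  rw [ap_shf_map, hx, ← rs_toShf, ← rs_toShf, hy, rs_comp, rs_comp]

lemma mono_shf_map {M N : PMod A.obj} (φ : M ⟶ N)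
    (h : ∀ (U : Cᵒᵖ) (x : M.obj U), appₗ φ U x = 0 → Loc J U fun _ f ↦ res M f x = 0) :
    Mono ((shf A).map φ) := by
  refine mono_of_ap_eq_zero _ fun U s hs ↦ eq_of_loc ?_
  refine (loc_exists_shf (0 : M ⟶ M) φ (fun U x hx ↦ (h U x hx).mono fun V f hf ↦
    ⟨0, hf.symm⟩) s hs).mono fun V f ⟨t, ht⟩ ↦ ?_
  rw [← ht, rs_zero, Functor.map_zero]
  rfl

end Sections

/-! ### The equational criterion for flatness -/

section Equational

variable {R : Type*} [CommRing R] {M N : Type*} [AddCommGroup M] [Module R M] [AddCommGroup N]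
  [Module R N]

lemma exists_of_lTensor_eq_zero {F : Type*} [AddCommGroup F] [Module R F] (g : F →ₗ[R] N)
    (hg : Function.Surjective g) {t : M ⊗[R] F} (ht : g.lTensor M t = 0) :
    ∃ (k : ℕ) (y : Fin k → M) (κ : Fin k → F), (∀ l, g (κ l) = 0) ∧ t = ∑ l, y l ⊗ₜ κ l := by
  obtain ⟨t', rfl⟩ := (lTensor_exact M g.exact_subtype_ker_map hg t).1 ht
  obtain ⟨k, y, κ, rfl⟩ := TensorProduct.exists_sum_tmul_eq t'
  exact ⟨k, y, fun l ↦ (κ l).1, fun l ↦ (κ l).2, by simp⟩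

/-- A relation `∑ xᵢ ⊗ nᵢ = 0` in a tensor product is a consequence of finitely many linear
relations in the second factor. -/
lemma exists_of_sum_tmul_eq_zero {ι : Type*} [Fintype ι] (x : ι → M) (n : ι → N)
    (h : ∑ i, x i ⊗ₜ[R] n i = 0) :
    ∃ (k : ℕ) (y : Fin k → M) (c : Fin k → ι → R) (d : Fin k → N →₀ R),
      (∀ i, x i = ∑ l, c l i • y l) ∧ (∀ z, ∑ l, d l z • y l = 0) ∧
        ∀ l, ∑ i, c l i • n i + Finsupp.linearCombination R id (d l) = 0 := by
  classical
  let g : (ι → R) × (N →₀ R) →ₗ[R] N :=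
    (Fintype.linearCombination R n).coprod (Finsupp.linearCombination R id)
  have hg : Function.Surjective g := fun z ↦ ⟨(0, Finsupp.single z 1), by simp [g]⟩
  let t : M ⊗[R] ((ι → R) × (N →₀ R)) := ∑ i, x i ⊗ₜ (Pi.single i 1, 0)
  have ht : g.lTensor M t = 0 := by
    rw [← h, map_sum]
    exact Finset.sum_congr rfl fun i _ ↦ by simp [g]
  obtain ⟨k, y, κ, hκ, ht'⟩ := exists_of_lTensor_eq_zero g hg ht
  have key (φ : (ι → R) × (N →₀ R) →ₗ[R] R) :
      ∑ l, φ (κ l) • y l = ∑ i, φ (Pi.single i 1, 0) • x i := by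
    have := congr(TensorProduct.rid R M (φ.lTensor M $ht'))
    simpa [t, map_sum] using this.symm
  refine ⟨k, y, fun l ↦ (κ l).1, fun l ↦ (κ l).2, fun i ↦ ?_, fun z ↦ ?_, fun l ↦ ?_⟩
  · have := key (LinearMap.proj i ∘ₗ LinearMap.fst R _ _)
    simp only [LinearMap.comp_apply, LinearMap.fst_apply, LinearMap.proj_apply] at this
    rw [this, Finset.sum_eq_single i]
    · simp
    · intro j _ hj
      rw [Pi.single_eq_of_ne hj.symm, zero_smul]
    · simp
  · have := key (Finsupp.lapply z ∘ₗ LinearMap.snd R _ _)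
    simpa using this
  · have := hκ l
    simpa [g, Fintype.linearCombination_apply] using this

end Equational

section Representable

variable {C : Type u} [SmallCategory C] (R : Cᵒᵖ ⥤ CommRingCat.{u}) (U : Cᵒᵖ)

/-- The restriction map of the free presheaf of modules on the presheaf represented by `U`. -/
noncomputable def freeRepRes {V W : Cᵒᵖ} (g : V ⟶ W) :
    ((U ⟶ V) →₀ R.obj V) →ₛₗ[(R.map g).hom] ((U ⟶ W) →₀ R.obj W) where
  toFun x := (x.mapRange (R.map g) (map_zero (R.map g).hom)).mapDomain (· ≫ g)
  map_add' x y := by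
    rw [Finsupp.mapRange_add (map_add (R.map g).hom), Finsupp.mapDomain_add]
  map_smul' c x := by
    rw [← Finsupp.mapDomain_smul]
    congr 1
    ext f
    simp

variable {U} in
lemma freeRepRes_single {V W : Cᵒᵖ} (g : V ⟶ W) (f : U ⟶ V) (c : R.obj V) :
    freeRepRes R U g (Finsupp.single f c) = Finsupp.single (f ≫ g) (R.map g c) := by
  simp [freeRepRes]

lemma freeRepRes_id (V : Cᵒᵖ) (x : (U ⟶ V) →₀ R.obj V) : freeRepRes R U (𝟙 V) x = x := by
  induction x using Finsupp.induction_linear with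
  | zero => exact map_zero _
  | add x y hx hy => rw [map_add, hx, hy]
  | single f c => rw [freeRepRes_single, Category.comp_id, R.map_id]; rfl

lemma freeRepRes_comp {V W X : Cᵒᵖ} (g : V ⟶ W) (h : W ⟶ X) (x : (U ⟶ V) →₀ R.obj V) :
    freeRepRes R U (g ≫ h) x = freeRepRes R U h (freeRepRes R U g x) := by
  induction x using Finsupp.induction_linear with
  | zero => simp only [map_zero]
  | add x y hx hy => rw [map_add, hx, hy, map_add, map_add]
  | single f c =>
    rw [freeRepRes_single, freeRepRes_single, freeRepRes_single, Category.assoc, R.map_comp]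
    rfl

/-- The free presheaf of modules on the presheaf represented by `U`. -/
noncomputable def freeRep : PMod R :=
  mkPMod (fun V ↦ (U ⟶ V) →₀ R.obj V) (freeRepRes R U) (freeRepRes_id R U) (freeRepRes_comp R U)

variable {R U} {ι : Type*} (a : ι → R.obj U)

/-- The elements of the free presheaf of modules on `U` whose coefficients lie in the ideal
generated by the `aᵢ`. -/
def idealRepSub (V : Cᵒᵖ) : Submodule (R.obj V) ((U ⟶ V) →₀ R.obj V) where
  carrier := {x | ∀ f : U ⟶ V, x f ∈ Ideal.span (Set.range fun i ↦ R.map f (a i))}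
  add_mem' hx hy f := add_mem (hx f) (hy f)
  zero_mem' _ := zero_mem _
  smul_mem' c _ hx f := Submodule.smul_mem _ c (hx f)

lemma single_mem_idealRepSub {V : Cᵒᵖ} {f : U ⟶ V} {c : R.obj V}
    (hc : c ∈ Ideal.span (Set.range fun i ↦ R.map f (a i))) :
    Finsupp.single f c ∈ idealRepSub a V := by
  classical
  intro h
  rw [Finsupp.single_apply]
  split_ifs with e
  · subst e; exact hc
  · exact zero_mem _

lemma freeRepRes_mem {V W : Cᵒᵖ} (g : V ⟶ W) {x : (U ⟶ V) →₀ R.obj V} (hx : x ∈ idealRepSub a V) :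
    freeRepRes R U g x ∈ idealRepSub a W := by
  rw [← Finsupp.sum_single x, Finsupp.sum, map_sum]
  refine Submodule.sum_mem _ fun f _ ↦ ?_
  rw [freeRepRes_single]
  refine single_mem_idealRepSub a ?_
  have h := Ideal.mem_map_of_mem (R.map g).hom (hx f)
  rw [Ideal.map_span, ← Set.range_comp] at h
  convert h using 4 with i
  rw [R.map_comp]
  rfl

/-- The restriction map of the subpresheaf generated by the `aᵢ`. -/
noncomputable def idealRepRes {V W : Cᵒᵖ} (g : V ⟶ W) :
    idealRepSub a V →ₛₗ[(R.map g).hom] idealRepSub a W where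
  toFun x := ⟨freeRepRes R U g x.1, freeRepRes_mem a g x.2⟩
  map_add' x y := Subtype.ext (map_add (freeRepRes R U g) x.1 y.1)
  map_smul' c x := Subtype.ext (map_smulₛₗ (freeRepRes R U g) c x.1)

/-- The subpresheaf of modules generated by the `aᵢ` in the free presheaf of modules on `U`. -/
noncomputable def idealRep : PMod R :=
  mkPMod (fun V ↦ idealRepSub a V) (idealRepRes a)
    (fun V x ↦ Subtype.ext (freeRepRes_id R U V x.1))
    (fun g h x ↦ Subtype.ext (freeRepRes_comp R U g h x.1))

/-- The inclusion of the subpresheaf generated by the `aᵢ`. -/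
noncomputable def idealRepι : idealRep a ⟶ freeRep R U :=
  mkPModHom (fun V ↦ (idealRepSub a V).subtype) (fun _ _ ↦ rfl)

end Representable

section Flat

variable {C : Type u} [SmallCategory C] {J : GrothendieckTopology C} {A : Sheaf J CommRingCat.{u}}

/-- The section `∑ xᵢ ⊗ nᵢ` of the tensor product of presheaves of modules. -/
noncomputable def tensorSec {R : Cᵒᵖ ⥤ CommRingCat.{u}} (M N : PMod R) {U : Cᵒᵖ} {ι : Type*}
    [Fintype ι] (x : ι → M.obj U) (n : ι → N.obj U) :
    (MonoidalCategoryStruct.tensorObj M N : PMod R).obj U :=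
  (∑ i, x i ⊗ₜ[R.obj U] n i : M.obj U ⊗[R.obj U] N.obj U)

lemma res_tensorSec {R : Cᵒᵖ ⥤ CommRingCat.{u}} (M N : PMod R) {U V : Cᵒᵖ} {ι : Type*} [Fintype ι]
    (x : ι → M.obj U) (n : ι → N.obj U) (f : U ⟶ V) :
    res _ f (tensorSec M N x n) = tensorSec M N (fun i ↦ res M f (x i)) fun i ↦ res N f (n i) :=
  map_sum (res (MonoidalCategoryStruct.tensorObj M N : PMod R) f) _ _

lemma whiskerLeft_tensorSec {R : Cᵒᵖ ⥤ CommRingCat.{u}} (M : PMod R) {N N' : PMod R} (φ : N ⟶ N')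
    {U : Cᵒᵖ} {ι : Type*} [Fintype ι] (x : ι → M.obj U) (n : ι → N.obj U) :
    appₗ (MonoidalCategoryStruct.whiskerLeft M φ) U (tensorSec M N x n) =
      tensorSec M N' x fun i ↦ appₗ φ U (n i) :=
  map_sum (appₗ (MonoidalCategoryStruct.whiskerLeft M φ) U) _ _

/-- The equational criterion for flatness, for one relation: a relation `∑ aᵢ xᵢ = 0` between
sections of a flat sheaf of modules is locally a consequence of relations between scalars. The
proof applies flatness to the inclusion of the ideal generated by the `aᵢ` over `U`, that is, of the
subsheaf generated by the `aᵢ` in the free sheaf of modules on `U`. -/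
lemma IsFlat.loc_relation {M : Mod A} (hM : IsFlat M) {U : Cᵒᵖ} {ι : Type*} [Fintype ι]
    (a : ι → A.obj.obj U) (x : ι → M.val.obj U) (h : ∑ i, a i • x i = 0) :
    Loc J U fun V f ↦ ∃ (n : ℕ) (b : ι → Fin n → A.obj.obj V) (y : Fin n → M.val.obj V),
      (∀ i, rs M f (x i) = ∑ l, b i l • y l) ∧ ∀ l, ∑ i, A.obj.map f (a i) * b i l = 0 := by
  classical
  let F := (shf A).map (idealRepι a)
  have hF : Mono F := mono_shf_map _ fun V z hz ↦ by
    have : z = 0 := Subtype.ext hz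
    subst this
    exact Loc.of_forall fun W f ↦ map_zero (res (idealRep a) f)
  have hmono := hM F hF
  set T := MonoidalCategoryStruct.whiskerLeft (C := PMod A.obj) M.val F.val
  let e (i : ι) : (idealRep a).obj U := ⟨Finsupp.single (𝟙 U) (a i), by
    refine single_mem_idealRepSub a (Ideal.subset_span ⟨i, ?_⟩)
    simp⟩
  let t := tensorSec M.val ((shf A).obj (idealRep a)).val x (fun i ↦ toShf (e i))
  have ht : appₗ T U t = 0 := by
    have he (i : ι) : ap F (toShf (e i)) =
        a i • toShf (M := freeRep A.obj U) (Finsupp.single (𝟙 U) 1) := by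
      refine (ap_shf_map _ _).trans (Eq.trans ?_ (map_smul (toShfₗ A (freeRep A.obj U) U) _ _))
      change toShf _ = toShf _
      congr 1
      exact (Finsupp.smul_single_one (𝟙 U) (a i)).symm
    refine (whiskerLeft_tensorSec M.val F.val x _).trans ?_
    change ∑ i, x i ⊗ₜ[A.obj.obj U] ap F (toShf (e i)) = 0
    simp only [he, tmul_smul, smul_tmul', ← sum_tmul]
    rw [h, zero_tmul]
  -- `t = ∑ xᵢ ⊗ aᵢ` vanishes in the tensor product with the ideal, by flatness
  have h2 : toShf t = 0 := by
    refine ap_injective ((shf A).map T) U ?_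
    rw [ap_shf_map, ht, ap_zero]
    exact map_zero (toShfₗ A _ U)
  have h3 := loc_of_toShf_eq (h2.trans (map_zero (toShfₗ A _ U)).symm)
  refine h3.bind fun V f hf ↦ ?_
  have h4 : ∑ i, rs M f (x i) ⊗ₜ[A.obj.obj V] toShf (M := idealRep a) (res _ f (e i)) = 0 := by
    rw [res_tensorSec, map_zero] at hf
    refine Eq.trans ?_ hf
    refine Finset.sum_congr rfl fun i _ ↦ ?_
    congr 1
    exact (rs_toShf f (e i)).symm
  -- the relations obtained so far involve sections of the sheaf associated with the ideal, which
  -- locally are elements of the ideal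
  obtain ⟨k, y, c, d, hx, hy, hcd⟩ := exists_of_sum_tmul_eq_zero _ _ h4
  let s : Finset (((shf A).obj (idealRep a)).val.obj V) := Finset.univ.biUnion fun l ↦ (d l).support
  have hs (l : Fin k) : (d l).support ⊆ s :=
    Finset.subset_biUnion_of_mem (fun l ↦ (d l).support) (Finset.mem_univ l)
  have h5 := Loc.finset_forall s (J := J) (q := fun z W g ↦ ∃ z' : (idealRep a).obj W,
    toShf z' = rs _ g z) fun z _ ↦ loc_exists_toShf z
  refine h5.bind fun W g hg ↦ ?_
  choose! z' hz' using hg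
  have h6 (l : Fin k) : toShf (M := idealRep a) (∑ i, A.obj.map g (c l i) • res _ (f ≫ g) (e i) +
      ∑ z ∈ s, A.obj.map g (d l z) • z' z) = toShf (M := idealRep a) 0 := by
    have := congr_arg (res ((shf A).obj (idealRep a)).val g) (hcd l)
    rw [map_add, Finsupp.linearCombination_apply,
      Finsupp.sum_of_support_subset _ (hs l) _ (by simp), map_sum, map_sum, map_zero] at this
    simp only [map_smulₛₗ, id] at this
    change toShfₗ A (idealRep a) W _ = toShfₗ A (idealRep a) W _
    rw [map_add, map_sum, map_sum, map_zero, ← this]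
    congr 1
    · refine Finset.sum_congr rfl fun i _ ↦ ?_
      rw [map_smul, res_comp]
      exact congr_arg _ (rs_toShf g (M := idealRep a) (res (idealRep a) f (e i))).symm
    · refine Finset.sum_congr rfl fun z hz ↦ ?_
      rw [map_smul]
      exact congr_arg _ (hz' z hz)
  have h7 := Loc.fintype_forall fun l ↦ loc_of_toShf_eq (h6 l)
  refine h7.mono fun X p hp ↦ ?_
  let ρ : A.obj.obj V →+* A.obj.obj X := (A.obj.map (g ≫ p)).hom
  -- the coefficient of the canonical basis element turns elements of the ideal into scalars
  let ev : (idealRep a).obj X →ₗ[A.obj.obj X] A.obj.obj X :=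
    Finsupp.lapply (f ≫ g ≫ p) ∘ₗ (idealRepSub a X).subtype
  have hev (i : ι) : ev (res (idealRep a) (f ≫ g ≫ p) (e i)) = A.obj.map (f ≫ g ≫ p) (a i) := by
    change freeRepRes A.obj U (f ≫ g ≫ p) (Finsupp.single (𝟙 U) (a i)) (f ≫ g ≫ p) = _
    rw [freeRepRes_single, Category.id_comp, Finsupp.single_eq_same]
  have hw (z) : ∃ w : ι → A.obj.obj X, ∑ i, w i * A.obj.map (f ≫ g ≫ p) (a i) =
      ev (res (idealRep a) p (z' z)) :=
    Ideal.mem_span_range_iff_exists_fun.1 ((res (idealRep a) p (z' z)).2 (f ≫ g ≫ p))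
  choose w hw using hw
  have hp' (l : Fin k) : ∑ i, ρ (c l i) * A.obj.map (f ≫ g ≫ p) (a i) +
      ∑ z ∈ s, ρ (d l z) * ∑ i, w z i * A.obj.map (f ≫ g ≫ p) (a i) = 0 := by
    have := congr_arg ev (hp l)
    rw [map_zero, map_zero, map_add, map_add, map_sum, map_sum, map_sum, map_sum] at this
    rw [← this]
    congr 1
    · refine Finset.sum_congr rfl fun i _ ↦ ?_
      rw [map_smulₛₗ, map_smul, ← res_comp, Category.assoc, hev]
      simp [ρ]
    · refine Finset.sum_congr rfl fun z hz ↦ ?_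
      rw [map_smulₛₗ, map_smul, hw]
      simp [ρ]
  -- in the relations just obtained, collect the coefficients of each `aᵢ`
  refine ⟨k, fun i l ↦ ρ (c l i) + ∑ z ∈ s, ρ (d l z) * w z i, fun l ↦ rs M (g ≫ p) (y l),
    fun i ↦ ?_, fun l ↦ ?_⟩
  · have h8 : ∑ l, (∑ z ∈ s, ρ (d l z) * w z i) • rs M (g ≫ p) (y l) = 0 := by
      simp only [Finset.sum_smul]
      rw [Finset.sum_comm]
      refine Finset.sum_eq_zero fun z _ ↦ ?_
      have := congr_arg (res M.val (g ≫ p)) (hy z)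
      rw [map_sum, map_zero] at this
      simp only [map_smulₛₗ] at this
      simp only [mul_comm _ (w z i), mul_smul, ← Finset.smul_sum]
      exact (congr_arg (w z i • ·) this).trans (smul_zero _)
    simp only [add_smul, Finset.sum_add_distrib]
    rw [h8, add_zero, rs_comp, hx]
    refine (map_sum (res M.val (g ≫ p)) _ _).trans ?_
    exact Finset.sum_congr rfl fun l _ ↦ map_smulₛₗ (res M.val (g ≫ p)) _ _
  · rw [← hp' l]
    simp only [mul_add, Finset.sum_add_distrib, Finset.mul_sum]
    rw [Finset.sum_comm]
    congr 1
    · exact Finset.sum_congr rfl fun i _ ↦ mul_comm _ _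
    · exact Finset.sum_congr rfl fun z _ ↦ Finset.sum_congr rfl fun i _ ↦ by ring

/-- The equational criterion for flatness, for finitely many relations. They are treated one after
the other: the sections trivializing the first relations satisfy the next one. -/
lemma IsFlat.loc_relations {M : Mod A} (hM : IsFlat M) {U : Cᵒᵖ} {ι : Type*} [Fintype ι]
    (T : Finset (ι → A.obj.obj U)) (x : ι → M.val.obj U) (h : ∀ a ∈ T, ∑ i, a i • x i = 0) :
    Loc J U fun V f ↦ ∃ (n : ℕ) (b : ι → Fin n → A.obj.obj V) (y : Fin n → M.val.obj V),
      (∀ i, rs M f (x i) = ∑ l, b i l • y l) ∧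
        ∀ a ∈ T, ∀ l, ∑ i, A.obj.map f (a i) * b i l = 0 := by
  classical
  induction T using Finset.induction_on with
  | empty =>
    refine Loc.of_forall fun V f ↦ ⟨Fintype.card ι, fun i ↦ Pi.single (Fintype.equivFin ι i) 1,
      fun l ↦ rs M f (x ((Fintype.equivFin ι).symm l)), fun i ↦ ?_, by simp⟩
    rw [Finset.sum_eq_single (Fintype.equivFin ι i)]
    · simp
    · intro l _ hl
      beta_reduce
      rw [Pi.single_eq_of_ne hl, zero_smul]
    · simp
  | insert a T _ ih =>
    refine (ih fun a' ha' ↦ h a' (Finset.mem_insert_of_mem ha')).bind fun V f hf ↦ ?_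
    obtain ⟨n, b, y, hb, hT⟩ := hf
    have h0 : ∑ l, (∑ i, A.obj.map f (a i) * b i l) • y l = 0 := by
      have := congr_arg (res M.val f) (h a (Finset.mem_insert_self _ _))
      rw [map_sum, map_zero] at this
      simp only [map_smulₛₗ] at this
      rw [← this]
      simp only [Finset.sum_smul, mul_smul]
      rw [Finset.sum_comm]
      refine Finset.sum_congr rfl fun i _ ↦ ?_
      rw [← Finset.smul_sum, ← hb]
      rfl
    refine (hM.loc_relation _ y h0).mono fun W g hg ↦ ?_
    obtain ⟨k, b', y', hb', ha⟩ := hg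
    have hmap (i) : A.obj.map (f ≫ g) (a i) = A.obj.map g (A.obj.map f (a i)) := by simp
    refine ⟨k, fun i r ↦ ∑ l, A.obj.map g (b i l) * b' l r, y', fun i ↦ ?_, fun a' ha' r ↦ ?_⟩
    · rw [rs_comp, hb]
      refine (map_sum (res M.val g) _ _).trans ?_
      simp only [map_smulₛₗ, Finset.sum_smul]
      rw [Finset.sum_comm]
      refine Finset.sum_congr rfl fun l _ ↦ ?_
      refine (congr_arg (_ • ·) (hb' l)).trans ?_
      simp only [Finset.smul_sum, mul_smul]
    · have key : ∑ i, A.obj.map (f ≫ g) (a' i) * ∑ l, A.obj.map g (b i l) * b' l r =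
          ∑ l, A.obj.map g (∑ i, A.obj.map f (a' i) * b i l) * b' l r := by
        simp only [map_sum, map_mul, Finset.mul_sum, Finset.sum_mul]
        rw [Finset.sum_comm]
        simp [mul_assoc]
      rw [key]
      obtain rfl | ha' := Finset.mem_insert.1 ha'
      · exact ha r
      · exact Finset.sum_eq_zero fun l _ ↦ by rw [hT a' ha' l, map_zero, zero_mul]

end Flat

section SemilinearCombination

variable {R S : Type*} [CommRing R] [CommRing S] (σ : R →+* S) {ι M : Type*} [AddCommGroup M]
  [Module S M]

/-- The semilinear map `∑ cᵢ eᵢ ↦ ∑ σ(cᵢ) xᵢ` on a free module. -/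
noncomputable def semiComb (x : ι → M) : (ι →₀ R) →ₛₗ[σ] M where
  toFun e := e.sum fun i c ↦ σ c • x i
  map_add' e e' := Finsupp.sum_add_index' (by simp) (by simp [add_smul])
  map_smul' c e := by
    rw [Finsupp.sum_smul_index' (by simp), Finsupp.smul_sum]
    simp [mul_smul]

@[simp]
lemma semiComb_single (x : ι → M) (i : ι) (c : R) :
    semiComb σ x (Finsupp.single i c) = σ c • x i := by
  simp [semiComb]

variable {σ}

lemma semilinear_congr {f g : (ι →₀ R) →ₛₗ[σ] M} {e : ι →₀ R}
    (h : ∀ i ∈ e.support, f (Finsupp.single i 1) = g (Finsupp.single i 1)) : f e = g e := by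
  rw [← Finsupp.sum_single e, Finsupp.sum, map_sum, map_sum]
  refine Finset.sum_congr rfl fun i hi ↦ ?_
  rw [← Finsupp.smul_single_one, map_smulₛₗ, map_smulₛₗ, h i hi]

end SemilinearCombination

section Lift

variable {C : Type u} [SmallCategory C] {J : GrothendieckTopology C} {A : Sheaf J CommRingCat.{u}}

/-- Let `N` be a flat quotient of a sheaf of modules `P`, and consider finitely many relations
between sections of `N`. Locally, the sections can be expressed in terms of finitely many sections
which lift to `P`, in such a way that the relations hold between the coefficients. -/
lemma IsFlat.loc_lift {P N : Mod A} (hN : IsFlat N) (φ : P ⟶ N) [Epi φ] {U : Cᵒᵖ} {ι : Type*}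
    (s : Finset ι) (x : ι → N.val.obj U) (T : Finset (ι →₀ A.obj.obj U))
    (hT : ∀ r ∈ T, Finsupp.linearCombination (A.obj.obj U) x r = 0) :
    Loc J U fun V f ↦ ∃ (k : ℕ)
      (δ : (ι →₀ A.obj.obj U) →ₛₗ[(A.obj.map f).hom] (Fin k → A.obj.obj V))
      (θ : Fin k → P.val.obj V), (∀ r ∈ T, δ r = 0) ∧
        ∀ i ∈ s, rs N f (x i) = ∑ l, δ (Finsupp.single i 1) l • ap φ (θ l) := by
  classical
  let s' : Finset ι := s ∪ T.biUnion Finsupp.support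
  have hs' (r) (hr : r ∈ T) : r.support ⊆ s' :=
    (Finset.subset_biUnion_of_mem Finsupp.support hr).trans Finset.subset_union_right
  refine (hN.loc_relations (ι := s') (T.image fun r i ↦ r i.1) (fun i ↦ x i.1) ?_).bind
    fun V f ⟨n, b, y, hb, hbT⟩ ↦ ?_
  · intro a ha
    obtain ⟨r, hr, rfl⟩ := Finset.mem_image.1 ha
    rw [← hT r hr, Finsupp.linearCombination_apply, Finsupp.sum_of_support_subset _ (hs' r hr) _
      (by simp)]
    exact Finset.sum_coe_sort s' fun i ↦ r i • x i
  refine (Loc.fintype_forall fun l ↦ loc_exists_of_epi φ (y l)).mono fun W g hg ↦ ?_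
  choose θ hθ using hg
  refine ⟨n, semiComb _ (fun i l ↦ if hi : i ∈ s' then A.obj.map g (b ⟨i, hi⟩ l) else 0), θ,
    fun r hr ↦ ?_, fun i hi ↦ ?_⟩
  · ext l
    have := congr_arg (A.obj.map g) (hbT _ (Finset.mem_image_of_mem _ hr) l)
    rw [map_zero, map_sum] at this
    simp only [Pi.zero_apply]
    rw [← this]
    simp only [semiComb, LinearMap.coe_mk, AddHom.coe_mk]
    rw [Finsupp.sum_of_support_subset _ (hs' r hr) _ (by simp), Finset.sum_apply,
      ← Finset.sum_coe_sort s']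
    refine Finset.sum_congr rfl fun i _ ↦ ?_
    simp
  · have hi' : i ∈ s' := Finset.mem_union_left _ hi
    rw [rs_comp, hb ⟨i, hi'⟩]
    refine (map_sum (res N.val g) _ _).trans (Finset.sum_congr rfl fun l _ ↦ ?_)
    rw [map_smulₛₗ]
    simp only [semiComb_single, map_one, one_smul, dif_pos hi', hθ]
    rfl

end Lift

/-! ### The cycles of the Koszul complex of a flat morphism -/

section Coordinates

variable {R S : Type u} [CommRing R] [CommRing S] {ρ : R →+* S} {I K P Z : Type u}
  [AddCommGroup P] [Module S P] [AddCommGroup Z] [Module S Z]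

/-- Consider a chain `c` of the Koszul complex of the inclusion of free modules
`R^(I) → R^(I) × R^(K)`, and semilinear maps `ψP` and `ψF` from these modules to `P` and `Z` which
on finite sets of basis vectors can be expressed in terms of sections `θ` of `P` and `ζ` of `Z`. If
the relations which force `c` to become a cycle hold between the coefficients, then the image of `c`
is a sum of a boundary and an element of `Λⁱ(Z) ⊗ Γ^{q-i}(ker u)`. Indeed, the image comes from a
cycle of the Koszul complex of the split map `ker u × Sᵐ → Sᵐ × Sⁿ`. -/
lemma kosMap_mem_sup_of_coordinates {q i : ℕ} (c : KosX R ((I →₀ R) × (K →₀ R)) (I →₀ R) q i)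
    (u : P →ₗ[S] Z) {m n : ℕ} (θ : Fin m → P) (ζ : Fin n → Z)
    (ψP : (I →₀ R) →ₛₗ[ρ] P) (ψZ : (K →₀ R) →ₛₗ[ρ] Z)
    (ψF : (I →₀ R) × (K →₀ R) →ₛₗ[ρ] Z) (hψF : ∀ e, ψF e = u (ψP e.1) + ψZ e.2)
    (δP : (I →₀ R) →ₛₗ[ρ] (Fin m → S)) (δZ : (K →₀ R) →ₛₗ[ρ] (Fin m → S))
    (γ : (K →₀ R) →ₛₗ[ρ] (Fin n → S)) (sP : Set I) (sZ : Set K)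
    (hP : ∀ x ∈ sP, u (ψP (Finsupp.single x 1)) = ∑ l, δP (Finsupp.single x 1) l • u (θ l))
    (hZ : ∀ z ∈ sZ, ψZ (Finsupp.single z 1) = ∑ l, δZ (Finsupp.single z 1) l • u (θ l) +
      ∑ l, γ (Finsupp.single z 1) l • ζ l)
    (T : Finset ((I →₀ R) × (K →₀ R))) (T' : Finset (I →₀ R))
    (hT : ∀ e ∈ T, δP e.1 + δZ e.2 = 0 ∧ γ e.2 = 0)
    (hT' : ∀ a ∈ T', δP a = 0 ∧ ψP a = 0) (hT's : ∀ a ∈ T', (a.support : Set I) ⊆ sP)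
    (hkill : ∀ {N N' : Type u} [AddCommGroup N] [Module S N] [AddCommGroup N'] [Module S N']
      (g' : (I →₀ R) × (K →₀ R) →ₛₗ[ρ] N) (f' : (I →₀ R) →ₛₗ[ρ] N'), (∀ k ∈ T, g' k = 0) →
        (∀ k ∈ T', f' k = 0) →
        kosMap g' f' q (i + 1) (kosD (LinearMap.inl R (I →₀ R) (K →₀ R)) q i c) = 0)
    (T₁ : Finset ((I →₀ R) × (K →₀ R))) (T₁' : Finset (I →₀ R))
    (hT₁ : ∀ e ∈ T₁, (e.1.support : Set I) ⊆ sP ∧ (e.2.support : Set K) ⊆ sZ)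
    (hT₁' : ∀ a ∈ T₁', (a.support : Set I) ⊆ sP)
    (hcongr : ∀ {N N' : Type u} [AddCommGroup N] [Module S N] [AddCommGroup N'] [Module S N']
      (g g' : (I →₀ R) × (K →₀ R) →ₛₗ[ρ] N) (f f' : (I →₀ R) →ₛₗ[ρ] N'), (∀ k ∈ T₁, g k = g' k) →
        (∀ k ∈ T₁', f k = f' k) → kosMap g f q i c = kosMap g' f' q i c) :
    kosMap ψF ψP q i c ∈ kosBd u q i ⊔ kosPure u q i := by
  classical
  let M := LinearMap.ker u
  let Θ : (Fin m → S) →ₗ[S] P := Fintype.linearCombination _ θ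
  let ζc : (Fin n → S) →ₗ[S] Z := Fintype.linearCombination _ ζ
  have hΘ (a : Fin m → S) : Θ a = ∑ l, a l • θ l := Fintype.linearCombination_apply _ _ _
  have hζc (a : Fin n → S) : ζc a = ∑ l, a l • ζ l := Fintype.linearCombination_apply _ _ _
  -- `ψP` is the sum of `Θ δP` and of a map `ψ` with values in `ker u`
  let ψ : (I →₀ R) →ₛₗ[ρ] P := ψP - Θ.comp δP
  have hψ' (a) : ψ a = ψP a - Θ (δP a) := rfl
  have hψ {x} (hx : x ∈ sP) : ψ (Finsupp.single x 1) ∈ M := by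
    rw [LinearMap.mem_ker, hψ', map_sub, hP x hx, hΘ, map_sum]
    simp only [map_smul, sub_self]
  let f₁ : (I →₀ R) →ₛₗ[ρ] M × (Fin m → S) := semiComb ρ fun x ↦
    (if hx : x ∈ sP then ⟨ψ (Finsupp.single x 1), hψ hx⟩ else 0, δP (Finsupp.single x 1))
  have hf₁ (a : I →₀ R) : (f₁ a).2 = δP a :=
    semilinear_congr (f := (LinearMap.snd S M _).comp f₁) (g := δP) fun x _ ↦ by
      simp [f₁]
  have hf₁' {a : I →₀ R} (ha : (a.support : Set I) ⊆ sP) : ((f₁ a).1 : P) = ψ a :=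
    semilinear_congr (f := (M.subtype ∘ₗ LinearMap.fst S M _).comp f₁) (g := ψ)
      fun x hx ↦ by simp [f₁, ha hx]
  let g₁ : (I →₀ R) × (K →₀ R) →ₛₗ[ρ] (Fin m → S) × (Fin n → S) :=
    { toFun := fun e ↦ (δP e.1 + δZ e.2, γ e.2)
      map_add' := fun e e' ↦ by
        simp only [Prod.fst_add, Prod.snd_add, map_add, Prod.mk_add_mk]
        rw [add_add_add_comm]
      map_smul' := fun c e ↦ by
        simp only [Prod.smul_fst, Prod.smul_snd, map_smulₛₗ, Prod.smul_mk, smul_add] }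
  have hg₁ (e) : g₁ e = (δP e.1 + δZ e.2, γ e.2) := rfl
  have hcomm₁ (a : I →₀ R) : g₁ (LinearMap.inl R (I →₀ R) (K →₀ R) a) =
      splitMap S M (Fin n → S) m (f₁ a) := by
    simp [hg₁, splitMap, hf₁]
  let f₂ : M × (Fin m → S) →ₗ[S] P := M.subtype.coprod Θ
  let g₂ : (Fin m → S) × (Fin n → S) →ₗ[S] Z := (u ∘ₗ Θ).coprod ζc
  have hcomm₂ (b) : g₂ (splitMap S M (Fin n → S) m b) = u (f₂ b) := by
    have : u b.1 = 0 := b.1.2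
    simp [g₂, f₂, splitMap, this]
  have hf₂₁ {a : I →₀ R} (ha : (a.support : Set I) ⊆ sP) : f₂ (f₁ a) = ψP a := by
    rw [LinearMap.coprod_apply, Submodule.subtype_apply, hf₁' ha, hf₁, hψ', sub_add_cancel]
  have hg₂₁ {e} (he : (e.1.support : Set I) ⊆ sP) (he' : (e.2.support : Set K) ⊆ sZ) :
      g₂ (g₁ e) = ψF e := by
    have h1 : u (ψP e.1) = u (Θ (δP e.1)) :=
      semilinear_congr (f := u.comp ψP) (g := (u ∘ₗ Θ).comp δP) fun x hx ↦ by
        simp [hP x (he hx), hΘ]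
    have h2 : ψZ e.2 = u (Θ (δZ e.2)) + ζc (γ e.2) :=
      semilinear_congr (f := ψZ) (g := (u ∘ₗ Θ).comp δZ + ζc.comp γ) fun x hx ↦ by
        simp [hZ x (he' hx), hΘ, hζc]
    rw [hψF, h1, h2, hg₁]
    simp [g₂, add_assoc]
  have hc₁ : kosD (splitMap S M (Fin n → S) m) q i (kosMap g₁ f₁ q i c) = 0 := by
    rw [kosD_kosMap g₁ f₁ (LinearMap.inl R (I →₀ R) (K →₀ R)) _ hcomm₁]
    refine hkill g₁ f₁ (fun e he ↦ ?_) fun a ha ↦ ?_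
    · exact Prod.ext (hT e he).1 (hT e he).2
    · refine Prod.ext (Subtype.ext ?_) ?_
      · rw [hf₁' (hT's a ha), hψ', (hT' a ha).1, (hT' a ha).2, map_zero, sub_zero]
        rfl
      · rw [hf₁, (hT' a ha).1]
        rfl
  have hgood := kosMap_mem_sup g₂ f₂ hcomm₂ (kosGood_splitMap M (Fin n → S) m q i _ hc₁)
  rw [← kosMap_comp (RingHom.id_comp ρ) g₁ g₂ (g₂.comp g₁) (fun _ ↦ rfl) f₁ f₂ (f₂.comp f₁)
    (fun _ ↦ rfl)] at hgood
  rwa [hcongr ψF (g₂.comp g₁) ψP (f₂.comp f₁)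
    (fun e he ↦ (hg₂₁ (hT₁ e he).1 (hT₁ e he).2).symm) fun a ha ↦ (hf₂₁ (hT₁' a ha)).symm]

end Coordinates

section LocalCycles

variable {C : Type u} [SmallCategory C] {J : GrothendieckTopology C} {A : Sheaf J CommRingCat.{u}}

/-- The coefficientwise restriction of vectors. -/
noncomputable def resVec {R : Cᵒᵖ ⥤ CommRingCat.{u}} {U V : Cᵒᵖ} (f : U ⟶ V) (n : ℕ) :
    (Fin n → R.obj U) →ₛₗ[(R.map f).hom] (Fin n → R.obj V) where
  toFun a l := R.map f (a l)
  map_add' _ _ := funext fun _ ↦ map_add (R.map f).hom _ _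
  map_smul' _ _ := funext fun _ ↦ map_mul (R.map f).hom _ _

lemma rs_sum_smul (M : Mod A) {U V : Cᵒᵖ} (f : U ⟶ V) {n : ℕ} (a : Fin n → A.obj.obj U)
    (x : Fin n → M.val.obj U) :
    rs M f (∑ l, a l • x l) = ∑ l, resVec f n a l • rs M f (x l) :=
  (map_sum (res M.val f) _ _).trans
    (Finset.sum_congr rfl fun _ _ ↦ map_smulₛₗ (res M.val f) _ _)

lemma ap_sum_smul {M N : Mod A} (φ : M ⟶ N) {U : Cᵒᵖ} {n : ℕ} (a : Fin n → A.obj.obj U)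
    (x : Fin n → M.val.obj U) : ap φ (∑ l, a l • x l) = ∑ l, a l • ap φ (x l) :=
  (map_sum (appₗ φ.val U) _ _).trans
    (Finset.sum_congr rfl fun _ _ ↦ map_smul (appₗ φ.val U) _ _)

variable {P Z B H : Mod A} {u : P ⟶ Z} {p : P ⟶ B} {j : B ⟶ Z} {h : Z ⟶ H}

/-- Sections of `Z` can locally be expressed by sections `ζ` whose images in the flat sheaf `H` are
independent, up to sections of the kernel `B` of `Z ⟶ H`. -/
lemma loc_coordinates_quotient [Epi h] (w : j ≫ h = 0) (hex : (ShortComplex.mk j h w).Exact)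
    (hH : IsFlat H) {U : Cᵒᵖ} (sZ : Finset (Z.val.obj U))
    (T : Finset (Z.val.obj U →₀ A.obj.obj U))
    (hT : ∀ b ∈ T, ap h (Finsupp.linearCombination (A.obj.obj U) id b) = 0) :
    Loc J U fun V f ↦ ∃ (n : ℕ)
      (γ : (Z.val.obj U →₀ A.obj.obj U) →ₛₗ[(A.obj.map f).hom] (Fin n → A.obj.obj V))
      (ζ : Fin n → Z.val.obj V) (β : Z.val.obj U → B.val.obj V), (∀ b ∈ T, γ b = 0) ∧
        ∀ z ∈ sZ, rs Z f z = ap j (β z) + ∑ l, γ (Finsupp.single z 1) l • ζ l := by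
  refine (IsFlat.loc_lift hH h sZ (fun z : Z.val.obj U ↦ ap h z) T (fun r hr ↦ ?_)).bind
    fun V f ⟨n, γ, ζ, hγT, hγ⟩ ↦ ?_
  · rw [← hT r hr, ap_eq, Finsupp.apply_linearCombination]
    rfl
  have hβ : Loc J V fun W g ↦ ∀ z ∈ sZ, ∃ β : B.val.obj W,
      ap j β = rs Z g (rs Z f z - ∑ l, γ (Finsupp.single z 1) l • ζ l) := by
    refine Loc.finset_forall sZ fun z hz ↦ loc_exists_of_exact hex _ ?_
    refine (ap_sub h _ _).trans ?_
    rw [ap_sum_smul, sub_eq_zero, ap_rs]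
    exact hγ z hz
  refine hβ.mono fun W g hβ ↦ ?_
  choose! β hβ using hβ
  have : RingHomCompTriple (A.obj.map f).hom (A.obj.map g).hom (A.obj.map (f ≫ g)).hom :=
    ⟨map_comp_hom f g⟩
  refine ⟨n, (resVec g n).comp γ, fun l ↦ rs Z g (ζ l), β, fun b hb ↦ ?_, fun z hz ↦ ?_⟩
  · rw [LinearMap.comp_apply, hγT b hb, map_zero]
  · rw [hβ z hz, rs_sub, rs_sum_smul, rs_comp, LinearMap.comp_apply, sub_add_cancel]

set_option maxHeartbeats 1000000 in
/-- Sections of `P` and `Z` can locally be expressed by sections `θ` of `P` and `ζ` of `Z` whose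
images in the flat sheaves `B` and `H` are independent. -/
lemma loc_coordinates (hu : p ≫ j = u) [Epi p] [Mono j] [Epi h] (w : j ≫ h = 0)
    (hex : (ShortComplex.mk j h w).Exact) (hB : IsFlat B) (hH : IsFlat H) {U : Cᵒᵖ}
    (sP : Finset (P.val.obj U)) (sZ : Finset (Z.val.obj U))
    (T : Finset ((P.val.obj U →₀ A.obj.obj U) × (Z.val.obj U →₀ A.obj.obj U)))
    (hT : ∀ e ∈ T, ap u (Finsupp.linearCombination (A.obj.obj U) id e.1) +
      Finsupp.linearCombination (A.obj.obj U) id e.2 = 0) (hTs : ∀ e ∈ T, e.2.support ⊆ sZ)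
    (T' : Finset (P.val.obj U →₀ A.obj.obj U))
    (hT' : ∀ a ∈ T', Finsupp.linearCombination (A.obj.obj U) id a = 0) :
    Loc J U fun V f ↦ ∃ (m n : ℕ)
      (δP : (P.val.obj U →₀ A.obj.obj U) →ₛₗ[(A.obj.map f).hom] (Fin m → A.obj.obj V))
      (δZ : (Z.val.obj U →₀ A.obj.obj U) →ₛₗ[(A.obj.map f).hom] (Fin m → A.obj.obj V))
      (γ : (Z.val.obj U →₀ A.obj.obj U) →ₛₗ[(A.obj.map f).hom] (Fin n → A.obj.obj V))
      (θ : Fin m → P.val.obj V) (ζ : Fin n → Z.val.obj V),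
      (∀ x ∈ sP, ap u (rs P f x) = ∑ l, δP (Finsupp.single x 1) l • ap u (θ l)) ∧
      (∀ z ∈ sZ, rs Z f z = ∑ l, δZ (Finsupp.single z 1) l • ap u (θ l) +
        ∑ l, γ (Finsupp.single z 1) l • ζ l) ∧
      (∀ e ∈ T, δP e.1 + δZ e.2 = 0 ∧ γ e.2 = 0) ∧ ∀ a ∈ T', δP a = 0 := by
  classical
  have hju {X : Cᵒᵖ} (x : P.val.obj X) : ap u x = ap j (ap p x) := by subst hu; rfl
  have hhu {X : Cᵒᵖ} (x : P.val.obj X) : ap h (ap u x) = 0 := by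
    rw [hju, ← ap_comp, w]; rfl
  refine (loc_coordinates_quotient w hex hH sZ (T.image Prod.snd) fun r hr ↦ ?_).bind
    fun V f ⟨n, γ, ζ, β, hγT, hγ⟩ ↦ ?_
  · obtain ⟨e, he, rfl⟩ := Finset.mem_image.1 hr
    have h1 := congr_arg (ap h) (hT e he)
    rwa [ap_add, hhu, zero_add, ap_zero] at h1
  replace hγT (e) (he : e ∈ T) : γ e.2 = 0 := hγT _ (Finset.mem_image_of_mem _ he)
  generalize hσ : (A.obj.map f).hom = σ at γ
  let ιP : (P.val.obj U →₀ A.obj.obj U) →ₛₗ[σ] (P.val.obj U ⊕ Z.val.obj U →₀ A.obj.obj V) :=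
    semiComb σ fun x ↦ Finsupp.single (Sum.inl x) 1
  let ιZ : (Z.val.obj U →₀ A.obj.obj U) →ₛₗ[σ] (P.val.obj U ⊕ Z.val.obj U →₀ A.obj.obj V) :=
    semiComb σ fun z ↦ Finsupp.single (Sum.inr z) 1
  have hιP (x) : ιP (Finsupp.single x 1) = Finsupp.single (Sum.inl x) 1 := by simp [ιP]
  have hιZ (x) : ιZ (Finsupp.single x 1) = Finsupp.single (Sum.inr x) 1 := by simp [ιZ]
  clear_value ιP ιZ
  subst hσ
  let xI : P.val.obj U ⊕ Z.val.obj U → B.val.obj V := Sum.elim (fun x ↦ rs B f (ap p x)) β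
  let Λ : (P.val.obj U ⊕ Z.val.obj U →₀ A.obj.obj V) →ₗ[A.obj.obj V] B.val.obj V :=
    Finsupp.linearCombination _ xI
  have hΛ (y) : Λ (Finsupp.single y 1) = xI y :=
    (Finsupp.linearCombination_single _ _ _).trans (one_smul _ _)
  have hΛP (a : P.val.obj U →₀ A.obj.obj U) :
      Λ (ιP a) = rs B f (ap p (Finsupp.linearCombination _ id a)) := by
    refine semilinear_congr (f := Λ.comp ιP)
      (g := (res B.val f).comp (appₗ p.val U ∘ₗ Finsupp.linearCombination _ id)) fun x _ ↦ ?_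
    simp only [LinearMap.comp_apply, hιP, hΛ, Finsupp.linearCombination_single, one_smul, id]
    rfl
  let ζc : (Fin n → A.obj.obj V) →ₗ[A.obj.obj V] Z.val.obj V := Fintype.linearCombination _ ζ
  have hζc (a) : ζc a = ∑ l, a l • ζ l := Fintype.linearCombination_apply _ _ _
  have hΛZ {b : Z.val.obj U →₀ A.obj.obj U} (hb : b.support ⊆ sZ) : ap j (Λ (ιZ b)) =
      rs Z f (Finsupp.linearCombination _ id b) - ζc (γ b) := by
    refine semilinear_congr (f := (appₗ j.val V ∘ₗ Λ).comp ιZ)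
      (g := (res Z.val f).comp (Finsupp.linearCombination _ id) - ζc.comp γ) fun z hz ↦ ?_
    simp only [LinearMap.comp_apply, LinearMap.sub_apply, hιZ, hΛ, Finsupp.linearCombination_single,
      one_smul, id, hζc]
    exact eq_sub_of_add_eq (hγ z (hb hz)).symm
  obtain ⟨T₂, hT₂⟩ : ∃ T₂ : Finset (P.val.obj U ⊕ Z.val.obj U →₀ A.obj.obj V), ∀ r, r ∈ T₂ ↔
      (∃ e ∈ T, ιP e.1 + ιZ e.2 = r) ∨ ∃ a ∈ T', ιP a = r :=
    ⟨T.image (fun e ↦ ιP e.1 + ιZ e.2) ∪ T'.image ιP, fun r ↦ by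
      rw [Finset.mem_union, Finset.mem_image, Finset.mem_image]⟩
  have hrel : ∀ r ∈ T₂, Λ r = 0 := by
    intro r hr
    obtain ⟨e, he, rfl⟩ | ⟨a, ha, rfl⟩ := (hT₂ r).1 hr
    · apply ap_injective j V
      rw [map_add, ap_add, hΛP, hΛZ (hTs e he), hγT e he, map_zero, sub_zero, ap_rs, ← hju,
        ← rs_add, hT e he, rs_zero, ap_zero]
    · rw [hΛP, hT' a ha, ap_zero, rs_zero]
  -- express the images of `sP` in `B` and the `B`-components of `sZ` simultaneously
  refine (IsFlat.loc_lift hB p (sP.disjSum sZ) xI T₂ hrel).mono fun X k ⟨m, δ, θ, hδT, hδ⟩ ↦ ?_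
  have : RingHomCompTriple (A.obj.map f).hom (A.obj.map k).hom (A.obj.map (f ≫ k)).hom :=
    ⟨map_comp_hom f k⟩
  refine ⟨m, n, δ.comp ιP, δ.comp ιZ, (resVec k n).comp γ, θ, fun l ↦ rs Z k (ζ l),
    fun x hx ↦ ?_, fun z hz ↦ ?_, fun e he ↦ ⟨?_, ?_⟩, fun a ha ↦ ?_⟩
  · have h1 := hδ (Sum.inl x) (Finset.inl_mem_disjSum.2 hx)
    rw [LinearMap.comp_apply, hιP, hju, ap_rs, rs_comp]
    refine (congr_arg (ap j) h1).trans ?_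
    rw [ap_sum_smul]
    simp only [hju]
  · have h1 := hδ (Sum.inr z) (Finset.inr_mem_disjSum.2 hz)
    rw [LinearMap.comp_apply, hιZ, LinearMap.comp_apply, rs_comp, hγ z hz, rs_add, rs_sum_smul,
      ← ap_rs]
    congr 1
    refine (congr_arg (ap j) h1).trans ?_
    rw [ap_sum_smul]
    simp only [hju]
  · rw [LinearMap.comp_apply, LinearMap.comp_apply, ← map_add]
    exact hδT _ ((hT₂ _).2 (Or.inl ⟨e, he, rfl⟩))
  · rw [LinearMap.comp_apply, hγT e he, map_zero]
  · exact hδT _ ((hT₂ _).2 (Or.inr ⟨a, ha, rfl⟩))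

set_option maxHeartbeats 1000000 in
/-- Let `u : P ⟶ Z` be the composition of an epimorphism `p : P ⟶ B` and a monomorphism `j : B ⟶ Z`
with cokernel `h : Z ⟶ H`, where `B` and `H` are flat. Then the cycles of the Koszul complex of `u`
are locally generated by the boundaries and by the elements of `Λⁱ(Z) ⊗ Γ^{q-i}(ker u)`. -/
theorem loc_kosGood (hu : p ≫ j = u) [Epi p] [Mono j] [Epi h] (w : j ≫ h = 0)
    (hex : (ShortComplex.mk j h w).Exact) (hB : IsFlat B) (hH : IsFlat H) {q i : ℕ} {U : Cᵒᵖ}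
    (c : KosX (A.obj.obj U) (Z.val.obj U) (P.val.obj U) q i)
    (hc : kosD (appₗ u.val U) q i c = 0) :
    Loc J U fun V f ↦ kosMap (res Z.val f) (res P.val f) q i c ∈
      kosBd (appₗ u.val V) q i ⊔ kosPure (appₗ u.val V) q i := by
  classical
  -- lift the cycle to a Koszul complex of free modules
  let eP : (P.val.obj U →₀ A.obj.obj U) →ₗ[A.obj.obj U] P.val.obj U :=
    Finsupp.linearCombination _ id
  let eZ : (Z.val.obj U →₀ A.obj.obj U) →ₗ[A.obj.obj U] Z.val.obj U :=
    Finsupp.linearCombination _ id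
  have heP : Function.Surjective eP := Finsupp.linearCombination_id_surjective _ _
  have heZ : Function.Surjective eZ := Finsupp.linearCombination_id_surjective _ _
  have hsP (x) : eP (Finsupp.single x 1) = x :=
    (Finsupp.linearCombination_single _ _ _).trans (one_smul _ _)
  have hsZ (x) : eZ (Finsupp.single x 1) = x :=
    (Finsupp.linearCombination_single _ _ _).trans (one_smul _ _)
  let eF : (P.val.obj U →₀ A.obj.obj U) × (Z.val.obj U →₀ A.obj.obj U) →ₗ[A.obj.obj U]
    Z.val.obj U := (appₗ u.val U ∘ₗ eP).coprod eZ
  have hF (e) : eF e = ap u (eP e.1) + eZ e.2 := rfl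
  have heF : Function.Surjective eF := fun z ↦ by
    obtain ⟨b, rfl⟩ := heZ z
    exact ⟨(0, b), by rw [hF, map_zero, ap_zero, zero_add]⟩
  obtain ⟨c, rfl⟩ := kosMap_surjective eF heF eP heP q i c
  have hdc : kosMap eF eP q (i + 1) (kosD (LinearMap.inl _ _ _) q i c) = 0 := by
    rw [← hc, kosD_kosMap eF eP (LinearMap.inl _ _ _) (appₗ u.val U) fun x ↦ by
      rw [hF, LinearMap.inl_apply, map_zero, add_zero]; rfl]
  obtain ⟨T, T', hT, hT', hkill⟩ := finitelyKilled_of_kosMap_eq_zero eF heF eP heP hdc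
  obtain ⟨T₁, T₁', hcongr⟩ := exists_finset_kosMap_congr c
  let sP : Finset (P.val.obj U) := T₁.biUnion (fun e ↦ e.1.support) ∪
    (T' ∪ T₁').biUnion Finsupp.support
  let sZ : Finset (Z.val.obj U) := (T ∪ T₁).biUnion (fun e ↦ e.2.support)
  have hsP' {a} (ha : a ∈ T' ∪ T₁') : a.support ⊆ sP :=
    (Finset.subset_biUnion_of_mem (fun e : P.val.obj U →₀ A.obj.obj U ↦ e.support) ha).trans
      Finset.subset_union_right
  have hsZ' {e} (he : e ∈ T ∪ T₁) : e.2.support ⊆ sZ :=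
    Finset.subset_biUnion_of_mem (fun e : (P.val.obj U →₀ A.obj.obj U) × _ ↦ e.2.support) he
  refine (loc_coordinates hu w hex hB hH sP sZ T hT (fun e he ↦ hsZ' (Finset.mem_union_left _ he))
    T' hT').mono fun V f ⟨m, n, δP, δZ, γ, θ, ζ, hP, hZ, hδT, hδT'⟩ ↦ ?_
  rw [← kosMap_comp (RingHom.comp_id _) eF (res Z.val f) ((res Z.val f).comp eF) (fun _ ↦ rfl) eP
    (res P.val f) ((res P.val f).comp eP) (fun _ ↦ rfl)]
  refine kosMap_mem_sup_of_coordinates c (appₗ u.val V) θ ζ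
    ((res P.val f).comp eP) ((res Z.val f).comp eZ) _ (fun e ↦ ?_) δP δZ γ sP sZ (fun x hx ↦ ?_)
    (fun z hz ↦ ?_) T T' hδT (fun a ha ↦ ⟨hδT' a ha, ?_⟩)
    (fun a ha ↦ hsP' (Finset.mem_union_left _ ha)) (fun g' f' ↦ hkill g' f') T₁ T₁'
    (fun e he ↦ ⟨?_, ?_⟩) (fun a ha ↦ hsP' (Finset.mem_union_right _ ha))
    (fun g g' f f' ↦ hcongr g g' f f')
  · rw [LinearMap.comp_apply, hF, map_add]
    exact congr_arg (· + _) (appₗ_res u.val f _).symm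
  · rw [LinearMap.comp_apply, hsP]
    exact hP x hx
  · rw [LinearMap.comp_apply, hsZ]
    exact hZ z hz
  · rw [LinearMap.comp_apply, hT' a ha, map_zero]
  · exact (Finset.subset_biUnion_of_mem (fun e : (P.val.obj U →₀ A.obj.obj U) ×
      (Z.val.obj U →₀ A.obj.obj U) ↦ e.1.support) he).trans Finset.subset_union_left
  · exact hsZ' (Finset.mem_union_right T he)

end LocalCycles

/-! ### Double complexes with contracted rows -/

section DoubleComplex

variable {𝒜 : Type*} [Category* 𝒜] [Abelian 𝒜]

/-- A first quadrant double complex `X b n` with anticommuting differentials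
`v : X b n ⟶ X (b + 1) n` and `d : X b n ⟶ X b (n + 1)`. The columns `X • n` are augmented by
`η : C n ⟶ X 0 n` and exact, while the rows `X b •` are augmented by `ε : K b ⟶ X b 0` and carry
a contracting homotopy given by `h` and `r`. -/
structure ResolvedDouble (C K : CochainComplex 𝒜 ℕ) where
  /-- the terms -/
  X : ℕ → ℕ → 𝒜
  /-- the differential of the columns -/
  v (b n : ℕ) : X b n ⟶ X (b + 1) n
  /-- the differential of the rows -/
  d (b n : ℕ) : X b n ⟶ X b (n + 1)
  /-- the contracting homotopy of the rows -/
  h (b n : ℕ) : X b (n + 1) ⟶ X b n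
  /-- the contracting homotopy of the augmented rows in degree zero -/
  r (b : ℕ) : X b 0 ⟶ K.X b
  /-- the augmentation of the rows -/
  ε (b : ℕ) : K.X b ⟶ X b 0
  /-- the augmentation of the columns -/
  η (n : ℕ) : C.X n ⟶ X 0 n
  v_d (b n : ℕ) : v b n ≫ d (b + 1) n = -(d b n ≫ v b (n + 1))
  v_v (b n : ℕ) : v b n ≫ v (b + 1) n = 0
  d_d (b n : ℕ) : d b n ≫ d b (n + 1) = 0
  C_η (n : ℕ) : C.d n (n + 1) ≫ η (n + 1) = η n ≫ d 0 n
  η_v (n : ℕ) : η n ≫ v 0 n = 0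
  mono_η (n : ℕ) : Mono (η n)
  exact_zero (n : ℕ) : (ShortComplex.mk (η n) (v 0 n) (η_v n)).Exact
  exact_succ (b n : ℕ) : (ShortComplex.mk (v b n) (v (b + 1) n) (v_v b n)).Exact
  h_d (b n : ℕ) : h b n ≫ d b n + d b (n + 1) ≫ h b (n + 1) = 𝟙 _
  d_h (b : ℕ) : d b 0 ≫ h b 0 = 𝟙 _ - r b ≫ ε b
  ε_r (b : ℕ) : ε b ≫ r b = 𝟙 _
  ε_d (b : ℕ) : ε b ≫ d b 0 = 0
  ε_v (b : ℕ) : ε b ≫ v b 0 = K.d b (b + 1) ≫ ε (b + 1)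

namespace ResolvedDouble

variable {C K : CochainComplex 𝒜 ℕ} (S : ResolvedDouble C K)

/-- The projection of the total complex onto `K` given by the zigzags `r (v h)ⁿ`, up to sign. -/
noncomputable def ρ : (n b m : ℕ) → b + n = m → (S.X b n ⟶ K.X m)
  | 0, b, _, hm => S.r b ≫ eqToHom (by subst hm; rfl)
  | n + 1, b, m, hm => -(S.h b n ≫ S.v b n ≫ ρ n (b + 1) m (by lia))

lemma ρ_zero (b : ℕ) : S.ρ 0 b b rfl = S.r b := by simp [ρ]

lemma d_ρ (n : ℕ) : ∀ (b m : ℕ) (hm : b + n = m),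
    S.d b n ≫ S.ρ (n + 1) b (m + 1) (by lia) =
      S.ρ n b m hm ≫ K.d m (m + 1) - S.v b n ≫ S.ρ n (b + 1) (m + 1) (by lia) := by
  induction n with
  | zero =>
    intro b m hm
    obtain rfl : b = m := by lia
    have := reassoc_of% S.d_h b
    have h2 := reassoc_of% S.ε_v b
    simp only [ρ, Preadditive.comp_neg, this, Preadditive.sub_comp, Category.id_comp,
      Category.assoc, h2]
    have h3 := S.ε_r (b + 1)
    simp [h3]
  | succ n ih =>
    intro b m hm
    have h1 : S.d b (n + 1) ≫ S.h b (n + 1) = 𝟙 _ - S.h b n ≫ S.d b n :=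
      eq_sub_of_add_eq' (S.h_d b n)
    have h2 : S.d b n ≫ S.v b (n + 1) = -(S.v b n ≫ S.d (b + 1) n) := by rw [S.v_d, neg_neg]
    have h3 := ih (b + 1) m (by lia)
    have h4 := S.v_v b n
    rw [ρ.eq_2, ρ.eq_2 S _ m n, Preadditive.comp_neg, reassoc_of% h1,
      Preadditive.sub_comp, Category.id_comp, Category.assoc, reassoc_of% h2,
      Preadditive.neg_comp, Category.assoc, h3]
    simp only [Preadditive.comp_sub, Preadditive.comp_neg, Preadditive.neg_comp, Category.assoc,
      reassoc_of% h4, zero_comp, comp_zero]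
    abel

/-- The comparison morphism of the two augmentations. -/
noncomputable def π : C ⟶ K where
  f n := S.η n ≫ S.ρ n 0 n (zero_add n)
  comm' i j hij := by
    obtain rfl : i + 1 = j := hij
    have h1 := S.C_η i
    have h2 := S.d_ρ i 0 i (zero_add i)
    have h3 := S.η_v i
    rw [reassoc_of% h1, h2, Preadditive.comp_sub, reassoc_of% h3, zero_comp, sub_zero,
      Category.assoc]

/-- A cocycle of the total complex that lies in one bidegree is cohomologous to one in the image
of `C`. -/
lemma exists_of_cocycle (b : ℕ) : ∀ (n m : ℕ) (hm : b + n = m) {T : 𝒜} (x : T ⟶ S.X b n)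
    (_ : x ≫ S.v b n = 0) (_ : x ≫ S.d b n = 0),
    ∃ (T' : 𝒜) (p : T' ⟶ T) (_ : Epi p) (t : T' ⟶ C.X m) (k : T' ⟶ K.X (m - 1)),
      t ≫ C.d m (m + 1) = 0 ∧ p ≫ x ≫ S.ρ n b m hm = t ≫ S.π.f m + k ≫ K.d (m - 1) m := by
  induction b with
  | zero =>
    intro n m hm T x hv hd
    obtain rfl : n = m := by lia
    obtain ⟨T', p, hp, t, ht⟩ := (S.exact_zero n).exact_up_to_refinements x hv
    dsimp at t ht
    refine ⟨T', p, hp, t, 0, ?_, ?_⟩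
    · have := S.mono_η (n + 1)
      rw [← cancel_mono (S.η (n + 1)), Category.assoc, S.C_η, ← reassoc_of% ht, hd]
      simp
    · simp [π, reassoc_of% ht]
  | succ b ih =>
    intro n m hm T x hv hd
    obtain rfl : m = b + n + 1 := by lia
    obtain ⟨T₁, p₁, hp₁, w, hw⟩ := (S.exact_succ b n).exact_up_to_refinements x hv
    dsimp at w hw
    have hw' : w ≫ S.d b n ≫ S.v b (n + 1) = 0 := by
      have := S.v_d b n
      rw [← neg_eq_zero, ← Preadditive.comp_neg, ← this, ← reassoc_of% hw, hd, comp_zero]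
    obtain ⟨T₂, p₂, hp₂, t, k, ht, hk⟩ := ih (n + 1) (b + n + 1) (by lia) (w ≫ S.d b n)
      (by rw [Category.assoc, hw']) (by rw [Category.assoc, S.d_d, comp_zero])
    let k' : T₂ ⟶ K.X (b + n) := k
    refine ⟨T₂, p₂ ≫ p₁, epi_comp _ _, -t, p₂ ≫ w ≫ S.ρ n b (b + n) rfl - k', ?_, ?_⟩
    · simp [ht]
    · have h1 := S.d_ρ n b (b + n) rfl
      rw [Category.assoc, h1] at hk
      simp only [Preadditive.comp_sub, Preadditive.neg_comp, Category.assoc] at hk ⊢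
      change _ = -(t ≫ _) + (p₂ ≫ w ≫ S.ρ n b (b + n) rfl - k') ≫ K.d (b + n) (b + n + 1)
      change _ = t ≫ _ + k' ≫ K.d (b + n) (b + n + 1) at hk
      simp only [Preadditive.sub_comp, Category.assoc]
      rw [reassoc_of% hw, sub_eq_iff_eq_add.1 hk]
      abel

/-- A cocycle of the total complex that lies in one bidegree and becomes a coboundary in `K` is
the coboundary of an element of one bidegree. -/
lemma exists_of_coboundary (n : ℕ) : ∀ (b m : ℕ) (hm : b + n + 1 = m) {T : 𝒜}
    (x : T ⟶ S.X b (n + 1)) (_ : x ≫ S.v b (n + 1) = 0) (_ : x ≫ S.d b (n + 1) = 0)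
    (k : T ⟶ K.X (b + n)) (_ : x ≫ S.ρ (n + 1) b m hm = k ≫ K.d (b + n) m),
    ∃ (T' : 𝒜) (p : T' ⟶ T) (_ : Epi p) (w : T' ⟶ S.X b n),
      w ≫ S.v b n = 0 ∧ p ≫ x = w ≫ S.d b n := by
  induction n with
  | zero =>
    intro b m hm T x hv hd k hk
    obtain rfl : m = b + 1 := by lia
    have hs : x = (x ≫ S.h b 0) ≫ S.d b 0 := by
      have := x ≫= S.h_d b 0
      rw [Preadditive.comp_add, reassoc_of% hd] at this
      simpa using this.symm
    have hx' : (x ≫ S.h b 0 ≫ S.v b 0) ≫ S.d (b + 1) 0 = 0 := by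
      rw [Category.assoc, Category.assoc, S.v_d]
      simp only [Preadditive.comp_neg, neg_eq_zero]
      simpa [← Category.assoc, ← hs] using hv
    have hx2 : x ≫ S.h b 0 ≫ S.v b 0 = -(k ≫ S.ε b ≫ S.v b 0) := by
      have h1 := (x ≫ S.h b 0 ≫ S.v b 0) ≫= S.d_h (b + 1)
      rw [← Category.assoc, hx', zero_comp, Preadditive.comp_sub, Category.comp_id,
        ← Category.assoc _ (S.r (b + 1))] at h1
      have h2 : (x ≫ S.h b 0 ≫ S.v b 0) ≫ S.r (b + 1) = -(k ≫ K.d b (b + 1)) := by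
        simp only [ρ, Preadditive.comp_neg] at hk
        have h3 := neg_eq_iff_eq_neg.1 hk
        simpa using h3
      rw [sub_eq_zero.1 h1.symm, h2, S.ε_v]
      simp
    refine ⟨T, 𝟙 T, inferInstance, x ≫ S.h b 0 + k ≫ S.ε b, ?_, ?_⟩
    · rw [Preadditive.add_comp, Category.assoc, hx2, Category.assoc, neg_add_cancel]
    · rw [Preadditive.add_comp, ← hs, Category.assoc, S.ε_d]
      simp
  | succ n ih =>
    intro b m hm T x hv hd k hk
    have hs : x = (x ≫ S.h b (n + 1)) ≫ S.d b (n + 1) := by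
      have := x ≫= S.h_d b (n + 1)
      rw [Preadditive.comp_add, reassoc_of% hd] at this
      simpa using this.symm
    have hx' : (x ≫ S.h b (n + 1) ≫ S.v b (n + 1)) ≫ S.d (b + 1) (n + 1) = 0 := by
      rw [Category.assoc, Category.assoc, S.v_d]
      simp only [Preadditive.comp_neg, neg_eq_zero]
      simpa [← Category.assoc, ← hs] using hv
    obtain ⟨T₁, p₁, hp₁, w', hw', hx₁⟩ := ih (b + 1) m (by lia)
      (x ≫ S.h b (n + 1) ≫ S.v b (n + 1))
      (by simp only [Category.assoc, S.v_v, comp_zero]) hx'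
      (-(k ≫ eqToHom (by congr 1; lia))) (by
        rw [ρ, Preadditive.comp_neg] at hk
        have h3 := neg_eq_iff_eq_neg.1 hk
        rw [Category.assoc, Category.assoc, h3]
        have : ∀ (a a' : ℕ) (e : a = a') (k : T ⟶ K.X a),
            -(k ≫ K.d a m) = (-(k ≫ eqToHom (by rw [e]))) ≫ K.d a' m := by
          rintro a _ rfl k
          simp
        exact this _ _ (by lia) k)
    obtain ⟨T₂, p₂, hp₂, y, hy⟩ := (S.exact_succ b n).exact_up_to_refinements w' hw'
    dsimp at y hy
    refine ⟨T₂, p₂ ≫ p₁, epi_comp _ _, (p₂ ≫ p₁) ≫ x ≫ S.h b (n + 1) + y ≫ S.d b n, ?_, ?_⟩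
    · have h1 := S.v_d b n
      rw [Preadditive.add_comp, Category.assoc, Category.assoc, Category.assoc, Category.assoc,
        hx₁, reassoc_of% hy, h1, Preadditive.comp_neg, neg_add_cancel]
    · rw [Preadditive.add_comp, Category.assoc y, S.d_d, comp_zero, add_zero]
      simpa only [Category.assoc] using (p₂ ≫ p₁) ≫= hs

/-- A double complex with contracted rows and exact columns yields a quasi-isomorphism between
the augmentations of its columns and of its rows. -/
theorem quasiIso_π : QuasiIso S.π := by
  refine ⟨fun m ↦ ?_⟩
  rw [quasiIsoAt_iff_isIso_homologyMap]
  have hnext : (ComplexShape.up ℕ).next m = m + 1 := by simp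
  have hprev : (ComplexShape.up ℕ).prev m = m - 1 := by cases m <;> simp
  have hmono : Mono (HomologicalComplex.homologyMap S.π m) := by
    rw [HomologicalComplex.mono_homologyMap_iff_up_to_refinements S.π (m - 1) m (m + 1)
      hprev hnext]
    intro T t ht k hk
    have := S.mono_η m
    have hv : (t ≫ S.η m) ≫ S.v 0 m = 0 := by rw [Category.assoc, S.η_v, comp_zero]
    have hd : (t ≫ S.η m) ≫ S.d 0 m = 0 := by
      rw [Category.assoc, ← S.C_η, reassoc_of% ht, zero_comp]
    have hρ : (t ≫ S.η m) ≫ S.ρ m 0 m (zero_add m) = k ≫ K.d (m - 1) m := by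
      simpa [π] using hk
    cases m with
    | zero =>
      refine ⟨T, 𝟙 T, inferInstance, 0, ?_⟩
      have h1 := (t ≫ S.η 0) ≫= S.d_h 0
      rw [← Category.assoc, hd, zero_comp, Preadditive.comp_sub, Category.comp_id,
        ← Category.assoc _ (S.r 0)] at h1
      rw [S.ρ_zero, K.shape _ _ (by simp), comp_zero] at hρ
      rw [hρ, zero_comp, sub_zero] at h1
      rw [← cancel_mono (S.η 0), Category.id_comp, ← h1]
      simp
    | succ n =>
      obtain ⟨T₁, p₁, hp₁, w, hw, hx⟩ := S.exists_of_coboundary n 0 (n + 1) (by lia) (t ≫ S.η _)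
        hv hd (k ≫ eqToHom (by simp)) (by
          rw [hρ]
          have : ∀ (a a' : ℕ) (e : a = a') (k : T ⟶ K.X a),
            k ≫ K.d a (n + 1) = (k ≫ eqToHom (by rw [e])) ≫ K.d a' (n + 1) := by
              rintro a _ rfl k
              simp
          exact this _ _ (by simp) k)
      obtain ⟨T₂, p₂, hp₂, t', ht'⟩ := (S.exact_zero n).exact_up_to_refinements w hw
      dsimp at t' ht'
      refine ⟨T₂, p₂ ≫ p₁, epi_comp _ _, t', ?_⟩
      have h1 := S.C_η n
      rw [← cancel_mono (S.η (n + 1)), Category.assoc, Category.assoc, hx, reassoc_of% ht']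
      simp [h1]
  have hepi : Epi (HomologicalComplex.homologyMap S.π m) := by
    rw [HomologicalComplex.epi_homologyMap_iff_up_to_refinements S.π (m - 1) m (m + 1)
      hprev hnext]
    intro T y hy
    obtain ⟨T', p, hp, t, k, ht, hk⟩ := S.exists_of_cocycle m 0 m rfl (y ≫ S.ε m)
      (by rw [Category.assoc, S.ε_v, reassoc_of% hy, zero_comp])
      (by rw [Category.assoc, S.ε_d, comp_zero])
    refine ⟨T', p, hp, t, ht, k, ?_⟩
    rw [← hk, S.ρ_zero, Category.assoc, S.ε_r, Category.comp_id]
  exact isIso_of_mono_of_epi _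

end ResolvedDouble

end DoubleComplex

/-! ### The cosimplicial object of a two-term complex -/

section DoldKan

open SimplexCategory SimplicialObject AlgebraicTopology.DoldKan Simplicial

/-- The monotone map `⦋n + 1⦌ ⟶ ⦋1⦌` sending only the last element to `1`. -/
def lastStep (n : ℕ) : ⦋n + 1⦌ ⟶ ⦋1⦌ :=
  SimplexCategory.mkHom ⟨fun i ↦ if i = Fin.last (n + 1) then 1 else 0, fun i j hij ↦ by
    dsimp only
    split_ifs with h1 h2
    · exact le_rfl
    · exact absurd (le_antisymm (Fin.le_last j) (h1 ▸ hij)) h2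
    · exact Fin.zero_le _
    · exact le_rfl⟩

lemma lastStep_apply (n : ℕ) (i : Fin (n + 2)) :
    (lastStep n).toOrderHom i = if i = Fin.last (n + 1) then 1 else 0 := rfl

instance (n : ℕ) : Epi (lastStep n) := by
  rw [SimplexCategory.epi_iff_surjective]
  intro i
  refine ⟨if i = 1 then Fin.last (n + 1) else 0, ?_⟩
  have h : (0 : Fin (n + 2)) ≠ Fin.last (n + 1) := by simp [Fin.ext_iff]
  change (lastStep n).toOrderHom _ = i
  rw [lastStep_apply]
  match i with
  | 0 => simp [h]
  | 1 => simp

lemma lastStep_zero : lastStep 0 = 𝟙 _ := by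
  ext i
  change ((lastStep 0).toOrderHom i : ℕ) = i
  rw [lastStep_apply]
  match i with
  | 0 => rfl
  | 1 => rfl

lemma δ_lastStep (n : ℕ) (i : Fin (n + 2)) :
    SimplexCategory.δ i.castSucc ≫ lastStep (n + 1) = lastStep n := by
  ext k
  change ((lastStep (n + 1)).toOrderHom (Fin.succAbove i.castSucc k) : ℕ) =
    (lastStep n).toOrderHom k
  rw [lastStep_apply, lastStep_apply]
  congr 2
  refine propext ⟨fun h ↦ ?_, fun h ↦ ?_⟩
  · simp only [Fin.ext_iff, Fin.succAbove, Fin.lt_def] at h ⊢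
    split_ifs at h <;> simp at h ⊢ <;> lia
  · subst h
    exact Fin.succAbove_of_lt_succ _ _ (by simp [Fin.lt_def]; lia)

/-- A map `⦋n + 1⦌ ⟶ ⦋k⦌` that agrees on the last two elements factors through the last
degeneracy. -/
lemma σ_δ_comp {n k : ℕ} (e : ⦋n + 1⦌ ⟶ ⦋k⦌)
    (he : e.toOrderHom (Fin.last n).castSucc = e.toOrderHom (Fin.last (n + 1))) :
    SimplexCategory.σ (Fin.last n) ≫ SimplexCategory.δ (Fin.last (n + 1)) ≫ e = e := by
  ext i
  change (e.toOrderHom (Fin.succAbove (Fin.last (n + 1)) (Fin.predAbove (Fin.last n) i)) : ℕ) =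
    e.toOrderHom i
  induction i using Fin.lastCases with
  | last => simp [he]
  | cast i => simp

/-- There is only one monotone map `⦋n + 1⦌ ⟶ ⦋1⦌` that separates the last two elements. -/
lemma eq_lastStep {n : ℕ} (e : ⦋n + 1⦌ ⟶ ⦋1⦌)
    (he : e.toOrderHom (Fin.last n).castSucc ≠ e.toOrderHom (Fin.last (n + 1))) :
    e = lastStep n := by
  have h1 : e.toOrderHom (Fin.last n).castSucc = 0 ∧ e.toOrderHom (Fin.last (n + 1)) = 1 := by
    have := e.toOrderHom.monotone (Fin.le_last (Fin.last n).castSucc)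
    revert he this
    generalize e.toOrderHom (Fin.last n).castSucc = a
    generalize e.toOrderHom (Fin.last (n + 1)) = b
    revert a b
    decide
  ext i
  rw [lastStep_apply]
  induction i using Fin.lastCases with
  | last => rw [h1.2, if_pos rfl]
  | cast i =>
    rw [if_neg (Fin.castSucc_lt_last i).ne]
    have := e.toOrderHom.monotone (show i.castSucc ≤ (Fin.last n).castSucc from Fin.le_last i)
    rw [h1.1] at this
    rw [le_antisymm this (Fin.zero_le _)]

lemma δ_last_lastStep (n : ℕ) :
    SimplexCategory.δ (Fin.last (n + 1)) ≫ lastStep n =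
      SimplexCategory.mkHom (n := n) (m := 0) ⟨fun _ ↦ 0, fun _ _ _ ↦ le_rfl⟩ ≫
        SimplexCategory.δ 1 := by
  ext k
  change ((lastStep n).toOrderHom (Fin.succAbove (Fin.last (n + 1)) k) : ℕ) = _
  rw [lastStep_apply, Fin.succAbove_last, if_neg (Fin.castSucc_lt_last k).ne]
  rfl

section Splitting

variable {𝒞 : Type*} [Category* 𝒞]
  {X : SimplicialObject 𝒞} (s : Splitting X)

lemma Splitting.ext_of_epi (s : Splitting X) {n : ℕ} {Z : 𝒞} {f g : X.obj (op ⦋n⦌) ⟶ Z}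
    (h : ∀ (k : ℕ) (e : ⦋n⦌ ⟶ ⦋k⦌) [Epi e],
      s.ι k ≫ X.map e.op ≫ f = s.ι k ≫ X.map e.op ≫ g) : f = g := by
  refine s.hom_ext' _ _ fun B ↦ ?_
  obtain ⟨⟨Δ⟩, e, he⟩ := B
  induction Δ using SimplexCategory.rec with | _ k
  have := h k e
  exact (Category.assoc _ _ _).trans (this.trans (Category.assoc _ _ _).symm)

/-- The projection of a split simplicial object onto one of its summands. -/
lemma Splitting.exists_proj [Preadditive 𝒞] {n k : ℕ} (e : ⦋n⦌ ⟶ ⦋k⦌) [Epi e] :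
    ∃ t : X.obj (op ⦋n⦌) ⟶ s.N k, s.ι k ≫ X.map e.op ≫ t = 𝟙 _ ∧
      ∀ (k' : ℕ) (e' : ⦋n⦌ ⟶ ⦋k'⦌) [Epi e'], Splitting.IndexSet.mk e' ≠ Splitting.IndexSet.mk e →
        s.ι k' ≫ X.map e'.op ≫ t = 0 := by
  classical
  refine ⟨s.desc _ fun B ↦ if h : B = Splitting.IndexSet.mk e then eqToHom (by rw [h]; rfl) else 0,
    ?_, fun k' e' _ hne ↦ ?_⟩
  · refine (Category.assoc _ _ _).symm.trans
      ((s.ι_desc _ _ (Splitting.IndexSet.mk e)).trans ?_)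
    rw [dif_pos rfl]
    rfl
  · refine (Category.assoc _ _ _).symm.trans
      ((s.ι_desc _ _ (Splitting.IndexSet.mk e')).trans ?_)
    rw [dif_neg hne]
    rfl

lemma Splitting.isIso_ι_zero [Preadditive 𝒞] : IsIso (s.ι 0) := by
  obtain ⟨t, ht, -⟩ := Splitting.exists_proj s (𝟙 ⦋0⦌)
  rw [op_id, X.map_id, Category.id_comp] at ht
  refine ⟨t, ht, Splitting.ext_of_epi s fun k e _ ↦ ?_⟩
  have hk : k = 0 := Nat.le_zero.1 (SimplexCategory.len_le_of_epi e)
  subst hk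
  obtain rfl : e = 𝟙 _ := Subsingleton.elim _ _
  rw [op_id, X.map_id, Category.id_comp, reassoc_of% ht, Category.id_comp, Category.comp_id]

lemma Splitting.lastStep_δ (n : ℕ) (i : Fin (n + 2)) :
    (s.ι 1 ≫ X.map (lastStep (n + 1)).op) ≫ X.δ i.castSucc = s.ι 1 ≫ X.map (lastStep n).op := by
  rw [Category.assoc, SimplicialObject.δ, ← X.map_comp, ← op_comp, δ_lastStep]

lemma Splitting.lastStep_δ_last [Preadditive 𝒞] (h : s.ι 1 ≫ X.δ 1 = 0) (n : ℕ) :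
    (s.ι 1 ≫ X.map (lastStep n).op) ≫ X.δ (Fin.last (n + 1)) = 0 := by
  rw [Category.assoc, SimplicialObject.δ, ← X.map_comp, ← op_comp, δ_last_lastStep, op_comp,
    X.map_comp]
  change s.ι 1 ≫ X.δ 1 ≫ _ = 0
  rw [reassoc_of% h, zero_comp]

/-- If the nondegenerate part of `X` is concentrated in degrees `0` and `1`, the only summand in
degree `n + 1` that is not in the image of the last degeneracy is the one indexed by
`lastStep n`. -/
lemma Splitting.exists_retraction [Preadditive 𝒞] (h : s.ι 1 ≫ X.δ 1 = 0)
    (hs : ∀ n, 2 ≤ n → IsZero (s.N n)) (n : ℕ) :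
    ∃ t : X.obj (op ⦋n + 1⦌) ⟶ s.N 1, (s.ι 1 ≫ X.map (lastStep n).op) ≫ t = 𝟙 _ ∧
      X.δ (Fin.last (n + 1)) ≫ X.σ (Fin.last n) + t ≫ s.ι 1 ≫ X.map (lastStep n).op = 𝟙 _ := by
  obtain ⟨t, ht, ht'⟩ := Splitting.exists_proj s (lastStep n)
  refine ⟨t, by rw [Category.assoc, ht], Splitting.ext_of_epi s fun k e he ↦ ?_⟩
  have h2 := Splitting.lastStep_δ_last s h n
  simp only [Category.assoc] at h2
  rw [Preadditive.comp_add, Preadditive.comp_add, Category.comp_id]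
  by_cases hk : 2 ≤ k
  · exact (hs k hk).eq_of_src _ _
  by_cases heq : e.toOrderHom (Fin.last n).castSucc = e.toOrderHom (Fin.last (n + 1))
  · have hne : Splitting.IndexSet.mk e ≠ Splitting.IndexSet.mk (lastStep n) := by
      intro h
      have hk1 : k = 1 := congr_arg (fun B : Splitting.IndexSet (op ⦋n + 1⦌) ↦ B.1.unop.len) h
      subst hk1
      obtain rfl : e = lastStep n := by
        exact congr_arg Subtype.val (eq_of_heq (Sigma.mk.inj_iff.1 h).2)
      rw [lastStep_apply, lastStep_apply, if_pos rfl, if_neg (Fin.castSucc_lt_last _).ne] at heq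
      exact absurd heq (by decide)
    have h3 := ht' k e hne
    have h4 := congr_arg (fun f ↦ s.ι k ≫ X.map f.op) (σ_δ_comp e heq)
    simp only [op_comp, X.map_comp, Category.assoc] at h4
    rw [reassoc_of% h3, zero_comp, add_zero]
    exact h4
  · have hk1 : k = 1 := by
      match k, e, heq, hk with
      | 0, e, heq, _ => exact absurd (Subsingleton.elim (α := Fin 1) _ _) heq
      | 1, _, _, _ => rfl
      | k + 2, _, _, hk => exact absurd (by lia) hk
    subst hk1
    obtain rfl := eq_lastStep e heq
    rw [reassoc_of% ht, reassoc_of% h2, zero_comp, zero_add]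

end Splitting

section Cosimplicial

variable {𝒟 : Type*} [Category* 𝒟] [Abelian 𝒟]

/-- The structure of the cosimplicial object `D` attached to a two-term complex `P ⟶ Q`: there
is a projection `l n : Dⁿ⁺¹ ⟶ Q` for every `n`, complementary to the last coface map
`Dⁿ ⟶ Dⁿ⁺¹` and compatible with the other coface maps. -/
structure TwoTermData (D : SimplexCategory ⥤ 𝒟) {P Q : 𝒟} (u : P ⟶ Q) where
  /-- the isomorphism in degree zero -/
  κ : D.obj ⦋0⦌ ≅ P
  /-- the projection onto `Q` -/
  l (n : ℕ) : D.obj ⦋n + 1⦌ ⟶ Q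
  /-- the section of the projection onto `Q` -/
  t (n : ℕ) : Q ⟶ D.obj ⦋n + 1⦌
  δ_l_zero : D.map (SimplexCategory.δ 0) ≫ l 0 = κ.hom ≫ u
  δ_l (n : ℕ) (i : Fin (n + 2)) : D.map (SimplexCategory.δ i.castSucc) ≫ l (n + 1) = l n
  δ_l_last (n : ℕ) : D.map (SimplexCategory.δ (Fin.last (n + 1))) ≫ l n = 0
  t_l (n : ℕ) : t n ≫ l n = 𝟙 _
  l_t (n : ℕ) : D.map (SimplexCategory.σ (Fin.last n)) ≫
    D.map (SimplexCategory.δ (Fin.last (n + 1))) + l n ≫ t n = 𝟙 _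

/-- The structure of a cosimplicial object depends on the two-term complex only up to
isomorphism. -/
def TwoTermData.ofIso {D : SimplexCategory ⥤ 𝒟} {P Q P' Q' : 𝒟} {u : P ⟶ Q} {u' : P' ⟶ Q'}
    (S : TwoTermData D u) (a : P ≅ P') (b : Q ≅ Q') (h : u ≫ b.hom = a.hom ≫ u') :
    TwoTermData D u' where
  κ := S.κ ≪≫ a
  l n := S.l n ≫ b.hom
  t n := b.inv ≫ S.t n
  δ_l_zero := by rw [← Category.assoc, S.δ_l_zero, Category.assoc, h, Iso.trans_hom, Category.assoc]
  δ_l n i := by rw [← Category.assoc, S.δ_l]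
  δ_l_last n := by rw [← Category.assoc, S.δ_l_last, zero_comp]
  t_l n := by
    have := S.t_l n
    rw [Category.assoc, reassoc_of% this, b.inv_hom_id]
  l_t n := by rw [Category.assoc, b.hom_inv_id_assoc, S.l_t]

/-- The cosimplicial object of a complex in degrees `0` and `1` is, in the opposite category, a
split simplicial object with nondegenerate part in degrees `0` and `1`. The last coface map and
`lastStep n` give its decomposition. -/
lemma nonempty_twoTermData (F : CochainComplex 𝒟 ℕ) (hF : ∀ n, 2 ≤ n → IsZero (F.X n)) :
    Nonempty (TwoTermData (doldKan F) (F.d 0 1)) := by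
  let K : ChainComplex 𝒟ᵒᵖ ℕ := ChainComplex.of (fun n ↦ op (F.X n)) (fun n ↦ (F.d n (n + 1)).op)
    (fun n ↦ by rw [← op_comp, F.d_comp_d, op_zero])
  let X : SimplicialObject 𝒟ᵒᵖ := AlgebraicTopology.DoldKan.Γ₀.obj K
  let s : Splitting X := AlgebraicTopology.DoldKan.Γ₀.splitting K
  have h0 : s.ι 1 ≫ X.δ 0 = K.d 1 0 ≫ s.ι 0 := by
    have h := AlgebraicTopology.DoldKan.Γ₀.Obj.mapMono_on_summand_id K
      (SimplexCategory.δ (n := 0) 0)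
    rw [AlgebraicTopology.DoldKan.Γ₀.Obj.Termwise.mapMono_δ₀] at h
    erw [Splitting.cofan_inj_id, Splitting.cofan_inj_id] at h
    exact h
  have h1 : s.ι 1 ≫ X.δ 1 = 0 := by
    have : Mono (SimplexCategory.δ (n := 0) 1) := inferInstance
    have h := AlgebraicTopology.DoldKan.Γ₀.Obj.mapMono_on_summand_id K
      (SimplexCategory.δ (n := 0) 1)
    rw [AlgebraicTopology.DoldKan.Γ₀.Obj.Termwise.mapMono_eq_zero] at h
    · erw [Splitting.cofan_inj_id, zero_comp] at h
      exact h
    · intro h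
      have := congr_arg SimplexCategory.len h
      simp at this
    · rw [Isδ₀.iff]
      decide
  have hs : ∀ n, 2 ≤ n → IsZero (s.N n) := fun n hn ↦ (hF n hn).op
  choose t ht ht' using Splitting.exists_retraction s h1 hs
  have hd : K.d 1 0 = (F.d 0 1).op :=
    ChainComplex.of_d (fun n ↦ op (F.X n)) (fun n ↦ (F.d n (n + 1)).op) 0
  have := Splitting.isIso_ι_zero s
  exact ⟨
    { κ := (asIso (s.ι 0)).unop
      l n := (s.ι 1 ≫ X.map (lastStep n).op).unop
      t n := (t n).unop
      δ_l_zero := by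
        have h : (s.ι 1 ≫ X.map (lastStep 0).op) ≫ X.δ 0 = (F.d 0 1).op ≫ s.ι 0 := by
          rw [← hd, ← h0, lastStep_zero, op_id, X.map_id, Category.comp_id]
        exact congr_arg Quiver.Hom.unop h
      δ_l n i := congr_arg Quiver.Hom.unop (Splitting.lastStep_δ s n i)
      δ_l_last n := congr_arg Quiver.Hom.unop (Splitting.lastStep_δ_last s h1 n)
      t_l n := congr_arg Quiver.Hom.unop (ht n)
      l_t n := congr_arg Quiver.Hom.unop (ht' n) }⟩

lemma nonempty_twoTermData_double {P Q : 𝒟} (v : P ⟶ Q) :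
    Nonempty (TwoTermData
      (doldKan (HomologicalComplex.double v (show (ComplexShape.up ℕ).Rel 0 1 from rfl))) v) := by
  have h : (ComplexShape.up ℕ).Rel 0 1 := rfl
  have h01 : (0 : ℕ) ≠ 1 := zero_ne_one
  obtain ⟨S⟩ := nonempty_twoTermData (HomologicalComplex.double v h) fun n hn ↦
    HomologicalComplex.isZero_double_X _ _ n (by lia) (by lia)
  exact ⟨S.ofIso (HomologicalComplex.doubleXIso₀ v h) (HomologicalComplex.doubleXIso₁ v h h01) (by
    rw [HomologicalComplex.double_d _ _ h01]
    simp)⟩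

end Cosimplicial

end DoldKan

/-! ### Functoriality of the terms of the Koszul complex -/

section Functors

section Presheaf

variable {C : Type u} [SmallCategory C] {R : Cᵒᵖ ⥤ CommRingCat.{u}}

/-- The functor `P ↦ Λⁱ(Q) ⊗ Γ^{q-i}(P)` on presheaves of modules. -/
noncomputable def preKosXFunctor (Q : PMod R) (q i : ℕ) : PMod R ⥤ PMod R where
  obj P := preKosX Q P q i
  map {P P'} φ := mkPModHom (fun U ↦ kosMap LinearMap.id (appₗ φ U) q i) (fun {U V} f x ↦ by
    refine (kosMap_comp (RingHom.id_comp _) (res Q f) LinearMap.id (res Q f) (fun _ ↦ rfl)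
      (res P f) (appₗ φ V) ((res P' f).comp (appₗ φ U)) (fun x ↦ (appₗ_res φ f x).symm)
      q i x).symm.trans ?_
    exact kosMap_comp (RingHom.comp_id _) LinearMap.id (res Q f) (res Q f) (fun _ ↦ rfl)
      (appₗ φ U) (res P' f) _ (fun _ ↦ rfl) q i x)
  map_id P := by
    ext U x
    exact kosMap_id (R := R.obj U) rfl _ (fun _ ↦ rfl) _ (fun _ ↦ rfl) q i x
  map_comp φ ψ := by
    ext U x
    exact kosMap_comp (R := R.obj U) rfl LinearMap.id LinearMap.id LinearMap.id (fun _ ↦ rfl)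
      (appₗ φ U) (appₗ ψ U) (appₗ (φ ≫ ψ) U) (fun _ ↦ rfl) q i x

/-- The differential of the presheaf Koszul complex. -/
noncomputable def preKosD {P Q : PMod R} (u : P ⟶ Q) (q i : ℕ) :
    preKosX Q P q i ⟶ preKosX Q P q (i + 1) :=
  mkPModHom (fun U ↦ kosD (appₗ u U) q i)
    (fun f x ↦ kosD_kosMap _ _ _ _ (fun x ↦ (appₗ_res u f x).symm) q i x)

lemma preKosXFunctor_map_preKosD {P P' Q : PMod R} (φ : P ⟶ P') (u : P ⟶ Q) (u' : P' ⟶ Q)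
    (h : φ ≫ u' = u) (q i : ℕ) :
    (preKosXFunctor Q q i).map φ ≫ preKosD u' q i =
      preKosD u q i ≫ (preKosXFunctor Q q (i + 1)).map φ := by
  subst h
  ext U x
  exact kosD_kosMap (R := R.obj U) LinearMap.id (appₗ φ U) (appₗ (φ ≫ u') U) (appₗ u' U)
    (fun _ ↦ rfl) q i x

/-- The map `Γ^q(P) → Λ⁰(Q) ⊗ Γ^{q-0}(P)`. -/
noncomputable def kosZero (S : Type u) [CommRing S] (Q P : Type u) [AddCommGroup Q] [Module S Q]
    [AddCommGroup P] [Module S P] (q : ℕ) : DPow S P q →ₗ[S] KosX S Q P q 0 :=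
  TensorProduct.mk S _ _ (exteriorPower.ιMulti S 0 Fin.elim0) ∘ₗ
    (LinearEquiv.ofEq (DPow S P q) (DPow S P ((q : ℤ) - (0 : ℕ))) (by simp)).toLinearMap

lemma kosZero_injective (S : Type u) [CommRing S] (Q P : Type u) [AddCommGroup Q] [Module S Q]
    [AddCommGroup P] [Module S P] (q : ℕ) : Function.Injective (kosZero S Q P q) := by
  let F : KosX S Q P q 0 ≃ₗ[S] DPow S P ((q : ℤ) - (0 : ℕ)) :=
    (exteriorPower.zeroEquiv S Q).rTensor _ ≪≫ₗ TensorProduct.lid S _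
  have h (γ : DPow S P q) : F (kosZero S Q P q γ) = LinearEquiv.ofEq _ _ (by simp) γ := by
    simp only [F, kosZero, LinearMap.comp_apply, TensorProduct.mk_apply, LinearEquiv.trans_apply,
      LinearEquiv.rTensor_tmul, LinearEquiv.coe_coe]
    rw [exteriorPower.zeroEquiv_ιMulti, TensorProduct.lid_tmul, one_smul]
  exact fun a b hab ↦ (LinearEquiv.injective _) ((h a).symm.trans ((congr_arg F hab).trans (h b)))

lemma kosZero_dpMap {S T : Type u} [CommRing S] [CommRing T] {σ : S →+* T}
    {Q P Q' P' : Type u} [AddCommGroup Q] [Module S Q] [AddCommGroup P] [Module S P]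
    [AddCommGroup Q'] [Module T Q'] [AddCommGroup P'] [Module T P'] (g : Q →ₛₗ[σ] Q')
    (f : P →ₛₗ[σ] P') (q : ℕ) (γ : DPow S P q) :
    kosZero T Q' P' q (dpMap f q γ) = kosMap g f q 0 (kosZero S Q P q γ) := by
  simp only [kosZero, LinearMap.comp_apply, TensorProduct.mk_apply, kosMap]
  refine Eq.trans ?_ (TensorProduct.map_tmul _ _ _ _).symm
  rw [extMap_ιMulti]
  exact congr_arg (exteriorPower.ιMulti T 0 · ⊗ₜ _) (Subsingleton.elim _ _)

lemma kosZero_prod {S : Type u} [CommRing S] {Q P : Type u} [AddCommGroup Q] [Module S Q]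
    [AddCommGroup P] [Module S P] {q r : ℕ} (y : Fin 0 → Q) (e : Fin r → ℤ) (x : Fin r → P)
    (h : ∑ k, e k = (q : ℤ) - (0 : ℕ)) :
    kosZero S Q P q ⟨∏ k, dpZ S (e k) (x k), prod_dpZ_mem e x (by simpa using h)⟩ =
      exteriorPower.ιMulti S 0 y ⊗ₜ ⟨∏ k, dpZ S (e k) (x k), prod_dpZ_mem e x h⟩ := by
  rw [Subsingleton.elim y Fin.elim0]
  rfl

lemma kosD_zero {S : Type u} [CommRing S] {Q P : Type u} [AddCommGroup Q] [Module S Q]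
    [AddCommGroup P] [Module S P] (q i : ℕ) (t : KosX S Q P q i) :
    kosD (0 : P →ₗ[S] Q) q i t = 0 := by
  suffices kosD (0 : P →ₗ[S] Q) q i = 0 from DFunLike.congr_fun this t
  refine kosX_ext (N := KosX S Q P q (i + 1)) q fun y r e x h ↦ ?_
  rw [kosD_tmul _ _ _ _ _ _ h]
  simp

/-- If `u` is surjective, the elements of `Λⁱ⁺¹(Q) ⊗ Γ^{q-i-1}(ker u)` are boundaries in the Koszul
complex. -/
lemma kosPure_le_range {S : Type u} [CommRing S] {Q P : Type u} [AddCommGroup Q] [Module S Q]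
    [AddCommGroup P] [Module S P] (v : P →ₗ[S] Q) (hv : Function.Surjective v) (q i : ℕ) :
    kosPure v q (i + 1) ≤ LinearMap.range (kosD v q i) := by
  refine Submodule.span_le.2 ?_
  rintro _ ⟨y, r, e, x, h, hx, rfl⟩
  obtain ⟨p, hp⟩ := hv (y 0)
  have h' : ∑ k, (Fin.cons 1 e : Fin (r + 1) → ℤ) k = (q : ℤ) - i := by
    rw [Fin.sum_univ_succ]
    simp [h]
    ring
  refine ⟨exteriorPower.ιMulti S i (Fin.tail y) ⊗ₜ
    ⟨_, prod_dpZ_mem (Fin.cons 1 e) (Fin.cons p x) h'⟩, ?_⟩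
  refine (kosD_tmul v q i _ _ _ h').trans ((Fin.sum_univ_succ _).trans
    ((congr_arg₂ (· + ·) ?_ (Finset.sum_eq_zero ?_)).trans (add_zero _)))
  · rw [wedge_ιMulti]
    congr 1
    · congr 1
      simp only [Fin.cons_zero, hp]
      exact Fin.cons_self_tail y
    · apply Subtype.ext
      simp [Fin.prod_univ_succ, dpZ, DividedPowerAlgebra.dp_zero]
  · intro k _
    simp [hx]

/-- The map `Γ^q(P) → Λ⁰(Q) ⊗ Γ^{q-0}(P)` of presheaves of modules. -/
noncomputable def preKosZero (Q P : PMod R) (q : ℕ) :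
    (preDPow R q).obj P ⟶ preKosX Q P q 0 :=
  mkPModHom (fun U ↦ kosZero (R.obj U) (Q.obj U) (P.obj U) q)
    (fun f γ ↦ kosZero_dpMap (res Q f) (res P f) q γ)

lemma preKosZero_naturality (Q : PMod R) {P P' : PMod R} (φ : P ⟶ P') (q : ℕ) :
    (preDPow R q).map φ ≫ preKosZero Q P' q =
      preKosZero Q P q ≫ (preKosXFunctor Q q 0).map φ := by
  ext U γ
  exact kosZero_dpMap (S := R.obj U) LinearMap.id (appₗ φ U) q γ

end Presheaf

section Sheaf

variable {C : Type u} [SmallCategory C] {J : GrothendieckTopology C}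
  {A : Sheaf J CommRingCat.{u}}

/-- The functor `P ↦ Λⁱ(Q) ⊗ Γ^{q-i}(P)` on sheaves of modules. -/
noncomputable def kosXFunctor (Q : Mod A) (q i : ℕ) : Mod A ⥤ Mod A :=
  SheafOfModules.forget _ ⋙ preKosXFunctor (R := A.obj) Q.val q i ⋙ shf A

/-- The differential of the Koszul complex. -/
noncomputable def kosDiff {P Q : Mod A} (u : P ⟶ Q) (q i : ℕ) :
    (kosXFunctor Q q i).obj P ⟶ (kosXFunctor Q q (i + 1)).obj P :=
  (shf A).map (preKosD (R := A.obj) u.val q i)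

lemma kos_d {P Q : Mod A} (u : P ⟶ Q) (q i : ℕ) : (kos u q).d i (i + 1) = kosDiff u q i := by
  change (shf A).map ((preKos (R := A.obj) u.val q).d i (i + 1)) = _
  rw [kosDiff]
  congr 1
  exact CochainComplex.of_d (fun i ↦ preKosX (R := A.obj) Q.val P.val q i)
    (fun i ↦ preKosD (R := A.obj) u.val q i) i

lemma kosDiff_kosDiff {P Q : Mod A} (u : P ⟶ Q) (q i : ℕ) :
    kosDiff u q i ≫ kosDiff u q (i + 1) = 0 := by
  rw [← kos_d, ← kos_d]
  exact (kos u q).d_comp_d _ _ _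

lemma kosXFunctor_map_kosDiff {P P' Q : Mod A} (φ : P ⟶ P') (u : P ⟶ Q) (u' : P' ⟶ Q)
    (h : φ ≫ u' = u) (q i : ℕ) :
    (kosXFunctor Q q i).map φ ≫ kosDiff u' q i =
      kosDiff u q i ≫ (kosXFunctor Q q (i + 1)).map φ := by
  have := preKosXFunctor_map_preKosD (R := A.obj) φ.val u.val u'.val
    (congr_arg SheafOfModules.Hom.val h) q i
  exact ((shf A).map_comp _ _).symm.trans ((congr_arg (shf A).map this).trans
    ((shf A).map_comp _ _))

/-- The map `Γ^q(P) → Λ⁰(Q) ⊗ Γ^{q-0}(P)` of sheaves of modules. -/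
noncomputable def dPowToKos (Q P : Mod A) (q : ℕ) :
    (dPow A q).obj P ⟶ (kosXFunctor Q q 0).obj P :=
  (shf A).map (preKosZero (R := A.obj) Q.val P.val q)

lemma dPowToKos_naturality (Q : Mod A) {P P' : Mod A} (φ : P ⟶ P') (q : ℕ) :
    (dPow A q).map φ ≫ dPowToKos Q P' q = dPowToKos Q P q ≫ (kosXFunctor Q q 0).map φ :=
  ((shf A).map_comp _ _).symm.trans ((congr_arg (shf A).map
    (preKosZero_naturality (R := A.obj) Q.val φ.val q)).trans ((shf A).map_comp _ _))

instance (Q P : Mod A) (q : ℕ) : Mono (dPowToKos Q P q) := by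
  refine mono_shf_map _ fun U x hx ↦ Loc.of_forall fun V f ↦ ?_
  have : x = 0 := kosZero_injective (A.obj.obj U) (Q.val.obj U) (P.val.obj U) q
    (hx.trans (map_zero _).symm)
  rw [this]
  exact map_zero (res _ f)

lemma isFlat_of_isZero {M : Mod A} (hM : IsZero M) : IsFlat M := by
  intro N N' f _
  have h (U : Cᵒᵖ) : Subsingleton (M.val.obj U) := ⟨fun x y ↦ by
    rw [← ap_id x, ← ap_id y, hM.eq_of_src (𝟙 M) 0]
    rfl⟩
  refine mono_shf_map _ fun U x _ ↦ Loc.of_forall fun V g ↦ ?_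
  have hx : x = 0 :=
    (inferInstance : Subsingleton (M.val.obj U ⊗[A.obj.obj U] N.val.obj U)).elim _ _
  rw [hx]
  exact map_zero (res _ g)

open ZeroObject in
/-- For a split epimorphism onto a flat sheaf of modules, the cycles of the Koszul complex are
locally generated by the boundaries and the divided powers of the kernel. -/
lemma loc_kosGood_of_split {P Q : Mod A} {l : P ⟶ Q} (hl : IsSplitEpi l) (hQ : IsFlat Q) {q i : ℕ}
    {U : Cᵒᵖ} (c : KosX (A.obj.obj U) (Q.val.obj U) (P.val.obj U) q i)
    (hc : kosD (appₗ l.val U) q i c = 0) :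
    Loc J U fun V f ↦ kosMap (res Q.val f) (res P.val f) q i c ∈
      kosBd (appₗ l.val V) q i ⊔ kosPure (appₗ l.val V) q i := by
  have : Epi (0 : Q ⟶ (0 : Mod A)) := ⟨fun _ _ _ ↦ (isZero_zero _).eq_of_src _ _⟩
  exact loc_kosGood (Category.comp_id l) (h := (0 : Q ⟶ (0 : Mod A))) comp_zero
    ((ShortComplex.exact_iff_epi _ rfl).2 (inferInstanceAs (Epi (𝟙 Q)))) hQ
    (isFlat_of_isZero (isZero_zero _)) c hc

lemma kosDiff_zero (P Q : Mod A) (q i : ℕ) : kosDiff (0 : P ⟶ Q) q i = 0 := by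
  have : preKosD (R := A.obj) (0 : P ⟶ Q).val q i = 0 := by
    ext U x
    exact kosD_zero (S := A.obj.obj U) q i x
  rw [kosDiff, this]
  exact (shf A).map_zero _ _

/-- The Koszul complex of a split epimorphism is exact in positive degrees. -/
lemma exact_kosDiff_of_split {P Q : Mod A} (l : P ⟶ Q) (hl : IsSplitEpi l) (hQ : IsFlat Q)
    (q i : ℕ) :
    (ShortComplex.mk (kosDiff l q i) (kosDiff l q (i + 1)) (kosDiff_kosDiff l q i)).Exact := by
  refine exact_of_loc fun U s hs ↦ loc_exists_shf (preKosD (R := A.obj) l.val q i)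
    (preKosD (R := A.obj) l.val q (i + 1)) (fun U c hc ↦ ?_) s hs
  refine (loc_kosGood_of_split hl hQ c hc).mono fun V f hf ↦ ?_
  have hsurj : Function.Surjective (appₗ l.val V) := fun y ↦
    ⟨ap (section_ l) y, by
      change ap l (ap _ y) = y
      rw [← ap_comp, IsSplitEpi.id, ap_id]⟩
  exact (sup_le le_rfl (kosPure_le_range _ hsurj q i) :
    _ ≤ LinearMap.range (kosD (appₗ l.val V) q i)) hf

lemma dPowToKos_kosDiff {M P Q : Mod A} {δ : M ⟶ P} {l : P ⟶ Q} (w : δ ≫ l = 0) (q : ℕ) :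
    ((dPow A q).map δ ≫ dPowToKos Q P q) ≫ kosDiff l q 0 = 0 := by
  rw [dPowToKos_naturality, Category.assoc, kosXFunctor_map_kosDiff δ 0 l w, kosDiff_zero,
    zero_comp, comp_zero]

/-- The cycles of degree zero of the Koszul complex of a split epimorphism are the divided powers
of the kernel. -/
lemma exact_dPowToKos_of_split {M P Q : Mod A} {δ : M ⟶ P} {l : P ⟶ Q} (w : δ ≫ l = 0)
    {σ : P ⟶ M} {t : Q ⟶ P} (hl : t ≫ l = 𝟙 _) (h : σ ≫ δ + l ≫ t = 𝟙 _) (hQ : IsFlat Q) (q : ℕ) :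
    (ShortComplex.mk _ _ (dPowToKos_kosDiff w q)).Exact := by
  refine exact_of_loc fun U s hs ↦ ?_
  have key := loc_exists_shf ((preDPow A.obj q).map δ.val ≫ preKosZero (R := A.obj) Q.val P.val q)
    (preKosD (R := A.obj) l.val q 0) (fun U c hc ↦ ?_) s hs
  · refine key.mono fun V f ⟨y, hy⟩ ↦ ⟨y, ?_⟩
    exact (congr_arg (fun φ ↦ ap φ y) ((shf A).map_comp _ _).symm).trans hy
  refine (loc_kosGood_of_split ⟨⟨t, hl⟩⟩ hQ c hc).mono fun V f hf ↦ ?_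
  change _ ∈ LinearMap.range
    (kosZero (A.obj.obj V) (Q.val.obj V) (P.val.obj V) q ∘ₗ dpMap (appₗ δ.val V) q)
  refine (sup_le bot_le (Submodule.span_le.2 ?_) : kosBd (appₗ l.val V) q 0 ⊔
    kosPure (appₗ l.val V) q 0 ≤ _) hf
  rintro _ ⟨y, r, e, x, he, hx, rfl⟩
  have hx' (k : Fin r) : ap δ (ap σ (x k)) = x k := by
    have := ap_id (M := P) (x k)
    rwa [← h, ap_add_hom, ap_comp, ap_comp, show ap l (x k) = 0 from hx k, ap_zero, add_zero]
      at this
  refine ⟨⟨∏ k, dpZ _ (e k) (ap σ (x k)), prod_dpZ_mem e _ (by simpa using he)⟩, ?_⟩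
  rw [LinearMap.comp_apply, dpMap_prod _ _ _ (by simpa using he), ← kosZero_prod y e x he]
  congr 1
  apply Subtype.ext
  exact congr_arg (fun x : Fin r → P.val.obj V ↦ ∏ k, dpZ (A.obj.obj V) (e k) (x k)) (funext hx')

end Sheaf

end Functors

/-! ### The derived divided powers of a two-term complex -/

section DerivedDividedPower

open SimplexCategory Simplicial

/-- The functor `⦋n⦌ ↦ ⦋n + 1⦌` adding a largest element. -/
def addTop : SimplexCategory ⥤ SimplexCategory where
  obj Δ := ⦋Δ.len + 1⦌
  map {Δ Δ'} f := SimplexCategory.mkHom ⟨fun i ↦ Fin.lastCases (motive := fun _ ↦ Fin (Δ'.len + 2))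
    (Fin.last _) (fun j ↦ (f.toOrderHom j).castSucc) i, fun i j hij ↦ by
      dsimp only
      induction j using Fin.lastCases with
      | last => rw [Fin.lastCases_last]; exact Fin.le_last _
      | cast j =>
        induction i using Fin.lastCases with
        | last => exact absurd hij (by simp)
        | cast i =>
          rw [Fin.lastCases_castSucc, Fin.lastCases_castSucc]
          exact Fin.castSucc_le_castSucc_iff.2
            (f.toOrderHom.monotone (Fin.castSucc_le_castSucc_iff.1 hij))⟩
  map_id Δ := by
    ext i
    change ((Fin.lastCases (Fin.last _) (fun j : Fin (Δ.len + 1) ↦ j.castSucc) i : Fin _) : ℕ) = i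
    induction i using Fin.lastCases with
    | last => rw [Fin.lastCases_last]
    | cast i => rw [Fin.lastCases_castSucc]
  map_comp {Δ Δ' Δ''} f g := by
    ext i
    change ((Fin.lastCases (Fin.last _) (fun j ↦ (g.toOrderHom (f.toOrderHom j)).castSucc) i :
      Fin (Δ''.len + 2)) : ℕ) = (Fin.lastCases (Fin.last _) (fun j ↦ (g.toOrderHom j).castSucc)
        (Fin.lastCases (Fin.last _) (fun j ↦ (f.toOrderHom j).castSucc) i : Fin (Δ'.len + 2)) :
          Fin (Δ''.len + 2))
    induction i using Fin.lastCases with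
    | last => simp only [Fin.lastCases_last]
    | cast i => simp only [Fin.lastCases_castSucc]

lemma addTop_δ (n : ℕ) (i : Fin (n + 2)) :
    addTop.map (SimplexCategory.δ i) = SimplexCategory.δ i.castSucc := by
  have h (j : Fin (n + 2)) : (Fin.lastCases (motive := fun _ ↦ Fin (n + 3)) (Fin.last (n + 2))
      (fun j : Fin (n + 1) ↦ (i.succAbove j).castSucc) j) = i.castSucc.succAbove j := by
    induction j using Fin.lastCases with
    | last =>
      rw [Fin.lastCases_last, Fin.succAbove_of_lt_succ _ _ (by simp [Fin.lt_def]; lia)]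
      rfl
    | cast j => rw [Fin.lastCases_castSucc, Fin.castSucc_succAbove_castSucc]
  ext j
  exact congr_arg Fin.val (h j)

section Preadditive

variable {𝒜 : Type*} [Category* 𝒜] [Preadditive 𝒜] (D : SimplexCategory ⥤ 𝒜)

/-- The alternating sum of all coface maps `Dⁿ⁺¹ ⟶ Dⁿ⁺²` except for the last one. -/
noncomputable def decD (n : ℕ) : D.obj ⦋n + 1⦌ ⟶ D.obj ⦋n + 2⦌ :=
  ∑ i : Fin (n + 2), (-1 : ℤ) ^ (i : ℕ) • D.map (SimplexCategory.δ i.castSucc)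

/-- `decD` is the differential of the complex of the cosimplicial object `n ↦ Dⁿ⁺¹` obtained by
dropping the last coface and codegeneracy maps. -/
lemma decD_decD (n : ℕ) : decD D n ≫ decD D (n + 1) = 0 := by
  have h (n : ℕ) : decD D n =
      AlgebraicTopology.AlternatingCofaceMapComplex.objD (addTop ⋙ D) n := by
    simp only [decD, AlgebraicTopology.AlternatingCofaceMapComplex.objD]
    refine Finset.sum_congr rfl fun i _ ↦ ?_
    congr 1
    change _ = D.map (addTop.map _)
    rw [addTop_δ]
    rfl
  rw [h, h]
  exact AlgebraicTopology.AlternatingCofaceMapComplex.d_squared _ n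

/-- The last codegeneracies, with signs, contract the complex with differential `decD`. -/
lemma σ_decD (n : ℕ) : ((-1 : ℤ) ^ (n + 1) • D.map (SimplexCategory.σ (Fin.last (n + 1)))) ≫
    decD D n + decD D (n + 1) ≫
      ((-1 : ℤ) ^ (n + 2) • D.map (SimplexCategory.σ (Fin.last (n + 2)))) = 𝟙 _ := by
  have h1 : decD D (n + 1) ≫ D.map (SimplexCategory.σ (Fin.last (n + 2))) =
      D.map (SimplexCategory.σ (Fin.last (n + 1))) ≫ decD D n + (-1 : ℤ) ^ (n + 2) • 𝟙 _ := by
    rw [decD, decD, Fin.sum_univ_castSucc, Preadditive.add_comp, Preadditive.sum_comp,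
      Preadditive.comp_sum]
    congr 1
    · refine Finset.sum_congr rfl fun i _ ↦ ?_
      rw [Preadditive.zsmul_comp, Preadditive.comp_zsmul, ← D.map_comp, ← D.map_comp]
      congr 2
      exact SimplexCategory.δ_comp_σ_of_le (i := i.castSucc) (j := Fin.last (n + 1))
        (by simp [Fin.le_def]; lia)
    · rw [Preadditive.zsmul_comp, ← D.map_comp]
      congr 1
      exact (congr_arg D.map (SimplexCategory.δ_comp_σ_self (i := Fin.last (n + 2)))).trans
        (D.map_id _)
  rw [Preadditive.comp_zsmul, h1, Preadditive.zsmul_comp, smul_add, smul_smul, ← mul_pow,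
    pow_succ _ (n + 1)]
  simp

lemma decD_σ_zero : decD D 0 ≫ ((-1 : ℤ) ^ 1 • D.map (SimplexCategory.σ (Fin.last 1))) =
    𝟙 _ - D.map (SimplexCategory.σ 0) ≫ D.map (SimplexCategory.δ 0) := by
  rw [decD, Fin.sum_univ_two, Preadditive.comp_zsmul, Preadditive.add_comp, Preadditive.zsmul_comp,
    Preadditive.zsmul_comp, ← D.map_comp, ← D.map_comp, ← D.map_comp]
  have h0 : SimplexCategory.δ (Fin.castSucc 0) ≫ SimplexCategory.σ (Fin.last 1) =
      SimplexCategory.σ 0 ≫ SimplexCategory.δ 0 :=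
    SimplexCategory.δ_comp_σ_of_le (n := 0) (i := 0) (j := 0) le_rfl
  have h1 : SimplexCategory.δ (Fin.castSucc 1) ≫ SimplexCategory.σ (Fin.last 1) = 𝟙 _ :=
    SimplexCategory.δ_comp_σ_self (i := Fin.last 1)
  rw [h0, h1, D.map_id]
  simp
  abel

lemma δ_decD {P : 𝒜} (f : P ⟶ D.obj ⦋0⦌) : (f ≫ D.map (SimplexCategory.δ 0)) ≫ decD D 0 = 0 := by
  have h : SimplexCategory.δ (n := 0) 0 ≫ SimplexCategory.δ (Fin.castSucc 0) =
      SimplexCategory.δ 0 ≫ SimplexCategory.δ (Fin.castSucc 1) :=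
    (SimplexCategory.δ_comp_δ (n := 0) (i := 0) (j := 0) le_rfl).symm
  rw [decD, Fin.sum_univ_two, Preadditive.comp_add, Preadditive.comp_zsmul, Preadditive.comp_zsmul,
    Category.assoc, Category.assoc, ← D.map_comp, ← D.map_comp, h]
  simp

end Preadditive

lemma exact_zsmul {𝒜 : Type*} [Category* 𝒜] [Abelian 𝒜] {X Y Z : 𝒜} {f : X ⟶ Y} {g : Y ⟶ Z}
    {w : f ≫ g = 0} (h : (ShortComplex.mk f g w).Exact) {a b : ℤ} (ha : a * a = 1)
    (hb : b * b = 1) (w' : (a • f) ≫ (b • g) = 0) : (ShortComplex.mk (a • f) (b • g) w').Exact := by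
  rw [ShortComplex.exact_iff_exact_up_to_refinements]
  intro T x hx
  dsimp at x hx
  have hx' : x ≫ g = 0 := by
    have := congr_arg (b • ·) hx
    simpa [Preadditive.comp_zsmul, smul_smul, hb] using this
  obtain ⟨T', π, hπ, y, hy⟩ := h.exact_up_to_refinements x hx'
  refine ⟨T', π, hπ, a • y, ?_⟩
  dsimp at hy ⊢
  rw [hy, Preadditive.comp_zsmul, Preadditive.zsmul_comp, smul_smul, ha, one_smul]

lemma neg_one_pow_mul_self (n : ℕ) : (-1 : ℤ) ^ n * (-1 : ℤ) ^ n = 1 := by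
  rw [← mul_pow]
  simp

variable {C : Type u} [SmallCategory C] {J : GrothendieckTopology C} {A : Sheaf J CommRingCat.{u}}

/-- The cochain complex associated with the cosimplicial sheaf of modules `Γ^q(D)`. -/
noncomputable def dPowComplex (D : SimplexCategory ⥤ Mod A) (q : ℕ) :
    CochainComplex (Mod A) ℕ :=
  AlgebraicTopology.AlternatingCofaceMapComplex.obj (D ⋙ dPow A q)

lemma dPowComplex_d (D : SimplexCategory ⥤ Mod A) (q n : ℕ) :
    (dPowComplex D q).d n (n + 1) =
      ∑ i : Fin (n + 2), (-1 : ℤ) ^ (i : ℕ) • (dPow A q).map (D.map (SimplexCategory.δ i)) :=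
  CochainComplex.of_d (fun n ↦ (dPow A q).obj (D.obj ⦋n⦌))
    (AlgebraicTopology.AlternatingCofaceMapComplex.objD (D ⋙ dPow A q)) n

lemma mono_dPowToKos (D : SimplexCategory ⥤ Mod A) (Q : Mod A) (q n : ℕ) :
    Mono ((dPow A q).map (D.map (SimplexCategory.δ (Fin.last (n + 1)))) ≫
      dPowToKos Q (D.obj ⦋n + 1⦌) q) := by
  have h : SplitMono (D.map (SimplexCategory.δ (Fin.last (n + 1)))) :=
    ⟨D.map (SimplexCategory.σ (Fin.last n)), by
      rw [← D.map_comp, ← D.map_id]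
      exact congr_arg D.map (SimplexCategory.δ_comp_σ_succ (i := Fin.last n))⟩
  have := (h.map (dPow A q)).mono
  exact mono_comp _ _

section

variable {D : SimplexCategory ⥤ Mod A} {P Q : Mod A} {u : P ⟶ Q} (S : TwoTermData D u)

lemma decD_kosDiff (q b n : ℕ) :
    decD (D ⋙ kosXFunctor Q q b) n ≫ kosDiff (S.l (n + 1)) q b =
      kosDiff (S.l n) q b ≫ decD (D ⋙ kosXFunctor Q q (b + 1)) n := by
  refine (Preadditive.sum_comp _ _ _).trans (Eq.trans ?_ (Preadditive.comp_sum _ _ _).symm)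
  refine Finset.sum_congr rfl fun i _ ↦ ?_
  rw [Preadditive.zsmul_comp, Preadditive.comp_zsmul]
  congr 1
  exact kosXFunctor_map_kosDiff _ _ _ (S.δ_l n i) q b

/-- The augmentation of the columns commutes with the differentials: composing with the last coface
map turns the cofaces of `Dⁿ` into those of `Dⁿ⁺¹` other than the last one. -/
lemma sum_dPow_decD (Q : Mod A) (q n : ℕ) :
    (∑ i : Fin (n + 2), (-1 : ℤ) ^ (i : ℕ) • (dPow A q).map (D.map (SimplexCategory.δ i))) ≫
        (dPow A q).map (D.map (SimplexCategory.δ (Fin.last (n + 2)))) ≫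
          dPowToKos Q (D.obj ⦋n + 2⦌) q =
      ((dPow A q).map (D.map (SimplexCategory.δ (Fin.last (n + 1)))) ≫
        dPowToKos Q (D.obj ⦋n + 1⦌) q) ≫ decD (D ⋙ kosXFunctor Q q 0) n := by
  refine (Preadditive.sum_comp _ _ _).trans (Eq.trans ?_ (Preadditive.comp_sum _ _ _).symm)
  refine Finset.sum_congr rfl fun i _ ↦ ?_
  rw [Preadditive.zsmul_comp, Preadditive.comp_zsmul]
  congr 1
  have h : SimplexCategory.δ i ≫ SimplexCategory.δ (Fin.last (n + 2)) =
      SimplexCategory.δ (Fin.last (n + 1)) ≫ SimplexCategory.δ i.castSucc := by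
    have := SimplexCategory.δ_comp_δ (i := i) (j := Fin.last (n + 1)) (Fin.le_last i)
    rwa [Fin.succ_last] at this
  rw [Functor.comp_map, Category.assoc, ← dPowToKos_naturality, ← Functor.map_comp_assoc,
    ← Functor.map_comp_assoc, ← D.map_comp, ← D.map_comp, h]

lemma dPowToKos_zsmul_kosDiff (q n : ℕ) :
    ((dPow A q).map (D.map (SimplexCategory.δ (Fin.last (n + 1)))) ≫
      dPowToKos Q (D.obj ⦋n + 1⦌) q) ≫ ((-1 : ℤ) ^ n • kosDiff (S.l n) q 0) = 0 := by
  rw [Preadditive.comp_zsmul, dPowToKos_kosDiff (S.δ_l_last n), smul_zero]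

lemma exact_dPowToKos (hQ : IsFlat Q) (q n : ℕ) :
    (ShortComplex.mk _ _ (dPowToKos_zsmul_kosDiff S q n)).Exact := by
  have := exact_zsmul (exact_dPowToKos_of_split (S.δ_l_last n) (S.t_l n) (S.l_t n) hQ q)
    (one_mul 1) (neg_one_pow_mul_self n)
    (by rw [one_smul, Preadditive.comp_zsmul, dPowToKos_kosDiff (S.δ_l_last n), smul_zero])
  simpa only [one_smul] using this

set_option maxHeartbeats 1000000 in
/-- The double complex `Λᵇ(Q) ⊗ Γ^{q-b}(Dⁿ⁺¹)` attached to the cosimplicial object `D` of a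
two-term complex `P ⟶ Q`. Its rows are contracted by the last codegeneracies onto the Koszul complex
of `P ⟶ Q`, and its columns are Koszul complexes of the split epimorphisms `Dⁿ⁺¹ ⟶ Q` with kernel
`Dⁿ`. -/
noncomputable def resolvedDouble (hQ : IsFlat Q) (q : ℕ) :
    ResolvedDouble (dPowComplex D q) (kos u q) where
  X b n := (kosXFunctor Q q b).obj (D.obj ⦋n + 1⦌)
  v b n := (-1 : ℤ) ^ n • kosDiff (S.l n) q b
  d b n := decD (D ⋙ kosXFunctor Q q b) n
  h b n := (-1 : ℤ) ^ (n + 1) •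
    (kosXFunctor Q q b).map (D.map (SimplexCategory.σ (Fin.last (n + 1))))
  r b := (kosXFunctor Q q b).map (D.map (SimplexCategory.σ 0) ≫ S.κ.hom)
  ε b := (kosXFunctor Q q b).map (S.κ.inv ≫ D.map (SimplexCategory.δ 0))
  η n := (dPow A q).map (D.map (SimplexCategory.δ (Fin.last (n + 1)))) ≫
    dPowToKos Q (D.obj ⦋n + 1⦌) q
  v_d b n := by
    have h := decD_kosDiff S q b n
    rw [Preadditive.zsmul_comp, Preadditive.comp_zsmul, pow_succ]
    simp [h]
  v_v b n := by
    rw [Preadditive.zsmul_comp, Preadditive.comp_zsmul, kosDiff_kosDiff, smul_zero, smul_zero]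
  d_d b n := decD_decD _ n
  C_η n := (congr_arg (· ≫ _) (dPowComplex_d D q n)).trans (sum_dPow_decD Q q n)
  η_v n := dPowToKos_zsmul_kosDiff S q n
  mono_η n := mono_dPowToKos D Q q n
  exact_zero n := exact_dPowToKos S hQ q n
  exact_succ b n := exact_zsmul (exact_kosDiff_of_split (S.l n) ⟨⟨S.t n, S.t_l n⟩⟩ hQ q b)
    (neg_one_pow_mul_self n) (neg_one_pow_mul_self n) _
  h_d b n := σ_decD (D ⋙ kosXFunctor Q q b) n
  d_h b := by
    refine (decD_σ_zero (D ⋙ kosXFunctor Q q b)).trans (congr_arg (𝟙 _ - ·) ?_)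
    refine Eq.trans ?_ ((kosXFunctor Q q b).map_comp _ _)
    rw [Category.assoc, S.κ.hom_inv_id_assoc, Functor.map_comp]
    rfl
  ε_r b := by
    refine ((kosXFunctor Q q b).map_comp _ _).symm.trans ?_
    have h : D.map (SimplexCategory.δ (n := 0) 0) ≫ D.map (SimplexCategory.σ 0) = 𝟙 _ := by
      rw [← D.map_comp, ← D.map_id]
      exact congr_arg D.map (SimplexCategory.δ_comp_σ_self (i := (0 : Fin 1)))
    rw [Category.assoc, reassoc_of% h, S.κ.inv_hom_id]
    exact (kosXFunctor Q q b).map_id _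
  ε_d b := by
    rw [Functor.map_comp]
    exact δ_decD (D ⋙ kosXFunctor Q q b) _
  ε_v b := by
    rw [pow_zero, one_smul, kos_d]
    refine kosXFunctor_map_kosDiff _ _ _ ?_ q b
    rw [Category.assoc, S.δ_l_zero, S.κ.inv_hom_id_assoc]

/-- The complex `Γ^q(D)` is quasi-isomorphic to the Koszul complex of `P ⟶ Q` if `Q` is flat. -/
lemma exists_quasiIso_kos (S : TwoTermData D u) (hQ : IsFlat Q) (q : ℕ) :
    ∃ φ : dPowComplex D q ⟶ kos u q, QuasiIso φ :=
  ⟨_, (resolvedDouble S hQ q).quasiIso_π⟩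

end

lemma derivedDPow_eq (F : CochainComplex (Mod A) ℕ) (q : ℕ) :
    derivedDPow q F = dPowComplex (doldKan F) q := rfl

lemma exists_quasiIso_derivedDPow (K : CDGA A) (hK : IsFlat K.Z1) (q : ℕ) :
    ∃ φ : derivedDPow q K.tauLE1 ⟶ kos K.del q, QuasiIso φ := by
  obtain ⟨S⟩ := nonempty_twoTermData_double K.del
  rw [derivedDPow_eq]
  exact exists_quasiIso_kos S hK q

/-- The derived divided powers of the two-term complex `K⁰ ⟶ Z¹K` are represented by the Koszul
complex. -/
theorem nonempty_derivedDPow_iso [HasDerivedCategory.{w} (Mod A)] (K : CDGA A)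
    (hK : IsFlat K.Z1) (q : ℕ) :
    Nonempty (DerivedCategory.Q.obj (toZ (derivedDPow q K.tauLE1)) ≅
      DerivedCategory.Q.obj (toZ (kos K.del q))) := by
  obtain ⟨φ, hφ⟩ := exists_quasiIso_derivedDPow K hK q
  generalize derivedDPow q K.tauLE1 = F at φ
  generalize kos K.del q = G at φ
  have := (HomologicalComplex.quasiIso_extendMap_iff φ ComplexShape.embeddingUpNat).2 hφ
  exact ⟨asIso (DerivedCategory.Q.map (HomologicalComplex.extendMap φ ComplexShape.embeddingUpNat))⟩

end DerivedDividedPower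

/-! ### Divided powers of a commutative algebra -/

section DividedPowersOfAlgebra

variable {R : Type u} [CommRing R] {M : Type u} [AddCommGroup M] [Module R M]

variable (R M) in
/-- The augmentation `Γ(M) → R` of the divided power algebra. -/
noncomputable def dpAug : DividedPowerAlgebra R M →ₐ[R] R :=
  DividedPowerAlgebra.lift' (f := fun p ↦ if p.1 = 0 then 1 else 0)
    (fun _ ↦ by simp)
    (fun n r _ ↦ by rcases n with _ | n <;> simp)
    (fun n p _ ↦ by rcases n with _ | n <;> rcases p with _ | p <;> simp)
    (fun n a b ↦ by
      rcases n with _ | n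
      · simp
      · rw [Finset.sum_eq_zero]
        · simp
        · rintro ⟨k, l⟩ h
          have h : k + l = n + 1 := Finset.HasAntidiagonal.mem_antidiagonal.1 h
          rcases k with _ | k
          · have : l ≠ 0 := by lia
            simp [this]
          · simp)

lemma dpAug_dpZ (n : ℤ) (x : M) : dpAug R M (dpZ R n x) = if n = 0 then 1 else 0 := by
  by_cases hn : n < 0
  · simp [dpZ_neg hn, hn.ne]
  · lift n to ℕ using not_lt.1 hn
    simp [dpZ_natCast, dpAug]

variable (β : M →ₗ[R] M →ₗ[R] M) (one : M)

/-- For a commutative `R`-algebra `M` with multiplication `β` and unit `one`, the map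
`Γⁿ(M) → M` which sends `x₁^{[e₁]} ⋯ x_r^{[e_r]}` to `n! / (e₁! ⋯ e_r!) x₁^{e₁} ⋯ x_r^{e_r}`,
extended by zero to the whole divided power algebra. On `Γⁿ(M)` it is `n!` times the inverse of
the usual map `Symⁿ(M) → Γⁿ(M)`, followed by the multiplication; the factor `n!` makes it defined
over every ring. -/
noncomputable def dpEval : ℕ → DividedPowerAlgebra R M →ₗ[R] M
  | 0 => (dpAug R M).toLinearMap.smulRight one
  | n + 1 => TensorProduct.lift (β.flip ∘ₗ dpEval n) ∘ₗ (comulDerivation R M).toLinearMap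

lemma dpEval_zero (γ : DividedPowerAlgebra R M) : dpEval β one 0 γ = dpAug R M γ • one := rfl

lemma dpEval_succ (n : ℕ) (γ : DividedPowerAlgebra R M) : dpEval β one (n + 1) γ =
    TensorProduct.lift (β.flip ∘ₗ dpEval β one n) (comulDerivation R M γ) := rfl

lemma dpEval_succ_prod (n : ℕ) {r : ℕ} (e : Fin r → ℤ) (x : Fin r → M) :
    dpEval β one (n + 1) (∏ k, dpZ R (e k) (x k)) =
      ∑ k, β (x k) (dpEval β one n (∏ l, dpZ R (e l - if l = k then 1 else 0) (x l))) := by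
  rw [dpEval_succ, comulDerivation_prod, map_sum]
  rfl

/-- On products of elements of degree one, `dpEval` is `n!` times the multiplication; this is the
inductive step. -/
lemma dpEval_mul_dp_one (hβ : ∀ x y z, β x (β y z) = β y (β x z)) (n : ℕ)
    (γ : DividedPowerAlgebra R M) (x : M) :
    dpEval β one (n + 1) (γ * DividedPowerAlgebra.dp R 1 x) =
      (n + 1) • β x (dpEval β one n γ) := by
  have hD : comulDerivation R M (DividedPowerAlgebra.dp R 1 x) = 1 ⊗ₜ x := by
    have := comulDerivation_dpZ (R := R) 1 x
    rwa [show (1 : ℤ) = ((1 : ℕ) : ℤ) from rfl, dpZ_natCast, Nat.cast_one, sub_self,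
      show (0 : ℤ) = ((0 : ℕ) : ℤ) from rfl, dpZ_natCast, DividedPowerAlgebra.dp_zero] at this
  have hx (γ : DividedPowerAlgebra R M) :
      γ • ((1 : DividedPowerAlgebra R M) ⊗ₜ[R] x) = γ ⊗ₜ x := by
    rw [smul_tmul', smul_eq_mul, mul_one]
  have haug : dpAug R M (DividedPowerAlgebra.dp R 1 x) = 0 := by
    have := dpAug_dpZ (R := R) 1 x
    rwa [show (1 : ℤ) = ((1 : ℕ) : ℤ) from rfl, dpZ_natCast] at this
  induction n generalizing γ with
  | zero =>
    rw [dpEval_succ, Derivation.leibniz, hD, hx, map_add, zero_add, one_smul, lift.tmul]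
    refine add_eq_left.2 ?_
    induction comulDerivation R M γ with
    | zero => rw [smul_zero, map_zero]
    | add a b ha hb => rw [smul_add, map_add, ha, hb, add_zero]
    | tmul a b =>
      rw [smul_tmul', smul_eq_mul, lift.tmul, LinearMap.comp_apply, dpEval_zero, map_mul, haug,
        zero_mul, zero_smul, map_zero, LinearMap.zero_apply]
  | succ n ih =>
    rw [dpEval_succ, Derivation.leibniz, hD, hx, map_add, lift.tmul, add_comm, add_smul (n + 1) 1,
      one_smul]
    congr 1
    rw [dpEval_succ]
    induction comulDerivation R M γ with
    | zero => rw [smul_zero, map_zero, map_zero, map_zero, smul_zero]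
    | add a b ha hb => rw [smul_add, map_add, ha, hb, map_add, map_add, smul_add]
    | tmul a b =>
      rw [smul_tmul', smul_eq_mul, lift.tmul, lift.tmul, LinearMap.comp_apply,
        LinearMap.comp_apply, mul_comm, ih, LinearMap.flip_apply,
        LinearMap.flip_apply, map_nsmul, hβ]

lemma dpEval_prod_dp_one (hβ : ∀ x y z, β x (β y z) = β y (β x z))
    (P : ∀ r : ℕ, (Fin r → M) → M) (hP₀ : ∀ x, P 0 x = one)
    (hP : ∀ r x, P (r + 1) x = β (x (Fin.last r)) (P r (Fin.init x))) (r : ℕ) (x : Fin r → M) :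
    dpEval β one r (∏ k, DividedPowerAlgebra.dp R 1 (x k)) = r.factorial • P r x := by
  induction r with
  | zero => rw [dpEval_zero, hP₀]; simp
  | succ r ih =>
    rw [Fin.prod_univ_castSucc, dpEval_mul_dp_one β one hβ, hP, Nat.factorial_succ, mul_smul]
    congr 1
    exact (congr_arg (β _) (ih (Fin.init x))).trans (map_nsmul _ _ _)

/-- The derivation property of `dpEval`: for a derivation `d` of the algebra `M`, it is the
formula `d(x₁^{e₁} ⋯ x_r^{e_r}) = ∑ₖ eₖ x₁^{e₁} ⋯ xₖ^{eₖ - 1} ⋯ x_r^{e_r} dxₖ`. -/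
lemma map_dpEval_succ_prod {N : Type u} [AddCommGroup N] [Module R N] (α : M →ₗ[R] N →ₗ[R] N)
    (d : M →ₗ[R] N) (hd : ∀ x y, d (β x y) = α x (d y) + α y (d x)) (hone : d one = 0)
    (hα : ∀ x y z, α (β x y) z = α x (α y z)) (n : ℕ) {r : ℕ} (e : Fin r → ℤ) (x : Fin r → M) :
    d (dpEval β one (n + 1) (∏ k, dpZ R (e k) (x k))) = (n + 1) •
      ∑ k, α (dpEval β one n (∏ l, dpZ R (e l - if l = k then 1 else 0) (x l))) (d (x k)) := by
  induction n generalizing e with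
  | zero =>
    rw [dpEval_succ_prod, map_sum, zero_add, one_smul]
    refine Finset.sum_congr rfl fun k _ ↦ ?_
    rw [hd, dpEval_zero, map_smul, hone, smul_zero, map_zero, zero_add]
  | succ n ih =>
    rw [dpEval_succ_prod, map_sum, add_smul (n + 1) 1, one_smul,
      Finset.sum_congr rfl fun k _ ↦ hd _ _, Finset.sum_add_distrib]
    congr 1
    rw [Finset.sum_congr rfl fun k _ ↦ congr_arg (α (x k)) (ih _)]
    simp only [map_nsmul, map_sum]
    rw [← Finset.smul_sum, Finset.sum_comm]
    congr 1
    refine Finset.sum_congr rfl fun k _ ↦ ?_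
    rw [dpEval_succ_prod, map_sum, LinearMap.sum_apply]
    refine Finset.sum_congr rfl fun l _ ↦ ?_
    rw [hα]
    simp only [sub_right_comm _ (if _ = k then (1 : ℤ) else 0)]

/-- `dpEval` is natural for semilinear homomorphisms of algebras. -/
lemma map_dpEval {S : Type u} [CommRing S] {σ : R →+* S} {N : Type u} [AddCommGroup N] [Module S N]
    (β' : N →ₗ[S] N →ₗ[S] N) (one' : N) (g : M →ₛₗ[σ] N) (hg : ∀ x y, g (β x y) = β' (g x) (g y))
    (hone : g one = one') (n : ℕ) (γ : DividedPowerAlgebra R M) :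
    g (dpEval β one n γ) = dpEval β' one' n (dpAlgMap g γ) := by
  induction γ using dp_induction with
  | add a b ha hb => simp only [map_add, ha, hb]
  | smul c a ha => rw [map_smul, map_smulₛₗ, ha, dpAlgMap_smul, map_smul]
  | prod r e x =>
    suffices ∀ e : Fin r → ℤ, g (dpEval β one n (∏ k, dpZ R (e k) (x k))) =
        dpEval β' one' n (dpAlgMap g (∏ k, dpZ R (e k) (x k))) by
      simpa only [dpZ_natCast] using this fun k ↦ e k
    clear e
    intro e
    induction n generalizing e with
    | zero =>
      rw [dpEval_zero, dpEval_zero, map_smulₛₗ, hone, dpAlgMap_prod, map_prod, map_prod, map_prod]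
      congr 1
      refine Finset.prod_congr rfl fun k _ ↦ ?_
      rw [dpAug_dpZ, dpAug_dpZ]
      split_ifs <;> simp
    | succ n ih =>
      rw [dpAlgMap_prod, dpEval_succ_prod, dpEval_succ_prod, map_sum]
      refine Finset.sum_congr rfl fun k _ ↦ ?_
      rw [hg, ih, dpAlgMap_prod]

end DividedPowersOfAlgebra

/-! ### The multiplication maps on sections -/

section MultiplicationMaps

variable {C : Type u} [SmallCategory C] {J : GrothendieckTopology C}
  {A : Sheaf J CommRingCat.{u}}

lemma hom_ext_toShf {M : PMod A.obj} {N : Mod A} {φ ψ : (shf A).obj M ⟶ N}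
    (h : ∀ (U : Cᵒᵖ) (x : M.obj U), ap φ (toShf x) = ap ψ (toShf x)) : φ = ψ := by
  refine ap_ext fun U s ↦ eq_of_loc ?_
  refine (loc_exists_toShf s).mono fun V f ⟨x, hx⟩ ↦ ?_
  rw [← ap_rs, ← ap_rs, ← hx, h]

/-- The morphism out of a sheafification given by a morphism of presheaves of modules. -/
noncomputable def shfLift {M : PMod A.obj} {N : Mod A} (φ : M ⟶ N.val) : (shf A).obj M ⟶ N :=
  ((PresheafOfModules.sheafificationAdjunction (𝟙 (ringSheaf A).obj)).homEquiv _ _).symm φ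

lemma ap_shfLift {M : PMod A.obj} {N : Mod A} (φ : M ⟶ N.val) {U : Cᵒᵖ} (x : M.obj U) :
    ap (shfLift φ) (toShf x) = appₗ φ U x := by
  have := ((PresheafOfModules.sheafificationAdjunction (𝟙 (ringSheaf A).obj)).homEquiv
    M N).apply_symm_apply φ
  rw [Adjunction.homEquiv_unit] at this
  exact congr(appₗ $this U x)

namespace CDGA

variable {K : CDGA A} {U : Cᵒᵖ}

lemma mul_comm_zero {i : ℕ} (s : (K.cx.X 0).val.obj U) (x : (K.cx.X i).val.obj U) :
    K.mul U (zero_add i) s x = K.mul U (add_zero i) x s := by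
  rw [K.mul_comm U (zero_add i) (add_zero i), zero_mul, pow_zero, one_smul]

lemma mul_eq_zero_of_factor {r : ℕ} {p : (K.cx.X r).val.obj U} {v w : (K.cx.X 1).val.obj U}
    (h : K.mul U (rfl : r + 1 = r + 1) p w = 0) :
    K.mul U (rfl : r + 1 + 1 = r + 1 + 1) (K.mul U rfl p v) w = 0 := by
  rw [K.mul_assoc U rfl (rfl : 1 + 1 = 2) rfl rfl,
    K.mul_comm U (rfl : 1 + 1 = 2) (rfl : 1 + 1 = 2) v w, map_zsmul,
    ← K.mul_assoc U (rfl : r + 1 = r + 1) (rfl : 1 + 1 = 2) rfl rfl, h, map_zero,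
    LinearMap.zero_apply, smul_zero]

/-- If `w² = 0`, a product of elements of degree one with a factor `w` is killed by `w`. -/
lemma prodOne_mul_eq_zero {w : (K.cx.X 1).val.obj U}
    (hw : K.mul U one_add_one_eq_two w w = 0) {r : ℕ} (z : Fin r → (K.cx.X 1).val.obj U)
    {k : Fin r} (hk : z k = w) : K.mul U rfl (prodOne z) w = 0 := by
  induction r with
  | zero => exact k.elim0
  | succ r ih =>
    induction k using Fin.lastCases with
    | last =>
      change K.mul U rfl (K.mul U rfl (prodOne (Fin.init z)) (z (Fin.last _))) w = 0
      rw [K.mul_assoc U rfl one_add_one_eq_two rfl rfl, hk, hw, map_zero]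
    | cast k => exact mul_eq_zero_of_factor (ih (Fin.init z) hk)

lemma prodOne_eq_zero {r : ℕ} (z : Fin r → (K.cx.X 1).val.obj U) {k l : Fin r} (h : z k = z l)
    (hkl : k ≠ l) (hw : K.mul U one_add_one_eq_two (z k) (z k) = 0) : prodOne z = 0 := by
  induction r with
  | zero => exact k.elim0
  | succ r ih =>
    change K.mul U rfl (prodOne (Fin.init z)) (z (Fin.last _)) = 0
    induction k using Fin.lastCases with
    | last =>
      induction l using Fin.lastCases with
      | last => exact absurd rfl hkl
      | cast l => exact prodOne_mul_eq_zero hw (Fin.init z) (k := l) h.symm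
    | cast k =>
      induction l using Fin.lastCases with
      | last =>
        rw [← h]
        exact prodOne_mul_eq_zero hw (Fin.init z) (k := k) rfl
      | cast l =>
        rw [ih (Fin.init z) (k := k) (l := l) h (by rintro rfl; exact hkl rfl) hw, map_zero,
          LinearMap.zero_apply]

lemma prodOne_update_add {r : ℕ} (z : Fin r → (K.cx.X 1).val.obj U) (k : Fin r)
    (x y : (K.cx.X 1).val.obj U) : prodOne (Function.update z k (x + y)) =
      prodOne (Function.update z k x) + prodOne (Function.update z k y) := by
  induction r with
  | zero => exact k.elim0
  | succ r ih =>
    simp only [prodOne]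
    induction k using Fin.lastCases with
    | last => simp only [Fin.init_update_last, Function.update_self, map_add]
    | cast k =>
      simp only [Fin.init_update_castSucc, ih, map_add, LinearMap.add_apply,
        Function.update_of_ne (Fin.castSucc_ne_last k).symm]

lemma prodOne_update_smul {r : ℕ} (z : Fin r → (K.cx.X 1).val.obj U) (k : Fin r)
    (c : A.obj.obj U) (x : (K.cx.X 1).val.obj U) : prodOne (Function.update z k (c • x)) =
      c • prodOne (Function.update z k x) := by
  induction r with
  | zero => exact k.elim0
  | succ r ih =>
    simp only [prodOne]
    induction k using Fin.lastCases with
    | last =>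
      simp only [Fin.init_update_last, Function.update_self]
      exact map_smul _ _ _
    | cast k =>
      simp only [Fin.init_update_castSucc, ih,
        Function.update_of_ne (Fin.castSucc_ne_last k).symm]
      rw [map_smul, LinearMap.smul_apply]

lemma prodOne_cons {r : ℕ} (h : 1 + r = r + 1) (x : (K.cx.X 1).val.obj U)
    (z : Fin r → (K.cx.X 1).val.obj U) :
    prodOne (Fin.cons x z : Fin (r + 1) → (K.cx.X 1).val.obj U) = K.mul U h x (prodOne z) := by
  induction r with
  | zero => exact (K.one_mul U x).trans (K.mul_one U x).symm
  | succ r ih =>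
    have h₁ : Fin.init (Fin.cons x z : Fin (r + 2) → (K.cx.X 1).val.obj U) =
        (Fin.cons x (Fin.init z) : Fin (r + 1) → (K.cx.X 1).val.obj U) := by
      ext k
      refine Fin.cases rfl (fun k ↦ rfl) k
    have h₂ : (Fin.cons x z : Fin (r + 2) → (K.cx.X 1).val.obj U) (Fin.last _) =
      z (Fin.last _) := rfl
    change K.mul U rfl (prodOne (Fin.init (Fin.cons x z : Fin (r + 2) → (K.cx.X 1).val.obj U)))
      ((Fin.cons x z : Fin (r + 2) → (K.cx.X 1).val.obj U) (Fin.last _)) =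
        K.mul U h x (K.mul U rfl _ _)
    rw [h₁, h₂, ih (by lia), K.mul_assoc U (by lia) rfl (by lia) (by lia)]

lemma d_one : ap (K.cx.d 0 1) (ap K.unit (1 : A.obj.obj U)) = 0 := by
  have : ap (K.unit ≫ K.cx.d 0 1) (1 : A.obj.obj U) = 0 := by rw [K.unit_d]; rfl
  exact this

lemma d_prodOne {r : ℕ} (z : Fin r → (K.cx.X 1).val.obj U) (hz : ∀ k, ap (K.cx.d 1 2) (z k) = 0) :
    ap (K.cx.d r (r + 1)) (prodOne z) = 0 := by
  induction r with
  | zero => exact d_one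
  | succ r ih =>
    change ap _ (K.mul U rfl _ _) = 0
    rw [K.leibniz U (rfl : r + 1 = r + 1) rfl rfl, hz, map_zero, smul_zero, add_zero,
      ih (Fin.init z) fun k ↦ hz _, map_zero, LinearMap.zero_apply]

lemma rs_unit {V : Cᵒᵖ} (f : U ⟶ V) : rs (K.cx.X 0) f (ap K.unit (1 : A.obj.obj U)) =
    ap K.unit (1 : A.obj.obj V) :=
  (ap_rs K.unit f _).symm.trans (congr_arg (ap K.unit) (map_one (A.obj.map f).hom))

lemma rs_prodOne {V : Cᵒᵖ} (f : U ⟶ V) {r : ℕ} (z : Fin r → (K.cx.X 1).val.obj U) :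
    rs _ f (prodOne z) = prodOne fun k ↦ rs _ f (z k) := by
  induction r with
  | zero => exact rs_unit f
  | succ r ih =>
    refine (K.mul_rs f rfl _ _).trans ?_
    rw [ih]
    rfl

lemma d_z1Val (z : K.Z1.val.obj U) : ap (K.cx.d 1 2) (K.z1Val z) = 0 := by
  rw [z1Val, ← ap_comp, K.cx.iCycles_d]
  rfl

lemma z1Val_del (x : (K.cx.X 0).val.obj U) : K.z1Val (ap K.del x) = ap (K.cx.d 0 1) x := by
  rw [z1Val, ← ap_comp, del, K.cx.toCycles_i]

/-- The square of every section of `Z¹(K)` vanishes, a condition which is only imposed if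
products of at least two such sections occur among those with `i` factors. -/
def SquareZero (K : CDGA A) (i : ℕ) : Prop :=
  2 ≤ i → ∀ (U : Cᵒᵖ) (z : K.Z1.val.obj U),
    K.mul U (one_add_one_eq_two) (K.z1Val z) (K.z1Val z) = 0

variable (U) in
/-- The product `Z¹(K)ⁱ → Kⁱ` as an alternating map. -/
noncomputable def prodOneAlt {i : ℕ} (hK : K.SquareZero i) :
    (K.Z1.val.obj U) [⋀^Fin i]→ₗ[A.obj.obj U] (K.cx.X i).val.obj U where
  toFun z := prodOne fun k ↦ K.z1Val (z k)
  map_update_add' z k x y := by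
    rename_i inst
    obtain rfl := Subsingleton.elim inst (instDecidableEqFin i)
    have h (v : K.Z1.val.obj U) : (fun l ↦ K.z1Val (Function.update z k v l)) =
        Function.update (fun l ↦ K.z1Val (z l)) k (K.z1Val v) :=
      funext fun l ↦ Function.apply_update (fun _ ↦ K.z1Val) z k v l
    simp only [h]
    exact (congr_arg (fun t ↦ prodOne (Function.update (fun l ↦ K.z1Val (z l)) k t))
      (ap_add _ x y)).trans (prodOne_update_add _ _ _ _)
  map_update_smul' z k c x := by
    rename_i inst
    obtain rfl := Subsingleton.elim inst (instDecidableEqFin i)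
    have h (v : K.Z1.val.obj U) : (fun l ↦ K.z1Val (Function.update z k v l)) =
        Function.update (fun l ↦ K.z1Val (z l)) k (K.z1Val v) :=
      funext fun l ↦ Function.apply_update (fun _ ↦ K.z1Val) z k v l
    simp only [h]
    exact (congr_arg (fun t ↦ prodOne (Function.update (fun l ↦ K.z1Val (z l)) k t))
      (ap_smul _ c x)).trans (prodOne_update_smul _ _ _ _)
  map_eq_zero_of_eq' z k l h hkl :=
    prodOne_eq_zero _ (congr_arg K.z1Val h) hkl (hK (by lia) U _)

variable (U) in
/-- The multiplication map `Λⁱ(Z¹(K)(U)) → Kⁱ(U)`. -/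
noncomputable def extProd {i : ℕ} (hK : K.SquareZero i) :
    ⋀[A.obj.obj U]^i (K.Z1.val.obj U) →ₗ[A.obj.obj U] (K.cx.X i).val.obj U :=
  exteriorPower.alternatingMapLinearEquiv (prodOneAlt U hK)

lemma extProd_ιMulti {i : ℕ} (hK : K.SquareZero i) (z : Fin i → K.Z1.val.obj U) :
    extProd U hK (exteriorPower.ιMulti _ i z) = prodOne fun k ↦ K.z1Val (z k) :=
  exteriorPower.alternatingMapLinearEquiv_apply_ιMulti _ _

lemma extProd_wedge {i : ℕ} (hK : K.SquareZero i) (hK' : K.SquareZero (i + 1)) (h : 1 + i = i + 1)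
    (x : K.Z1.val.obj U) (y : ⋀[A.obj.obj U]^i (K.Z1.val.obj U)) :
    extProd U hK' (wedge (A.obj.obj U) _ i x y) = K.mul U h (K.z1Val x) (extProd U hK y) := by
  suffices extProd U hK' ∘ₗ wedge (A.obj.obj U) _ i x =
      K.mul U h (K.z1Val x) ∘ₗ extProd U hK from DFunLike.congr_fun this y
  refine extPow_ext (N := (K.cx.X (i + 1)).val.obj U) fun z ↦ ?_
  rw [LinearMap.comp_apply, LinearMap.comp_apply, wedge_ιMulti, extProd_ιMulti, extProd_ιMulti,
    ← prodOne_cons h]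
  congr 1
  ext k
  refine Fin.cases rfl (fun k ↦ rfl) k

lemma d_extProd {i : ℕ} (hK : K.SquareZero i) (y : ⋀[A.obj.obj U]^i (K.Z1.val.obj U)) :
    ap (K.cx.d i (i + 1)) (extProd U hK y) = 0 := by
  suffices appₗ (K.cx.d i (i + 1)).val U ∘ₗ extProd U hK = 0 from DFunLike.congr_fun this y
  refine extPow_ext (N := (K.cx.X (i + 1)).val.obj U) fun z ↦ ?_
  rw [LinearMap.comp_apply, extProd_ιMulti]
  exact d_prodOne _ fun k ↦ d_z1Val _

lemma rs_extProd {i : ℕ} (hK : K.SquareZero i) {V : Cᵒᵖ} (f : U ⟶ V)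
    (y : ⋀[A.obj.obj U]^i (K.Z1.val.obj U)) :
    rs _ f (extProd U hK y) = extProd V hK (extMap (res K.Z1.val f) i y) := by
  suffices (res (K.cx.X i).val f).comp (extProd U hK) =
    (extProd V hK).comp (extMap (res K.Z1.val f) i) from DFunLike.congr_fun this y
  refine extPow_ext (N := (K.cx.X i).val.obj V) fun z ↦ ?_
  rw [LinearMap.comp_apply, LinearMap.comp_apply, extMap_ιMulti, extProd_ιMulti, extProd_ιMulti]
  refine (rs_prodOne f _).trans ?_
  congr 1
  ext k
  exact (ap_rs (K.cx.iCycles 1) f (z k)).symm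

variable (U) in
/-- The map `Λⁱ(Z¹(K)) ⊗ Γ^{q-i}(K⁰) → Kⁱ` which, for `n = q - i`, is `n!` times the
multiplication map. -/
noncomputable def mulPre {i : ℕ} (hK : K.SquareZero i) (q n : ℕ) :
    KosX (A.obj.obj U) (K.Z1.val.obj U) ((K.cx.X 0).val.obj U) q i →ₗ[A.obj.obj U]
      (K.cx.X i).val.obj U :=
  TensorProduct.lift ((K.mul U (add_zero i)).compl₁₂ (extProd U hK)
    (dpEval (K.mul U (zero_add 0)) (ap K.unit (1 : A.obj.obj U)) n ∘ₗ Submodule.subtype _))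

lemma mulPre_tmul {i : ℕ} (hK : K.SquareZero i) (q n : ℕ)
    (y : ⋀[A.obj.obj U]^i (K.Z1.val.obj U))
    (γ : DPow (A.obj.obj U) ((K.cx.X 0).val.obj U) ((q : ℤ) - i)) :
    mulPre U hK q n (y ⊗ₜ γ) = K.mul U (add_zero i) (extProd U hK y)
      (dpEval (K.mul U (zero_add 0)) (ap K.unit (1 : A.obj.obj U)) n γ.1) := rfl

lemma mul_mul_comm_zero (x y z : (K.cx.X 0).val.obj U) :
    K.mul U (zero_add 0) x (K.mul U (zero_add 0) y z) =
      K.mul U (zero_add 0) y (K.mul U (zero_add 0) x z) := by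
  rw [← K.mul_assoc U (zero_add 0) (zero_add 0) (zero_add 0) (zero_add 0), mul_comm_zero x y,
    K.mul_assoc U (zero_add 0) (zero_add 0) (zero_add 0) (zero_add 0)]

lemma d_dpEval_succ_prod (n : ℕ) {r : ℕ} (e : Fin r → ℤ) (x : Fin r → (K.cx.X 0).val.obj U) :
    ap (K.cx.d 0 1) (dpEval (K.mul U (zero_add 0)) (ap K.unit (1 : A.obj.obj U)) (n + 1)
      (∏ k, dpZ (A.obj.obj U) (e k) (x k))) = (n + 1) •
      ∑ k, K.mul U (zero_add 1) (dpEval (K.mul U (zero_add 0)) (ap K.unit (1 : A.obj.obj U)) n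
        (∏ l, dpZ (A.obj.obj U) (e l - if l = k then 1 else 0) (x l)))
          (ap (K.cx.d 0 1) (x k)) := by
  refine map_dpEval_succ_prod _ _ (K.mul U (zero_add 1)) (appₗ (K.cx.d 0 1).val U) (fun x y ↦ ?_)
    d_one (fun x y z ↦ ?_) n e x
  · refine (K.leibniz U (zero_add 0) (add_zero 1) (zero_add 1) x y).trans ?_
    exact (congr_arg₂ (· + ·) (mul_comm_zero y _).symm (by rw [pow_zero, one_smul]; rfl)).trans
      (add_comm _ _)
  · exact K.mul_assoc U (zero_add 0) (zero_add 1) (zero_add 1) (zero_add 1) x y z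

/-- The sign in the Leibniz rule is the one for moving `v` to the front. -/
lemma sign_smul_mul_mul {i : ℕ} (h : 1 + i = i + 1) (p : (K.cx.X i).val.obj U)
    (s : (K.cx.X 0).val.obj U) (v : (K.cx.X 1).val.obj U) :
    (-1 : ℤ) ^ i • K.mul U (rfl : i + 1 = i + 1) p (K.mul U (zero_add 1) s v) =
      K.mul U (add_zero (i + 1)) (K.mul U h v p) s := by
  have hs : (-1 : ℤ) ^ i * (-1) ^ (i * 1) = 1 := by
    rw [_root_.mul_one, ← mul_pow, neg_one_mul, neg_neg, one_pow]
  rw [mul_comm_zero, K.mul_comm U rfl h, smul_smul, hs, one_smul,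
    K.mul_assoc U (add_zero 1) (zero_add i) h h, mul_comm_zero,
    K.mul_assoc U h (add_zero i) (add_zero (i + 1)) h]

lemma d_mul_mulPre {i n : ℕ} (h : 1 + i = i + 1) (p : (K.cx.X i).val.obj U)
    (hp : ap (K.cx.d i (i + 1)) p = 0) {r : ℕ} (e : Fin r → ℤ)
    (x : Fin r → (K.cx.X 0).val.obj U) :
    ap (K.cx.d i (i + 1)) (K.mul U (add_zero i) p
      (dpEval (K.mul U (zero_add 0)) (ap K.unit (1 : A.obj.obj U)) (n + 1)
        (∏ k, dpZ (A.obj.obj U) (e k) (x k)))) =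
    (n + 1) • ∑ k, K.mul U (add_zero (i + 1)) (K.mul U h (ap (K.cx.d 0 1) (x k)) p)
      (dpEval (K.mul U (zero_add 0)) (ap K.unit (1 : A.obj.obj U)) n
        (∏ l, dpZ (A.obj.obj U) (e l - if l = k then 1 else 0) (x l))) := by
  refine (K.leibniz U (add_zero i) (add_zero (i + 1)) rfl _ _).trans ?_
  rw [hp, map_zero, LinearMap.zero_apply, zero_add]
  refine (congr_arg (fun t ↦ (-1 : ℤ) ^ i • K.mul U (rfl : i + 1 = i + 1) p t)
    (d_dpEval_succ_prod n e x)).trans ?_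
  rw [map_nsmul, smul_comm, map_sum, Finset.smul_sum]
  congr 1
  exact Finset.sum_congr rfl fun k _ ↦ sign_smul_mul_mul h _ _ _

/-- The scaled multiplication maps commute with the differentials up to the quotient `n + 1` of the
scaling factors. -/
lemma d_mulPre_succ {i : ℕ} (hK : K.SquareZero i) (hK' : K.SquareZero (i + 1)) (q n : ℕ)
    (t : KosX (A.obj.obj U) (K.Z1.val.obj U) ((K.cx.X 0).val.obj U) q i) :
    ap (K.cx.d i (i + 1)) (mulPre U hK q (n + 1) t) =
      (n + 1) • mulPre U hK' q n (kosD (appₗ K.del.val U) q i t) := by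
  suffices appₗ (K.cx.d i (i + 1)).val U ∘ₗ mulPre U hK q (n + 1) =
      (n + 1) • (mulPre U hK' q n ∘ₗ kosD (appₗ K.del.val U) q i) from DFunLike.congr_fun this t
  refine kosX_ext (N := (K.cx.X (i + 1)).val.obj U) q fun z r e x h ↦ ?_
  refine (d_mul_mulPre (add_comm 1 i) _ (d_extProd hK _) e x).trans ?_
  refine congr_arg ((n + 1) • ·) (Eq.trans ?_
    (congr_arg (mulPre U hK' q n) (kosD_tmul _ q i _ e x h)).symm)
  refine Eq.trans ?_ (map_sum (mulPre U hK' q n) _ _).symm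
  refine Finset.sum_congr rfl fun k _ ↦ ?_
  rw [mulPre_tmul, extProd_wedge hK hK' (add_comm 1 i), ← ap_eq, z1Val_del]

lemma d_mulPre_zero {i : ℕ} (hK : K.SquareZero i) (q : ℕ)
    (t : KosX (A.obj.obj U) (K.Z1.val.obj U) ((K.cx.X 0).val.obj U) q i) :
    ap (K.cx.d i (i + 1)) (mulPre U hK q 0 t) = 0 := by
  suffices appₗ (K.cx.d i (i + 1)).val U ∘ₗ mulPre U hK q 0 = 0 from DFunLike.congr_fun this t
  refine kosX_ext (N := (K.cx.X (i + 1)).val.obj U) q fun z r e x h ↦ ?_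
  rw [LinearMap.comp_apply, mulPre_tmul]
  refine (K.leibniz U (add_zero i) (add_zero (i + 1)) rfl _ _).trans ?_
  rw [d_extProd, map_zero, LinearMap.zero_apply, zero_add, dpEval_zero, ap_smul, d_one, smul_zero,
    map_zero, smul_zero]
  rfl

lemma rs_mulPre {i : ℕ} (hK : K.SquareZero i) (q n : ℕ) {V : Cᵒᵖ} (f : U ⟶ V)
    (t : KosX (A.obj.obj U) (K.Z1.val.obj U) ((K.cx.X 0).val.obj U) q i) :
    rs _ f (mulPre U hK q n t) =
      mulPre V hK q n (kosMap (res K.Z1.val f) (res (K.cx.X 0).val f) q i t) := by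
  suffices (res (K.cx.X i).val f).comp (mulPre U hK q n) = (mulPre V hK q n).comp
    (kosMap (res K.Z1.val f) (res (K.cx.X 0).val f) q i) from DFunLike.congr_fun this t
  refine kosX_ext (N := (K.cx.X i).val.obj V) q fun z r e x h ↦ ?_
  rw [LinearMap.comp_apply, LinearMap.comp_apply, kosMap, TensorProduct.map_tmul, mulPre_tmul,
    mulPre_tmul, ← rs_extProd]
  refine (K.mul_rs f (add_zero i) _ _).trans ?_
  congr 1
  exact map_dpEval _ _ _ _ (res (K.cx.X 0).val f) (fun x y ↦ K.mul_rs f (zero_add 0) x y)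
    (rs_unit f) n _

/-- On the sections `z₁ ∧ ⋯ ∧ zᵢ ⊗ x₁ ⋯ xⱼ`, the map `mulPre` is `j!` times the product. -/
lemma mulPre_dpProd {q i j : ℕ} (hK : K.SquareZero i) (h : i + j = q)
    (z : Fin i → K.Z1.val.obj U) (x : Fin j → (K.cx.X 0).val.obj U) :
    mulPre U hK q j (exteriorPower.ιMulti (A.obj.obj U) i z ⊗ₜ[A.obj.obj U]
      dpProd (R := A.obj.obj U) (by lia : (j : ℤ) = (q : ℤ) - i) x) =
    j.factorial • K.mul U (add_zero i) (prodOne fun k ↦ K.z1Val (z k)) (prodZero x) := by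
  rw [mulPre_tmul, extProd_ιMulti, ← map_nsmul]
  congr 1
  refine dpEval_prod_dp_one _ _ mul_mul_comm_zero (fun r x ↦ prodZero x) (fun _ ↦ rfl)
    (fun r x ↦ ?_) j x
  exact (mul_comm_zero _ _).symm

end CDGA

end MultiplicationMaps

/-! ### The multiplication maps as morphisms of sheaves -/

section MultiplicationMorphisms

variable {C : Type u} [SmallCategory C] {J : GrothendieckTopology C}
  {A : Sheaf J CommRingCat.{u}}

lemma ap_nsmul_hom {M N : Mod A} (φ : M ⟶ N) {U : Cᵒᵖ} (n : ℕ) (x : M.val.obj U) :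
    ap (n • φ) x = n • ap φ x := by
  induction n with
  | zero => rw [zero_smul, zero_smul, ap_zero_hom]
  | succ n ih => rw [add_smul, add_smul, ap_add_hom, ih, one_smul, one_smul]

lemma rs_nsmul (M : Mod A) {U V : Cᵒᵖ} (f : U ⟶ V) (n : ℕ) (x : M.val.obj U) :
    rs M f (n • x) = n • rs M f x := map_nsmul (res M.val f) n x

lemma toShf_nsmul {M : PMod A.obj} {U : Cᵒᵖ} (n : ℕ) (x : M.obj U) :
    (toShf (n • x) : ((shf A).obj M).val.obj U) = n • toShf x := map_nsmul (toShfₗ A M U) n x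

lemma eq_zero_of_nsmul_eq_zero {R M : Type*} [CommRing R] [AddCommGroup M] [Module R M] {n : ℕ}
    (hn : IsUnit (n : R)) {x : M} (h : n • x = 0) : x = 0 := by
  rw [← Nat.cast_smul_eq_nsmul R] at h
  exact (hn.smul_eq_zero).1 h

/-- Multiplication by an integer which is invertible on the ringed site is an isomorphism. -/
lemma isIso_nsmul_id {n : ℕ} (hn : ∀ U : Cᵒᵖ, IsUnit ((n : ℕ) : A.obj.obj U)) (M : Mod A) :
    IsIso (n • 𝟙 M) := by
  have : Mono (n • 𝟙 M) := mono_of_ap_eq_zero _ fun U x hx ↦ by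
    rw [ap_nsmul_hom, ap_id] at hx
    exact eq_zero_of_nsmul_eq_zero (hn U) hx
  have : Epi (n • 𝟙 M) := epi_of_loc _ fun U y ↦ .of_forall fun V f ↦ by
    obtain ⟨c, hc⟩ := (hn V).exists_right_inv
    refine ⟨c • rs M f y, ?_⟩
    rw [ap_nsmul_hom, ap_id, ← Nat.cast_smul_eq_nsmul (A.obj.obj V), smul_smul, hc, one_smul]
  exact isIso_of_mono_of_epi _

lemma nsmul_hom_injective {n : ℕ} (hn : ∀ U : Cᵒᵖ, IsUnit ((n : ℕ) : A.obj.obj U)) {M N : Mod A}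
    {φ ψ : M ⟶ N} (h : n • φ = n • ψ) : φ = ψ := by
  have := isIso_nsmul_id hn N
  rw [← cancel_mono (n • 𝟙 N), Preadditive.comp_nsmul, Preadditive.comp_nsmul, Category.comp_id,
    Category.comp_id, h]

lemma isUnit_factorial {m n : ℕ} (h : n ≤ m)
    (hm : ∀ U : Cᵒᵖ, IsUnit ((m.factorial : ℕ) : A.obj.obj U)) (U : Cᵒᵖ) :
    IsUnit ((n.factorial : ℕ) : A.obj.obj U) :=
  isUnit_of_dvd_unit (Nat.cast_dvd_cast (Nat.factorial_dvd_factorial h)) (hm U)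

namespace CDGA

variable {K : CDGA A}

/-- The morphism `Λⁱ(Z¹(K)) ⊗ Γ^{q-i}(K⁰) ⟶ Kⁱ` which, for `n = q - i`, is `n!` times the
multiplication map. -/
noncomputable def mulHom {i : ℕ} (hK : K.SquareZero i) (q n : ℕ) :
    (kos K.del q).X i ⟶ K.cx.X i :=
  shfLift (M := preKosX K.Z1.val (K.cx.X 0).val q i)
    (mkPModHom (fun U ↦ mulPre U hK q n) fun f x ↦ (rs_mulPre hK q n f x).symm)

lemma ap_mulHom {i : ℕ} (hK : K.SquareZero i) (q n : ℕ) {U : Cᵒᵖ}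
    (t : KosX (A.obj.obj U) (K.Z1.val.obj U) ((K.cx.X 0).val.obj U) q i) :
    ap (mulHom hK q n) (toShf (M := preKosX K.Z1.val (K.cx.X 0).val q i) t) = mulPre U hK q n t :=
  ap_shfLift _ _

lemma ap_kos_d {q i : ℕ} {U : Cᵒᵖ}
    (t : KosX (A.obj.obj U) (K.Z1.val.obj U) ((K.cx.X 0).val.obj U) q i) :
    ap ((kos K.del q).d i (i + 1)) (toShf (M := preKosX K.Z1.val (K.cx.X 0).val q i) t) =
      toShf (M := preKosX K.Z1.val (K.cx.X 0).val q (i + 1)) (kosD (appₗ K.del.val U) q i t) := by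
  rw [kos_d]
  exact ap_shf_map (preKosD _ _ _) _

lemma mulHom_succ_d {i : ℕ} (hK : K.SquareZero i) (hK' : K.SquareZero (i + 1)) (q n : ℕ) :
    mulHom hK q (n + 1) ≫ K.cx.d i (i + 1) =
      (n + 1) • ((kos K.del q).d i (i + 1) ≫ mulHom hK' q n) := by
  refine hom_ext_toShf (M := preKosX K.Z1.val (K.cx.X 0).val q i) fun U t ↦ ?_
  refine (congr_arg (ap _) (ap_mulHom hK q (n + 1) t)).trans ((d_mulPre_succ hK hK' q n t).trans ?_)
  refine Eq.trans ?_ (ap_nsmul_hom _ _ _).symm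
  refine congr_arg ((n + 1) • ·) ?_
  refine ((congr_arg (ap (mulHom hK' q n)) (ap_kos_d t)).trans (ap_mulHom hK' q n _)).symm

lemma mulHom_zero_d {i : ℕ} (hK : K.SquareZero i) (q : ℕ) :
    mulHom hK q 0 ≫ K.cx.d i (i + 1) = 0 := by
  refine hom_ext_toShf (M := preKosX K.Z1.val (K.cx.X 0).val q i) fun U t ↦ ?_
  exact (congr_arg (ap _) (ap_mulHom hK q 0 t)).trans (d_mulPre_zero hK q t)

section

variable {n : ℕ} (hn : ∀ U : Cᵒᵖ, IsUnit ((n.factorial : ℕ) : A.obj.obj U))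

/-- The multiplication map `Λⁱ(Z¹(K)) ⊗ Γⁿ(K⁰) ⟶ Kⁱ`, where `n = q - i`, if `n!` is invertible. -/
noncomputable def mulMap (hn : ∀ U : Cᵒᵖ, IsUnit ((n.factorial : ℕ) : A.obj.obj U)) {i : ℕ}
    (hK : K.SquareZero i) (q : ℕ) : (kos K.del q).X i ⟶ K.cx.X i :=
  haveI := isIso_nsmul_id hn (K.cx.X i)
  mulHom hK q n ≫ inv (n.factorial • 𝟙 (K.cx.X i))

lemma factorial_smul_mulMap {i : ℕ} (hK : K.SquareZero i) (q : ℕ) :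
    n.factorial • mulMap hn hK q = mulHom hK q n := by
  have := isIso_nsmul_id hn (K.cx.X i)
  have h : n.factorial • mulMap hn hK q = mulMap hn hK q ≫ (n.factorial • 𝟙 (K.cx.X i)) := by
    rw [Preadditive.comp_nsmul, Category.comp_id]
  rw [h, mulMap, Category.assoc, IsIso.inv_hom_id, Category.comp_id]

lemma isMulMap_mulMap {i q : ℕ} (h : i + n = q) (hK : K.SquareZero i) :
    K.IsMulMap h (mulMap hn hK q) := by
  intro U z x
  have h₁ := congr_arg (fun φ ↦ ap φ (kosSection K.del h z x)) (factorial_smul_mulMap hn hK q)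
  have h₂ := (ap_nsmul_hom (mulMap hn hK q) n.factorial (kosSection K.del h z x)).symm.trans
    (h₁.trans ((ap_mulHom hK q n _).trans (mulPre_dpProd hK h z x)))
  rw [← sub_eq_zero]
  refine eq_zero_of_nsmul_eq_zero (hn U) ?_
  rw [smul_sub, h₂, sub_self]

lemma mulMap_zero_d (h₀ : ∀ U : Cᵒᵖ, IsUnit (((0 : ℕ).factorial : ℕ) : A.obj.obj U)) {i : ℕ}
    (hK : K.SquareZero i) (q : ℕ) : mulMap h₀ hK q ≫ K.cx.d i (i + 1) = 0 := by
  refine nsmul_hom_injective h₀ ?_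
  rw [← Preadditive.nsmul_comp, factorial_smul_mulMap, mulHom_zero_d, smul_zero]

lemma mulMap_succ_d (hn' : ∀ U : Cᵒᵖ, IsUnit (((n + 1).factorial : ℕ) : A.obj.obj U)) {i : ℕ}
    (hK : K.SquareZero i) (hK' : K.SquareZero (i + 1)) (q : ℕ) :
    mulMap hn' hK q ≫ K.cx.d i (i + 1) = (kos K.del q).d i (i + 1) ≫ mulMap hn hK' q := by
  refine nsmul_hom_injective hn' ?_
  rw [← Preadditive.nsmul_comp, factorial_smul_mulMap, mulHom_succ_d hK hK', Nat.factorial_succ,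
    mul_smul, ← factorial_smul_mulMap hn hK' q, Preadditive.comp_nsmul]

/-- In the degree below the range where the multiplication maps are defined, the composition of
the differential of the Koszul complex with the multiplication map becomes a boundary after
multiplication by `n + 1`. -/
lemma exists_comp_d_eq_nsmul {i : ℕ} (hK : K.SquareZero i) (hK' : K.SquareZero (i + 1)) (q : ℕ) :
    ∃ ρ : (kos K.del q).X i ⟶ K.cx.X i, ρ ≫ K.cx.d i (i + 1) =
      (n + 1) • ((kos K.del q).d i (i + 1) ≫ mulMap hn hK' q) := by
  have := isIso_nsmul_id hn (K.cx.X i)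
  refine ⟨mulHom hK q (n + 1) ≫ inv (n.factorial • 𝟙 (K.cx.X i)), nsmul_hom_injective hn ?_⟩
  rw [← Preadditive.nsmul_comp]
  have h : n.factorial • (mulHom hK q (n + 1) ≫ inv (n.factorial • 𝟙 (K.cx.X i))) =
      mulHom hK q (n + 1) := by
    refine Eq.trans ?_ ((Category.assoc _ _ _).trans ((congr_arg _ (IsIso.inv_hom_id
      (n.factorial • 𝟙 (K.cx.X i)))).trans (Category.comp_id _)))
    rw [Preadditive.comp_nsmul, Category.comp_id]
  rw [h, mulHom_succ_d hK hK', smul_comm, ← factorial_smul_mulMap hn hK' q,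
    Preadditive.comp_nsmul]

end

end CDGA

end MultiplicationMorphisms

/-! ### Exterior powers of sheaves of modules -/

section ExteriorPowers

section Algebra

variable {R : Type u} [CommRing R] {F : Type u} [AddCommGroup F] [Module R F]

/-- The image of an element of `Λⁱ(F)` under a semilinear map only depends on the values of this map
on finitely many elements. -/
lemma exists_finset_extMap_congr {i : ℕ} (y : ⋀[R]^i F) :
    ∃ T : Finset F, ∀ {S : Type u} [CommRing S] {σ : R →+* S} {N : Type u} [AddCommGroup N]
      [Module S N] (g g' : F →ₛₗ[σ] N), (∀ k ∈ T, g k = g' k) → extMap g i y = extMap g' i y := by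
  classical
  have hy : y ∈ Submodule.span R (Set.range (exteriorPower.ιMulti R i (M := F))) := by
    rw [exteriorPower.ιMulti_span]; trivial
  induction hy using Submodule.span_induction with
  | mem y h =>
    obtain ⟨e, rfl⟩ := h
    refine ⟨Finset.univ.image e, fun g g' h ↦ ?_⟩
    rw [extMap_ιMulti, extMap_ιMulti]
    congr 1
    ext k
    exact h _ (Finset.mem_image_of_mem e (Finset.mem_univ k))
  | zero => exact ⟨∅, fun g g' _ ↦ by rw [map_zero, map_zero]⟩
  | add a b _ _ ha hb =>
    obtain ⟨T, hT⟩ := ha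
    obtain ⟨T', hT'⟩ := hb
    refine ⟨T ∪ T', fun g g' h ↦ ?_⟩
    rw [map_add, map_add, hT g g' fun k hk ↦ h k (Finset.mem_union_left _ hk),
      hT' g g' fun k hk ↦ h k (Finset.mem_union_right _ hk)]
  | smul c a _ ha =>
    obtain ⟨T, hT⟩ := ha
    exact ⟨T, fun g g' h ↦ by rw [map_smulₛₗ, map_smulₛₗ, hT g g' h]⟩

lemma exteriorPower_pi_eq_zero {k i : ℕ} {r : R} (hr : r ∈ nonZeroDivisors R)
    {y : ⋀[R]^i (Fin k → R)} (h : r • y = 0) : y = 0 := by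
  have b := (Pi.basisFun R (Fin k)).exteriorPower i
  refine b.ext_elem fun j ↦ ?_
  have := DFunLike.congr_fun (congr_arg b.repr h) j
  rw [map_smul, map_zero, Finsupp.smul_apply, Finsupp.zero_apply, smul_eq_mul] at this
  rw [map_zero, Finsupp.zero_apply]
  exact (mem_nonZeroDivisors_iff.1 hr).1 _ this

end Algebra

variable {C : Type u} [SmallCategory C] {J : GrothendieckTopology C}
  {A : Sheaf J CommRingCat.{u}}

/-- The presheaf of exterior powers of a flat sheaf of modules has locally no torsion: by the
equational criterion for flatness, a relation comes locally from a relation in an exterior power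
of a free module. -/
lemma IsFlat.loc_extMap_eq_zero {H : Mod A} (hH : IsFlat H) {i N : ℕ}
    (hN : ∀ U : Cᵒᵖ, (N : A.obj.obj U) ∈ nonZeroDivisors (A.obj.obj U)) {U : Cᵒᵖ}
    (y : ⋀[A.obj.obj U]^i (H.val.obj U)) (hy : N • y = 0) :
    Loc J U fun _ f ↦ extMap (res H.val f) i y = 0 := by
  classical
  let L := Finsupp.linearCombination (A.obj.obj U) (id : H.val.obj U → H.val.obj U)
  have hL : Function.Surjective L := Finsupp.linearCombination_id_surjective _ _
  obtain ⟨e, he⟩ := extMap_surjective L hL i y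
  have hNe : extMap L i (N • e) = 0 := by rw [map_nsmul, he, hy]
  obtain ⟨T, hT, hT'⟩ := exists_finset_extMap_eq_zero L hL hNe
  obtain ⟨T₁, hT₁⟩ := exists_finset_extMap_congr e
  refine (hH.loc_lift (𝟙 H) (T₁.biUnion Finsupp.support) id T hT).mono
    fun V f ⟨k, δ, θ, hδ, hθ⟩ ↦ ?_
  have h₀ : extMap δ i e = 0 := by
    refine exteriorPower_pi_eq_zero (hN V) ?_
    have := hT' δ hδ
    rwa [map_nsmul, ← Nat.cast_smul_eq_nsmul (A.obj.obj V)] at this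
  let Θ : (Fin k → A.obj.obj V) →ₗ[A.obj.obj V] H.val.obj V :=
    Fintype.linearCombination (A.obj.obj V) θ
  have h₁ : extMap (res H.val f) i (extMap L i e) = extMap Θ i (extMap δ i e) := by
    rw [← extMap_comp (RingHom.comp_id _) L (res H.val f) ((res H.val f).comp L) (fun _ ↦ rfl),
      ← extMap_comp (RingHom.id_comp _) δ Θ (Θ.comp δ) (fun _ ↦ rfl)]
    refine hT₁ _ _ fun t ht ↦ semilinear_congr fun x hx ↦ ?_
    have := hθ x (Finset.mem_biUnion.2 ⟨t, ht, hx⟩)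
    have hLx : L (Finsupp.single x 1) = x := by simp [L]
    rw [LinearMap.comp_apply, hLx]
    exact this
  rw [← he, h₁, h₀, map_zero]

/-- The exterior powers of a flat sheaf of modules are torsion free. -/
lemma IsFlat.extPow_eq_zero {H : Mod A} (hH : IsFlat H) {i N : ℕ}
    (hN : ∀ U : Cᵒᵖ, (N : A.obj.obj U) ∈ nonZeroDivisors (A.obj.obj U)) {U : Cᵒᵖ}
    (s : ((shf A).obj (preExt i H.val)).val.obj U) (hs : N • s = 0) : s = 0 := by
  refine eq_of_loc ?_
  refine (loc_exists_toShf (M := preExt i H.val) s).bind fun V f ⟨x, hx⟩ ↦ ?_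
  have h : toShf (M := preExt i H.val) (N • x) = toShf (M := preExt i H.val) (0 : _) := by
    refine (toShf_nsmul N x).trans ?_
    rw [hx, ← rs_nsmul, hs, rs_zero]
    exact (map_zero (toShfₗ A (preExt i H.val) V)).symm
  refine (loc_of_toShf_eq h).bind fun W g hg ↦ ?_
  have hg' : N • extMap (res H.val g) i x = 0 := by
    refine (map_nsmul (extMap (res H.val g) i) N x).symm.trans (hg.trans ?_)
    exact map_zero (res (preExt i H.val) g)
  refine (hH.loc_extMap_eq_zero hN _ hg').mono fun X k hk ↦ ?_
  rw [← Category.assoc, rs_comp, rs_comp, ← hx, rs_zero, rs_toShf, rs_toShf]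
  refine (congr_arg (toShf (M := preExt i H.val)) hk).trans ?_
  exact map_zero (toShfₗ A (preExt i H.val) X)

/-- The kernel of `Λⁱ(Z) → Λⁱ(H)` for a quotient `H` of `Z` is locally spanned by the exterior
products with a factor in the kernel of `Z → H`. -/
lemma loc_mem_span_of_extMap_eq_zero {P Z H : Mod A} (u : P ⟶ Z) (h : Z ⟶ H) [Epi h]
    (w : u ≫ h = 0) (hex : (ShortComplex.mk u h w).Exact) {i : ℕ} {U : Cᵒᵖ}
    (y : ⋀[A.obj.obj U]^i (Z.val.obj U)) (hy : extMap (appₗ h.val U) i y = 0) :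
    Loc J U fun V f ↦ extMap (res Z.val f) i y ∈ Submodule.span (A.obj.obj V)
      {z | ∃ e : Fin i → Z.val.obj V, (∃ j x, e j = ap u x) ∧
        z = exteriorPower.ιMulti (A.obj.obj V) i e} := by
  classical
  let F : (Z.val.obj U) × (H.val.obj U →₀ A.obj.obj U) →ₗ[A.obj.obj U] H.val.obj U :=
    (appₗ h.val U).coprod (Finsupp.linearCombination (A.obj.obj U) id)
  have hF : Function.Surjective F := fun x ↦ ⟨(0, Finsupp.single x 1), by simp [F]⟩
  have hFy : extMap F i (extMap (LinearMap.inl (A.obj.obj U) _ _) i y) = 0 := by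
    rw [← extMap_comp (RingHom.comp_id _) _ _ (appₗ h.val U) (fun x ↦ by simp [F]), hy]
  obtain ⟨T, hT, hT'⟩ := exists_finset_extMap_eq_zero F hF hFy
  -- lift the finitely many sections of `H` occurring in `T`
  have h₁ : Loc J U fun V f ↦ ∀ η ∈ T.biUnion fun k ↦ k.2.support,
      ∃ ζ, ap h ζ = rs H f η :=
    Loc.finset_forall _ fun η _ ↦ loc_exists_of_epi h η
  refine h₁.bind fun V f hf ↦ ?_
  let ζ : H.val.obj U → Z.val.obj V := fun η ↦ if hη : _ then (hf η hη).choose else 0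
  have hζ (η) (hη : η ∈ T.biUnion fun k ↦ k.2.support) : ap h (ζ η) = rs H f η := by
    simp only [ζ, dif_pos hη]
    exact (hf η hη).choose_spec
  let G : (Z.val.obj U) × (H.val.obj U →₀ A.obj.obj U) →ₛₗ[(A.obj.map f).hom] Z.val.obj V :=
    (res Z.val f).comp (LinearMap.fst (A.obj.obj U) _ _) +
      (semiComb (A.obj.map f).hom ζ).comp (LinearMap.snd (A.obj.obj U) _ _)
  have hG (k) (hk : k ∈ T) : ap h (G k) = 0 := by
    have h₂ : (appₗ h.val V).comp (semiComb (A.obj.map f).hom ζ) k.2 =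
        (res H.val f).comp (Finsupp.linearCombination (A.obj.obj U) id) k.2 := by
      refine semilinear_congr fun η hη ↦ ?_
      rw [LinearMap.comp_apply, LinearMap.comp_apply, semiComb_single, map_one, one_smul,
        Finsupp.linearCombination_single, one_smul]
      exact hζ η (Finset.mem_biUnion.2 ⟨k, hk, hη⟩)
    have h₃ := hT k hk
    change ap h (rs Z f k.1 + semiComb (A.obj.map f).hom ζ k.2) = 0
    rw [ap_add, ap_rs]
    refine (congr_arg (rs H f (ap h k.1) + ·) h₂).trans ?_
    refine (rs_add H f _ _).symm.trans ((congr_arg (rs H f) h₃).trans (rs_zero H f))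
  have h₄ : Loc J V fun W g ↦ ∀ k ∈ T, ∃ x, ap u x = rs Z g (G k) :=
    Loc.finset_forall _ fun k hk ↦ loc_exists_of_exact hex _ (hG k hk)
  refine h₄.mono fun W g hg ↦ ?_
  let D : Submodule (A.obj.obj W) (Z.val.obj W) := LinearMap.range (appₗ u.val W)
  have h₅ : extMap D.mkQ i (extMap (res Z.val (f ≫ g)) i y) = 0 := by
    have : RingHomCompTriple (A.obj.map f).hom (A.obj.map g).hom (A.obj.map (f ≫ g)).hom :=
      ⟨map_comp_hom f g⟩
    have h₆ := hT' (D.mkQ.comp ((res Z.val g).comp G)) fun k hk ↦ by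
      obtain ⟨x, hx⟩ := hg k hk
      rw [LinearMap.comp_apply, Submodule.mkQ_apply, Submodule.Quotient.mk_eq_zero]
      exact ⟨x, hx⟩
    rw [← extMap_comp (RingHom.comp_id _) _ _ (D.mkQ.comp (res Z.val (f ≫ g)))] at h₆
    · rw [← extMap_comp (RingHom.id_comp _) _ _ (D.mkQ.comp (res Z.val (f ≫ g))) (fun _ ↦ rfl)]
      exact h₆
    · intro x
      simp only [LinearMap.comp_apply]
      congr 1
      have hx : G (LinearMap.inl (A.obj.obj U) _ _ x) = res Z.val f x := by
        simp [G]
      rw [hx]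
      exact res_comp Z.val f g x
  refine Submodule.span_mono ?_ (mem_span_ιMulti_of_extMap_eq_zero D.mkQ D.mkQ_surjective h₅)
  rintro z ⟨e, ⟨j, hj⟩, rfl⟩
  rw [Submodule.mkQ_apply, Submodule.Quotient.mk_eq_zero] at hj
  obtain ⟨x, hx⟩ := hj
  exact ⟨e, ⟨j, x, hx.symm⟩, rfl⟩

end ExteriorPowers

/-! ### Truncations -/

section HomologyClass

variable {D : Type*} [Category* D] [Abelian D] {ι : Type*} {c : ComplexShape ι}

/-- The morphism to the homology given by a morphism to the cycles. -/
noncomputable def homologyClass (X : HomologicalComplex D c) {E : D} {i : ι} (k : E ⟶ X.X i)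
    (j : ι) (hj : c.next i = j) (w : k ≫ X.d i j = 0) : E ⟶ X.homology i :=
  X.liftCycles k j hj w ≫ X.homologyπ i

variable {X Y : HomologicalComplex D c} {E : D} {i : ι}

lemma comp_homologyClass {E' : D} (e : E' ⟶ E) (k : E ⟶ X.X i) (j : ι) (hj : c.next i = j)
    (w : k ≫ X.d i j = 0) (w' : (e ≫ k) ≫ X.d i j = 0) :
    e ≫ homologyClass X k j hj w = homologyClass X (e ≫ k) j hj w' := by
  rw [homologyClass, homologyClass, ← Category.assoc, HomologicalComplex.comp_liftCycles]

lemma homologyClass_congr {k k' : E ⟶ X.X i} (h : k = k') (j : ι) (hj : c.next i = j)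
    (w : k ≫ X.d i j = 0) (w' : k' ≫ X.d i j = 0) :
    homologyClass X k j hj w = homologyClass X k' j hj w' := by
  subst h
  rfl

lemma homologyClass_map (k : E ⟶ X.X i) (j : ι) (hj : c.next i = j) (w : k ≫ X.d i j = 0)
    (f : X ⟶ Y) (w' : (k ≫ f.f i) ≫ Y.d i j = 0) :
    homologyClass X k j hj w ≫ HomologicalComplex.homologyMap f i =
      homologyClass Y (k ≫ f.f i) j hj w' := by
  rw [homologyClass, homologyClass, Category.assoc, HomologicalComplex.homologyπ_naturality,
    ← Category.assoc, HomologicalComplex.liftCycles_comp_cyclesMap]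

lemma homologyClass_iCycles (j : ι) (hj : c.next i = j) (w : X.iCycles i ≫ X.d i j = 0) :
    homologyClass X (X.iCycles i) j hj w = X.homologyπ i := by
  have : X.liftCycles (X.iCycles i) j hj w = 𝟙 _ := by
    rw [← cancel_mono (X.iCycles i), HomologicalComplex.liftCycles_i, Category.id_comp]
  rw [homologyClass, this, Category.id_comp]

lemma homologyClass_extend {κ : Type*} {c' : ComplexShape κ} (e : c.Embedding c')
    (k : E ⟶ X.X i) (j : ι) (hj : c.next i = j) (w : k ≫ X.d i j = 0) {i' : κ} (hi : e.f i = i')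
    (j' : κ) (hj' : c'.next i' = j')
    (w' : (k ≫ (X.extendXIso e hi).inv) ≫ (X.extend e).d i' j' = 0) :
    homologyClass X k j hj w ≫ (X.extendHomologyIso e hi).inv =
      homologyClass (X.extend e) (k ≫ (X.extendXIso e hi).inv) j' hj' w' := by
  rw [homologyClass, homologyClass, Category.assoc,
    HomologicalComplex.homologyπ_extendHomologyIso_inv, ← Category.assoc]
  congr 1
  rw [← cancel_mono ((X.extend e).iCycles i'), Category.assoc,
    HomologicalComplex.extendCyclesIso_inv_iCycles, HomologicalComplex.liftCycles_i,
    HomologicalComplex.liftCycles_i_assoc]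

/-- A class with values in the lowest degree of a complex vanishes only if the cycle is zero. -/
lemma eq_zero_of_homologyClass_eq_zero (k : E ⟶ X.X i) (j : ι) (hj : c.next i = j)
    (w : k ≫ X.d i j = 0) (hX : X.d (c.prev i) i = 0) (h : homologyClass X k j hj w = 0) :
    k = 0 := by
  have := X.isIso_homologyπ (c.prev i) i rfl hX
  have h' : X.liftCycles k j hj w = 0 := by
    rw [← cancel_mono (X.homologyπ i), zero_comp]
    exact h
  rw [← X.liftCycles_i k j hj w, h', zero_comp]

lemma isZero_homology_of_isZero_X (h : IsZero (X.X i)) : IsZero (X.homology i) :=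
  ShortComplex.isZero_homology_of_isZero_X₂ (X.sc i) h

end HomologyClass

section Truncation

variable {D : Type*} [Category* D] [Abelian D]

lemma isStrictlyLE_double {E E' : D} (f : E ⟶ E') {i n : ℤ} (h : i + 1 ≤ n) :
    CochainComplex.IsStrictlyLE (HomologicalComplex.double f
      (show (ComplexShape.up ℤ).Rel i (i + 1) from rfl)) n := by
  rw [CochainComplex.isStrictlyLE_iff]
  exact fun j hj ↦ HomologicalComplex.isZero_double_X f _ j (by lia) (by lia)

/-- Morphisms from a complex in degrees `≤ n` factor through the truncation `τ_{≤ n}`. -/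
lemma exists_lift_of_isStrictlyLE {S X : CochainComplex D ℤ} {n : ℤ} [S.IsStrictlyLE n] (f : S ⟶ X)
    (i : ℤ) : ∃ ν : S.X i ⟶ (X.truncLE n).X i, ν ≫ (X.ιTruncLE n).f i = f.f i := by
  refine ⟨(inv (S.ιTruncLE n) ≫ CochainComplex.truncLEMap f n).f i, ?_⟩
  rw [← HomologicalComplex.comp_f, Category.assoc, CochainComplex.ιTruncLE_naturality,
    IsIso.inv_hom_id_assoc]

/-- In degrees below `n`, the truncation `τ_{≤ n}` agrees with the complex. A morphism `k : E ⟶ Xⁱ`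
lifts since it extends to a morphism from the complex `E = E` in degrees `i` and `i + 1`. -/
lemma exists_lift_ιTruncLE_of_lt {X : CochainComplex D ℤ} {n i : ℤ} (h : i < n) {E : D}
    (k : E ⟶ X.X i) : ∃ ν : E ⟶ (X.truncLE n).X i, ν ≫ (X.ιTruncLE n).f i = k := by
  have hr : (ComplexShape.up ℤ).Rel i (i + 1) := rfl
  have hi : i ≠ i + 1 := by lia
  have : CochainComplex.IsStrictlyLE (HomologicalComplex.double (𝟙 E) hr) n :=
    isStrictlyLE_double (𝟙 E) h
  obtain ⟨ν, hν⟩ := exists_lift_of_isStrictlyLE (n := n)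
    (HomologicalComplex.mkHomFromDouble hr hi k (k ≫ X.d i (i + 1))
    (Category.id_comp _).symm (fun _ _ ↦ by rw [Category.assoc, X.d_comp_d, comp_zero])) i
  refine ⟨(HomologicalComplex.doubleXIso₀ (𝟙 E) hr).inv ≫ ν, ?_⟩
  rw [Category.assoc, hν, HomologicalComplex.mkHomFromDouble_f₀, Iso.inv_hom_id_assoc]

/-- In degree `n`, the truncation `τ_{≤ n}` consists of the cycles. -/
lemma exists_lift_ιTruncLE_of_cycle {X : CochainComplex D ℤ} {n : ℤ} {E : D}
    (k : E ⟶ X.X n) (w : k ≫ X.d n (n + 1) = 0) :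
    ∃ ν : E ⟶ (X.truncLE n).X n, ν ≫ (X.ιTruncLE n).f n = k := by
  obtain ⟨ν, hν⟩ := exists_lift_of_isStrictlyLE (n := n)
    (HomologicalComplex.mkHomFromSingle (c := ComplexShape.up ℤ) k
      (fun j hj ↦ by obtain rfl : n + 1 = j := hj; exact w)) n
  refine ⟨(HomologicalComplex.singleObjXSelf _ n E).inv ≫ ν, ?_⟩
  rw [Category.assoc, hν, HomologicalComplex.mkHomFromSingle_f, Iso.inv_hom_id_assoc]

end Truncation

section Extension

variable {C : Type u} [SmallCategory C] {J : GrothendieckTopology C}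
  {A : Sheaf J CommRingCat.{u}}

lemma toZ_d (F : CochainComplex (Mod A) ℕ) (i j : ℕ) :
    (toZ F).d (i : ℤ) (j : ℤ) = (toZIso F i).hom ≫ F.d i j ≫ (toZIso F j).inv :=
  F.extend_d_eq _ _ _

/-- A morphism of complexes out of an extension by zero. -/
lemma exists_hom_toZ {F : CochainComplex (Mod A) ℕ} {M : CochainComplex (Mod A) ℤ}
    (g : ∀ i : ℕ, F.X i ⟶ M.X (i : ℤ))
    (hg : ∀ i : ℕ, g i ≫ M.d (i : ℤ) ((i + 1 : ℕ) : ℤ) = F.d i (i + 1) ≫ g (i + 1)) :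
    ∃ φ : toZ F ⟶ M, ∀ i : ℕ, (toZIso F i).inv ≫ φ.f (i : ℤ) = g i := by
  let f : ∀ n : ℤ, (toZ F).X n ⟶ M.X n := fun n ↦ match n with
    | Int.ofNat i => (toZIso F i).hom ≫ g i
    | Int.negSucc _ => 0
  refine ⟨{ f := f, comm' := ?_ }, fun i ↦ (toZIso F i).inv_hom_id_assoc (g i)⟩
  rintro n n' (h : n + 1 = n')
  match n with
  | Int.ofNat i =>
    obtain rfl : ((i + 1 : ℕ) : ℤ) = n' := h
    change ((toZIso F i).hom ≫ g i) ≫ M.d (i : ℤ) ((i + 1 : ℕ) : ℤ) =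
      (toZ F).d (i : ℤ) ((i + 1 : ℕ) : ℤ) ≫ (toZIso F (i + 1)).hom ≫ g (i + 1)
    rw [toZ_d, Category.assoc, Category.assoc, Category.assoc, Iso.inv_hom_id_assoc, hg]
  | Int.negSucc i =>
    refine (F.isZero_extend_X _ _ fun j ↦ ?_).eq_of_src _ _
    change (j : ℤ) ≠ Int.negSucc i
    lia

end Extension

/-! ### Morphisms between truncations -/

section TruncatedComparison

variable {C : Type u} [SmallCategory C] {J : GrothendieckTopology C}
  {A : Sheaf J CommRingCat.{u}} {F G : CochainComplex (Mod A) ℕ}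

/-- A morphism of complexes defined in degrees `[a, q]` extends by zero to a morphism to the
truncation `τ_{≥ a}` of a complex concentrated in degrees `≤ q`, if it induces zero on boundaries
in degree `a`. -/
lemma exists_hom_toZ_truncGE {a q : ℕ} (hF : ∀ i, q < i → IsZero (F.X i))
    {L : CochainComplex (Mod A) ℤ} (hL : IsZero (L.X ((q + 1 : ℕ) : ℤ)))
    (ν : ∀ i : ℕ, F.X i ⟶ L.X (i : ℤ))
    (hν : ∀ i, a ≤ i → i < q →
      F.d i (i + 1) ≫ ν (i + 1) = ν i ≫ L.d (i : ℤ) ((i + 1 : ℕ) : ℤ))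
    (hνa : ∀ i, i + 1 = a → F.d i (i + 1) ≫ ν (i + 1) ≫
      (L.πTruncGE (a : ℤ)).f ((i + 1 : ℕ) : ℤ) = 0) :
    ∃ f : toZ F ⟶ L.truncGE (a : ℤ), ∀ i : ℕ, a ≤ i → i ≤ q →
      (toZIso F i).inv ≫ f.f (i : ℤ) = ν i ≫ (L.πTruncGE (a : ℤ)).f (i : ℤ) := by
  obtain ⟨f, hf⟩ := exists_hom_toZ (F := F) (M := L.truncGE (a : ℤ))
    (fun i ↦ if a ≤ i ∧ i ≤ q then ν i ≫ (L.πTruncGE (a : ℤ)).f (i : ℤ) else 0) (fun i ↦ by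
      beta_reduce
      rcases lt_or_ge q i with hi | hi
      · exact (hF i hi).eq_of_src _ _
      rcases lt_or_ge i a with ha | ha
      · rw [if_neg (by lia), zero_comp]
        split_ifs with h
        · exact (hνa i (by lia)).symm
        · rw [comp_zero]
      · rw [if_pos ⟨ha, hi⟩, Category.assoc, HomologicalComplex.Hom.comm]
        rcases hi.lt_or_eq with hi | rfl
        · rw [if_pos ⟨by lia, by lia⟩, ← Category.assoc, ← Category.assoc, hν i ha hi]
        · rw [if_neg (by lia), comp_zero, hL.eq_of_tgt (L.d _ _) 0, zero_comp, comp_zero])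
  exact ⟨f, fun i ha hq ↦ (hf i).trans (if_pos ⟨ha, hq⟩)⟩

lemma up_int_next (i : ℕ) : (ComplexShape.up ℤ).next (i : ℤ) = ((i + 1 : ℕ) : ℤ) :=
  CochainComplex.next _ _

/-- The homology of an extension by zero. -/
noncomputable def toZHomologyIso (F : CochainComplex (Mod A) ℕ) (i : ℕ) :
    (toZ F).homology (i : ℤ) ≅ F.homology i :=
  F.extendHomologyIso ComplexShape.embeddingUpNat rfl

lemma comp_toZIso_inv_d {E : Mod A} {i : ℕ} {k : E ⟶ F.X i} (w : k ≫ F.d i (i + 1) = 0) :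
    (k ≫ (toZIso F i).inv) ≫ (toZ F).d (i : ℤ) ((i + 1 : ℕ) : ℤ) = 0 := by
  rw [toZ_d, Category.assoc, Iso.inv_hom_id_assoc, ← Category.assoc, w, zero_comp]

lemma homologyClass_toZ {E : Mod A} {i : ℕ} (k : E ⟶ F.X i) (w : k ≫ F.d i (i + 1) = 0) :
    homologyClass F k (i + 1) (CochainComplex.next _ _) w ≫ (toZHomologyIso F i).inv =
      homologyClass (toZ F) (k ≫ (toZIso F i).inv) _ (up_int_next i) (comp_toZIso_inv_d w) :=
  homologyClass_extend _ _ _ _ _ _ _ (up_int_next i) _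

lemma comp_hom_d {E : Mod A} {L M : CochainComplex (Mod A) ℤ} (f : L ⟶ M) {i j : ℤ} {k : E ⟶ L.X i}
    (w : k ≫ L.d i j = 0) : (k ≫ f.f i) ≫ M.d i j = 0 := by
  rw [Category.assoc, f.comm, ← Category.assoc, w, zero_comp]

section

variable {L T : CochainComplex (Mod A) ℤ} (ι : L ⟶ toZ G) [Mono ι] (π : L ⟶ T)

lemma lift_d_eq_zero {E : Mod A} {i : ℕ} {k : E ⟶ G.X i} (w : k ≫ G.d i (i + 1) = 0)
    {ν : E ⟶ L.X (i : ℤ)} (hν : ν ≫ ι.f (i : ℤ) = k ≫ (toZIso G i).inv) :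
    ν ≫ L.d (i : ℤ) ((i + 1 : ℕ) : ℤ) = 0 := by
  rw [← cancel_mono (ι.f ((i + 1 : ℕ) : ℤ)), zero_comp, Category.assoc, ← ι.comm, ← Category.assoc,
    hν, comp_toZIso_inv_d w]

/-- The class of a cycle of `G` which lifts to `L` agrees with the class of the lift. -/
lemma homologyClass_lift {E : Mod A} {i : ℕ} {k : E ⟶ G.X i} (w : k ≫ G.d i (i + 1) = 0)
    {ν : E ⟶ L.X (i : ℤ)} (hν : ν ≫ ι.f (i : ℤ) = k ≫ (toZIso G i).inv) :
    homologyClass G k (i + 1) (CochainComplex.next _ _) w ≫ (toZHomologyIso G i).inv =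
      homologyClass L ν _ (up_int_next i) (lift_d_eq_zero ι w hν) ≫
        HomologicalComplex.homologyMap ι (i : ℤ) := by
  rw [homologyClass_toZ, homologyClass_map _ _ _ _ _ (comp_hom_d ι (lift_d_eq_zero ι w hν))]
  exact homologyClass_congr hν.symm _ _ _ _

/-- If a cycle of `G` is a boundary, its lift to `L` vanishes in a complex `T` without boundaries in
this degree. -/
lemma lift_comp_eq_zero {E : Mod A} {i : ℕ} {k : E ⟶ G.X i} (w : k ≫ G.d i (i + 1) = 0)
    (hk : homologyClass G k (i + 1) (CochainComplex.next _ _) w = 0)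
    {ν : E ⟶ L.X (i : ℤ)} (hν : ν ≫ ι.f (i : ℤ) = k ≫ (toZIso G i).inv)
    [IsIso (HomologicalComplex.homologyMap ι (i : ℤ))]
    (hT : T.d ((ComplexShape.up ℤ).prev (i : ℤ)) (i : ℤ) = 0) : ν ≫ π.f (i : ℤ) = 0 := by
  have w' := lift_d_eq_zero ι w hν
  refine eq_zero_of_homologyClass_eq_zero _ _ (up_int_next i) (comp_hom_d π w') hT ?_
  have h := homologyClass_lift ι w hν
  rw [hk, zero_comp, ← zero_comp (f := HomologicalComplex.homologyMap ι (i : ℤ)),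
    cancel_mono] at h
  rw [← homologyClass_map ν _ (up_int_next i) w', ← h, zero_comp]

/-- The map induced on homology by a morphism `f`, in terms of a morphism `μ : Fⁱ ⟶ Gⁱ` from which
it arises. -/
lemma isIso_homologyMap_of_lift {i : ℕ} (μ : F.X i ⟶ G.X i)
    (hμ : (F.iCycles i ≫ μ) ≫ G.d i (i + 1) = 0) (ν : F.X i ⟶ L.X (i : ℤ))
    (hν : ν ≫ ι.f (i : ℤ) = μ ≫ (toZIso G i).inv) (f : toZ F ⟶ T)
    (hf : (toZIso F i).inv ≫ f.f (i : ℤ) = ν ≫ π.f (i : ℤ))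
    [IsIso (HomologicalComplex.homologyMap ι (i : ℤ))]
    [IsIso (HomologicalComplex.homologyMap π (i : ℤ))]
    (h : F.homology i ⟶ G.homology i) [IsIso h]
    (hh : F.homologyπ i ≫ h =
      homologyClass G (F.iCycles i ≫ μ) (i + 1) (CochainComplex.next _ _) hμ) :
    IsIso (HomologicalComplex.homologyMap f (i : ℤ)) := by
  have hν' : (F.iCycles i ≫ ν) ≫ ι.f (i : ℤ) = (F.iCycles i ≫ μ) ≫ (toZIso G i).inv := by
    rw [Category.assoc, hν, Category.assoc]
  have w := lift_d_eq_zero ι hμ hν'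
  have wF := F.iCycles_d i (i + 1)
  have h₁ : F.homologyπ i ≫ (toZHomologyIso F i).inv ≫ HomologicalComplex.homologyMap f (i : ℤ) =
      homologyClass L (F.iCycles i ≫ ν) _ (up_int_next i) w ≫
        HomologicalComplex.homologyMap π (i : ℤ) := by
    rw [homologyClass_map _ _ _ _ _ (comp_hom_d π w), ← Category.assoc,
      ← homologyClass_iCycles (X := F) (i + 1) (CochainComplex.next _ _) wF,
      homologyClass_toZ, homologyClass_map _ _ _ _ _ (comp_hom_d f (comp_toZIso_inv_d wF))]
    refine homologyClass_congr ?_ _ _ _ _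
    rw [Category.assoc, Category.assoc, hf]
  have h₂ : F.homologyπ i ≫ h ≫ (toZHomologyIso G i).inv =
      homologyClass L (F.iCycles i ≫ ν) _ (up_int_next i) w ≫
        HomologicalComplex.homologyMap ι (i : ℤ) := by
    rw [← Category.assoc, hh, homologyClass_lift ι hμ hν']
  have h₃ : HomologicalComplex.homologyMap f (i : ℤ) = (toZHomologyIso F i).hom ≫ h ≫
      (toZHomologyIso G i).inv ≫ inv (HomologicalComplex.homologyMap ι (i : ℤ)) ≫
        HomologicalComplex.homologyMap π (i : ℤ) := by
    rw [← cancel_epi (toZHomologyIso F i).inv, ← cancel_epi (F.homologyπ i), h₁,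
      Iso.inv_hom_id_assoc, ← Category.assoc h, ← Category.assoc (F.homologyπ i), h₂,
      Category.assoc, IsIso.hom_inv_id_assoc]
  rw [h₃]
  infer_instance

end

lemma exists_lift_toZ {i q : ℕ} (hi : i ≤ q) (μ : F.X i ⟶ G.X i)
    (hμ : i = q → μ ≫ G.d i (i + 1) = 0) :
    ∃ ν : F.X i ⟶ ((toZ G).truncLE (q : ℤ)).X (i : ℤ),
      ν ≫ ((toZ G).ιTruncLE (q : ℤ)).f (i : ℤ) = μ ≫ (toZIso G i).inv := by
  rcases hi.lt_or_eq with hi | rfl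
  · exact exists_lift_ιTruncLE_of_lt (by lia) _
  · refine exists_lift_ιTruncLE_of_cycle _ ?_
    exact comp_toZIso_inv_d (hμ rfl)

/-- The conclusion of `exists_truncation_quasiIso`, for a subcomplex `L` of `G` with the properties
of `τ_{≤ q} G`, and given lifts of the morphisms to `L`. -/
lemma exists_truncation_quasiIso_of_lift {a q : ℕ} (haq : a ≤ q)
    (hF : ∀ i, q < i → IsZero (F.X i)) (μ : ∀ i, F.X i ⟶ G.X i)
    (hμ : ∀ i, a ≤ i → i < q → F.d i (i + 1) ≫ μ (i + 1) = μ i ≫ G.d i (i + 1))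
    (hw : ∀ i, a ≤ i → i ≤ q → (F.iCycles i ≫ μ i) ≫ G.d i (i + 1) = 0)
    (H : ∀ i, a ≤ i → i ≤ q → ∃ h : F.homology i ⟶ G.homology i, IsIso h ∧
      ∀ w : (F.iCycles i ≫ μ i) ≫ G.d i (i + 1) = 0, F.homologyπ i ≫ h =
        homologyClass G (F.iCycles i ≫ μ i) (i + 1) (CochainComplex.next _ _) w)
    {L : CochainComplex (Mod A) ℤ} [L.IsStrictlyLE (q : ℤ)] (ι : L ⟶ toZ G) [Mono ι]
    (hι : ∀ i : ℕ, i ≤ q → IsIso (HomologicalComplex.homologyMap ι (i : ℤ)))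
    (ν : ∀ i : ℕ, F.X i ⟶ L.X (i : ℤ))
    (hν : ∀ i, a ≤ i → i ≤ q → ν i ≫ ι.f (i : ℤ) = μ i ≫ (toZIso G i).inv) :
    ∃ φ : (toZ F).truncGE (a : ℤ) ⟶ L.truncGE (a : ℤ), QuasiIso φ ∧
      ∀ i : ℕ, a ≤ i → i ≤ q →
        (toZIso F i).inv ≫ ((toZ F).πTruncGE (a : ℤ)).f (i : ℤ) ≫ φ.f (i : ℤ) =
          ν i ≫ (L.πTruncGE (a : ℤ)).f (i : ℤ) := by
  have hd (i : ℕ) (ha : a ≤ i) (hi : i < q) :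
      F.d i (i + 1) ≫ ν (i + 1) = ν i ≫ L.d (i : ℤ) ((i + 1 : ℕ) : ℤ) := by
    rw [← cancel_mono (ι.f ((i + 1 : ℕ) : ℤ)), Category.assoc,
      Category.assoc, hν (i + 1) (ha.trans i.le_succ) hi, ← HomologicalComplex.Hom.comm,
      ← Category.assoc (ν i), hν i ha hi.le, toZ_d, Category.assoc, Iso.inv_hom_id_assoc,
      ← Category.assoc, hμ i ha hi, Category.assoc]
  have hπ (i : ℕ) (hi : a ≤ i) :
      IsIso (HomologicalComplex.homologyMap (L.πTruncGE (a : ℤ)) (i : ℤ)) := by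
    have := CochainComplex.quasiIsoAt_πTruncGE L (a : ℤ) (i : ℤ) (Int.ofNat_le.2 hi)
    rwa [quasiIsoAt_iff_isIso_homologyMap] at this
  have hbd (i : ℕ) (hi : i + 1 = a) : F.d i (i + 1) ≫ ν (i + 1) ≫
      (L.πTruncGE (a : ℤ)).f ((i + 1 : ℕ) : ℤ) = 0 := by
    subst hi
    obtain ⟨h, -, hh⟩ := H (i + 1) le_rfl haq
    have w := hw (i + 1) le_rfl haq
    have e : F.toCycles i (i + 1) ≫ F.iCycles (i + 1) ≫ μ (i + 1) = F.d i (i + 1) ≫ μ (i + 1) := by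
      rw [F.toCycles_i_assoc]
    have w₁ : (F.d i (i + 1) ≫ μ (i + 1)) ≫ G.d (i + 1) (i + 1 + 1) = 0 := by
      rw [← e, Category.assoc, w, comp_zero]
    have h₁ : homologyClass G (F.d i (i + 1) ≫ μ (i + 1)) (i + 1 + 1)
        (CochainComplex.next _ _) w₁ = 0 := by
      have h₂ := comp_homologyClass (F.toCycles i (i + 1)) (F.iCycles (i + 1) ≫ μ (i + 1))
        (i + 1 + 1) (CochainComplex.next _ _) w (by rw [Category.assoc, w, comp_zero])
      rw [← hh w, F.toCycles_comp_homologyπ_assoc, zero_comp] at h₂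
      rw [h₂]
      exact homologyClass_congr e.symm _ _ _ _
    have := hι (i + 1) haq
    rw [← Category.assoc]
    refine lift_comp_eq_zero ι (L.πTruncGE ((i + 1 : ℕ) : ℤ)) w₁ h₁ ?_ ?_
    · rw [Category.assoc, hν _ le_rfl haq, Category.assoc]
    · refine (CochainComplex.isZero_of_isStrictlyGE (L.truncGE ((i + 1 : ℕ) : ℤ))
        ((i + 1 : ℕ) : ℤ) _ ?_).eq_of_src _ _
      rw [CochainComplex.prev]
      exact sub_one_lt _
  obtain ⟨f, hf⟩ := exists_hom_toZ_truncGE (a := a) hF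
    (L.isZero_of_isStrictlyLE (q : ℤ) _ (Int.ofNat_lt.2 q.lt_succ_self)) ν hd hbd
  have hφ : (toZ F).πTruncGE (a : ℤ) ≫ CochainComplex.truncGEMap f (a : ℤ) ≫
      inv ((L.truncGE (a : ℤ)).πTruncGE (a : ℤ)) = f := by
    rw [← Category.assoc, CochainComplex.πTruncGE_naturality, Category.assoc, IsIso.hom_inv_id,
      Category.comp_id]
  have hqi : QuasiIso (CochainComplex.truncGEMap f (a : ℤ)) := by
    rw [CochainComplex.quasiIso_truncGEMap_iff]
    intro n hn
    obtain ⟨i, rfl⟩ := Int.eq_ofNat_of_zero_le ((Int.natCast_nonneg a).trans hn)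
    have ha : a ≤ i := Int.ofNat_le.1 hn
    have := hπ i ha
    rw [quasiIsoAt_iff_isIso_homologyMap]
    rcases le_or_gt i q with hi | hi
    · have := hι i hi
      obtain ⟨h, hh, hh'⟩ := H i ha hi
      exact isIso_homologyMap_of_lift ι (L.πTruncGE (a : ℤ)) (μ i) (hw i ha hi) (ν i)
        (hν i ha hi) f (hf i ha hi) h (hh' _)
    · have h₁ : IsZero ((toZ F).homology (i : ℤ)) :=
        (isZero_homology_of_isZero_X (hF i hi)).of_iso (toZHomologyIso F i)
      have h₂ : IsZero (L.homology (i : ℤ)) :=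
        isZero_homology_of_isZero_X (L.isZero_of_isStrictlyLE (q : ℤ) (i : ℤ) (Int.ofNat_lt.2 hi))
      have h₃ := h₂.of_iso
        (asIso (HomologicalComplex.homologyMap (L.πTruncGE (a : ℤ)) (i : ℤ))).symm
      exact ⟨0, h₁.eq_of_src _ _, h₃.eq_of_src _ _⟩
  refine ⟨CochainComplex.truncGEMap f (a : ℤ) ≫ inv ((L.truncGE (a : ℤ)).πTruncGE (a : ℤ)),
    inferInstance, fun i ha hi ↦ ?_⟩
  rw [← HomologicalComplex.comp_f, hφ, hf i ha hi]

/-- Morphisms `μᵢ : Fⁱ ⟶ Gⁱ` in degrees `a ≤ i ≤ q` which commute with the differentials in this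
range and induce isomorphisms on homology (in particular, they map boundaries to boundaries in
degree `a`) define a quasi-isomorphism `τ_{≥ a} F ⟶ τ_{[a, q]} G`, if `F` is concentrated in
degrees `≤ q`. -/
lemma exists_truncation_quasiIso {a q : ℕ} (haq : a ≤ q) (hF : ∀ i, q < i → IsZero (F.X i))
    (μ : ∀ i, F.X i ⟶ G.X i)
    (hμ : ∀ i, a ≤ i → i < q → F.d i (i + 1) ≫ μ (i + 1) = μ i ≫ G.d i (i + 1))
    (hμq : μ q ≫ G.d q (q + 1) = 0)
    (H : ∀ i, a ≤ i → i ≤ q → ∃ h : F.homology i ⟶ G.homology i, IsIso h ∧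
      ∀ w : (F.iCycles i ≫ μ i) ≫ G.d i (i + 1) = 0, F.homologyπ i ≫ h =
        homologyClass G (F.iCycles i ≫ μ i) (i + 1) (CochainComplex.next _ _) w) :
    ∃ φ : (toZ F).truncGE (a : ℤ) ⟶ ((toZ G).truncLE (q : ℤ)).truncGE (a : ℤ), QuasiIso φ ∧
      ∀ i : ℕ, a ≤ i → i ≤ q → ∃ ν : F.X i ⟶ ((toZ G).truncLE (q : ℤ)).X (i : ℤ),
        ν ≫ ((toZ G).ιTruncLE (q : ℤ)).f (i : ℤ) = μ i ≫ (toZIso G i).inv ∧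
        (toZIso F i).inv ≫ ((toZ F).πTruncGE (a : ℤ)).f (i : ℤ) ≫ φ.f (i : ℤ) =
          ν ≫ (((toZ G).truncLE (q : ℤ)).πTruncGE (a : ℤ)).f (i : ℤ) := by
  have hw (i : ℕ) (ha : a ≤ i) (hq : i ≤ q) : (F.iCycles i ≫ μ i) ≫ G.d i (i + 1) = 0 := by
    rcases hq.lt_or_eq with hq | rfl
    · rw [Category.assoc, ← hμ i ha hq, HomologicalComplex.iCycles_d_assoc, zero_comp]
    · rw [Category.assoc, hμq, comp_zero]
  have hν (i : ℕ) : ∃ ν : F.X i ⟶ ((toZ G).truncLE (q : ℤ)).X (i : ℤ), a ≤ i → i ≤ q →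
      ν ≫ ((toZ G).ιTruncLE (q : ℤ)).f (i : ℤ) = μ i ≫ (toZIso G i).inv := by
    by_cases hi : i ≤ q
    · obtain ⟨ν, hν⟩ := exists_lift_toZ hi (μ i) (fun h ↦ by subst h; exact hμq)
      exact ⟨ν, fun _ _ ↦ hν⟩
    · exact ⟨0, fun _ h ↦ absurd h hi⟩
  choose ν hν using hν
  have hιm : Mono ((toZ G).ιTruncLE (q : ℤ)) := by
    rw [CochainComplex.ιTruncLE]
    infer_instance
  have hι (i : ℕ) (hi : i ≤ q) :
      IsIso (HomologicalComplex.homologyMap ((toZ G).ιTruncLE (q : ℤ)) (i : ℤ)) := by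
    have := CochainComplex.quasiIsoAt_ιTruncLE (toZ G) (q : ℤ) (i : ℤ) (Int.ofNat_le.2 hi)
    rwa [quasiIsoAt_iff_isIso_homologyMap] at this
  obtain ⟨φ, hφ, hφ'⟩ := exists_truncation_quasiIso_of_lift haq hF μ hμ hw H
    ((toZ G).ιTruncLE (q : ℤ)) hι ν hν
  exact ⟨φ, hφ, fun i ha hi ↦ ⟨ν i, hν i ha hi, hφ' i ha hi⟩⟩

end TruncatedComparison

/-! ### Koszul cycles with constant divided powers -/

section ConstantDividedPowers

variable {R : Type u} [CommRing R] {P Q : Type u} [AddCommGroup P] [Module R P]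
  [AddCommGroup Q] [Module R Q]

lemma factorial_smul_dp (n : ℕ) (x : P) :
    n.factorial • DividedPowerAlgebra.dp R n x = DividedPowerAlgebra.dp R 1 x ^ n := by
  induction n with
  | zero => simp [DividedPowerAlgebra.dp_zero]
  | succ n ih =>
    rw [pow_succ, ← ih, smul_mul_assoc, DividedPowerAlgebra.dp_mul, smul_smul,
      Nat.factorial_succ, Nat.choose_succ_self_right, mul_comm]

lemma exists_dp_eq_smul_pow {n : ℕ} (hn : IsUnit (n.factorial : R)) (x : P) :
    ∃ c : R, DividedPowerAlgebra.dp R n x = c • DividedPowerAlgebra.dp R 1 x ^ n := by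
  obtain ⟨c, hc⟩ := hn.exists_left_inv
  exact ⟨c, by rw [← factorial_smul_dp, ← Nat.cast_smul_eq_nsmul R, smul_smul, hc, one_smul]⟩

lemma exists_prod_dpZ_eq_smul_pow {n : ℕ} (hn : IsUnit (n.factorial : R)) (one : P) {r : ℕ}
    (e : Fin r → ℤ) (x : Fin r → P) (h : ∑ k, e k = n) (hx : ∀ k, ∃ a : R, x k = a • one) :
    ∃ c : R, ∏ k, dpZ R (e k) (x k) = c • DividedPowerAlgebra.dp R 1 one ^ n := by
  by_cases he : ∃ k, e k < 0
  · obtain ⟨k, hk⟩ := he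
    exact ⟨0, by rw [zero_smul, Finset.prod_eq_zero (Finset.mem_univ k) (dpZ_neg hk (x k))]⟩
  · push Not at he
    lift e to Fin r → ℕ using he
    have h' : ∑ k, e k = n := by
      beta_reduce at h
      exact_mod_cast h
    have hc (k : Fin r) : ∃ c : R, dpZ R (e k) (x k) =
        c • DividedPowerAlgebra.dp R 1 one ^ (e k) := by
      obtain ⟨a, ha⟩ := hx k
      have hk : IsUnit ((e k).factorial : R) := isUnit_of_dvd_unit (Nat.cast_dvd_cast
        (Nat.factorial_dvd_factorial (h' ▸ Finset.single_le_sum (f := e)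
          (fun _ _ ↦ Nat.zero_le _) (Finset.mem_univ k)))) hn
      obtain ⟨c, hc⟩ := exists_dp_eq_smul_pow hk one
      exact ⟨a ^ e k * c, by rw [dpZ_natCast, ha, DividedPowerAlgebra.dp_smul, hc, smul_smul]⟩
    choose c hc using hc
    refine ⟨∏ k, c k, ?_⟩
    rw [Finset.prod_congr rfl fun k _ ↦ hc k, Finset.prod_smul, Finset.prod_pow_eq_pow_sum, h']

lemma dpProd_eq {r : ℕ} {n : ℤ} (h : (r : ℤ) = n) (x : Fin r → P) :
    dpProd (R := R) h x = ⟨∏ k, dpZ R 1 (x k), prod_dpZ_mem (fun _ ↦ 1) x (by simpa using h)⟩ :=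
  Subtype.ext (by
    change ∏ k, DividedPowerAlgebra.dp R 1 (x k) = ∏ k, dpZ R 1 (x k)
    exact Finset.prod_congr rfl fun k _ ↦ (dpZ_natCast (R := R) 1 (x k)).symm)

variable (Q) in
/-- The map `Λⁱ(Q) → Λⁱ(Q) ⊗ Γ^{q-i}(P)`, `y ↦ y ⊗ p ⋯ p`. -/
noncomputable def tmulPow {q i n : ℕ} (h : (n : ℤ) = (q : ℤ) - i) (p : P) :
    ⋀[R]^i Q →ₗ[R] KosX R Q P q i :=
  (TensorProduct.mk R _ _).flip (dpProd h fun _ ↦ p)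

lemma tmulPow_apply {q i n : ℕ} (h : (n : ℤ) = (q : ℤ) - i) (p : P) (y : ⋀[R]^i Q) :
    tmulPow Q h p y = y ⊗ₜ dpProd (R := R) h fun _ ↦ p := rfl

/-- If the kernel of `v` is generated by `p`, then the elements of `Λⁱ(Q) ⊗ Γⁿ(ker v)` are of the
form `y ⊗ pⁿ`, provided that `n!` is invertible. -/
lemma kosPure_le_range_tmulPow (v : P →ₗ[R] Q) {q i n : ℕ} (h : (n : ℤ) = (q : ℤ) - i) (p : P)
    (hv : ∀ x, v x = 0 → ∃ a : R, x = a • p) (hn : IsUnit (n.factorial : R)) :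
    kosPure v q i ≤ LinearMap.range (tmulPow Q h p) := by
  rw [kosPure, Submodule.span_le]
  rintro t ⟨y, r, e, x, he, hx, rfl⟩
  obtain ⟨c, hc⟩ := exists_prod_dpZ_eq_smul_pow hn p e x (he.trans h.symm) fun k ↦ hv _ (hx k)
  refine ⟨c • exteriorPower.ιMulti R i y, ?_⟩
  rw [tmulPow_apply, smul_tmul]
  congr 1
  refine Subtype.ext (Eq.trans ?_ hc.symm)
  change c • ∏ _ : Fin n, DividedPowerAlgebra.dp R 1 p = _
  rw [Finset.prod_const, Finset.card_univ, Fintype.card_fin]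

lemma kosD_tmulPow (v : P →ₗ[R] Q) {q i n : ℕ} (h : (n : ℤ) = (q : ℤ) - i) {p : P} (hp : v p = 0)
    (y : ⋀[R]^i Q) : kosD v q i (tmulPow Q h p y) = 0 := by
  rw [tmulPow_apply, dpProd_eq]
  refine (kosD_tmul v q i y _ _ (by simpa using h)).trans ?_
  refine Finset.sum_eq_zero fun k _ ↦ ?_
  rw [hp, map_zero, LinearMap.zero_apply, zero_tmul]

/-- Koszul boundaries: `(v(x) ∧ y) ⊗ pⁿ` is the image of `y ⊗ x pⁿ` if `v(p) = 0`. -/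
lemma kosD_tmul_dpProd_cons (v : P →ₗ[R] Q) {q i n : ℕ} (h' : ((n + 1 : ℕ) : ℤ) = (q : ℤ) - i)
    (h : (n : ℤ) = (q : ℤ) - (i + 1 : ℕ)) {p : P} (hp : v p = 0) (x : P) (y : ⋀[R]^i Q) :
    kosD v q i (y ⊗ₜ dpProd (R := R) h' (Fin.cons x fun _ ↦ p)) =
      tmulPow Q h p (wedge R Q i (v x) y) := by
  rw [tmulPow_apply, dpProd_eq h']
  refine (kosD_tmul v q i y _ _ (by simpa using h')).trans ?_
  refine (Fin.sum_univ_succ _).trans ((congr_arg (_ + ·)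
    (Finset.sum_eq_zero fun k _ ↦ ?_)).trans ((add_zero _).trans ?_))
  · rw [Fin.cons_succ, hp, map_zero, LinearMap.zero_apply, zero_tmul]
  · congr 1
    refine Subtype.ext ?_
    change ∏ l : Fin (n + 1), _ = ∏ _ : Fin n, DividedPowerAlgebra.dp R 1 p
    rw [Fin.prod_univ_succ]
    have h₀ : dpZ R (1 - if (0 : Fin (n + 1)) = 0 then 1 else 0)
        ((Fin.cons x fun _ ↦ p : Fin (n + 1) → P) 0) = 1 := by
      rw [if_pos rfl, sub_self]
      exact (dpZ_natCast (R := R) 0 _).trans DividedPowerAlgebra.dp_zero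
    rw [h₀, one_mul]
    refine Finset.prod_congr rfl fun k _ ↦ ?_
    rw [if_neg (Fin.succ_ne_zero k), sub_zero]
    exact dpZ_natCast (R := R) 1 p

/-- For `v(p) = 0`, the elements `y ⊗ pⁿ` are boundaries if `y` is an exterior product with a factor
`v(x)`. -/
lemma tmulPow_mem_range_kosD (v : P →ₗ[R] Q) {q i n : ℕ} (h : (n : ℤ) = (q : ℤ) - (i + 1 : ℕ))
    {p : P} (hp : v p = 0) (e : Fin (i + 1) → Q) (j : Fin (i + 1)) (x : P) (hj : e j = v x) :
    tmulPow Q h p (exteriorPower.ιMulti R (i + 1) e) ∈ LinearMap.range (kosD v q i) := by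
  -- move the factor `v(x)` to the front
  suffices ∀ e : Fin (i + 1) → Q, e 0 = v x →
      tmulPow Q h p (exteriorPower.ιMulti R (i + 1) e) ∈ LinearMap.range (kosD v q i) by
    by_cases h₀ : j = 0
    · subst h₀
      exact this e hj
    · have h₁ := (exteriorPower.ιMulti R (i + 1) (M := Q)).map_swap e (Ne.symm h₀)
      have h₂ := this (e ∘ Equiv.swap 0 j) (by simpa using hj)
      have h₃ : exteriorPower.ιMulti R (i + 1) e =
          (-1 : R) • exteriorPower.ιMulti R (i + 1) (e ∘ Equiv.swap 0 j) := by
        refine Subtype.ext ?_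
        have h₄ : (exteriorPower.ιMulti R (i + 1) (e ∘ Equiv.swap 0 j)).1 =
          -(exteriorPower.ιMulti R (i + 1) e).1 := congr_arg Subtype.val h₁
        change _ = (-1 : R) • (exteriorPower.ιMulti R (i + 1) (e ∘ Equiv.swap 0 j)).1
        rw [h₄, neg_smul, one_smul, neg_neg]
      rw [h₃, map_smul]
      exact Submodule.smul_mem _ _ h₂
  intro e he
  refine ⟨_, (kosD_tmul_dpProd_cons v (by push_cast at h ⊢; linarith) h hp x
    (exteriorPower.ιMulti R i (Fin.tail e))).trans ?_⟩
  rw [wedge_ιMulti, ← he, Fin.cons_self_tail]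

lemma kosMap_tmulPow {S : Type u} [CommRing S] {σ : R →+* S} {P' Q' : Type u} [AddCommGroup P']
    [Module S P'] [AddCommGroup Q'] [Module S Q'] (g : Q →ₛₗ[σ] Q') (f : P →ₛₗ[σ] P') {q i n : ℕ}
    (h : (n : ℤ) = (q : ℤ) - i) (p : P) (y : ⋀[R]^i Q) :
    kosMap g f q i (tmulPow Q h p y) = tmulPow Q' h (f p) (extMap g i y) := by
  rw [tmulPow_apply, tmulPow_apply, kosMap, TensorProduct.map_tmul, dpProd_eq, dpProd_eq]
  congr 1
  exact dpMap_prod f (fun _ ↦ 1) (fun _ ↦ p) (by simpa using h)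

end ConstantDividedPowers

/-! ### The cohomology of the Koszul complex of an abstract Koszul complex -/

section KoszulCohomology

variable {C : Type u} [SmallCategory C] {J : GrothendieckTopology C}
  {A : Sheaf J CommRingCat.{u}}

section Homology

variable {F : CochainComplex (Mod A) ℕ} {i : ℕ} {U : Cᵒᵖ}

lemma ap_homologyπ_eq_zero (c : (F.cycles i).val.obj U) (i' : ℕ) (b : (F.X i').val.obj U)
    (h : ap (F.iCycles i) c = ap (F.d i' i) b) : ap (F.homologyπ i) c = 0 := by
  have hc : c = ap (F.toCycles i' i) b := by
    refine ap_injective (F.iCycles i) U ?_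
    rw [h, ← ap_comp, F.toCycles_i]
  rw [hc, ← ap_comp, F.toCycles_comp_homologyπ]
  rfl

lemma ap_homologyClass_eq_zero {E : Mod A} (k : E ⟶ F.X i) (w : k ≫ F.d i (i + 1) = 0)
    (y : E.val.obj U) (i' : ℕ) (b : (F.X i').val.obj U) (h : ap k y = ap (F.d i' i) b) :
    ap (homologyClass F k (i + 1) (CochainComplex.next _ _) w) y = 0 := by
  rw [homologyClass, ap_comp]
  refine ap_homologyπ_eq_zero _ i' b ?_
  rw [← ap_comp, F.liftCycles_i, h]

/-- If a cycle differs from `k y` by a boundary, its class is the class of `k y`. -/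
lemma ap_homologyπ_eq {E : Mod A} (k : E ⟶ F.X i) (w : k ≫ F.d i (i + 1) = 0)
    (y : E.val.obj U) (c : (F.cycles i).val.obj U) (i' : ℕ) (b : (F.X i').val.obj U)
    (h : ap (F.iCycles i) c = ap (F.d i' i) b + ap k y) :
    ap (homologyClass F k (i + 1) (CochainComplex.next _ _) w) y = ap (F.homologyπ i) c := by
  rw [homologyClass, ap_comp, ← sub_eq_zero, ← ap_sub]
  refine ap_homologyπ_eq_zero _ i' (-b) ?_
  rw [ap_sub, ← ap_comp, F.liftCycles_i, h]
  have : ap (F.d i' i) (-b) = - ap (F.d i' i) b := map_neg (appₗ (F.d i' i).val U) b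
  rw [this]
  abel

/-- If `ψ` and `ψ ≫ h` are epimorphisms with the same kernel, then `h` is an isomorphism. -/
lemma isIso_of_epi_comp {E X Y : Mod A} (ψ : E ⟶ X) (h : X ⟶ Y) (hψ : Epi ψ) (hE : Epi (ψ ≫ h))
    (hker : ∀ (U : Cᵒᵖ) (y : E.val.obj U), ap (ψ ≫ h) y = 0 → ap ψ y = 0) : IsIso h := by
  have : Epi h := epi_of_epi ψ h
  have : Mono h := mono_of_ap_eq_zero h fun U x hx ↦ eq_of_loc (by
    refine (loc_exists_of_epi ψ x).mono fun V f ⟨y, hy⟩ ↦ ?_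
    rw [← hy, rs_zero, hker V y]
    rw [ap_comp, hy, ap_rs, hx, rs_zero])
  exact isIso_of_mono_of_epi h

end Homology

/-- The morphism on exterior powers induced by a morphism of sheaves of modules. -/
noncomputable def extPowMap (i : ℕ) {M N : Mod A} (φ : M ⟶ N) : extPow i M ⟶ extPow i N :=
  (shf A).map (X := preExt i M.val) (Y := preExt i N.val)
    (mkPModHom (fun U ↦ extMap (appₗ φ.val U) i) fun {U V} f x ↦ by
      refine (extMap_comp (RingHom.id_comp _) (res M.val f) (appₗ φ.val V)
        ((res N.val f).comp (appₗ φ.val U)) (fun x ↦ (appₗ_res φ.val f x).symm) i x).symm.trans ?_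
      exact extMap_comp (RingHom.comp_id _) (appₗ φ.val U) (res N.val f) _ (fun _ ↦ rfl) i x)

lemma ap_extPowMap {i : ℕ} {M N : Mod A} (φ : M ⟶ N) {U : Cᵒᵖ}
    (y : ⋀[A.obj.obj U]^i (M.val.obj U)) :
    ap (extPowMap i φ) (toShf (M := preExt i M.val) y) =
      toShf (M := preExt i N.val) (extMap (appₗ φ.val U) i y) :=
  ap_shf_map _ _

lemma exists_extMap_add {R S : Type u} [CommRing R] [CommRing S] {σ : R →+* S} {M N : Type u}
    {N' : Type u} [AddCommGroup M] [Module S M] [AddCommGroup N] [Module S N] [AddCommGroup N']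
    [Module R N'] (g : M →ₗ[S] N) (g' : N' →ₛₗ[σ] N) {i : ℕ} {y z : ⋀[R]^i N'}
    (hy : ∃ x, extMap g i x = extMap g' i y) (hz : ∃ x, extMap g i x = extMap g' i z) :
    ∃ x, extMap g i x = extMap g' i (y + z) := by
  obtain ⟨x, hx⟩ := hy
  obtain ⟨x', hx'⟩ := hz
  exact ⟨x + x', by rw [map_add, map_add, hx, hx']⟩

lemma exists_extMap_smul {R S : Type u} [CommRing R] [CommRing S] {σ : R →+* S} {M N : Type u}
    {N' : Type u} [AddCommGroup M] [Module S M] [AddCommGroup N] [Module S N] [AddCommGroup N']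
    [Module R N'] (g : M →ₗ[S] N) (g' : N' →ₛₗ[σ] N) {i : ℕ} (c : R) {y : ⋀[R]^i N'}
    (h : ∃ x, extMap g i x = extMap g' i y) : ∃ x, extMap g i x = extMap g' i (c • y) := by
  obtain ⟨x, hx⟩ := h
  exact ⟨σ c • x, by rw [map_smul, map_smulₛₗ, hx]⟩

lemma loc_exists_extMap {i : ℕ} {M N : Mod A} (φ : M ⟶ N) [Epi φ] {U : Cᵒᵖ}
    (y : ⋀[A.obj.obj U]^i (N.val.obj U)) :
    Loc J U fun V f ↦ ∃ x, extMap (appₗ φ.val V) i x = extMap (res N.val f) i y := by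
  have hy : y ∈ Submodule.span (A.obj.obj U)
      (Set.range (exteriorPower.ιMulti (A.obj.obj U) i (M := N.val.obj U))) := by
    rw [exteriorPower.ιMulti_span]
    trivial
  induction hy using Submodule.span_induction with
  | mem y h =>
    obtain ⟨e, rfl⟩ := h
    refine (Loc.fintype_forall fun k ↦ loc_exists_of_epi φ (e k)).mono fun V f h ↦ ?_
    choose x hx using h
    refine ⟨exteriorPower.ιMulti _ i x, ?_⟩
    rw [extMap_ιMulti, extMap_ιMulti]
    congr 1
    exact funext hx
  | zero => exact .of_forall fun V f ↦ ⟨0, by rw [map_zero, map_zero]⟩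
  | add a b _ _ ha hb =>
    exact (ha.and hb).mono fun V f h ↦
      exists_extMap_add (appₗ φ.val V) (res N.val f) h.1 h.2
  | smul c a _ ha =>
    exact ha.mono fun V f hx ↦ exists_extMap_smul (appₗ φ.val V) (res N.val f) c hx

lemma epi_extPowMap (i : ℕ) {M N : Mod A} (φ : M ⟶ N) [Epi φ] : Epi (extPowMap i φ) :=
  epi_shf_map (M := preExt i M.val) (N := preExt i N.val) _ fun _ y ↦ loc_exists_extMap φ y

lemma hom_ext_extPow {i : ℕ} {M N : Mod A} {φ ψ : extPow i M ⟶ N}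
    (h : ∀ (U : Cᵒᵖ) (z : Fin i → M.val.obj U), ap φ (extSection z) = ap ψ (extSection z)) :
    φ = ψ := by
  refine hom_ext_toShf (M := preExt i M.val) fun U y ↦ ?_
  suffices appₗ φ.val U ∘ₗ toShfₗ A (preExt i M.val) U =
    appₗ ψ.val U ∘ₗ toShfₗ A (preExt i M.val) U from DFunLike.congr_fun this y
  exact extPow_ext (N := N.val.obj U) fun z ↦ h U z

namespace CDGA

variable {K : CDGA A}

lemma del_one (U : Cᵒᵖ) : ap K.del (ap K.unit (1 : A.obj.obj U)) = 0 := by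
  refine ap_injective (K.cx.iCycles 1) U ?_
  refine (z1Val_del (K := K) _).trans (d_one.trans (ap_zero _).symm)

/-- The kernel of `∂ : K⁰ → Z¹(K)` is generated by the unit. -/
lemma IsAbstractKoszul.exists_eq_smul_one (hK : K.IsAbstractKoszul) {U : Cᵒᵖ}
    (x : (K.cx.X 0).val.obj U) (hx : ap K.del x = 0) :
    ∃ a : A.obj.obj U, x = a • ap K.unit (1 : A.obj.obj U) := by
  have hd : ap (K.cx.d 0 1) x = 0 := by
    rw [← z1Val_del, hx]
    exact ap_zero _
  have hex : (ShortComplex.mk (K.cx.iCycles 0) (K.cx.d 0 1) (K.cx.iCycles_d 0 1)).Exact :=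
    ShortComplex.exact_of_f_is_kernel _ (K.cx.cyclesIsKernel 0 1 (CochainComplex.next _ _))
  have : Mono (ShortComplex.mk (K.cx.iCycles 0) (K.cx.d 0 1) (K.cx.iCycles_d 0 1)).f :=
    inferInstanceAs (Mono (K.cx.iCycles 0))
  obtain ⟨c, hc⟩ := exists_ap_eq_of_exact hex x hd
  have := hK.isIso_toH0
  have hπ : IsIso (K.cx.homologyπ 0) :=
    K.cx.isIso_homologyπ _ 0 rfl (K.cx.shape _ _ (by simp))
  let a : (SheafOfModules.unit (ringSheaf A)).val.obj U :=
    ap (inv K.toH0) (ap (K.cx.homologyπ 0) c)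
  have ha : ap (K.cx.homologyπ 0) (ap (K.cx.liftCycles K.unit 1 (by simp) K.unit_d) a) =
      ap (K.cx.homologyπ 0) c := by
    rw [← ap_comp]
    change ap K.toH0 (ap (inv K.toH0) (ap (K.cx.homologyπ 0) c)) = _
    rw [← ap_comp, IsIso.inv_hom_id, ap_id]
  have hca := ap_injective (K.cx.homologyπ 0) U ha
  refine ⟨a, ?_⟩
  have h₁ : ap K.unit a = x := by
    refine Eq.trans ?_ hc
    refine Eq.trans ?_ (congr_arg (ap (K.cx.iCycles 0)) hca)
    exact (congr_arg (fun φ ↦ ap φ a) (K.cx.liftCycles_i K.unit 1 (by simp) K.unit_d)).symm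
  rw [← h₁]
  refine Eq.trans ?_ (ap_smul K.unit (M := SheafOfModules.unit (ringSheaf A)) a (1 : A.obj.obj U))
  congr 1
  exact (_root_.mul_one (M := A.obj.obj U) a).symm

section

variable {q i n : ℕ} (h : (n : ℤ) = (q : ℤ) - i)

variable (K) in
/-- The morphism `Λⁱ(Z¹(K)) ⟶ Kos^q(∂)ⁱ`, `y ↦ y ⊗ 1ⁿ`, where `n = q - i`. -/
noncomputable def constHom : extPow i K.Z1 ⟶ (kos K.del q).X i :=
  (shf A).map (X := preExt i K.Z1.val) (Y := preKosX K.Z1.val (K.cx.X 0).val q i)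
    (mkPModHom (fun U ↦ tmulPow (K.Z1.val.obj U) h (ap K.unit (1 : A.obj.obj U)))
      fun {U V} f x ↦ by
        refine Eq.trans ?_ (kosMap_tmulPow (res K.Z1.val f) (res (K.cx.X 0).val f) h _ x).symm
        exact congr_arg (fun p ↦ tmulPow (K.Z1.val.obj V) h p (extMap (res K.Z1.val f) i x))
          (rs_unit f).symm)

lemma ap_constHom {U : Cᵒᵖ} (y : ⋀[A.obj.obj U]^i (K.Z1.val.obj U)) :
    ap (K.constHom h) (toShf (M := preExt i K.Z1.val) y) =
      toShf (M := preKosX K.Z1.val (K.cx.X 0).val q i)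
        (tmulPow (K.Z1.val.obj U) h (ap K.unit (1 : A.obj.obj U)) y) :=
  ap_shf_map _ _

lemma constHom_d : K.constHom h ≫ (kos K.del q).d i (i + 1) = 0 := by
  refine hom_ext_toShf (M := preExt i K.Z1.val) fun U y ↦ ?_
  refine (congr_arg (ap ((kos K.del q).d i (i + 1))) (ap_constHom h y)).trans
    ((ap_kos_d _).trans ?_)
  exact (congr_arg (toShf (M := preKosX K.Z1.val (K.cx.X 0).val q (i + 1)))
    (kosD_tmulPow (appₗ K.del.val U) h (del_one U) y)).trans
    (map_zero (toShfₗ A (preKosX K.Z1.val (K.cx.X 0).val q (i + 1)) U))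

variable (K) in
/-- The morphism `Λⁱ(Z¹(K)) ⟶ Hⁱ(Kos^q(∂))` given by the classes of the cycles `y ⊗ 1ⁿ`. -/
noncomputable def constClass : extPow i K.Z1 ⟶ (kos K.del q).homology i :=
  homologyClass (kos K.del q) (K.constHom h) (i + 1) (CochainComplex.next _ _) (constHom_d h)

lemma exists_d_eq_of_mem_kosBd {U : Cᵒᵖ}
    {c : KosX (A.obj.obj U) (K.Z1.val.obj U) ((K.cx.X 0).val.obj U) q i}
    (hc : c ∈ kosBd (appₗ K.del.val U) q i) : ∃ (i' : ℕ) (b : ((kos K.del q).X i').val.obj U),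
      toShf (M := preKosX K.Z1.val (K.cx.X 0).val q i) c = ap ((kos K.del q).d i' i) b := by
  rcases i with _ | i
  · refine ⟨0, 0, ?_⟩
    have h₀ : c = 0 := (Submodule.mem_bot _).1 hc
    rw [h₀, ap_zero]
    exact map_zero (toShfₗ A (preKosX K.Z1.val (K.cx.X 0).val q 0) U)
  · obtain ⟨t, rfl⟩ := hc
    exact ⟨i, toShf (M := preKosX K.Z1.val (K.cx.X 0).val q i) t, (ap_kos_d t).symm⟩

lemma exact_del_homologyπ : (ShortComplex.mk K.del (K.cx.homologyπ 1)
    (K.cx.toCycles_comp_homologyπ 0 1)).Exact :=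
  ShortComplex.exact_of_g_is_cokernel _
    (K.cx.homologyIsCokernel 0 1 (CochainComplex.prev_nat_succ 0))

/-- The cycles of the Koszul complex of `∂` are locally sums of boundaries and of elements of
`Λⁱ(Z¹(K)) ⊗ Γ^{q-i}(ker ∂)`. -/
lemma FlatCondition.loc_mem_kosBd_sup_kosPure (hflat : K.FlatCondition) {U : Cᵒᵖ}
    (c : KosX (A.obj.obj U) (K.Z1.val.obj U) ((K.cx.X 0).val.obj U) q i)
    (hc : kosD (appₗ K.del.val U) q i c = 0) :
    Loc J U fun V f ↦ kosMap (res K.Z1.val f) (res (K.cx.X 0).val f) q i c ∈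
      kosBd (appₗ K.del.val V) q i ⊔ kosPure (appₗ K.del.val V) q i := by
  have w₀ : image.ι (K.cx.d 0 1) ≫ K.cx.d 1 2 = 0 := by
    rw [← cancel_epi (factorThruImage (K.cx.d 0 1)), image.fac_assoc, comp_zero, K.cx.d_comp_d]
  let j : image (K.cx.d 0 1) ⟶ K.Z1 :=
    K.cx.liftCycles (image.ι (K.cx.d 0 1)) 2 (CochainComplex.next _ _) w₀
  have hj : j ≫ K.cx.iCycles 1 = image.ι (K.cx.d 0 1) := K.cx.liftCycles_i _ _ _ _
  have : Mono j := by
    have : Mono (j ≫ K.cx.iCycles 1) := by rw [hj]; infer_instance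
    exact mono_of_mono j (K.cx.iCycles 1)
  have hu : factorThruImage (K.cx.d 0 1) ≫ j = K.del := by
    rw [← cancel_mono (K.cx.iCycles 1), Category.assoc, hj, image.fac, del, K.cx.toCycles_i]
  have w : j ≫ K.cx.homologyπ 1 = 0 := by
    rw [← cancel_epi (factorThruImage (K.cx.d 0 1)), ← Category.assoc, hu, comp_zero]
    exact K.cx.toCycles_comp_homologyπ 0 1
  refine loc_kosGood hu w (exact_of_loc fun V x hx ↦ ?_) hflat.flat_image hflat.flat_homology c hc
  refine (loc_exists_of_exact (exact_del_homologyπ (K := K)) x hx).mono fun W f ⟨y, hy⟩ ↦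
    ⟨ap (factorThruImage (K.cx.d 0 1)) y, ?_⟩
  rw [← hy, ← ap_comp]
  exact congr_arg (fun φ : K.cx.X 0 ⟶ K.Z1 ↦ ap φ y) hu

/-- The cohomology of the Koszul complex of `∂` is generated by the classes of `y ⊗ 1ⁿ`. -/
lemma epi_constClass (hK : K.IsAbstractKoszul) (hflat : K.FlatCondition)
    (hn : ∀ U : Cᵒᵖ, IsUnit ((n.factorial : ℕ) : A.obj.obj U)) : Epi (K.constClass h) := by
  refine epi_of_loc _ fun U y ↦ ?_
  refine (loc_exists_of_epi ((kos K.del q).homologyπ i) y).bind fun V f ⟨c, hc⟩ ↦ ?_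
  refine (loc_exists_toShf (M := preKosX K.Z1.val (K.cx.X 0).val q i)
    (ap ((kos K.del q).iCycles i) c)).bind fun W g ⟨t, ht⟩ ↦ ?_
  have ht₀ : toShf (M := preKosX K.Z1.val (K.cx.X 0).val q (i + 1))
      (kosD (appₗ K.del.val W) q i t) =
      toShf (M := preKosX K.Z1.val (K.cx.X 0).val q (i + 1)) (0 : _) := by
    refine (ap_kos_d t).symm.trans ((congr_arg (ap ((kos K.del q).d i (i + 1))) ht).trans ?_)
    refine (ap_rs ((kos K.del q).d i (i + 1)) g _).trans ?_
    rw [← ap_comp, HomologicalComplex.iCycles_d]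
    exact (rs_zero _ g).trans
      (map_zero (toShfₗ A (preKosX K.Z1.val (K.cx.X 0).val q (i + 1)) W)).symm
  refine (loc_of_toShf_eq ht₀).bind fun X k hk ↦ ?_
  have hk' : kosD (appₗ K.del.val X) q i
      (kosMap (res K.Z1.val k) (res (K.cx.X 0).val k) q i t) = 0 := by
    refine (kosD_kosMap _ _ _ _ (fun x ↦ (appₗ_res K.del.val k x).symm) q i t).trans
      (hk.trans ?_)
    exact map_zero (res (preKosX K.Z1.val (K.cx.X 0).val q (i + 1)) k)
  refine (hflat.loc_mem_kosBd_sup_kosPure _ hk').mono fun Y l hl ↦ ?_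
  obtain ⟨b, hb, p, hp, hbp⟩ := Submodule.mem_sup.1 hl
  obtain ⟨z, rfl⟩ := kosPure_le_range_tmulPow _ h (ap K.unit (1 : A.obj.obj Y))
    (fun x hx ↦ hK.exists_eq_smul_one x hx) (hn Y) hp
  obtain ⟨i', b', hb'⟩ := exists_d_eq_of_mem_kosBd hb
  refine ⟨toShf (M := preExt i K.Z1.val) z, ?_⟩
  refine (ap_homologyπ_eq (F := kos K.del q) (K.constHom h) (constHom_d h)
    (toShf (M := preExt i K.Z1.val) z) (rs _ l (rs _ k (rs _ g c))) i' b' ?_).trans ?_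
  · rw [ap_rs, ap_rs, ap_rs, ← hb', ap_constHom h]
    refine Eq.trans (congr_arg (rs _ l) (congr_arg (rs _ k) ht.symm)) ?_
    refine Eq.trans (congr_arg (rs _ l) (rs_toShf (M := preKosX K.Z1.val (K.cx.X 0).val q i) k t))
      ((rs_toShf (M := preKosX K.Z1.val (K.cx.X 0).val q i) l _).trans ?_)
    exact (congr_arg (toShf (M := preKosX K.Z1.val (K.cx.X 0).val q i)) hbp.symm).trans
      (map_add (toShfₗ A (preKosX K.Z1.val (K.cx.X 0).val q i) Y) _ _)
  · rw [ap_rs, ap_rs, ap_rs, hc]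
    simp only [rs_comp]

end

end CDGA

end KoszulCohomology

/-! ### The comparison on cohomology -/

section CohomologyComparison

section Homology

variable {D : Type*} [Category* D] [Abelian D] {F G : CochainComplex D ℕ}

lemma homologyClass_comp_d {E : D} {i' i : ℕ} (ρ : E ⟶ G.X i')
    (w : (ρ ≫ G.d i' i) ≫ G.d i (i + 1) = 0) :
    homologyClass G (ρ ≫ G.d i' i) (i + 1) (CochainComplex.next _ _) w = 0 := by
  have h : G.liftCycles (ρ ≫ G.d i' i) (i + 1) (CochainComplex.next _ _) w =
      ρ ≫ G.toCycles i' i := by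
    rw [← cancel_mono (G.iCycles i), G.liftCycles_i, Category.assoc, G.toCycles_i]
  rw [homologyClass, h, Category.assoc, G.toCycles_comp_homologyπ, comp_zero]

lemma nsmul_homologyClass {E : D} {i : ℕ} (N : ℕ) (k : E ⟶ G.X i) (w : k ≫ G.d i (i + 1) = 0)
    (w' : (N • k) ≫ G.d i (i + 1) = 0) :
    homologyClass G (N • k) (i + 1) (CochainComplex.next _ _) w' =
      N • homologyClass G k (i + 1) (CochainComplex.next _ _) w := by
  have h : G.liftCycles (N • k) (i + 1) (CochainComplex.next _ _) w' =
      N • G.liftCycles k (i + 1) (CochainComplex.next _ _) w := by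
    rw [← cancel_mono (G.iCycles i), G.liftCycles_i, Preadditive.nsmul_comp, G.liftCycles_i]
  rw [homologyClass, h, Preadditive.nsmul_comp, homologyClass]

/-- A morphism in degree `i` which maps cycles to cycles and boundaries to boundaries induces a
morphism on homology. -/
lemma exists_homology_hom {i' i : ℕ} (hi : (ComplexShape.up ℕ).prev i = i') (μ : F.X i ⟶ G.X i)
    (w : (F.iCycles i ≫ μ) ≫ G.d i (i + 1) = 0)
    (hb : ∀ w' : (F.d i' i ≫ μ) ≫ G.d i (i + 1) = 0,
      homologyClass G (F.d i' i ≫ μ) (i + 1) (CochainComplex.next _ _) w' = 0) :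
    ∃ h : F.homology i ⟶ G.homology i, F.homologyπ i ≫ h =
      homologyClass G (F.iCycles i ≫ μ) (i + 1) (CochainComplex.next _ _) w := by
  have h₁ : F.toCycles i' i ≫ F.iCycles i ≫ μ = F.d i' i ≫ μ := by rw [F.toCycles_i_assoc]
  have w₁ : (F.toCycles i' i ≫ F.iCycles i ≫ μ) ≫ G.d i (i + 1) = 0 := by
    rw [Category.assoc, w, comp_zero]
  have w₂ : (F.d i' i ≫ μ) ≫ G.d i (i + 1) = 0 := by rw [← h₁, w₁]
  have h₂ : F.toCycles i' i ≫ homologyClass G (F.iCycles i ≫ μ) (i + 1)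
      (CochainComplex.next _ _) w = 0 := by
    rw [comp_homologyClass _ _ _ _ _ w₁, homologyClass_congr h₁ _ _ _ w₂, hb]
  exact ⟨(F.homologyIsCokernel i' i hi).desc (CokernelCofork.ofπ _ h₂),
    (F.homologyIsCokernel i' i hi).fac (CokernelCofork.ofπ _ h₂) WalkingParallelPair.one⟩

end Homology

variable {C : Type u} [SmallCategory C] {J : GrothendieckTopology C}
  {A : Sheaf J CommRingCat.{u}}

namespace CDGA

variable {K : CDGA A}

lemma prodZero_one {U : Cᵒᵖ} (n : ℕ) :
    prodZero (K := K) (fun _ : Fin n ↦ ap K.unit (1 : A.obj.obj U)) =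
      ap K.unit (1 : A.obj.obj U) := by
  induction n with
  | zero => rfl
  | succ n ih =>
    refine (K.mul_one U _).trans ?_
    exact ih

section

variable {q i n : ℕ} (h : (n : ℤ) = (q : ℤ) - i)

lemma tmulPow_mem_kosBd {U : Cᵒᵖ} {y : ⋀[A.obj.obj U]^i (K.Z1.val.obj U)}
    (hy : y ∈ Submodule.span (A.obj.obj U) {z | ∃ e : Fin i → K.Z1.val.obj U,
      (∃ j x, e j = ap K.del x) ∧ z = exteriorPower.ιMulti (A.obj.obj U) i e}) :
    tmulPow (K.Z1.val.obj U) h (ap K.unit (1 : A.obj.obj U)) y ∈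
      kosBd (appₗ K.del.val U) q i := by
  suffices Submodule.span (A.obj.obj U) {z | ∃ e : Fin i → K.Z1.val.obj U,
      (∃ j x, e j = ap K.del x) ∧ z = exteriorPower.ιMulti (A.obj.obj U) i e} ≤
      (kosBd (appₗ K.del.val U) q i).comap
        (tmulPow (K.Z1.val.obj U) h (ap K.unit (1 : A.obj.obj U))) from this hy
  rw [Submodule.span_le]
  rintro _ ⟨e, ⟨j, x, hj⟩, rfl⟩
  cases i with
  | zero => exact j.elim0
  | succ i => exact tmulPow_mem_range_kosD (appₗ K.del.val U) h (del_one U) e j x hj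

/-- An element of `Λⁱ(Z¹(K))` which vanishes in `Λⁱ(H¹(K))` has vanishing class in the cohomology
of the Koszul complex. -/
lemma ap_constClass_eq_zero {U : Cᵒᵖ} (y : (extPow i K.Z1).val.obj U)
    (hy : ap (extPowMap i (K.cx.homologyπ 1)) y = 0) : ap (K.constClass h) y = 0 := by
  refine eq_of_loc ?_
  refine (loc_exists_toShf (M := preExt i K.Z1.val) y).bind fun V f ⟨t, ht⟩ ↦ ?_
  have ht₀ : toShf (M := preExt i (K.cx.homology 1).val)
      (extMap (appₗ (K.cx.homologyπ 1).val V) i t) =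
      toShf (M := preExt i (K.cx.homology 1).val) (0 : _) := by
    refine (ap_extPowMap (K.cx.homologyπ 1) t).symm.trans
      ((congr_arg (ap (extPowMap i (K.cx.homologyπ 1))) ht).trans ?_)
    refine (ap_rs (extPowMap i (K.cx.homologyπ 1)) f y).trans ?_
    rw [hy]
    exact (rs_zero _ f).trans (map_zero (toShfₗ A (preExt i (K.cx.homology 1).val) V)).symm
  refine (loc_of_toShf_eq ht₀).bind fun W g hg ↦ ?_
  have hg' : extMap (appₗ (K.cx.homologyπ 1).val W) i (extMap (res K.Z1.val g) i t) = 0 := by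
    refine Eq.trans ?_ (hg.trans (map_zero (res (preExt i (K.cx.homology 1).val) g)))
    refine (extMap_comp (RingHom.id_comp _) (res K.Z1.val g) (appₗ (K.cx.homologyπ 1).val W)
      ((res (K.cx.homology 1).val g).comp (appₗ (K.cx.homologyπ 1).val V))
      (fun x ↦ (appₗ_res (K.cx.homologyπ 1).val g x).symm) i t).symm.trans ?_
    exact extMap_comp (RingHom.comp_id _) (appₗ (K.cx.homologyπ 1).val V)
      (res (K.cx.homology 1).val g) _ (fun _ ↦ rfl) i t
  refine (loc_mem_span_of_extMap_eq_zero K.del (K.cx.homologyπ 1)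
    (K.cx.toCycles_comp_homologyπ 0 1) exact_del_homologyπ _ hg').mono fun X k hk ↦ ?_
  obtain ⟨i', b, hb⟩ := exists_d_eq_of_mem_kosBd (tmulPow_mem_kosBd h hk)
  have h₁ := ap_homologyClass_eq_zero (F := kos K.del q) (K.constHom h) (constHom_d h)
    (toShf (M := preExt i K.Z1.val) (extMap (res K.Z1.val k) i (extMap (res K.Z1.val g) i t)))
    i' b ((ap_constHom h _).trans hb)
  have h₂ : toShf (M := preExt i K.Z1.val)
      (extMap (res K.Z1.val k) i (extMap (res K.Z1.val g) i t)) =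
      rs (extPow i K.Z1) ((f ≫ g) ≫ k) y := by
    rw [rs_comp, rs_comp]
    refine Eq.trans ?_ (congr_arg (rs _ k) (congr_arg (rs _ g) ht))
    exact ((congr_arg (rs _ k) (rs_toShf (M := preExt i K.Z1.val) g t)).trans
      (rs_toShf (M := preExt i K.Z1.val) k _)).symm
  rw [← ap_rs, rs_zero, ← Category.assoc, ← h₂]
  exact h₁

/-- On `Λⁱ(Z¹(K))`, the map induced on cohomology by multiplication is the composition of the
projection to `Λⁱ(H¹(K))` with the isomorphism to `Hⁱ(K)`. -/
lemma homologyClass_constHom_comp (h' : i + n = q) {μ : (kos K.del q).X i ⟶ K.cx.X i}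
    (hμ : K.IsMulMap h' μ) (w : (K.constHom h ≫ μ) ≫ K.cx.d i (i + 1) = 0)
    (e : extPow i (K.cx.homology 1) ⟶ K.cx.homology i)
    (he : ∀ (U : Cᵒᵖ) (z : Fin i → K.Z1.val.obj U) (c : (K.cx.cycles i).val.obj U),
      ap (K.cx.iCycles i) c = prodOne (fun k ↦ K.z1Val (z k)) →
        ap e (extSection fun k ↦ ap (K.cx.homologyπ 1) (z k)) = ap (K.cx.homologyπ i) c) :
    homologyClass K.cx (K.constHom h ≫ μ) (i + 1) (CochainComplex.next _ _) w =
      extPowMap i (K.cx.homologyπ 1) ≫ e := by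
  refine hom_ext_extPow fun U z ↦ ?_
  have h₁ : ap (K.cx.iCycles i) (ap (K.cx.liftCycles (K.constHom h ≫ μ) (i + 1)
      (CochainComplex.next _ _) w) (extSection z)) = prodOne (fun k ↦ K.z1Val (z k)) := by
    refine (congr_arg (fun φ ↦ ap φ (extSection z)) (K.cx.liftCycles_i (K.constHom h ≫ μ)
      (i + 1) (CochainComplex.next _ _) w)).trans ?_
    refine (congr_arg (ap μ) (ap_constHom h _)).trans ?_
    refine (hμ U z fun _ ↦ ap K.unit (1 : A.obj.obj U)).trans ?_
    rw [prodZero_one]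
    exact K.mul_one U _
  refine (he U z _ h₁).symm.trans (congr_arg (ap e) ?_)
  refine ((ap_extPowMap (K.cx.homologyπ 1) _).trans ?_).symm
  exact congr_arg (toShf (M := preExt i (K.cx.homology 1).val)) (extMap_ιMulti _ i z)

/-- Multiplication maps induce isomorphisms on cohomology. -/
lemma isIso_of_isMulMap (hK : K.IsAbstractKoszul) (hflat : K.FlatCondition)
    (hn : ∀ U : Cᵒᵖ, IsUnit ((n.factorial : ℕ) : A.obj.obj U)) (h' : i + n = q)
    {μ : (kos K.del q).X i ⟶ K.cx.X i} (hμ : K.IsMulMap h' μ)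
    (w : ((kos K.del q).iCycles i ≫ μ) ≫ K.cx.d i (i + 1) = 0)
    (φ : (kos K.del q).homology i ⟶ K.cx.homology i)
    (hφ : (kos K.del q).homologyπ i ≫ φ =
      homologyClass K.cx ((kos K.del q).iCycles i ≫ μ) (i + 1) (CochainComplex.next _ _) w) :
    IsIso φ := by
  have h : (n : ℤ) = (q : ℤ) - i := by rw [← h', Nat.cast_add, add_sub_cancel_left]
  obtain ⟨e, he⟩ := hK.exists_iso i
  have h₁ : (kos K.del q).liftCycles (K.constHom h) (i + 1) (CochainComplex.next _ _)
      (constHom_d h) ≫ (kos K.del q).iCycles i ≫ μ = K.constHom h ≫ μ := by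
    rw [HomologicalComplex.liftCycles_i_assoc]
  have w₁ : ((kos K.del q).liftCycles (K.constHom h) (i + 1) (CochainComplex.next _ _)
      (constHom_d h) ≫ (kos K.del q).iCycles i ≫ μ) ≫ K.cx.d i (i + 1) = 0 := by
    rw [Category.assoc, w, comp_zero]
  have w₂ : (K.constHom h ≫ μ) ≫ K.cx.d i (i + 1) = 0 := by rw [← h₁, w₁]
  have h₂ : K.constClass h ≫ φ = extPowMap i (K.cx.homologyπ 1) ≫ e.hom := by
    rw [constClass, homologyClass, Category.assoc, hφ, comp_homologyClass _ _ _ _ _ w₁,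
      homologyClass_congr h₁ _ _ _ w₂, homologyClass_constHom_comp h h' hμ w₂ e.hom he]
  have := epi_extPowMap i (K.cx.homologyπ 1)
  refine isIso_of_epi_comp (K.constClass h) φ (epi_constClass h hK hflat hn)
    (by rw [h₂]; infer_instance) fun U y hy ↦ ap_constClass_eq_zero h y ?_
  refine ap_injective e.hom U ?_
  rw [← ap_comp, ← h₂, hy, ap_zero]

end

/-- The cohomology of an abstract Koszul complex with flat `H¹` has no torsion by an integer
which is a nonzerodivisor. -/
lemma IsAbstractKoszul.eq_zero_of_nsmul_eq_zero (hK : K.IsAbstractKoszul)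
    (hflat : K.FlatCondition) {N : ℕ}
    (hN : ∀ U : Cᵒᵖ, (N : A.obj.obj U) ∈ nonZeroDivisors (A.obj.obj U)) {i : ℕ} {E : Mod A}
    (φ : E ⟶ K.cx.homology i) (h : N • φ = 0) : φ = 0 := by
  obtain ⟨e, -⟩ := hK.exists_iso i
  have h₁ : N • (φ ≫ e.inv) = 0 := by rw [← Preadditive.nsmul_comp, h, zero_comp]
  rw [← cancel_mono e.inv, zero_comp]
  refine ap_ext fun U x ↦ ?_
  refine (hflat.flat_homology.extPow_eq_zero hN _ ?_).trans (ap_zero_hom x).symm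
  refine (ap_nsmul_hom (φ ≫ e.inv) N x).symm.trans ?_
  rw [h₁]
  rfl

end CDGA

end CohomologyComparison

/-! ### The quasi-isomorphism of truncated complexes -/

section ComparisonTheorem

lemma subsingleton_dPow {R M : Type u} [CommRing R] [AddCommGroup M] [Module R M] {n : ℤ}
    (hn : n < 0) : Subsingleton (DPow R M n) := by
  refine Submodule.subsingleton_iff_eq_bot.2 ?_
  refine Submodule.span_eq_bot.2 ?_
  rintro _ ⟨r, e, x, h, -⟩
  exact absurd (h ▸ Finset.sum_nonneg fun k _ ↦ Int.natCast_nonneg (e k)) (not_le.2 hn)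

variable {C : Type u} [SmallCategory C] {J : GrothendieckTopology C}
  {A : Sheaf J CommRingCat.{u}}

lemma isZero_kos_X {P Q : Mod A} (u : P ⟶ Q) {q i : ℕ} (hi : q < i) : IsZero ((kos u q).X i) := by
  rw [IsZero.iff_id_eq_zero]
  refine hom_ext_toShf (M := preKosX Q.val P.val q i) fun U t ↦ ?_
  have h₁ : Subsingleton (DPow (A.obj.obj U) (P.val.obj U) ((q : ℤ) - i)) :=
    subsingleton_dPow (sub_neg.2 (Int.ofNat_lt.2 hi))
  have h₂ : Subsingleton (KosX (A.obj.obj U) (Q.val.obj U) (P.val.obj U) q i) := inferInstance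
  have ht : t = (0 : KosX (A.obj.obj U) (Q.val.obj U) (P.val.obj U) q i) := h₂.elim _ _
  rw [ht]
  exact map_zero (toShfₗ A (preKosX Q.val P.val q i) U)

namespace CDGA

variable {K : CDGA A}

/-- The multiplication maps define a quasi-isomorphism of truncated complexes. -/
lemma exists_quasiIso_isInducedByMul {m q : ℕ}
    (hm : ∀ U : Cᵒᵖ, IsUnit ((m.factorial : ℕ) : A.obj.obj U)) (hmq : m ≤ q)
    (hq : q = m ∨ ∀ U : Cᵒᵖ, ((m + 1 : ℕ) : A.obj.obj U) ∈ nonZeroDivisors (A.obj.obj U))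
    (hK : K.IsAbstractKoszul) (hflat : K.FlatCondition) (hsq : K.SquareZero q) :
    ∃ φ : K.truncKos q m ⟶ K.truncK ((q : ℤ) - m) q, K.IsInducedByMul φ ∧ QuasiIso φ := by
  have hs {i n : ℕ} (h : i + n = q) : K.SquareZero i :=
    fun h₂ ↦ hsq (h₂.trans (h ▸ Nat.le_add_right i n))
  -- extend the multiplication maps, defined for `q - m ≤ i ≤ q`, by zero
  have hex (i : ℕ) : ∃ μ : (kos K.del q).X i ⟶ K.cx.X i, ∀ (n : ℕ) (h : i + n = q) (hn : n ≤ m),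
      μ = mulMap (isUnit_factorial hn hm) (hs h) q := by
    by_cases hi : i + (q - i) = q ∧ q - i ≤ m
    · refine ⟨mulMap (isUnit_factorial hi.2 hm) (hs hi.1) q, fun n h hn ↦ ?_⟩
      obtain rfl : n = q - i := by omega
      rfl
    · exact ⟨0, fun n h hn ↦ absurd (by omega) hi⟩
  choose μ hμ using hex
  have hcomm (i n : ℕ) (h : i + (n + 1) = q) (hn : n + 1 ≤ m) :
      (kos K.del q).d i (i + 1) ≫ μ (i + 1) = μ i ≫ K.cx.d i (i + 1) := by
    rw [hμ i (n + 1) h hn, hμ (i + 1) n (by omega) (by omega)]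
    exact (mulMap_succ_d (isUnit_factorial (by omega) hm) (isUnit_factorial hn hm) (hs h)
      (hs (n := n) (by omega)) q).symm
  have hlast : μ q ≫ K.cx.d q (q + 1) = 0 := by
    rw [hμ q 0 (add_zero q) (Nat.zero_le m)]
    exact mulMap_zero_d (isUnit_factorial (Nat.zero_le m) hm) (hs (add_zero q)) q
  have hw (i n : ℕ) (h : i + n = q) (hn : n ≤ m) :
      ((kos K.del q).iCycles i ≫ μ i) ≫ K.cx.d i (i + 1) = 0 := by
    cases n with
    | zero =>
      obtain rfl : i = q := h
      rw [Category.assoc, hlast, comp_zero]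
    | succ n =>
      rw [Category.assoc, ← hcomm i n h hn, HomologicalComplex.iCycles_d_assoc, zero_comp]
  -- the induced maps on cohomology
  have hH (i n : ℕ) (h : i + n = q) (hn : n ≤ m) :
      ∃ φ : (kos K.del q).homology i ⟶ K.cx.homology i, (kos K.del q).homologyπ i ≫ φ =
        homologyClass K.cx ((kos K.del q).iCycles i ≫ μ i) (i + 1)
          (CochainComplex.next _ _) (hw i n h hn) := by
    cases i with
    | zero =>
      refine exists_homology_hom CochainComplex.prev_nat_zero (μ 0) _ fun w' ↦ ?_
      have h₀ : (kos K.del q).d 0 0 ≫ μ 0 = 0 ≫ K.cx.d 0 0 := by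
        rw [(kos K.del q).shape _ _ (by simp), zero_comp, zero_comp]
      rw [homologyClass_congr h₀ _ _ _ (by rw [← h₀, w']), homologyClass_comp_d]
    | succ i =>
      refine exists_homology_hom (CochainComplex.prev_nat_succ i) (μ (i + 1)) _ fun w' ↦ ?_
      rcases hn.lt_or_eq with hn' | rfl
      · have h₀ := hcomm i n (by omega) hn'
        rw [homologyClass_congr h₀ _ _ _ (by rw [← h₀, w']), homologyClass_comp_d]
      · -- in the lowest degree, boundaries are mapped to torsion classes
        have hN := hq.resolve_left (by omega)
        obtain ⟨ρ, hρ⟩ := exists_comp_d_eq_nsmul (isUnit_factorial hn hm)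
          (hs (i := i) (n := n + 1) (by omega)) (hs h) q
        rw [← hμ (i + 1) n h hn] at hρ
        have w₁ : ((n + 1) • ((kos K.del q).d i (i + 1) ≫ μ (i + 1))) ≫
            K.cx.d (i + 1) (i + 1 + 1) = 0 := by
          rw [Preadditive.nsmul_comp, w', smul_zero]
        refine hK.eq_zero_of_nsmul_eq_zero hflat hN _ ?_
        rw [← nsmul_homologyClass (n + 1) _ w' w₁,
          homologyClass_congr hρ.symm _ _ _ (by rw [hρ, w₁]), homologyClass_comp_d]
  have H := exists_truncation_quasiIso (F := kos K.del q) (G := K.cx) (a := q - m)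
    (q := q) (Nat.sub_le q m) (fun i hi ↦ isZero_kos_X K.del hi) μ
    (fun i ha hi ↦ hcomm i (q - i - 1) (by omega) (by omega)) hlast fun i ha hi ↦ by
      have h : i + (q - i) = q := by omega
      have hn : q - i ≤ m := by omega
      obtain ⟨φ, hφ⟩ := hH i (q - i) h hn
      refine ⟨φ, isIso_of_isMulMap hK hflat (isUnit_factorial hn hm) h ?_ _ φ hφ, fun _ ↦ hφ⟩
      rw [hμ i (q - i) h hn]
      exact isMulMap_mulMap _ h _
  have hmul (i j : ℕ) (h : i + j = q) (hj : j ≤ m) : K.IsMulMap h (μ i) := by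
    rw [hμ i j h hj]
    exact isMulMap_mulMap _ h _
  have ha : ((q - m : ℕ) : ℤ) = (q : ℤ) - m := Nat.cast_sub hmq
  rw [ha] at H
  obtain ⟨φ, hφ, hφ'⟩ := H
  exact ⟨φ, fun i j h hj ↦ by
    obtain ⟨ν, hν⟩ := hφ' i (by omega) (by omega)
    exact ⟨μ i, ν, hmul i j h hj, hν⟩, hφ⟩

end CDGA

end ComparisonTheorem

end Koszul

theorem theorem2p6 {C : Type u} [SmallCategory C] (J : GrothendieckTopology C)
    (A : Sheaf J CommRingCat.{u}) [HasDerivedCategory.{w} (Mod A)]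
    (m q : ℕ) (hm : ∀ U : Cᵒᵖ, IsUnit ((m.factorial : ℕ) : A.obj.obj U)) (hmq : m ≤ q)
    (hq : q = m ∨ ∀ U : Cᵒᵖ, ((m + 1 : ℕ) : A.obj.obj U) ∈ nonZeroDivisors (A.obj.obj U))
    (K : CDGA A) (hK : K.IsAbstractKoszul) (hflat : K.FlatCondition)
    (hsq : 2 ≤ q → ∀ (U : Cᵒᵖ) (z : K.Z1.val.obj U),
      K.mul U (one_add_one_eq_two) (K.z1Val z) (K.z1Val z) = 0) :
    (∃ φ : K.truncKos q m ⟶ K.truncK ((q : ℤ) - m) q, K.IsInducedByMul φ ∧ QuasiIso φ) ∧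
      Nonempty (DerivedCategory.Q.obj (toZ (derivedDPow q K.tauLE1)) ≅
        DerivedCategory.Q.obj (toZ (kos K.del q))) := by
  exact ⟨CDGA.exists_quasiIso_isInducedByMul hm hmq hq hK hflat hsq,
    nonempty_derivedDPow_iso K hflat.flat_cycles q⟩
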